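/- **Model.** Customers $i=1,2,\dots$ arrive with arm features $x_{i,k}\in\mathbb R^d$ ($k\in[K]$) and customer feature $z_i\in\mathbb R^d$. With $p(u)=1/(1+e^{-u})$, the unobserved group $g_i\in\{1,2\}$ satisfies $\Pr(g_i=1\mid (x_{i,k})_k,z_i)=p(z_i^\top\theta^*)$; playing arm $a_i$ yields $y_i=x_i^\top\beta^*_{g_i}+\epsilon_i$ with $x_i:=x_{i,a_i}$ and $\epsilon_i\sim N(0,\sigma^2)$, $\sigma>0$, independent of the features and the group. The customers are independent and the features $((x_{i,k})_k,z_i)$ are i.i.d. Write $\gamma=(\theta,\beta_1,\beta_2)$, $\gamma^*=(\theta^*,\beta_1^*,\beta_2^*)$, $\Delta^*=\|\beta_1^*-\beta_2^*\|_2$ and $D(\gamma)=\|\beta_1-\beta_1^*\|_2+\|\beta_2-\beta_2^*\|_2+\|\theta-\theta^*\|_2$. **Algorithm.** Episode $\tau\ge0$ consists of the next $N_\tau=2^\tau n_0$ customers. In episode $0$ the arms are drawn uniformly from $[K]$, independently of everything else. In episode $\tau\ge1$, first an estimate $\hat\gamma^{(\tau)}$ is computed from the records $(y_i,x_i,z_i)$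 of episode $\tau-1$; then each customer of episode $\tau$ is served by the arm that is greedy for $\hat\gamma^{(\tau)}$, where the arm greedy for $\gamma$ maximizes $x_{i,k}^\top\beta_{\hat g}$ over $k$, with $\hat g=1$ if $z_i^\top\theta\ge0$ and $\hat g=2$ otherwise (ties are broken by a fixed measurable rule). To compute $\hat\gamma^{(\tau)}$, take $t_\tau$ disjoint batches $I^{(1)},\dots,I^{(t_\tau)}$ of $n_\tau=\lfloor N_{\tau-1}/t_\tau\rfloor$ customers each from episode $\tau-1$, start at $\gamma^{(\tau,0)}$, and for $t=1,\dots,t_\tau$ let $\omega_i$ be the posterior probability of group $1$ under $\gamma^{(\tau,t-1)}$, $$\omega_i=\frac{p(z_i^\top\theta)\,\phi\big((y_i-x_i^\top\beta_1)/\sigma\big)}{p(z_i^\top\theta)\,\phi\big((y_i-x_i^\top\beta_1)/\sigma\big)+(1-p(z_i^\top\theta))\,\phi\big((y_i-x_i^\top\beta_2)/\sigma\big)}\quad\text{at }(\theta,\beta_1,\beta_2)=\gamma^{(\tau,t-1)},$$ with $\phi$ the standard normal density, and let the components of $\gamma^{(\tau,t)}$ be (measurably selected) minimizers of $$\beta_1\mapsto\frac1{2n_\tau}\sum_{i\in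 I^{(t)}}\omega_i\frac{(y_i-x_i^\top\beta_1)^2}{\sigma^2}+\lambda_\tau^{(t)}\|\beta_1\|_1,\qquad \beta_2\mapsto\frac1{2n_\tau}\sum_{i\in I^{(t)}}(1-\omega_i)\frac{(y_i-x_i^\top\beta_2)^2}{\sigma^2}+\lambda_\tau^{(t)}\|\beta_2\|_1,$$ $$\theta\mapsto-\frac1{n_\tau}\sum_{i\in I^{(t)}}\big[\omega_i\log p(z_i^\top\theta)+(1-\omega_i)\log(1-p(z_i^\top\theta))\big]+\lambda_\tau^{(t)}\|\theta\|_1 .$$ Set $\hat\gamma^{(\tau)}=\gamma^{(\tau,t_\tau)}$, and $\gamma^{(\tau,0)}=\hat\gamma^{(\tau-1)}$ for $\tau\ge2$. The initial estimator $\gamma^{(1,0)}$ is independent of all customers. **Theorem.** Fix $K$, $\xi\in(0,1/2)$, $M>1$, $S,L,\sigma>0$, $0<a\le b$ and $T\in\mathbb N$. There are constants $\delta_{1,0},C_{\rm SNR},c_0,C>0$, depending only on these, such that the following holds for all $d,s\in\mathbb N$, all $n_0\ge2$ and all iteration numbers with $a\log n_0\le t_1\le b\log n_0$ and $1\le t_\tau\le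 T$ for $\tau\ge2$, provided that $s^2\log d\,\log n_0\le c_0n_0$. There are regularization levels $\lambda_\tau^{(t)}>0$, not depending on the underlying distribution, such that for every model for which $\theta^*,\beta_1^*,\beta_2^*$ have at most $s$ non-zero entries each and * (A1) $\xi<p(z_i^\top\theta^*)<1-\xi$ almost surely; * (A2) $D(\gamma^{(1,0)})\le\delta_{1,0}$ almost surely; * (A3) $\Delta^*/\sigma\ge C_{\rm SNR}$; * (A4) $x_{i,k}$ (for each $k$) and $z_i$ are sub-Gaussian with parameter $S$, i.e. $\Pr(|v^\top w|\ge u)\le2e^{-u^2/(2S^2)}$ for $w\in\{x_{i,k},z_i\}$, $\|v\|_2=1$, $u\ge0$, and the eigenvalues of $\mathbb E[x_{i,k}x_{i,k}^\top]$ and $\mathbb E[z_iz_i^\top]$ lie in $(1/M,M)$; moreover, for every $\gamma$ with $D(\gamma)\le\delta_{1,0}$, the features $x_i^\gamma$ of the arm that is greedy for $\gamma$ satisfy $\lambda_{\min}(\mathbb E[x_i^\gamma (x_i^\gamma)^\top])>1/M$; * (A5) $\Pr\big(|x_{i,k}^\top(\beta_1^*-\beta_2^*)|\le h\Delta^*\big)\le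 Lh$ for all $k$ and $h>0$ (as is the case, for a suitable $L$, if $x_{i,k}^\top(\beta_1^*-\beta_2^*)/\Delta^*$ has a bounded density around $0$), one has, for every $\tau\ge1$, with probability at least $1-d^{-1}$, both $$\|\hat\beta_1^{(\tau)}-\beta_1^*\|_2+\|\hat\beta_2^{(\tau)}-\beta_2^*\|_2+\|\hat\theta^{(\tau)}-\theta^*\|_2\le C\sqrt{\frac{s\log d\log n_0}{N_{\tau-1}}}$$ and $$\|\hat\beta_1^{(\tau)}-\beta_1^*\|_1+\|\hat\beta_2^{(\tau)}-\beta_2^*\|_1+\|\hat\theta^{(\tau)}-\theta^*\|_1\le C\sqrt{\frac{s^2\log d\log n_0}{N_{\tau-1}}}.$$ -/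

import Mathlib

open MeasureTheory ProbabilityTheory
open scoped RealInnerProductSpace

noncomputable section

namespace LHLB

/-- The feature and coefficient space `ℝ^d` with the Euclidean norm. -/
abbrev Vec (d : ℕ) : Type := EuclideanSpace ℝ (Fin d)

/-- A parameter `γ = (θ, β₁, β₂)`: `γ.1 = θ`, `γ.2.1 = β₁`, `γ.2.2 = β₂`. -/
abbrev Param (d : ℕ) : Type := Vec d × Vec d × Vec d

/-- One record `(y, x, z)` of the collected data: the reward, the feature of the chosen arm, and
the customer feature. -/
abbrev Obs (d : ℕ) : Type := ℝ × Vec d × Vec d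

/-- The `ℓ₀` size (number of non-zero coordinates). -/
def l0 {d : ℕ} (v : Vec d) : ℕ := (Finset.univ.filter fun j => v j ≠ 0).card

/-- The `ℓ₁` norm. -/
def l1 {d : ℕ} (v : Vec d) : ℝ := ∑ j, |v j|

/-- Total `ℓ₂` distance `‖β₁ - β₁'‖₂ + ‖β₂ - β₂'‖₂ + ‖θ - θ'‖₂`. -/
def err2 {d : ℕ} (γ γ' : Param d) : ℝ :=
  ‖γ.2.1 - γ'.2.1‖ + ‖γ.2.2 - γ'.2.2‖ + ‖γ.1 - γ'.1‖

/-- Total `ℓ₁` distance `‖β₁ - β₁'‖₁ + ‖β₂ - β₂'‖₁ + ‖θ - θ'‖₁`. -/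
def err1 {d : ℕ} (γ γ' : Param d) : ℝ :=
  l1 (γ.2.1 - γ'.2.1) + l1 (γ.2.2 - γ'.2.2) + l1 (γ.1 - γ'.1)

/-! ### The bandit model -/

/-- The random primitives attached to the customers `i = 0, 1, 2, …`: arm features `X i ω k`,
customer feature `Z i ω`, latent group `g i ω` (the value `0` is group 1, the value `1` is
group 2), noise `ε i ω`, and the uniform draw `U i ω` of an arm used for exploration. -/
structure Primitives (Ω : Type*) (d K : ℕ) where
  X : ℕ → Ω → Fin K → Vec d
  Z : ℕ → Ω → Vec d
  g : ℕ → Ω → Fin 2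
  ε : ℕ → Ω → ℝ
  U : ℕ → Ω → Fin K

namespace Primitives

variable {Ω : Type*} {d K : ℕ}

/-- The observable context of customer `i`. -/
def ctx (B : Primitives Ω d K) (i : ℕ) (ω : Ω) : (Fin K → Vec d) × Vec d := (B.X i ω, B.Z i ω)

/-- Everything that is random about customer `i`. -/
def customer (B : Primitives Ω d K) (i : ℕ) (ω : Ω) :
    ((Fin K → Vec d) × Vec d) × Fin 2 × ℝ × Fin K :=
  (B.ctx i ω, B.g i ω, B.ε i ω, B.U i ω)

/-- The record `(y_i, x_{i,a_i}, z_i)` obtained when the arms `a` are played, where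
`y_i = ⟨x_{i,a_i}, β_{g_i}⟩ + ε_i`. -/
def obs (B : Primitives Ω d K) (γs : Param d) (a : ℕ → Ω → Fin K) (i : ℕ) (ω : Ω) : Obs d :=
  (⟪B.X i ω (a i ω), if B.g i ω = 0 then γs.2.1 else γs.2.2⟫ + B.ε i ω, B.X i ω (a i ω), B.Z i ω)

end Primitives

/-- The latent heterogeneous linear bandit with parameter `γs = (θ*, β₁*, β₂*)` and noise level
`σ`: customers are independent, contexts are i.i.d., the group of customer `i` is group 1 with
conditional probability `p(z_iᵀθ*)` given the context (`Real.sigmoid` is `p`), the noise is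
`N(0, σ²)` and independent of context and group, and the exploration draw is uniform on the arms
and independent of context, group and noise. -/
structure IsLatentBandit {Ω : Type*} [MeasurableSpace Ω] (μ : Measure Ω) {d K : ℕ}
    (γs : Param d) (σ : ℝ) (B : Primitives Ω d K) : Prop where
  measurable_customer : ∀ i, Measurable (B.customer i)
  indep_customers : iIndepFun B.customer μ
  ident_ctx : ∀ i, IdentDistrib (B.ctx i) (B.ctx 0) μ μ
  group_prob : ∀ i (A : Set ((Fin K → Vec d) × Vec d)), MeasurableSet A →
    μ.real ({ω | B.g i ω = 0} ∩ B.ctx i ⁻¹' A)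
      = ∫ ω in B.ctx i ⁻¹' A, Real.sigmoid ⟪B.Z i ω, γs.1⟫ ∂μ
  noise_law : ∀ i, μ.map (B.ε i) = gaussianReal 0 (σ ^ 2).toNNReal
  noise_indep : ∀ i, IndepFun (B.ε i) (fun ω => (B.ctx i ω, B.g i ω)) μ
  explore_law : ∀ i k, μ.real {ω | B.U i ω = k} = 1 / (K : ℝ)
  explore_indep : ∀ i, IndepFun (B.U i) (fun ω => (B.ctx i ω, B.g i ω, B.ε i ω)) μ

/-- A random vector is sub-Gaussian with parameter `S` (no centering):
`P(|vᵀW| ≥ t) ≤ 2 exp(-t² / (2 S²))` for all unit vectors `v` and all `t ≥ 0`. -/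
def SubGaussianVec {Ω : Type*} [MeasurableSpace Ω] (μ : Measure Ω) {d : ℕ} (W : Ω → Vec d)
    (S : ℝ) : Prop :=
  ∀ v : Vec d, ‖v‖ = 1 → ∀ t : ℝ, 0 ≤ t →
    μ.real {ω | t ≤ |⟪W ω, v⟫|} ≤ 2 * Real.exp (-t ^ 2 / (2 * S ^ 2))

/-- All eigenvalues of `E[W Wᵀ]` are larger than `l`, through the quadratic form
`vᵀ E[W Wᵀ] v = E[(Wᵀv)²]`. -/
def SecondMomentGT {Ω : Type*} [MeasurableSpace Ω] (μ : Measure Ω) {d : ℕ} (W : Ω → Vec d)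
    (l : ℝ) : Prop :=
  ∀ v : Vec d, ‖v‖ = 1 → l < ∫ ω, ⟪W ω, v⟫ ^ 2 ∂μ

/-- All eigenvalues of `E[W Wᵀ]` are smaller than `u`. -/
def SecondMomentLT {Ω : Type*} [MeasurableSpace Ω] (μ : Measure Ω) {d : ℕ} (W : Ω → Vec d)
    (u : ℝ) : Prop :=
  ∀ v : Vec d, ‖v‖ = 1 → ∫ ω, ⟪W ω, v⟫ ^ 2 ∂μ < u

/-- An `argmax` rule over the arms with some (measurable) way of breaking ties. -/
structure IsArgmaxRule {K : ℕ} (am : (Fin K → ℝ) → Fin K) : Prop where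
  measurable : Measurable am
  le_max : ∀ (v : Fin K → ℝ) (k : Fin K), v k ≤ v (am v)

/-- The greedy arm for the parameter `γ`: predict group 1 if `zᵀθ ≥ 0` and group 2 otherwise,
then maximize `⟨x_k, β⟩` for the coefficient of the predicted group. -/
def greedyArm {d K : ℕ} (am : (Fin K → ℝ) → Fin K) (γ : Param d)
    (c : (Fin K → Vec d) × Vec d) : Fin K :=
  am fun k => ⟪c.1 k, if 0 ≤ ⟪c.2, γ.1⟫ then γ.2.1 else γ.2.2⟫

/-- The regularity conditions on parameters and covariates. Except for the last two fields these
are: sparsity, group probabilities bounded away from `0` and `1`, signal-to-noise ratio at least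
`CSNR`, sub-Gaussian covariates, well-conditioned second moments.

`small_ball` says that `x_{i,k}ᵀ(β₁* - β₂*) / ‖β₁* - β₂*‖₂` puts mass at most `L h` on `[-h, h]`;
it follows (for a suitable `L`) if this variable has a bounded density around `0`.

`greedy` says that the features collected by the greedy rule are non-degenerate as well, for
all parameters in the `δ`-neighbourhood of the truth. -/
structure Regular {Ω : Type*} [MeasurableSpace Ω] (μ : Measure Ω) {d K : ℕ} (s : ℕ)
    (ξ M S L σ CSNR δ : ℝ) (am : (Fin K → ℝ) → Fin K) (γs : Param d)
    (B : Primitives Ω d K) : Prop where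
  sparse_θ : l0 γs.1 ≤ s
  sparse_β₁ : l0 γs.2.1 ≤ s
  sparse_β₂ : l0 γs.2.2 ≤ s
  group_nondegenerate : ∀ i, ∀ᵐ ω ∂μ,
    ξ < Real.sigmoid ⟪B.Z i ω, γs.1⟫ ∧ Real.sigmoid ⟪B.Z i ω, γs.1⟫ < 1 - ξ
  snr : CSNR ≤ ‖γs.2.1 - γs.2.2‖ / σ
  subGaussian_X : ∀ i k, SubGaussianVec μ (fun ω => B.X i ω k) S
  subGaussian_Z : ∀ i, SubGaussianVec μ (B.Z i) S
  moment_X : ∀ i k, SecondMomentGT μ (fun ω => B.X i ω k) (1 / M) ∧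
    SecondMomentLT μ (fun ω => B.X i ω k) M
  moment_Z : ∀ i, SecondMomentGT μ (B.Z i) (1 / M) ∧ SecondMomentLT μ (B.Z i) M
  small_ball : ∀ i k (h : ℝ), 0 < h →
    μ.real {ω | |⟪B.X i ω k, γs.2.1 - γs.2.2⟫| ≤ h * ‖γs.2.1 - γs.2.2‖} ≤ L * h
  greedy : ∀ i (γ : Param d), err2 γ γs ≤ δ →
    SecondMomentGT μ (fun ω => B.X i ω (greedyArm am γ (B.ctx i ω))) (1 / M)

/-! ### The learning algorithm -/

/-- The E-step weight `ω(y, x, z; γ)`; `gaussianPDFReal 0 1` is the standard normal density. -/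
def weight {d : ℕ} (σ : ℝ) (o : Obs d) (γ : Param d) : ℝ :=
  Real.sigmoid ⟪o.2.2, γ.1⟫ * gaussianPDFReal 0 1 ((o.1 - ⟪o.2.1, γ.2.1⟫) / σ) /
    (Real.sigmoid ⟪o.2.2, γ.1⟫ * gaussianPDFReal 0 1 ((o.1 - ⟪o.2.1, γ.2.1⟫) / σ) +
      (1 - Real.sigmoid ⟪o.2.2, γ.1⟫) * gaussianPDFReal 0 1 ((o.1 - ⟪o.2.1, γ.2.2⟫) / σ))

/-- `Q_{n1}(β | γ)` on the batch `I` of the records `o`. -/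
def Q1 {d : ℕ} (σ : ℝ) (I : Finset ℕ) (o : ℕ → Obs d) (γ : Param d) (β : Vec d) : ℝ :=
  -(1 / (2 * (I.card : ℝ))) *
    ∑ i ∈ I, weight σ (o i) γ * (((o i).1 - ⟪(o i).2.1, β⟫) ^ 2 / σ ^ 2)

/-- `Q_{n2}(β | γ)`. -/
def Q2 {d : ℕ} (σ : ℝ) (I : Finset ℕ) (o : ℕ → Obs d) (γ : Param d) (β : Vec d) : ℝ :=
  -(1 / (2 * (I.card : ℝ))) *
    ∑ i ∈ I, (1 - weight σ (o i) γ) * (((o i).1 - ⟪(o i).2.1, β⟫) ^ 2 / σ ^ 2)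

/-- `Q_{n3}(θ | γ)`. -/
def Q3 {d : ℕ} (σ : ℝ) (I : Finset ℕ) (o : ℕ → Obs d) (γ : Param d) (θ : Vec d) : ℝ :=
  1 / (I.card : ℝ) *
    ∑ i ∈ I, (weight σ (o i) γ * Real.log (Real.sigmoid ⟪(o i).2.2, θ⟫) +
      (1 - weight σ (o i) γ) * Real.log (1 - Real.sigmoid ⟪(o i).2.2, θ⟫))

/-- `γ'` is a result of one regularized EM iteration from `γ` on the batch `I`. -/
structure IsEMStep {d : ℕ} (σ lam : ℝ) (I : Finset ℕ) (o : ℕ → Obs d) (γ γ' : Param d) : Prop where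
  β₁ : IsMinOn (fun β => -Q1 σ I o γ β + lam * l1 β) Set.univ γ'.2.1
  β₂ : IsMinOn (fun β => -Q2 σ I o γ β + lam * l1 β) Set.univ γ'.2.2
  θ : IsMinOn (fun θ => -Q3 σ I o γ θ + lam * l1 θ) Set.univ γ'.1

/-- `N_τ = 2^τ n₀`, the length of episode `τ`. -/
def epLen (n₀ τ : ℕ) : ℕ := 2 ^ τ * n₀

/-- The first customer of episode `τ`, i.e. `N_0 + … + N_{τ-1}`. -/
def epStart (n₀ τ : ℕ) : ℕ := ∑ r ∈ Finset.range τ, epLen n₀ r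

/-- `n_τ`, the size of each of the `tmax τ` batches into which the customers of episode `τ - 1`
are split (rounded down). -/
def batchSize (n₀ : ℕ) (tmax : ℕ → ℕ) (τ : ℕ) : ℕ := epLen n₀ (τ - 1) / tmax τ

/-- The first customer after the first `t` batches used in episode `τ`. -/
def batchEnd (n₀ : ℕ) (tmax : ℕ → ℕ) (τ t : ℕ) : ℕ :=
  epStart n₀ (τ - 1) + t * batchSize n₀ tmax τ

/-- The batch of customers of episode `τ - 1` used in the `t`-th EM iteration of episode `τ`
(`t ≥ 1`). -/
def batch (n₀ : ℕ) (tmax : ℕ → ℕ) (τ t : ℕ) : Finset ℕ :=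
  Finset.Ico (batchEnd n₀ tmax τ (t - 1)) (batchEnd n₀ tmax τ t)

/-- A run of the phased learning algorithm. `a i` is the arm played for customer `i`, `γ τ t` the
EM iterate after `t` iterations in episode `τ ≥ 1`; the estimate of episode `τ` is
`γ τ (tmax τ)`. The initial estimate `γ 1 0` is independent of the customers, later episodes
are started at the previous estimate. Minimizers need not be unique; the iterates are
required to be functions of the initial estimate and of the records used so far. -/
structure IsRun {Ω : Type*} [MeasurableSpace Ω] (μ : Measure Ω) {d K : ℕ}
    (am : (Fin K → ℝ) → Fin K) (γs : Param d) (σ : ℝ) (B : Primitives Ω d K)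
    (n₀ : ℕ) (tmax : ℕ → ℕ) (lam : ℕ → ℕ → ℝ)
    (a : ℕ → Ω → Fin K) (γ : ℕ → ℕ → Ω → Param d) : Prop where
  init_measurable : Measurable (γ 1 0)
  init_indep : IndepFun (γ 1 0) (fun ω i => B.customer i ω) μ
  explore : ∀ i ω, i < epLen n₀ 0 → a i ω = B.U i ω
  exploit : ∀ τ i ω, 1 ≤ τ → epStart n₀ τ ≤ i → i < epStart n₀ (τ + 1) →
    a i ω = greedyArm am (γ τ (tmax τ) ω) (B.ctx i ω)
  warm_start : ∀ τ ω, 2 ≤ τ → γ τ 0 ω = γ (τ - 1) (tmax (τ - 1)) ω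
  em_step : ∀ τ t ω, 1 ≤ τ → 1 ≤ t → t ≤ tmax τ →
    IsEMStep σ (lam τ t) (batch n₀ tmax τ t) (fun i => B.obs γs a i ω)
      (γ τ (t - 1) ω) (γ τ t ω)
  adapted : ∀ τ t, 1 ≤ τ → 1 ≤ t → t ≤ tmax τ →
    Measurable[MeasurableSpace.comap
      (fun ω => (γ 1 0 ω, fun i : Fin (batchEnd n₀ tmax τ t) => B.obs γs a i ω))
      inferInstance] (γ τ t)

end LHLB

end

noncomputable section

namespace LHLB

/-! ### Pointwise bounds for the posterior weights and the logistic loss -/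

lemma sigmoid_sub_le {a b : ℝ} (h : b ≤ a) :
    Real.sigmoid a - Real.sigmoid b ≤ (a - b) * (1 - Real.sigmoid b) := by
  have e1 : (1 : ℝ) - Real.exp (-(a - b)) ≤ a - b := by
    have := Real.add_one_le_exp (-(a - b)); linarith
  have hpa := Real.sigmoid_pos a
  have hla := Real.sigmoid_lt_one a
  have hlb := Real.sigmoid_lt_one b
  have key : Real.sigmoid a - Real.sigmoid b
      = Real.sigmoid a * ((1 - Real.sigmoid b) * (1 - Real.exp (-(a - b)))) := by
    rw [Real.sigmoid_def, Real.sigmoid_def]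
    have ha : (0 : ℝ) < 1 + Real.exp (-a) := by positivity
    have hb : (0 : ℝ) < 1 + Real.exp (-b) := by positivity
    have : Real.exp (-(a - b)) = Real.exp (-a) / Real.exp (-b) := by
      rw [← Real.exp_sub]; congr 1; ring
    rw [this]
    have hb' : Real.exp (-b) ≠ 0 := (Real.exp_pos _).ne'
    field_simp
    ring
  have h0 : (0 : ℝ) ≤ 1 - Real.exp (-(a - b)) := by
    have : Real.exp (-(a - b)) ≤ 1 := Real.exp_le_one_iff.2 (by linarith)
    linarith
  rw [key]
  have h1 : (1 - Real.sigmoid b) * (1 - Real.exp (-(a - b))) ≤ (a - b) * (1 - Real.sigmoid b) := by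
    nlinarith
  have h2 : 0 ≤ (1 - Real.sigmoid b) * (1 - Real.exp (-(a - b))) :=
    mul_nonneg (by linarith) h0
  nlinarith

lemma one_sub_sigmoid_le (b : ℝ) : 1 - Real.sigmoid b ≤ Real.exp (-b) := by
  rw [← Real.sigmoid_neg, ← Real.sigmoid_mul_rexp_neg]
  have := Real.sigmoid_le_one b
  have := Real.exp_pos (-b)
  nlinarith

lemma abs_sigmoid_sub_le (a b : ℝ) : |Real.sigmoid a - Real.sigmoid b| ≤ |a - b| := by
  wlog h : b ≤ a generalizing a b
  · rw [abs_sub_comm, abs_sub_comm a b]; exact this b a (le_of_not_ge h)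
  rw [abs_of_nonneg (sub_nonneg.2 (Real.sigmoid_le h)), abs_of_nonneg (sub_nonneg.2 h)]
  have := sigmoid_sub_le h
  have := Real.sigmoid_pos b
  nlinarith

lemma abs_sigmoid_sub_le_exp {a b q : ℝ} (ha : q ≤ a) (hb : q ≤ b) :
    |Real.sigmoid a - Real.sigmoid b| ≤ |a - b| * Real.exp (-q) := by
  wlog h : b ≤ a generalizing a b
  · rw [abs_sub_comm, abs_sub_comm a b]; exact this hb ha (le_of_not_ge h)
  rw [abs_of_nonneg (sub_nonneg.2 (Real.sigmoid_le h)), abs_of_nonneg (sub_nonneg.2 h)]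
  refine (sigmoid_sub_le h).trans (mul_le_mul_of_nonneg_left ?_ (sub_nonneg.2 h))
  exact (one_sub_sigmoid_le b).trans (Real.exp_le_exp.2 (by linarith))

/-- The log-odds of the posterior weight. -/
def logOdds {d : ℕ} (σ : ℝ) (o : Obs d) (γ : Param d) : ℝ :=
  ⟪o.2.2, γ.1⟫ + ((o.1 - ⟪o.2.1, γ.2.2⟫) ^ 2 - (o.1 - ⟪o.2.1, γ.2.1⟫) ^ 2) / (2 * σ ^ 2)

lemma weight_eq_sigmoid {d : ℕ} {σ : ℝ} (hσ : 0 < σ) (o : Obs d) (γ : Param d) :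
    weight σ o γ = Real.sigmoid (logOdds σ o γ) := by
  unfold weight logOdds
  set u := ⟪o.2.2, γ.1⟫
  set p := o.1 - ⟪o.2.1, γ.2.1⟫
  set q := o.1 - ⟪o.2.1, γ.2.2⟫
  have hG : ∀ t : ℝ, gaussianPDFReal 0 1 t = (√(2 * Real.pi))⁻¹ * Real.exp (-t ^ 2 / 2) := by
    intro t; simp [gaussianPDFReal]
  rw [hG, hG, ← Real.sigmoid_neg, ← Real.sigmoid_mul_rexp_neg u]
  have hc : (0 : ℝ) < (√(2 * Real.pi))⁻¹ := by positivity
  have hs := Real.sigmoid_pos u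
  have e : Real.exp (-(q / σ) ^ 2 / 2)
      = Real.exp (-(p / σ) ^ 2 / 2) * Real.exp (-((q ^ 2 - p ^ 2) / (2 * σ ^ 2))) := by
    rw [← Real.exp_add]; congr 1; field_simp; ring
  rw [e, Real.sigmoid_def (u + _), neg_add, Real.exp_add]
  have h1 := Real.exp_pos (-(p / σ) ^ 2 / 2)
  have h2 := Real.exp_pos (-u)
  have h3 := Real.exp_pos (-((q ^ 2 - p ^ 2) / (2 * σ ^ 2)))
  rw [div_eq_iff (by positivity)]
  field_simp

lemma weight_nonneg {d : ℕ} {σ : ℝ} (hσ : 0 < σ) (o : Obs d) (γ : Param d) : 0 ≤ weight σ o γ := by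
  rw [weight_eq_sigmoid hσ]; exact Real.sigmoid_nonneg _

lemma weight_le_one {d : ℕ} {σ : ℝ} (hσ : 0 < σ) (o : Obs d) (γ : Param d) : weight σ o γ ≤ 1 := by
  rw [weight_eq_sigmoid hσ]; exact Real.sigmoid_le_one _

lemma cube_mul_exp_neg_le {t : ℝ} (ht : 0 ≤ t) : (1 + t) ^ 3 * Real.exp (-t) ≤ 18 := by
  have h := Real.pow_div_factorial_le_exp (1 + t) (by linarith) 3
  have h2 : Real.exp (1 + t) = Real.exp 1 * Real.exp t := Real.exp_add _ _
  have h3 : Real.exp 1 ≤ 3 := Real.exp_one_lt_three.le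
  have h4 : Real.exp t * Real.exp (-t) = 1 := by rw [← Real.exp_add]; simp
  have h5 := Real.exp_pos (-t)
  have h6 := Real.exp_pos t
  have h7 : (1 + t) ^ 3 ≤ 18 * Real.exp t := by
    norm_num [Nat.factorial] at h
    nlinarith
  calc (1 + t) ^ 3 * Real.exp (-t) ≤ 18 * Real.exp t * Real.exp (-t) := by gcongr
    _ = 18 := by rw [mul_assoc, h4]; ring

/-- Far from the decision boundary both log-odds are large. -/
lemma logOdds_lower {σ l a b r₁ r₂ ε D W : ℝ} (hσ : 0 < σ) (ha : |a| ≤ l)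
    (hW : 1 + |ε| + (|r₁| + |r₂| + |b|) ≤ W) (hD : 4 * W ≤ |D|) :
    |D| - (25 / 16 * σ ^ 2 + l) ≤
      a + b + ((ε + D - r₂) ^ 2 - (ε - r₁) ^ 2) / (2 * σ ^ 2) := by
  have h1 := abs_le.1 ha
  have hb := neg_abs_le b
  have e1 := abs_nonneg ε
  have e2 := abs_nonneg r₁
  have e3 := abs_nonneg r₂
  have e4 := abs_nonneg b
  have hnum : D ^ 2 / 2 ≤ (ε + D - r₂) ^ 2 - (ε - r₁) ^ 2 := by
    have k1 : |D| - (|ε| + |r₂|) ≤ |ε + D - r₂| := by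
      have := abs_sub_abs_le_abs_sub D (r₂ - ε)
      have h2 : |r₂ - ε| ≤ |r₂| + |ε| := abs_sub _ _
      have h3 : D - (r₂ - ε) = ε + D - r₂ := by ring
      rw [h3] at this; linarith
    have k2 : |ε - r₁| ≤ |ε| + |r₁| := abs_sub _ _
    rw [← sq_abs (ε + D - r₂), ← sq_abs (ε - r₁), ← sq_abs D]
    have k3 : (|D| - W) ^ 2 ≤ |ε + D - r₂| ^ 2 := by
      apply pow_le_pow_left₀ <;> linarith
    have k4 : |ε - r₁| ^ 2 ≤ W ^ 2 := by
      apply pow_le_pow_left₀ (abs_nonneg _); linarith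
    nlinarith [abs_nonneg D]
  have hq : D ^ 2 / 2 / (2 * σ ^ 2) ≤ ((ε + D - r₂) ^ 2 - (ε - r₁) ^ 2) / (2 * σ ^ 2) := by
    gcongr
  have hsq : 5 / 4 * |D| - 25 / 16 * σ ^ 2 ≤ D ^ 2 / 2 / (2 * σ ^ 2) := by
    rw [← sq_abs D, le_div_iff₀ (by positivity)]
    nlinarith [sq_nonneg (|D| - 5 / 2 * σ ^ 2)]
  linarith

lemma logOdds_sub_le {σ a b r₁ r₂ ε D V : ℝ} (hV1 : 1 ≤ V) (hV : |ε + D| ≤ V)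
    (hr₂ : |r₂| ≤ V) (hε : |ε| ≤ V) (hr₁ : |r₁| ≤ V) :
    |a + b + ((ε + D - r₂) ^ 2 - (ε - r₁) ^ 2) / (2 * σ ^ 2)
      - (a + ((ε + D) ^ 2 - ε ^ 2) / (2 * σ ^ 2))| ≤
      (1 + 1 / σ ^ 2) * (2 * ((|r₁| + |r₂| + |b|) * V)) := by
  have e2 := abs_nonneg r₁
  have e3 := abs_nonneg r₂
  have e4 := abs_nonneg b
  have hXY : a + b + ((ε + D - r₂) ^ 2 - (ε - r₁) ^ 2) / (2 * σ ^ 2)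
      - (a + ((ε + D) ^ 2 - ε ^ 2) / (2 * σ ^ 2))
      = b + (-(2 * (ε + D) * r₂) + r₂ ^ 2 + 2 * ε * r₁ - r₁ ^ 2) / (2 * σ ^ 2) := by
    ring
  have hn : |-(2 * (ε + D) * r₂) + r₂ ^ 2 + 2 * ε * r₁ - r₁ ^ 2|
      ≤ 2 * (2 * ((|r₁| + |r₂| + |b|) * V)) := by
    have : |-(2 * (ε + D) * r₂) + r₂ ^ 2 + 2 * ε * r₁ - r₁ ^ 2|
        ≤ 2 * |ε + D| * |r₂| + |r₂| ^ 2 + 2 * |ε| * |r₁| + |r₁| ^ 2 := by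
      calc _ ≤ |-(2 * (ε + D) * r₂) + r₂ ^ 2 + 2 * ε * r₁| + |r₁ ^ 2| := abs_sub _ _
        _ ≤ |-(2 * (ε + D) * r₂) + r₂ ^ 2| + |2 * ε * r₁| + |r₁ ^ 2| := by
          gcongr; exact abs_add_le _ _
        _ ≤ |-(2 * (ε + D) * r₂)| + |r₂ ^ 2| + |2 * ε * r₁| + |r₁ ^ 2| := by
          gcongr; exact abs_add_le _ _
        _ = _ := by simp [abs_mul]
    refine this.trans ?_
    calc 2 * |ε + D| * |r₂| + |r₂| ^ 2 + 2 * |ε| * |r₁| + |r₁| ^ 2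
        ≤ 2 * V * |r₂| + V * |r₂| + 2 * V * |r₁| + V * |r₁| := by
          rw [sq, sq]; gcongr
      _ ≤ _ := by nlinarith
  rw [hXY]
  calc _ ≤ |b| + |(-(2 * (ε + D) * r₂) + r₂ ^ 2 + 2 * ε * r₁ - r₁ ^ 2) / (2 * σ ^ 2)| :=
        abs_add_le _ _
    _ ≤ (|r₁| + |r₂| + |b|) * V * 2 + 2 * (2 * ((|r₁| + |r₂| + |b|) * V)) / (2 * σ ^ 2) := by
        rw [abs_div, abs_of_nonneg (by positivity : 0 ≤ 2 * σ ^ 2)]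
        gcongr
        nlinarith
    _ = _ := by
        rw [mul_div_mul_left _ _ (two_ne_zero)]; ring

set_option maxHeartbeats 1000000 in
lemma sigmoid_perturb {σ l : ℝ} (hσ : 0 < σ) (hl : 0 ≤ l) :
    ∃ C : ℝ, 1 ≤ C ∧ ∀ a b r₁ r₂ ε D : ℝ, |a| ≤ l →
      |Real.sigmoid (a + b + ((ε + D - r₂) ^ 2 - (ε - r₁) ^ 2) / (2 * σ ^ 2))
          - Real.sigmoid (a + ((ε + D) ^ 2 - ε ^ 2) / (2 * σ ^ 2))|
          * ((1 + |ε| + |ε + D|) * (1 + |D|))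
        ≤ C * ((|r₁| + |r₂| + |b|) * (1 + |ε| + (|r₁| + |r₂| + |b|)) ^ 5) ∧
      (1 - Real.sigmoid (a + b + ((ε + D - r₂) ^ 2 - (ε - r₁) ^ 2) / (2 * σ ^ 2))) * |ε + D|
        ≤ C * (1 + |ε| + (|r₁| + |r₂| + |b|)) := by
  set E := Real.exp (25 / 16 * σ ^ 2 + l) with hE
  have hE1 : 1 ≤ E := Real.one_le_exp (by positivity)
  set c := 1 + 1 / σ ^ 2 with hc
  have hc1 : 1 ≤ c := by rw [hc]; have : 0 < 1 / σ ^ 2 := by positivity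
                         linarith
  refine ⟨500 * c * E, by nlinarith [mul_le_mul hc1 hE1 (by norm_num) (by linarith)], ?_⟩
  intro a b r₁ r₂ ε D ha
  set R := |r₁| + |r₂| + |b| with hR
  set W := 1 + |ε| + R with hW
  set X := a + b + ((ε + D - r₂) ^ 2 - (ε - r₁) ^ 2) / (2 * σ ^ 2) with hX
  set Y := a + ((ε + D) ^ 2 - ε ^ 2) / (2 * σ ^ 2) with hY
  have e1 := abs_nonneg ε
  have e2 := abs_nonneg r₁
  have e3 := abs_nonneg r₂
  have e4 := abs_nonneg b
  have e5 := abs_nonneg D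
  have hR0 : 0 ≤ R := by positivity
  have hW1 : 1 ≤ W := by linarith
  have hεD : |ε + D| ≤ |ε| + |D| := abs_add_le _ _
  have hWD : W ≤ W * (1 + |D|) := le_mul_of_one_le_right (by linarith) (by linarith)
  have hDW : 1 + |D| ≤ W * (1 + |D|) := le_mul_of_one_le_left (by linarith) hW1
  have hWD2 : |ε| + |D| ≤ W * (1 + |D|) := by
    have : W * (1 + |D|) = W + W * |D| := by ring
    have h2 : |D| ≤ W * |D| := le_mul_of_one_le_left e5 hW1
    linarith
  have hdiff : |X - Y| ≤ c * (2 * (R * (W * (1 + |D|)))) :=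
    logOdds_sub_le (by linarith) (by linarith) (by linarith) (by linarith) (by linarith)
  have hA : 1 + |ε| + |ε + D| ≤ 2 * (W * (1 + |D|)) := by linarith
  have hcE : c ≤ c * E := by nlinarith
  rcases le_or_gt (4 * W) |D| with hD | hD
  · have hXl : |D| - (25 / 16 * σ ^ 2 + l) ≤ X := logOdds_lower hσ ha le_rfl hD
    have hYl : |D| - (25 / 16 * σ ^ 2 + l) ≤ Y := by
      have h := logOdds_lower (b := 0) (r₁ := 0) (r₂ := 0) (W := W) (D := D) (ε := ε) hσ ha
        (by simp; linarith) hD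
      simpa [hY] using h
    have hexp : Real.exp (-(|D| - (25 / 16 * σ ^ 2 + l))) = E * Real.exp (-|D|) := by
      rw [hE, ← Real.exp_add]; congr 1; ring
    have h18 := cube_mul_exp_neg_le e5
    constructor
    · have h1 := abs_sigmoid_sub_le_exp hXl hYl
      rw [hexp] at h1
      calc |Real.sigmoid X - Real.sigmoid Y| * ((1 + |ε| + |ε + D|) * (1 + |D|))
          ≤ (c * (2 * (R * (W * (1 + |D|))))) * (E * Real.exp (-|D|))
            * (2 * (W * (1 + |D|)) * (1 + |D|)) := by
            gcongr
            exact h1.trans (by gcongr)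
        _ = 4 * c * E * (R * W ^ 2) * ((1 + |D|) ^ 3 * Real.exp (-|D|)) := by ring
        _ ≤ 4 * c * E * (R * W ^ 5) * 18 := by
            gcongr
            norm_num
        _ = 72 * (c * E * (R * W ^ 5)) := by ring
        _ ≤ 500 * (c * E * (R * W ^ 5)) := by gcongr; norm_num
        _ = 500 * c * E * (R * W ^ 5) := by ring
    · have h1 : 1 - Real.sigmoid X ≤ E * Real.exp (-|D|) := by
        rw [← hexp]
        exact (one_sub_sigmoid_le X).trans (Real.exp_le_exp.2 (by linarith))
      calc (1 - Real.sigmoid X) * |ε + D|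
          ≤ (E * Real.exp (-|D|)) * (2 * (W * (1 + |D|))) := by
            gcongr
            linarith
        _ = 2 * E * W * ((1 + |D|) ^ 1 * Real.exp (-|D|)) := by ring
        _ ≤ 2 * E * W * ((1 + |D|) ^ 3 * Real.exp (-|D|)) := by
            gcongr
            · linarith
            · norm_num
        _ ≤ 2 * E * W * 18 := by gcongr
        _ = 36 * 1 * E * W := by ring
        _ ≤ 500 * c * E * W := by gcongr; norm_num
  · have hD5 : 1 + |D| ≤ 5 * W := by linarith
    constructor
    · calc |Real.sigmoid X - Real.sigmoid Y| * ((1 + |ε| + |ε + D|) * (1 + |D|))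
          ≤ (c * (2 * (R * (W * (1 + |D|))))) * (2 * (W * (1 + |D|)) * (1 + |D|)) := by
            gcongr
            exact (abs_sigmoid_sub_le X Y).trans hdiff
        _ = 4 * c * (R * W ^ 2) * (1 + |D|) ^ 3 := by ring
        _ ≤ 4 * c * (R * W ^ 2) * (5 * W) ^ 3 := by gcongr
        _ = 500 * c * (R * W ^ 5) := by ring
        _ ≤ 500 * c * E * (R * W ^ 5) := by
            have : 0 ≤ R * W ^ 5 := by positivity
            rw [mul_assoc 500 c E]
            gcongr
    · have h0 : 1 - Real.sigmoid X ≤ 1 := by linarith [Real.sigmoid_pos X]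
      have h1 : |ε + D| ≤ 5 * W := by linarith
      calc (1 - Real.sigmoid X) * |ε + D| ≤ 1 * (5 * W) := by gcongr
        _ = 5 * 1 * 1 * W := by ring
        _ ≤ 500 * c * E * W := by gcongr; norm_num

lemma weight_perturb {σ l : ℝ} (hσ : 0 < σ) (hl : 0 ≤ l) :
    ∃ C : ℝ, 1 ≤ C ∧ ∀ (d : ℕ) (γ γs : Param d) (x z : Vec d) (y ε : ℝ), |⟪z, γs.1⟫| ≤ l →
      (y = ⟪x, γs.2.1⟫ + ε ∨ y = ⟪x, γs.2.2⟫ + ε) → ∀ R : ℝ,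
      R = |⟪x, γ.2.1 - γs.2.1⟫| + |⟪x, γ.2.2 - γs.2.2⟫| + |⟪z, γ.1 - γs.1⟫| →
      |weight σ (y, x, z) γ - weight σ (y, x, z) γs| *
          ((1 + |y - ⟪x, γs.2.1⟫| + |y - ⟪x, γs.2.2⟫|) * (1 + |⟪x, γs.2.1 - γs.2.2⟫|))
        ≤ C * (R * (1 + |ε| + R) ^ 5) ∧
      weight σ (y, x, z) γ * |y - ⟪x, γs.2.1⟫| ≤ C * (1 + |ε| + R) ∧
      (1 - weight σ (y, x, z) γ) * |y - ⟪x, γs.2.2⟫| ≤ C * (1 + |ε| + R) := by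
  obtain ⟨C, hC, h⟩ := sigmoid_perturb hσ hl
  refine ⟨C, hC, ?_⟩
  intro d γ γs x z y ε hz hy R hR
  rw [weight_eq_sigmoid hσ, weight_eq_sigmoid hσ]
  unfold logOdds
  simp only
  set r₁ := ⟪x, γ.2.1 - γs.2.1⟫ with hr₁
  set r₂ := ⟪x, γ.2.2 - γs.2.2⟫ with hr₂
  set b := ⟪z, γ.1 - γs.1⟫ with hb
  have g1 : ⟪x, γ.2.1⟫ = ⟪x, γs.2.1⟫ + r₁ := by rw [hr₁, inner_sub_right]; ring
  have g2 : ⟪x, γ.2.2⟫ = ⟪x, γs.2.2⟫ + r₂ := by rw [hr₂, inner_sub_right]; ring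
  have g3 : ⟪z, γ.1⟫ = ⟪z, γs.1⟫ + b := by rw [hb, inner_sub_right]; ring
  have g4 : ⟪x, γs.2.1 - γs.2.2⟫ = ⟪x, γs.2.1⟫ - ⟪x, γs.2.2⟫ := inner_sub_right _ _ _
  rw [g1, g2, g3, g4]
  have hRε : 0 ≤ |ε| := abs_nonneg ε
  have hR0 : 0 ≤ R := by rw [hR]; positivity
  have triv : ∀ w : ℝ, w ≤ 1 → w * |ε| ≤ C * (1 + |ε| + R) := by
    intro w hw; nlinarith
  rcases hy with hy | hy
  · obtain ⟨h1, h2⟩ := h ⟪z, γs.1⟫ b r₁ r₂ ε (⟪x, γs.2.1⟫ - ⟪x, γs.2.2⟫) hz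
    rw [← hR] at h1 h2
    have k1 : y - (⟪x, γs.2.2⟫ + r₂) = ε + (⟪x, γs.2.1⟫ - ⟪x, γs.2.2⟫) - r₂ := by rw [hy]; ring
    have k2 : y - (⟪x, γs.2.1⟫ + r₁) = ε - r₁ := by rw [hy]; ring
    have k3 : y - ⟪x, γs.2.2⟫ = ε + (⟪x, γs.2.1⟫ - ⟪x, γs.2.2⟫) := by rw [hy]; ring
    have k4 : y - ⟪x, γs.2.1⟫ = ε := by rw [hy]; ring
    rw [k1, k2, k3, k4]
    exact ⟨h1, triv _ (Real.sigmoid_le_one _), h2⟩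
  · obtain ⟨h1, h2⟩ := h (-⟪z, γs.1⟫) (-b) r₂ r₁ ε (⟪x, γs.2.2⟫ - ⟪x, γs.2.1⟫) (by rwa [abs_neg])
    have hR' : |r₂| + |r₁| + |-b| = R := by rw [hR, abs_neg]; ring
    rw [hR'] at h1 h2
    have k1 : y - (⟪x, γs.2.1⟫ + r₁) = ε + (⟪x, γs.2.2⟫ - ⟪x, γs.2.1⟫) - r₁ := by rw [hy]; ring
    have k2 : y - (⟪x, γs.2.2⟫ + r₂) = ε - r₂ := by rw [hy]; ring
    have k3 : y - ⟪x, γs.2.1⟫ = ε + (⟪x, γs.2.2⟫ - ⟪x, γs.2.1⟫) := by rw [hy]; ring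
    have k4 : y - ⟪x, γs.2.2⟫ = ε := by rw [hy]; ring
    rw [k1, k2, k3, k4]
    have m1 : -⟪z, γs.1⟫ + -b
          + ((ε + (⟪x, γs.2.2⟫ - ⟪x, γs.2.1⟫) - r₁) ^ 2 - (ε - r₂) ^ 2) / (2 * σ ^ 2)
        = -(⟪z, γs.1⟫ + b + ((ε - r₂) ^ 2 - (ε + (⟪x, γs.2.2⟫ - ⟪x, γs.2.1⟫) - r₁) ^ 2) / (2 * σ ^ 2)) := by
      ring
    have m2 : -⟪z, γs.1⟫ + ((ε + (⟪x, γs.2.2⟫ - ⟪x, γs.2.1⟫)) ^ 2 - ε ^ 2) / (2 * σ ^ 2)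
        = -(⟪z, γs.1⟫ + (ε ^ 2 - (ε + (⟪x, γs.2.2⟫ - ⟪x, γs.2.1⟫)) ^ 2) / (2 * σ ^ 2)) := by
      ring
    rw [m1, m2, Real.sigmoid_neg, Real.sigmoid_neg] at h1
    rw [m1, Real.sigmoid_neg] at h2
    refine ⟨?_, ?_, ?_⟩
    · rw [sub_sub_sub_cancel_left, abs_sub_comm] at h1
      rw [abs_sub_comm ⟪x, γs.2.1⟫]
      convert h1 using 2
      ring
    · simpa using h2
    · exact triv _ (by linarith [Real.sigmoid_pos (⟪z, γs.1⟫ + b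
        + ((ε - r₂) ^ 2 - (ε + (⟪x, γs.2.2⟫ - ⟪x, γs.2.1⟫) - r₁) ^ 2) / (2 * σ ^ 2))])

/-- The quadratic-then-linear function `min (b², |b|)`. -/
def hub (b : ℝ) : ℝ := min (b ^ 2) |b|

lemma hub_nonneg (b : ℝ) : 0 ≤ hub b := le_min (sq_nonneg _) (abs_nonneg _)

lemma hub_le_sq (b : ℝ) : hub b ≤ b ^ 2 := min_le_left _ _

lemma hub_scale {t : ℝ} (ht : 0 ≤ t) (b : ℝ) : min (t ^ 2) t * hub b ≤ hub (t * b) := by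
  have h0 : 0 ≤ min (t ^ 2) t := le_min (sq_nonneg _) ht
  refine le_min ?_ ?_
  · rw [mul_pow]; exact mul_le_mul (min_le_left _ _) (min_le_left _ _) (hub_nonneg _) (sq_nonneg _)
  · rw [abs_mul, abs_of_nonneg ht]
    exact mul_le_mul (min_le_right _ _) (min_le_right _ _) (hub_nonneg _) ht

lemma trunc_sq_le_hub {B : ℝ} (hB : 1 ≤ B) (b : ℝ) : (min |b| B) ^ 2 ≤ B * hub b := by
  unfold hub
  have hb := abs_nonneg b
  have h0 : 0 ≤ min |b| B := le_min hb (by linarith)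
  rw [mul_min_of_nonneg _ _ (by linarith : (0:ℝ) ≤ B)]
  refine le_min ?_ ?_
  · have : (min |b| B) ^ 2 ≤ |b| ^ 2 := pow_le_pow_left₀ h0 (min_le_left _ _) 2
    rw [sq_abs] at this
    nlinarith [sq_nonneg b]
  · rw [sq, mul_comm B]
    exact mul_le_mul (min_le_left _ _) (min_le_right _ _) h0 hb

lemma one_add_add_sq_le_exp {t : ℝ} (ht : -1 ≤ t) : 1 + t + t ^ 2 / 4 ≤ Real.exp t := by
  have h := Real.add_one_le_exp (t / 2)
  have h2 : Real.exp t = Real.exp (t / 2) ^ 2 := by rw [← Real.exp_nat_mul]; congr 1; push_cast; ring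
  rw [h2]
  nlinarith

/-- Lower bound for the excess logistic loss. -/
lemma log_mgf_bernoulli_lower {p b : ℝ} (hp0 : 0 < p) (hp1 : p < 1) :
    p * (1 - p) / 8 * hub b ≤ Real.log (1 - p + p * Real.exp b) - p * b := by
  have hq : 0 < 1 - p := by linarith
  have key : ∀ u : ℝ, Real.log (1 - p + p * Real.exp u) - p * u
      = Real.log ((1 - p) * Real.exp (-p * u) + p * Real.exp ((1 - p) * u)) := by
    intro u
    have : (1 - p) * Real.exp (-p * u) + p * Real.exp ((1 - p) * u)
        = (1 - p + p * Real.exp u) * Real.exp (-(p * u)) := by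
      have e : Real.exp ((1 - p) * u) = Real.exp u * Real.exp (-(p * u)) := by
        rw [← Real.exp_add]; congr 1; ring
      rw [e, neg_mul]; ring
    rw [this, Real.log_mul (by positivity) (Real.exp_pos _).ne', Real.log_exp]; ring
  have small : ∀ u : ℝ, |u| ≤ 1 → p * (1 - p) / 8 * u ^ 2 ≤
      Real.log ((1 - p) * Real.exp (-p * u) + p * Real.exp ((1 - p) * u)) := by
    intro u hu
    have hu' := abs_le.1 hu
    have h1 := one_add_add_sq_le_exp (t := -p * u) (by nlinarith)
    have h2 := one_add_add_sq_le_exp (t := (1 - p) * u) (by nlinarith)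
    have hu2 : u ^ 2 ≤ 1 := by nlinarith
    set w := p * (1 - p) * u ^ 2 / 4 with hw
    have hw0 : 0 ≤ w := by positivity
    have hw1 : w ≤ 1 := by nlinarith [sq_nonneg u]
    have h3 : 1 + w ≤ (1 - p) * Real.exp (-p * u) + p * Real.exp ((1 - p) * u) := by
      calc 1 + w = (1 - p) * (1 + -p * u + (-p * u) ^ 2 / 4)
            + p * (1 + (1 - p) * u + ((1 - p) * u) ^ 2 / 4) := by rw [hw]; ring
        _ ≤ _ := by gcongr
    have h4 : w / 2 ≤ Real.log (1 + w) := by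
      have := Real.one_sub_inv_le_log_of_pos (by linarith : 0 < 1 + w)
      refine le_trans ?_ this
      have : 1 - (1 + w)⁻¹ = w / (1 + w) := by field_simp; ring
      rw [this]
      gcongr
      linarith
    calc p * (1 - p) / 8 * u ^ 2 = w / 2 := by rw [hw]; ring
      _ ≤ Real.log (1 + w) := h4
      _ ≤ _ := Real.log_le_log (by linarith) h3
  rw [key]
  rcases le_or_gt |b| 1 with hb | hb
  · refine le_trans ?_ (small b hb)
    have := hub_le_sq b
    gcongr
  · set t := |b| with ht
    have ht0 : 0 < t := by linarith
    set u := b / t with hu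
    have hu1 : |u| = 1 := by rw [hu, abs_div, abs_of_pos ht0, ← ht]; field_simp
    have hbu : b = t * u := by rw [hu]; field_simp
    have hs := small u hu1.le
    have hu2 : u ^ 2 = 1 := by rw [← sq_abs, hu1]; norm_num
    rw [hu2, mul_one] at hs
    set A := (1 - p) * Real.exp (-p * u) + p * Real.exp ((1 - p) * u) with hA
    have hA0 : 0 < A := by positivity
    have hconv := (convexOn_rpow hb.le).2 (Set.mem_Ici.2 (Real.exp_pos (-p * u)).le)
      (Set.mem_Ici.2 (Real.exp_pos ((1 - p) * u)).le) hq.le hp0.le (by ring)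
    simp only [smul_eq_mul] at hconv
    rw [← Real.exp_mul, ← Real.exp_mul] at hconv
    have e1 : -p * u * t = -p * b := by rw [hbu]; ring
    have e2 : (1 - p) * u * t = (1 - p) * b := by rw [hbu]; ring
    rw [e1, e2] at hconv
    calc p * (1 - p) / 8 * hub b ≤ p * (1 - p) / 8 * t := by
          gcongr; exact min_le_right _ _
      _ ≤ Real.log A * t := by gcongr
      _ = Real.log (A ^ t) := by rw [Real.log_rpow hA0]; ring
      _ ≤ _ := Real.log_le_log (Real.rpow_pos_of_pos hA0 _) hconv

lemma log_sigmoid_expand {u : ℝ} : Real.log (Real.sigmoid u) = u - Real.log (1 + Real.exp u) ∧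
    Real.log (1 - Real.sigmoid u) = -Real.log (1 + Real.exp u) := by
  have h : Real.log (1 - Real.sigmoid u) = -Real.log (1 + Real.exp u) := by
    rw [← Real.sigmoid_neg, Real.sigmoid_def, neg_neg, Real.log_inv]
  refine ⟨?_, h⟩
  have := Real.sigmoid_mul_rexp_neg (-u)
  rw [neg_neg] at this
  rw [← this, Real.log_mul (Real.sigmoid_pos _).ne' (Real.exp_pos _).ne', Real.log_exp,
    Real.sigmoid_neg, h]
  ring

/-- The excess of the logistic loss at `u + b` over its value at `u`. -/
lemma logistic_excess {ξ u b w : ℝ} (hξ0 : 0 < ξ) (h1 : ξ < Real.sigmoid u)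
    (h2 : Real.sigmoid u < 1 - ξ) :
    ξ ^ 2 / 8 * hub b - (w - Real.sigmoid u) * b ≤
      -(w * Real.log (Real.sigmoid (u + b)) + (1 - w) * Real.log (1 - Real.sigmoid (u + b)))
      + (w * Real.log (Real.sigmoid u) + (1 - w) * Real.log (1 - Real.sigmoid u)) := by
  obtain ⟨a1, a2⟩ := @log_sigmoid_expand u
  obtain ⟨b1, b2⟩ := @log_sigmoid_expand (u + b)
  rw [a1, a2, b1, b2]
  have hb := log_mgf_bernoulli_lower (b := b) (Real.sigmoid_pos u) (Real.sigmoid_lt_one u)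
  have e : Real.log (1 - Real.sigmoid u + Real.sigmoid u * Real.exp b)
      = Real.log (1 + Real.exp (u + b)) - Real.log (1 + Real.exp u) := by
    rw [← Real.log_div (by positivity) (by positivity)]
    congr 1
    have : Real.sigmoid u = Real.exp u / (1 + Real.exp u) := by
      rw [Real.sigmoid_def, Real.exp_neg]; field_simp; ring
    rw [this, Real.exp_add]; field_simp; ring
  rw [e] at hb
  have h3 : ξ ^ 2 / 8 * hub b ≤ Real.sigmoid u * (1 - Real.sigmoid u) / 8 * hub b := by
    apply mul_le_mul_of_nonneg_right _ (hub_nonneg _)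
    nlinarith
  nlinarith

/-! ### Deterministic analysis of the `ℓ₁`-penalized steps -/

/-- The signed sum of coordinate vectors `∑ₗ ± e_{φ l}`. -/
def dirVec {d m : ℕ} (φ : Fin m → Fin d × Bool) : Vec d :=
  ∑ l, (if (φ l).2 then (1 : ℝ) else -1) • EuclideanSpace.single (φ l).1 (1 : ℝ)

lemma inner_dirVec {d m : ℕ} (G : Vec d) (φ : Fin m → Fin d × Bool) :
    ⟪G, dirVec φ⟫ = ∑ l, (if (φ l).2 then (1 : ℝ) else -1) * G (φ l).1 := by
  unfold dirVec
  rw [inner_sum]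
  refine Finset.sum_congr rfl fun l _ => ?_
  rw [inner_smul_right, EuclideanSpace.inner_single_right]
  simp

lemma dirVec_apply {d m : ℕ} (φ : Fin m → Fin d × Bool) (j : Fin d) :
    dirVec φ j = ∑ l, (if (φ l).2 then (1 : ℝ) else -1) * (if j = (φ l).1 then 1 else 0) := by
  unfold dirVec
  rw [WithLp.ofLp_sum, Finset.sum_apply]
  refine Finset.sum_congr rfl fun l _ => ?_
  rw [PiLp.smul_apply, smul_eq_mul, PiLp.single_apply]

lemma norm_sq_dirVec_of_injective {d m : ℕ} (φ : Fin m → Fin d × Bool)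
    (h : Function.Injective fun l => (φ l).1) : ‖dirVec φ‖ ^ 2 = m := by
  rw [← real_inner_self_eq_norm_sq, inner_dirVec]
  have : ∀ l, (if (φ l).2 then (1 : ℝ) else -1) * dirVec φ (φ l).1 = 1 := by
    intro l
    rw [dirVec_apply, Finset.sum_eq_single l]
    · by_cases hb : (φ l).2 <;> simp [hb]
    · intro l' _ hl
      have : (φ l).1 ≠ (φ l').1 := fun e => hl (h e.symm)
      simp [this]
    · simp
  simp [this]

lemma norm_dirVec_const {d m : ℕ} (j : Fin d) (b : Bool) :
    ‖dirVec (fun _ : Fin m => (j, b))‖ = m := by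
  unfold dirVec
  simp only [Finset.sum_const, Finset.card_univ, Fintype.card_fin]
  rw [← Nat.cast_smul_eq_nsmul ℝ, norm_smul, norm_smul]
  cases b <;> simp

lemma sign_mul_eq_abs (x : ℝ) : (if decide (0 ≤ x) then (1 : ℝ) else -1) * x = |x| := by
  by_cases h : 0 ≤ x
  · simp [h, abs_of_nonneg h]
  · simp [h, abs_of_neg (not_le.1 h)]

lemma l1_nonneg {d : ℕ} (v : Vec d) : 0 ≤ l1 v := Finset.sum_nonneg fun _ _ => abs_nonneg _

lemma sum_abs_le_sqrt_card_mul_norm {d : ℕ} (J : Finset (Fin d)) (v : Vec d) :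
    ∑ j ∈ J, |v j| ≤ √(J.card : ℝ) * ‖v‖ := by
  have h1 : (∑ j ∈ J, |v j|) ^ 2 ≤ J.card * ∑ j ∈ J, |v j| ^ 2 := sq_sum_le_card_mul_sum_sq
  have h2 : ∑ j ∈ J, |v j| ^ 2 ≤ ‖v‖ ^ 2 := by
    rw [EuclideanSpace.norm_sq_eq]
    simp only [Real.norm_eq_abs]
    exact Finset.sum_le_sum_of_subset_of_nonneg (Finset.subset_univ _) fun _ _ _ => sq_nonneg _
  have h0 : 0 ≤ ∑ j ∈ J, |v j| := Finset.sum_nonneg fun _ _ => abs_nonneg _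
  rw [← Real.sqrt_sq h0, ← Real.sqrt_sq (norm_nonneg v), ← Real.sqrt_mul (Nat.cast_nonneg _)]
  exact Real.sqrt_le_sqrt (h1.trans (by gcongr))

/-- If all signed sums of `m` coordinates of `G` are controlled, then at most `m` coordinates
exceed `lam / 2`, and `G` acts as an `ℓ₁` perturbation of size `lam / 2` plus an `ℓ₂` one. -/
lemma inner_le_of_dirVec {d m : ℕ} (hm : 0 < m) {G : Vec d} {lam : ℝ} (hlam : 0 ≤ lam)
    (h : ∀ φ : Fin m → Fin d × Bool, ⟪G, dirVec φ⟫ ≤ ‖dirVec φ‖ * (√m * lam / 2)) (v : Vec d) :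
    ⟪G, v⟫ ≤ lam / 2 * l1 v + m * lam / 2 * ‖v‖ := by
  have hm' : (0 : ℝ) < m := by exact_mod_cast hm
  set t := √(m : ℝ) * lam / 2 with ht
  set J : Finset (Fin d) := Finset.univ.filter fun j => lam / 2 < |G j| with hJ
  have hcard : J.card < m := by
    by_contra hge
    obtain ⟨J', hJ', hc⟩ := Finset.exists_subset_card_eq (not_lt.1 hge)
    let e := J'.equivFinOfCardEq hc
    let φ : Fin m → Fin d × Bool := fun l => ((e.symm l : Fin d), decide (0 ≤ G (e.symm l)))
    have hinj : Function.Injective fun l => (φ l).1 := by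
      intro a b hab
      exact e.symm.injective (Subtype.ext hab)
    have h1 := h φ
    have h2 : ‖dirVec φ‖ = √m := by
      rw [← norm_sq_dirVec_of_injective φ hinj, Real.sqrt_sq (norm_nonneg _)]
    rw [h2, inner_dirVec] at h1
    have h3 : (m : ℝ) * (lam / 2) < ∑ l, (if (φ l).2 then (1 : ℝ) else -1) * G (φ l).1 := by
      have : ∀ l, (if (φ l).2 then (1 : ℝ) else -1) * G (φ l).1 = |G (e.symm l)| :=
        fun l => sign_mul_eq_abs _
      simp_rw [this]
      have hlt : ∑ l : Fin m, lam / 2 < ∑ l : Fin m, |G (e.symm l)| := by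
        apply Finset.sum_lt_sum_of_nonempty
        · exact ⟨⟨0, hm⟩, Finset.mem_univ _⟩
        · intro l _
          have := hJ' (e.symm l).2
          rw [hJ, Finset.mem_filter] at this
          exact this.2
      simpa using hlt
    have h4 : √(m : ℝ) * t = m * (lam / 2) := by
      rw [ht]
      have := Real.mul_self_sqrt hm'.le
      linear_combination (lam / 2) * this
    linarith
  have hsup : ∀ j, |G j| ≤ t := by
    intro j
    have h1 := h (fun _ => (j, decide (0 ≤ G j)))
    rw [norm_dirVec_const, inner_dirVec] at h1
    simp only [sign_mul_eq_abs, Finset.sum_const, Finset.card_univ, Fintype.card_fin,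
      nsmul_eq_mul] at h1
    exact le_of_mul_le_mul_left h1 hm'
  have hsplit : ⟪G, v⟫ ≤ ∑ j, (lam / 2 * |v j| + if j ∈ J then t * |v j| else 0) := by
    rw [PiLp.inner_apply]
    refine Finset.sum_le_sum fun j _ => ?_
    have h1 : ⟪G j, v j⟫ ≤ |G j| * |v j| := by
      rw [← abs_mul]
      refine le_trans (le_of_eq ?_) (le_abs_self _)
      simp [mul_comm]
    refine h1.trans ?_
    by_cases hj : j ∈ J
    · rw [if_pos hj]
      have := mul_le_mul_of_nonneg_right (hsup j) (abs_nonneg (v j))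
      have : 0 ≤ lam / 2 * |v j| := by positivity
      linarith
    · rw [if_neg hj, add_zero]
      refine mul_le_mul_of_nonneg_right ?_ (abs_nonneg _)
      rw [hJ, Finset.mem_filter] at hj
      simpa using hj
  refine hsplit.trans ?_
  rw [Finset.sum_add_distrib, ← Finset.mul_sum, Finset.sum_ite_mem, Finset.univ_inter,
    ← Finset.mul_sum]
  have ht0 : 0 ≤ t := by positivity
  have h5 : t * ∑ j ∈ J, |v j| ≤ m * lam / 2 * ‖v‖ := by
    have h6 : √(J.card : ℝ) ≤ √m := Real.sqrt_le_sqrt (by exact_mod_cast hcard.le)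
    calc t * ∑ j ∈ J, |v j| ≤ t * (√(J.card : ℝ) * ‖v‖) := by
          gcongr; exact sum_abs_le_sqrt_card_mul_norm J v
      _ ≤ t * (√m * ‖v‖) := by gcongr
      _ = m * lam / 2 * ‖v‖ := by
          rw [ht]
          have := Real.mul_self_sqrt hm'.le
          linear_combination (lam / 2 * ‖v‖) * this
  unfold l1
  linarith

/-- The decrease of the `ℓ₁` norm is controlled on the support. -/
lemma l1_sub_le {d s : ℕ} {βs v : Vec d} (hs : l0 βs ≤ s) :
    l1 βs - l1 (βs + v) ≤ 2 * √s * ‖v‖ - l1 v := by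
  set J : Finset (Fin d) := Finset.univ.filter fun j => βs j ≠ 0 with hJ
  have h1 : l1 βs - l1 (βs + v) ≤ ∑ j, ((if j ∈ J then 2 * |v j| else 0) - |v j|) := by
    unfold l1
    rw [← Finset.sum_sub_distrib]
    refine Finset.sum_le_sum fun j _ => ?_
    by_cases hj : j ∈ J
    · rw [if_pos hj]
      have := abs_sub_abs_le_abs_sub (βs j) (βs j + v j)
      rw [PiLp.add_apply]
      have e : |βs j - (βs j + v j)| = |v j| := by rw [← abs_neg]; congr 1; ring
      rw [e] at this; linarith
    · rw [if_neg hj]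
      have h0 : βs j = 0 := by rw [hJ, Finset.mem_filter] at hj; simpa using hj
      simp [h0]
  refine h1.trans ?_
  rw [Finset.sum_sub_distrib, Finset.sum_ite_mem, Finset.univ_inter, ← Finset.mul_sum]
  have h2 := sum_abs_le_sqrt_card_mul_norm J v
  have h3 : √(J.card : ℝ) ≤ √s := Real.sqrt_le_sqrt (by exact_mod_cast hs)
  have h4 : √(J.card : ℝ) * ‖v‖ ≤ √s * ‖v‖ := by gcongr
  unfold l1
  linarith

/-- Error bound for a penalized minimizer from a basic inequality, a noise bound and restricted
curvature. -/
lemma penalized_error {d s m : ℕ} (hm : 0 < m) {I : Finset ℕ} (hI : 0 < I.card)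
    {βs v : Vec d} (hs : l0 βs ≤ s) {score mean : ℕ → Vec d} {lam η ρ c : ℝ} {curv : Vec d → ℝ}
    (hlam : 0 < lam) (hη : 0 ≤ η) (hc : 0 < c)
    (hbasic : I.card * curv v ≤ ∑ i ∈ I, ⟪score i, v⟫ + I.card * (lam * (l1 βs - l1 (βs + v))))
    (hnoise : ∀ φ : Fin m → Fin d × Bool, ∑ i ∈ I, ⟪score i - mean i, dirVec φ⟫
      ≤ I.card * (‖dirVec φ‖ * (√m * lam / 2)))
    (hmean : ∀ i ∈ I, ∀ u, ⟪mean i, u⟫ ≤ η * ‖u‖)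
    (hcurv0 : 0 ≤ curv v)
    (hcurv : l1 v ≤ ρ * ‖v‖ → c * min (‖v‖ ^ 2) ‖v‖ ≤ curv v)
    (hρ : 4 * √s + m + 2 * η / lam ≤ ρ)
    (hsmall : 2 * lam * √s + m * lam / 2 + η < c) :
    ‖v‖ ≤ (2 * lam * √s + m * lam / 2 + η) / c ∧ l1 v ≤ ρ * ‖v‖ := by
  have hn : (0 : ℝ) < I.card := by exact_mod_cast hI
  set G : Vec d := (I.card : ℝ)⁻¹ • ∑ i ∈ I, (score i - mean i) with hG
  have hG1 : ∀ u, ⟪G, u⟫ = (I.card : ℝ)⁻¹ * ∑ i ∈ I, ⟪score i - mean i, u⟫ := by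
    intro u; rw [hG, real_inner_smul_left, sum_inner]
  have hGn := inner_le_of_dirVec hm (G := G) hlam.le (fun φ => by
    rw [hG1, inv_mul_le_iff₀ hn]; exact hnoise φ) v
  have hscore : ∑ i ∈ I, ⟪score i, v⟫ ≤ I.card * (⟪G, v⟫ + η * ‖v‖) := by
    rw [mul_add, hG1, mul_inv_cancel_left₀ hn.ne']
    have : ∀ i ∈ I, ⟪score i, v⟫ ≤ ⟪score i - mean i, v⟫ + η * ‖v‖ := by
      intro i hi
      have := hmean i hi v
      rw [inner_sub_left]; linarith
    calc _ ≤ ∑ i ∈ I, (⟪score i - mean i, v⟫ + η * ‖v‖) := Finset.sum_le_sum this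
      _ = _ := by rw [Finset.sum_add_distrib, Finset.sum_const, nsmul_eq_mul]
  have hb : curv v ≤ ⟪G, v⟫ + η * ‖v‖ + lam * (l1 βs - l1 (βs + v)) := by
    have : (I.card : ℝ) * curv v ≤ I.card * (⟪G, v⟫ + η * ‖v‖ + lam * (l1 βs - l1 (βs + v))) := by
      linarith
    exact le_of_mul_le_mul_left this hn
  have hl1 := mul_le_mul_of_nonneg_left (l1_sub_le (v := v) hs) hlam.le
  have hmain : curv v + lam / 2 * l1 v ≤ (2 * lam * √s + m * lam / 2 + η) * ‖v‖ := by
    nlinarith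
  have hcone : l1 v ≤ ρ * ‖v‖ := by
    have h1 : lam / 2 * l1 v ≤ lam / 2 * ((4 * √s + m + 2 * η / lam) * ‖v‖) := by
      have : lam / 2 * ((4 * √s + m + 2 * η / lam) * ‖v‖)
          = (2 * lam * √s + m * lam / 2 + η) * ‖v‖ := by field_simp; ring
      rw [this]; linarith
    have h2 := le_of_mul_le_mul_left h1 (by positivity)
    exact h2.trans (mul_le_mul_of_nonneg_right hρ (norm_nonneg _))
  refine ⟨?_, hcone⟩
  have h3 := hcurv hcone
  have h4 : 0 ≤ lam / 2 * l1 v := mul_nonneg (by positivity) (l1_nonneg v)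
  rcases (norm_nonneg v).eq_or_lt with h0 | h0
  · rw [← h0]; positivity
  · have h5 : c * min ‖v‖ 1 * ‖v‖ ≤ (2 * lam * √s + m * lam / 2 + η) * ‖v‖ := by
      have : min (‖v‖ ^ 2) ‖v‖ = min ‖v‖ 1 * ‖v‖ := by
        rw [min_mul_of_nonneg _ _ h0.le, sq, one_mul]
      rw [this] at h3; nlinarith
    have h6 := le_of_mul_le_mul_right h5 h0
    rw [le_div_iff₀ hc]
    rcases le_total ‖v‖ 1 with h7 | h7
    · rw [min_eq_left h7] at h6; linarith
    · rw [min_eq_right h7] at h6; linarith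

/-! ### Restricted curvature by empirical approximation -/

/-- Maurey's empirical method: a convex combination of vectors of norm at most `√C` is
approximated by an average of `k` of them up to the squared error `C / k`. -/
lemma exists_average_approx {H ι : Type*} [NormedAddCommGroup H] [InnerProductSpace ℝ H]
    [Fintype ι] (P : ι → H) (w : ι → ℝ) (hw : ∀ j, 0 ≤ w j) (hw1 : ∑ j, w j = 1) {C : ℝ}
    (hP : ∀ j, ‖P j‖ ^ 2 ≤ C) (k : ℕ) :
    ∃ φ : Fin k → ι, ‖∑ l, (P (φ l) - ∑ j, w j • P j)‖ ^ 2 ≤ k * C := by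
  set u := ∑ j, w j • P j with hu
  induction k with
  | zero => exact ⟨Fin.elim0, by simp⟩
  | succ k ih =>
    obtain ⟨φ, hφ⟩ := ih
    set D := ∑ l, (P (φ l) - u) with hD
    have havg : ∑ j, w j * ‖D + (P j - u)‖ ^ 2 ≤ ∑ j, w j * (‖D‖ ^ 2 + C) := by
      have e : ∀ j, w j * ‖D + (P j - u)‖ ^ 2
          = w j * ‖D‖ ^ 2 + 2 * (⟪D, w j • P j⟫ - w j * ⟪D, u⟫)
            + (w j * ‖P j‖ ^ 2 - 2 * ⟪w j • P j, u⟫ + w j * ‖u‖ ^ 2) := by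
        intro j
        rw [norm_add_sq_real, norm_sub_sq_real, inner_sub_right, real_inner_smul_left,
          real_inner_smul_right]
        ring
      have e2 : ∑ j, w j * ‖D + (P j - u)‖ ^ 2 = ‖D‖ ^ 2 + (∑ j, w j * ‖P j‖ ^ 2 - ‖u‖ ^ 2) := by
        simp_rw [e]
        rw [Finset.sum_add_distrib, Finset.sum_add_distrib, Finset.sum_add_distrib,
          Finset.sum_sub_distrib, ← Finset.mul_sum, Finset.sum_sub_distrib, ← inner_sum,
          ← Finset.sum_mul, ← Finset.sum_mul, ← Finset.sum_mul, ← Finset.mul_sum, ← sum_inner,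
          hw1, ← hu, real_inner_self_eq_norm_sq]
        ring
      have e3 : ∑ j, w j * (‖D‖ ^ 2 + C) = ‖D‖ ^ 2 + C := by rw [← Finset.sum_mul, hw1, one_mul]
      have e4 : ∑ j, w j * ‖P j‖ ^ 2 ≤ C := by
        calc _ ≤ ∑ j, w j * C := Finset.sum_le_sum fun j _ =>
              mul_le_mul_of_nonneg_left (hP j) (hw j)
          _ = C := by rw [← Finset.sum_mul, hw1, one_mul]
      rw [e2, e3]
      nlinarith [sq_nonneg ‖u‖]
    have hex : ∃ j, ‖D + (P j - u)‖ ^ 2 ≤ ‖D‖ ^ 2 + C := by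
      by_contra hno
      push Not at hno
      have hpos : ∃ j, 0 < w j := by
        by_contra hz
        push Not at hz
        have : ∑ j, w j ≤ 0 := Finset.sum_nonpos fun j _ => hz j
        linarith
      obtain ⟨j₀, hj₀⟩ := hpos
      have : ∑ j, w j * (‖D‖ ^ 2 + C) < ∑ j, w j * ‖D + (P j - u)‖ ^ 2 :=
        Finset.sum_lt_sum (fun j _ => mul_le_mul_of_nonneg_left (hno j).le (hw j))
          ⟨j₀, Finset.mem_univ _, mul_lt_mul_of_pos_left (hno j₀) hj₀⟩
      linarith
    obtain ⟨j, hj⟩ := hex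
    refine ⟨Fin.snoc φ j, ?_⟩
    rw [Fin.sum_univ_castSucc]
    simp only [Fin.snoc_castSucc, Fin.snoc_last]
    push_cast
    rw [← hD]
    linarith

lemma trunc_sq_transfer {B : ℝ} (hB : 0 ≤ B) (b b' : ℝ) :
    (min |b'| B) ^ 2 ≤ 2 * (min |b| B) ^ 2 + 2 * (b - b') ^ 2 := by
  have h0 : 0 ≤ min |b'| B := le_min (abs_nonneg _) hB
  have h1 : min |b'| B ≤ min |b| B + |b - b'| := by
    have h2 : |b'| ≤ |b| + |b - b'| := by
      have := abs_sub_abs_le_abs_sub b' b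
      rw [abs_sub_comm] at this; linarith
    rcases le_total |b| B with h | h
    · rw [min_eq_left h]; exact (min_le_left _ _).trans h2
    · rw [min_eq_right h]; exact (min_le_right _ _).trans (by linarith [abs_nonneg (b - b')])
  calc (min |b'| B) ^ 2 ≤ (min |b| B + |b - b'|) ^ 2 := pow_le_pow_left₀ h0 h1 2
    _ ≤ 2 * (min |b| B) ^ 2 + 2 * |b - b'| ^ 2 := by
      nlinarith [sq_nonneg (min |b| B - |b - b'|)]
    _ = _ := by rw [sq_abs]

/-- A vector of `ℓ₁` norm at most `ρ` is close, in the Euclidean norm and in the empirical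
seminorm of the design, to a normalized signed sum of coordinate vectors. -/
lemma exists_dirVec_approx {d : ℕ} (hd : 0 < d) {I : Finset ℕ} (x : ℕ → Vec d) {C ρ : ℝ}
    (hC : 0 ≤ C) (hρ : 0 < ρ) (hcol : ∀ j, ∑ i ∈ I, (x i j) ^ 2 ≤ C * I.card) {v : Vec d} (hv : l1 v ≤ ρ)
    {k : ℕ} (hk : 0 < k) :
    ∃ φ : Fin k → Fin d × Bool,
      ∑ i ∈ I, ⟪x i, v - (ρ / k) • dirVec φ⟫ ^ 2 ≤ ρ ^ 2 * (C + 1) / k * I.card ∧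
      ‖v - (ρ / k) • dirVec φ‖ ^ 2 ≤ ρ ^ 2 * (C + 1) / k := by
  have hk' : (0 : ℝ) < k := by exact_mod_cast hk
  have hd' : (0 : ℝ) < d := by exact_mod_cast hd
  let f : Vec d →ₗ[ℝ] EuclideanSpace ℝ (I ⊕ Fin d) :=
    { toFun := fun u => WithLp.toLp 2 (Sum.elim (fun i => ⟪x i, u⟫ / √(I.card : ℝ)) fun j => u j)
      map_add' := fun u u' => by
        ext a; rcases a with i | j <;> simp [inner_add_right, add_div]
      map_smul' := fun c u => by
        ext a; rcases a with i | j <;> simp [real_inner_smul_right, mul_div_assoc] }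
  have hf : ∀ u, ‖f u‖ ^ 2 = (∑ i ∈ I, ⟪x i, u⟫ ^ 2) / I.card + ‖u‖ ^ 2 := by
    intro u
    rw [EuclideanSpace.norm_sq_eq, Fintype.sum_sum_type, EuclideanSpace.norm_sq_eq u]
    congr 1
    rw [Finset.sum_div, ← Finset.sum_coe_sort I]
    refine Finset.sum_congr rfl fun i _ => ?_
    simp [f, div_pow]
  let sg : Bool → ℝ := fun b => if b then 1 else -1
  let P : Fin d × Bool → Vec d := fun a => ρ • (sg a.2 • EuclideanSpace.single a.1 (1 : ℝ))
  let w : Fin d × Bool → ℝ := fun a =>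
    (|v a.1| + sg a.2 * v a.1) / (2 * ρ) + (1 - l1 v / ρ) / (2 * d)
  have hslack : 0 ≤ 1 - l1 v / ρ := by
    rw [sub_nonneg, div_le_one hρ]; exact hv
  have hw : ∀ a, 0 ≤ w a := by
    rintro ⟨j, b⟩
    have : 0 ≤ |v j| + sg b * v j := by
      cases b
      · simp [sg]; exact le_abs_self _
      · simp [sg]; linarith [neg_abs_le (v j)]
    have h2 : 0 ≤ (1 - l1 v / ρ) / (2 * d) := by positivity
    have h3 : 0 ≤ (|v j| + sg b * v j) / (2 * ρ) := by positivity
    simp only [w]; linarith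
  have hw1 : ∑ a, w a = 1 := by
    rw [Fintype.sum_prod_type]
    have : ∀ j : Fin d, ∑ b, w (j, b) = |v j| / ρ + (1 - l1 v / ρ) / d := by
      intro j
      simp [w, sg]
      field_simp
      ring
    simp_rw [this]
    rw [Finset.sum_add_distrib, ← Finset.sum_div]
    simp only [Finset.sum_const, Finset.card_univ, Fintype.card_fin, nsmul_eq_mul]
    rw [mul_div_cancel₀ _ hd'.ne']
    unfold l1
    ring
  have hwP : ∑ a, w a • P a = v := by
    ext j
    rw [WithLp.ofLp_sum, Finset.sum_apply, Fintype.sum_prod_type]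
    rw [Finset.sum_eq_single j]
    · simp [w, P, sg]
      field_simp
      ring
    · intro j' _ hj'
      simp [P, hj'.symm]
    · simp
  have hP : ∀ a, ‖f (P a)‖ ^ 2 ≤ ρ ^ 2 * (C + 1) := by
    rintro ⟨j, b⟩
    have hsg : sg b ^ 2 = 1 := by cases b <;> simp [sg]
    have e1 : ∀ i, ⟪x i, P (j, b)⟫ ^ 2 = ρ ^ 2 * (x i j) ^ 2 := by
      intro i
      simp only [P]
      rw [real_inner_smul_right, real_inner_smul_right, EuclideanSpace.inner_single_right]
      simp only [one_mul, conj_trivial]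
      rw [mul_pow, mul_pow, hsg, one_mul]
    have e2 : ‖P (j, b)‖ ^ 2 = ρ ^ 2 := by
      simp only [P]
      rw [norm_smul, norm_smul, mul_pow, mul_pow, Real.norm_eq_abs, Real.norm_eq_abs, sq_abs,
        sq_abs, hsg]
      simp
    rw [hf, e2]
    simp_rw [e1]
    rw [← Finset.mul_sum, mul_div_assoc, mul_add, mul_one]
    gcongr
    rcases Nat.eq_zero_or_pos I.card with h0 | h0
    · rw [h0]; simpa using hC
    · rw [div_le_iff₀ (by exact_mod_cast h0)]; exact hcol j
  obtain ⟨φ, hφ⟩ := exists_average_approx (fun a => f (P a)) w hw hw1 hP k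
  have e3 : ∑ a, w a • f (P a) = f v := by
    rw [← hwP, map_sum]; simp
  have e4 : ∑ l, (f (P (φ l)) - ∑ a, w a • f (P a))
      = (-(k : ℝ)) • f (v - (ρ / k) • dirVec φ) := by
    rw [e3, Finset.sum_sub_distrib, ← map_sum]
    have : ∑ l, P (φ l) = ρ • dirVec φ := by
      simp only [P, dirVec, sg]
      rw [Finset.smul_sum]
    rw [this, ← map_smul]
    simp only [Finset.sum_const, Finset.card_univ, Fintype.card_fin]
    rw [← Nat.cast_smul_eq_nsmul ℝ, ← map_smul, ← map_sub]
    congr 1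
    rw [smul_sub, smul_smul]
    have : -(k : ℝ) * (ρ / k) = -ρ := by field_simp
    rw [this]
    module
  rw [e4, norm_smul, mul_pow, Real.norm_eq_abs, sq_abs, neg_sq] at hφ
  have h5 : ‖f (v - (ρ / k) • dirVec φ)‖ ^ 2 ≤ ρ ^ 2 * (C + 1) / k := by
    rw [le_div_iff₀ hk']
    have : (k : ℝ) * (‖f (v - (ρ / k) • dirVec φ)‖ ^ 2 * k) ≤ k * (ρ ^ 2 * (C + 1)) := by
      linarith
    exact le_of_mul_le_mul_left this hk'
  rw [hf] at h5
  have hnn : 0 ≤ (∑ i ∈ I, ⟪x i, v - (ρ / k) • dirVec φ⟫ ^ 2) / I.card :=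
    div_nonneg (Finset.sum_nonneg fun _ _ => sq_nonneg _) (Nat.cast_nonneg _)
  refine ⟨φ, ?_, by linarith⟩
  rcases I.eq_empty_or_nonempty with h0 | h0
  · simp [h0]
  · have hc : (0 : ℝ) < I.card := by exact_mod_cast h0.card_pos
    rw [← div_le_iff₀ hc]
    linarith [sq_nonneg ‖v - (ρ / k) • dirVec φ‖]

lemma restricted_curvature {d k : ℕ} (hd : 0 < d) (hk : 0 < k) {I : Finset ℕ} (x : ℕ → Vec d)
    (w : ℕ → ℝ) (hw : ∀ i, 0 ≤ w i ∧ w i ≤ 1) {ρ B C c : ℝ} (hB : 1 ≤ B) (hC : 0 ≤ C) (hρ : 0 < ρ)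
    (hcol : ∀ j, ∑ i ∈ I, (x i j) ^ 2 ≤ C * I.card)
    (hk1 : ρ ^ 2 * (C + 1) / k ≤ 1 / 4) (hk2 : ρ ^ 2 * (C + 1) / k ≤ c / 4)
    (hnet : ∀ φ : Fin k → Fin d × Bool, 1 / 2 ≤ ‖(ρ / k) • dirVec φ‖ →
      ‖(ρ / k) • dirVec φ‖ ≤ 3 / 2 →
      c * I.card ≤ ∑ i ∈ I, w i * (min |⟪x i, (ρ / k) • dirVec φ⟫| B) ^ 2)
    {v : Vec d} (hv : l1 v ≤ ρ * ‖v‖) :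
    c / (4 * B) * min (‖v‖ ^ 2) ‖v‖ * I.card ≤ ∑ i ∈ I, w i * hub ⟪x i, v⟫ := by
  rcases (norm_nonneg v).eq_or_lt with h0 | h0
  · rw [← h0]
    rw [zero_pow two_ne_zero, min_self, mul_zero, zero_mul]
    exact Finset.sum_nonneg fun i _ => mul_nonneg (hw i).1 (hub_nonneg _)
  set t := ‖v‖ with ht
  set u : Vec d := t⁻¹ • v with hu
  have hvu : v = t • u := by rw [hu, smul_smul, mul_inv_cancel₀ h0.ne', one_smul]
  have hun : ‖u‖ = 1 := by
    rw [hu, norm_smul, norm_inv, Real.norm_of_nonneg h0.le, ← ht, inv_mul_cancel₀ h0.ne']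
  have hul : l1 u ≤ ρ := by
    have : l1 u = t⁻¹ * l1 v := by
      unfold l1; rw [Finset.mul_sum]
      refine Finset.sum_congr rfl fun j _ => ?_
      rw [hu, PiLp.smul_apply, smul_eq_mul, abs_mul, abs_of_pos (inv_pos.2 h0)]
    rw [this, inv_mul_le_iff₀ h0]; linarith
  obtain ⟨φ, h1, h2⟩ := exists_dirVec_approx hd x hC hρ hcol hul hk
  set u' := (ρ / k) • dirVec φ with hu'
  have h3 : ‖u - u'‖ ≤ 1 / 2 := by
    have : ‖u - u'‖ ^ 2 ≤ (1 / 2) ^ 2 := h2.trans (hk1.trans (by norm_num))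
    exact le_of_sq_le_sq this (by norm_num)
  have h4 : 1 / 2 ≤ ‖u'‖ := by
    have := norm_sub_norm_le u u'; rw [hun] at this; linarith
  have h5 : ‖u'‖ ≤ 3 / 2 := by
    have := norm_sub_norm_le u' u; rw [hun, norm_sub_rev] at this; linarith
  have h6 := hnet φ h4 h5
  have h7 : ∑ i ∈ I, w i * (min |⟪x i, u'⟫| B) ^ 2
      ≤ 2 * ∑ i ∈ I, w i * (min |⟪x i, u⟫| B) ^ 2 + 2 * ∑ i ∈ I, ⟪x i, u - u'⟫ ^ 2 := by
    rw [Finset.mul_sum, Finset.mul_sum, ← Finset.sum_add_distrib]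
    refine Finset.sum_le_sum fun i _ => ?_
    have := trunc_sq_transfer (by linarith : 0 ≤ B) ⟪x i, u⟫ ⟪x i, u'⟫
    rw [inner_sub_right]
    have := mul_le_mul_of_nonneg_left this (hw i).1
    nlinarith [(hw i).2, sq_nonneg (⟪x i, u⟫ - ⟪x i, u'⟫)]
  have hcard : (0 : ℝ) ≤ I.card := Nat.cast_nonneg _
  have h8 : c / 4 * I.card ≤ ∑ i ∈ I, w i * (min |⟪x i, u⟫| B) ^ 2 := by
    have := mul_le_mul_of_nonneg_right hk2 hcard
    linarith
  have hB0 : 0 < B := by linarith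
  have hmin0 : 0 ≤ min (t ^ 2) t := le_min (sq_nonneg _) h0.le
  have h9 : ∑ i ∈ I, w i * (min |⟪x i, u⟫| B) ^ 2 ≤ B * ∑ i ∈ I, w i * hub ⟪x i, u⟫ := by
    rw [Finset.mul_sum]
    refine Finset.sum_le_sum fun i _ => ?_
    have := mul_le_mul_of_nonneg_left (trunc_sq_le_hub hB ⟪x i, u⟫) (hw i).1
    linarith
  have h10 : min (t ^ 2) t * ∑ i ∈ I, w i * hub ⟪x i, u⟫ ≤ ∑ i ∈ I, w i * hub ⟪x i, v⟫ := by
    rw [Finset.mul_sum]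
    refine Finset.sum_le_sum fun i _ => ?_
    have := mul_le_mul_of_nonneg_left (hub_scale h0.le ⟪x i, u⟫) (hw i).1
    have e : ⟪x i, v⟫ = t * ⟪x i, u⟫ := by
      conv_lhs => rw [hvu]
      exact real_inner_smul_right _ _ _
    rw [e]
    linarith
  refine le_trans ?_ h10
  have h11 : c / (4 * B) * I.card ≤ ∑ i ∈ I, w i * hub ⟪x i, u⟫ := by
    have : B * (c / (4 * B) * I.card) ≤ B * ∑ i ∈ I, w i * hub ⟪x i, u⟫ := by
      have e : B * (c / (4 * B) * I.card) = c / 4 * I.card := by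
        rw [← div_div]
        rw [← mul_assoc, mul_div_cancel₀ _ hB0.ne']
      rw [e]; linarith
    exact le_of_mul_le_mul_left this hB0
  calc _ = min (t ^ 2) t * (c / (4 * B) * I.card) := by ring
    _ ≤ _ := by gcongr

/-! ### Exponential moments and concentration -/

/-- An exponential tail yields an exponential moment. -/
lemma exp_moment_of_tail {Ω : Type*} [MeasurableSpace Ω] {μ : Measure Ω} [IsProbabilityMeasure μ]
    {Y : Ω → ℝ} (hY : Measurable Y) {A b : ℝ} (hA : 0 ≤ A) (hb : 0 < b)
    (h : ∀ t, 0 ≤ t → μ.real {ω | t ≤ Y ω} ≤ A * Real.exp (-t / b)) :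
    Integrable (fun ω => Real.exp (Y ω / (2 * b))) μ ∧
      ∫ ω, Real.exp (Y ω / (2 * b)) ∂μ ≤ 1 + A := by
  have hmeas : Measurable fun ω => Real.exp (Y ω / (2 * b)) := (hY.div_const _).exp
  have hnn : 0 ≤ᵐ[μ] fun ω => Real.exp (Y ω / (2 * b)) :=
    Filter.Eventually.of_forall fun ω => (Real.exp_pos _).le
  have hlin : ∫⁻ ω, ENNReal.ofReal (Real.exp (Y ω / (2 * b))) ∂μ ≤ ENNReal.ofReal (1 + A) := by
    rw [lintegral_eq_lintegral_meas_le μ hnn hmeas.aemeasurable]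
    have hsplit : Set.Ioi (0 : ℝ) = Set.Ioc 0 1 ∪ Set.Ioi 1 :=
      (Set.Ioc_union_Ioi_eq_Ioi zero_le_one).symm
    rw [hsplit]
    refine (lintegral_union_le _ _ _).trans ?_
    rw [ENNReal.ofReal_add zero_le_one hA]
    refine add_le_add ?_ ?_
    · calc ∫⁻ t in Set.Ioc (0 : ℝ) 1, μ {a | t ≤ Real.exp (Y a / (2 * b))}
          ≤ ∫⁻ t in Set.Ioc (0 : ℝ) 1, 1 := lintegral_mono fun t => prob_le_one
        _ = ENNReal.ofReal 1 := by simp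
    · have hpt : ∀ t ∈ Set.Ioi (1 : ℝ), μ {a | t ≤ Real.exp (Y a / (2 * b))}
          ≤ ENNReal.ofReal (A * t ^ (-2 : ℝ)) := by
        intro t ht
        have ht1 : (1 : ℝ) < t := ht
        have ht0 : 0 < t := by linarith
        have hset : {a | t ≤ Real.exp (Y a / (2 * b))} = {a | 2 * b * Real.log t ≤ Y a} := by
          ext a
          simp only [Set.mem_ofPred_eq]
          rw [← Real.log_le_iff_le_exp ht0, le_div_iff₀ (by positivity), mul_comm]
        have h1 := h (2 * b * Real.log t) (by have := Real.log_nonneg ht1.le; positivity)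
        have h2 : Real.exp (-(2 * b * Real.log t) / b) = t ^ (-2 : ℝ) := by
          rw [Real.rpow_def_of_pos ht0]; congr 1; field_simp
        rw [h2] at h1
        rw [hset, ← ofReal_measureReal]
        exact ENNReal.ofReal_le_ofReal h1
      calc ∫⁻ t in Set.Ioi (1 : ℝ), μ {a | t ≤ Real.exp (Y a / (2 * b))}
          ≤ ∫⁻ t in Set.Ioi (1 : ℝ), ENNReal.ofReal (A * t ^ (-2 : ℝ)) :=
            setLIntegral_mono' measurableSet_Ioi hpt
        _ = ENNReal.ofReal (∫ t in Set.Ioi (1 : ℝ), A * t ^ (-2 : ℝ)) := by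
            rw [ofReal_integral_eq_lintegral_ofReal]
            · exact (integrableOn_Ioi_rpow_of_lt (by norm_num) one_pos).const_mul A
            · refine (ae_restrict_iff' measurableSet_Ioi).2 (Filter.Eventually.of_forall ?_)
              intro t ht
              have : (0 : ℝ) < t := lt_trans one_pos ht
              positivity
        _ ≤ ENNReal.ofReal A := by
            apply ENNReal.ofReal_le_ofReal
            rw [integral_const_mul, integral_Ioi_rpow_of_lt (by norm_num) one_pos]
            norm_num
  have hintg : Integrable (fun ω => Real.exp (Y ω / (2 * b))) μ := by
    refine ⟨hmeas.aestronglyMeasurable, ?_⟩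
    rw [hasFiniteIntegral_iff_ofReal hnn]
    exact hlin.trans_lt ENNReal.ofReal_lt_top
  refine ⟨hintg, ?_⟩
  rw [integral_eq_lintegral_of_nonneg_ae hnn hmeas.aestronglyMeasurable]
  exact ENNReal.toReal_le_of_le_ofReal (by linarith) hlin

/-- Polynomial moments from an exponential one. -/
lemma moment_of_exp_moment {Ω : Type*} [MeasurableSpace Ω] {μ : Measure Ω}
    {N : Ω → ℝ} (hN : Measurable N) (hN0 : ∀ ω, 0 ≤ N ω) {K H : ℝ} (hK : 0 < K)
    (hintg : Integrable (fun ω => Real.exp (N ω / K)) μ) (hH : ∫ ω, Real.exp (N ω / K) ∂μ ≤ H)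
    (k : ℕ) :
    Integrable (fun ω => N ω ^ k) μ ∧ ∫ ω, N ω ^ k ∂μ ≤ k.factorial * K ^ k * H := by
  have hb : ∀ ω, N ω ^ k ≤ k.factorial * K ^ k * Real.exp (N ω / K) := by
    intro ω
    have := Real.pow_div_factorial_le_exp (N ω / K) (div_nonneg (hN0 ω) hK.le) k
    rw [div_pow, div_div, div_le_iff₀ (by positivity)] at this
    linarith
  have hi := hintg.const_mul (k.factorial * K ^ k)
  have hi2 : Integrable (fun ω => N ω ^ k) μ := by
    refine hi.mono' (hN.pow_const k).aestronglyMeasurable (Filter.Eventually.of_forall fun ω => ?_)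
    rw [Real.norm_of_nonneg (pow_nonneg (hN0 ω) k)]
    exact hb ω
  refine ⟨hi2, ?_⟩
  calc ∫ ω, N ω ^ k ∂μ ≤ ∫ ω, k.factorial * K ^ k * Real.exp (N ω / K) ∂μ :=
        integral_mono hi2 hi hb
    _ = k.factorial * K ^ k * ∫ ω, Real.exp (N ω / K) ∂μ := integral_const_mul _ _
    _ ≤ _ := by gcongr

lemma exp_le_quadratic (x : ℝ) : Real.exp x ≤ 1 + x + x ^ 2 * Real.exp |x| := by
  have h := Complex.norm_exp_sub_sum_le_norm_mul_exp (x : ℂ) 2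
  simp only [Finset.sum_range_succ, Finset.sum_range_zero] at h
  norm_num at h
  have e : Complex.exp (x : ℂ) - (1 + (x : ℂ)) = ((Real.exp x - (1 + x) : ℝ) : ℂ) := by
    push_cast; rfl
  rw [e, Complex.norm_real, Real.norm_eq_abs] at h
  have := (abs_le.1 h).2
  linarith

lemma mgf_centered_le {Ω : Type*} [MeasurableSpace Ω] {μ : Measure Ω} [IsProbabilityMeasure μ]
    {X : Ω → ℝ} (hX : Measurable X) {K H : ℝ} (hK : 0 < K)
    (hintg : Integrable (fun ω => Real.exp (|X ω| / K)) μ)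
    (hH : ∫ ω, Real.exp (|X ω| / K) ∂μ ≤ H) {t : ℝ} (ht0 : 0 ≤ t) (ht : t ≤ 1 / (2 * K)) :
    Integrable (fun ω => Real.exp (t * (X ω - ∫ ω', X ω' ∂μ))) μ ∧
    mgf (fun ω => X ω - ∫ ω', X ω' ∂μ) μ t ≤ Real.exp (8 * H * K ^ 2 * t ^ 2) := by
  have htK : t * (2 * K) ≤ 1 := by
    rwa [le_div_iff₀ (by positivity)] at ht
  have hXi : Integrable X μ := by
    have := (moment_of_exp_moment hX.abs (fun ω => abs_nonneg _) hK hintg hH 1).1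
    simp only [pow_one] at this
    exact (integrable_norm_iff hX.aestronglyMeasurable).1 this
  have hpt : ∀ ω, Real.exp (t * X ω)
      ≤ 1 + t * X ω + 8 * K ^ 2 * t ^ 2 * Real.exp (|X ω| / K) := by
    intro ω
    have h1 := exp_le_quadratic (t * X ω)
    set u := |X ω| / (2 * K) with hu
    have hu0 : 0 ≤ u := by positivity
    have hXu : |X ω| = 2 * K * u := by rw [hu]; field_simp
    have h2 : |t * X ω| ≤ u := by
      rw [abs_mul, abs_of_nonneg ht0, hXu]; nlinarith
    have h3 : u ^ 2 ≤ 2 * Real.exp u := by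
      have := Real.pow_div_factorial_le_exp u hu0 2
      norm_num [Nat.factorial] at this; linarith
    have h4 : Real.exp (|X ω| / K) = Real.exp u * Real.exp u := by
      rw [← Real.exp_add]; congr 1; rw [hu]; field_simp; norm_num
    have h5 : (t * X ω) ^ 2 = t ^ 2 * (4 * K ^ 2 * u ^ 2) := by
      rw [mul_pow, ← sq_abs (X ω), hXu]; ring
    rw [h5] at h1
    rw [h4]
    have h6 : Real.exp |t * X ω| ≤ Real.exp u := Real.exp_le_exp.2 h2
    calc Real.exp (t * X ω) ≤ 1 + t * X ω + t ^ 2 * (4 * K ^ 2 * u ^ 2) * Real.exp |t * X ω| := h1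
      _ ≤ 1 + t * X ω + t ^ 2 * (4 * K ^ 2 * (2 * Real.exp u)) * Real.exp u := by gcongr
      _ = _ := by ring
  have hdom : Integrable (fun ω => 1 + t * X ω + 8 * K ^ 2 * t ^ 2 * Real.exp (|X ω| / K)) μ :=
    ((integrable_const _).add (hXi.const_mul t)).add (hintg.const_mul _)
  have hi1 : Integrable (fun ω => Real.exp (t * X ω)) μ := by
    refine hdom.mono' (hX.const_mul t).exp.aestronglyMeasurable
      (Filter.Eventually.of_forall fun ω => ?_)
    rw [Real.norm_of_nonneg (Real.exp_pos _).le]; exact hpt ω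
  have hexp : ∀ ω, Real.exp (t * (X ω - ∫ ω', X ω' ∂μ))
      = Real.exp (-(t * ∫ ω', X ω' ∂μ)) * Real.exp (t * X ω) := by
    intro ω; rw [← Real.exp_add]; congr 1; ring
  refine ⟨by simp_rw [hexp]; exact hi1.const_mul _, ?_⟩
  unfold mgf
  simp_rw [hexp]
  rw [integral_const_mul]
  have h7 : ∫ ω, Real.exp (t * X ω) ∂μ ≤ 1 + t * ∫ ω, X ω ∂μ + 8 * H * K ^ 2 * t ^ 2 := by
    calc ∫ ω, Real.exp (t * X ω) ∂μ
        ≤ ∫ ω, (1 + t * X ω + 8 * K ^ 2 * t ^ 2 * Real.exp (|X ω| / K)) ∂μ :=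
          integral_mono hi1 hdom hpt
      _ = 1 + t * ∫ ω, X ω ∂μ + 8 * K ^ 2 * t ^ 2 * ∫ ω, Real.exp (|X ω| / K) ∂μ := by
          have hadd : Integrable (fun ω => 1 + t * X ω) μ :=
            (integrable_const _).add (hXi.const_mul t)
          rw [integral_add hadd (hintg.const_mul _),
            integral_add (integrable_const _) (hXi.const_mul t), integral_const_mul,
            integral_const_mul]
          simp
      _ ≤ 1 + t * ∫ ω, X ω ∂μ + 8 * K ^ 2 * t ^ 2 * H := by gcongr
      _ = _ := by ring
  calc Real.exp (-(t * ∫ ω', X ω' ∂μ)) * ∫ ω, Real.exp (t * X ω) ∂μ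
      ≤ Real.exp (-(t * ∫ ω', X ω' ∂μ)) *
        Real.exp (t * ∫ ω, X ω ∂μ + 8 * H * K ^ 2 * t ^ 2) := by
        gcongr
        refine h7.trans ?_
        have := Real.add_one_le_exp (t * ∫ ω, X ω ∂μ + 8 * H * K ^ 2 * t ^ 2)
        linarith
    _ = _ := by rw [← Real.exp_add]; congr 1; ring

/-- Bernstein's inequality, in the sub-Gaussian range, for independent variables with a uniform
exponential moment. -/
lemma bernstein {Ω : Type*} [MeasurableSpace Ω] {μ : Measure Ω} [IsProbabilityMeasure μ]
    {X : ℕ → Ω → ℝ} (hind : iIndepFun X μ) (hX : ∀ i, Measurable (X i)) {K H : ℝ} (hK : 0 < K)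
    (hH0 : 0 < H) (I : Finset ℕ)
    (hintg : ∀ i ∈ I, Integrable (fun ω => Real.exp (|X i ω| / K)) μ)
    (hH : ∀ i ∈ I, ∫ ω, Real.exp (|X i ω| / K) ∂μ ≤ H) {r : ℝ} (hr : 0 ≤ r) (hr' : r ≤ 8 * H * K) :
    μ.real {ω | I.card * r ≤ ∑ i ∈ I, (X i ω - ∫ ω', X i ω' ∂μ)}
      ≤ Real.exp (-(I.card * r ^ 2 / (32 * H * K ^ 2))) := by
  set t := r / (16 * H * K ^ 2) with ht
  have ht0 : 0 ≤ t := by positivity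
  have htK : t ≤ 1 / (2 * K) := by
    rw [ht, div_le_div_iff₀ (by positivity) (by positivity)]
    nlinarith
  set Y : ℕ → Ω → ℝ := fun i ω => X i ω - ∫ ω', X i ω' ∂μ with hY
  have hYm : ∀ i, Measurable (Y i) := fun i => (hX i).sub_const _
  have hYind : iIndepFun Y μ :=
    hind.comp (fun i y => y - ∫ ω', X i ω' ∂μ) fun i => measurable_id.sub_const _
  have hmgf : mgf (∑ i ∈ I, Y i) μ t ≤ Real.exp (I.card * (8 * H * K ^ 2 * t ^ 2)) := by
    rw [hYind.mgf_sum hYm]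
    calc ∏ i ∈ I, mgf (Y i) μ t ≤ ∏ i ∈ I, Real.exp (8 * H * K ^ 2 * t ^ 2) := by
          refine Finset.prod_le_prod (fun i _ => mgf_nonneg) fun i hi => ?_
          exact (mgf_centered_le (hX i) hK (hintg i hi) (hH i hi) ht0 htK).2
      _ = _ := by rw [Finset.prod_const, ← Real.exp_nat_mul]
  have hintg' : Integrable (fun ω => Real.exp (t * (∑ i ∈ I, Y i) ω)) μ :=
    hYind.integrable_exp_mul_sum hYm fun i hi =>
      (mgf_centered_le (hX i) hK (hintg i hi) (hH i hi) ht0 htK).1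
  have hch := measure_ge_le_exp_mul_mgf (μ := μ) (X := ∑ i ∈ I, Y i) (I.card * r) ht0 hintg'
  have hset : {ω | I.card * r ≤ ∑ i ∈ I, (X i ω - ∫ ω', X i ω' ∂μ)}
      = {ω | I.card * r ≤ (∑ i ∈ I, Y i) ω} := by
    ext ω; simp [hY, Finset.sum_apply]
  rw [hset]
  refine hch.trans ?_
  calc Real.exp (-t * (I.card * r)) * mgf (∑ i ∈ I, Y i) μ t
      ≤ Real.exp (-t * (I.card * r)) * Real.exp (I.card * (8 * H * K ^ 2 * t ^ 2)) := by gcongr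
    _ = _ := by
        rw [← Real.exp_add]; congr 1; rw [ht]; field_simp; ring

/-- Tails of a centered Gaussian. -/
lemma gaussian_abs_tail {Ω : Type*} [MeasurableSpace Ω] {μ : Measure Ω} [IsProbabilityMeasure μ]
    {ε : Ω → ℝ} (hε : Measurable ε) {σ : ℝ}
    (hlaw : μ.map ε = gaussianReal 0 (σ ^ 2).toNNReal) {t : ℝ} (ht : 0 ≤ t) :
    μ.real {ω | t ≤ |ε ω|} ≤ 2 * Real.exp (-t ^ 2 / (2 * σ ^ 2)) := by
  have hc : (((σ ^ 2).toNNReal : NNReal) : ℝ) = σ ^ 2 := Real.coe_toNNReal _ (sq_nonneg _)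
  have hsub : HasSubgaussianMGF ε (σ ^ 2).toNNReal μ := by
    refine ⟨fun u => ?_, fun u => ?_⟩
    · have h : Integrable (fun x => Real.exp (u * x)) (μ.map ε) := by
        rw [hlaw]; exact integrable_exp_mul_gaussianReal u
      exact h.comp_measurable hε
    · rw [mgf_gaussianReal hlaw]; simp
  have h1 := hsub.measure_ge_le ht
  have h2 := hsub.neg.measure_ge_le ht
  rw [hc] at h1 h2
  have hsub : {ω | t ≤ |ε ω|} ⊆ {ω | t ≤ ε ω} ∪ {ω | t ≤ (-ε) ω} := by
    intro ω hω
    rw [Set.mem_ofPred_eq] at hω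
    rcases le_abs.1 hω with h | h
    · exact Or.inl h
    · exact Or.inr h
  calc _ ≤ μ.real ({ω | t ≤ ε ω} ∪ {ω | t ≤ (-ε) ω}) := measureReal_mono hsub
    _ ≤ _ := measureReal_union_le _ _
    _ ≤ _ := by linarith

/-! ### Population bounds for a single record -/

/-- The record of a customer with features `x`, `z`, group `g` and noise `ε`. -/
def record {Ω : Type*} {d : ℕ} (γs : Param d) (x z : Ω → Vec d) (g : Ω → Fin 2) (ε : Ω → ℝ)
    (ω : Ω) : Obs d :=
  (⟪x ω, if g ω = 0 then γs.2.1 else γs.2.2⟫ + ε ω, x ω, z ω)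

/-- A quadratic envelope of the noise and of finitely many projections of the features. -/
def envelope {Ω : Type*} {d : ℕ} (x z : Ω → Vec d) (ε : Ω → ℝ) (u₁ u₂ u₃ v : Vec d) (ω : Ω) : ℝ :=
  1 + ε ω ^ 2 + ⟪x ω, u₁⟫ ^ 2 + ⟪x ω, u₂⟫ ^ 2 + ⟪z ω, u₃⟫ ^ 2 + ⟪x ω, v⟫ ^ 2 + ⟪z ω, v⟫ ^ 2

/-- The distributional properties of a single record on which the analysis relies. -/
structure IsSample {Ω : Type*} [MeasurableSpace Ω] (μ : Measure Ω) {d : ℕ} (γs : Param d)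
    (σ ξ M K H κ : ℝ) (x z : Ω → Vec d) (g : Ω → Fin 2) (ε : Ω → ℝ) : Prop where
  measurable_x : Measurable x
  measurable_z : Measurable z
  measurable_g : Measurable g
  measurable_ε : Measurable ε
  integrable_env : ∀ u₁ u₂ u₃ v : Vec d, ‖u₁‖ ≤ 1 → ‖u₂‖ ≤ 1 → ‖u₃‖ ≤ 1 → ‖v‖ ≤ 1 →
    Integrable (fun ω => Real.exp (envelope x z ε u₁ u₂ u₃ v ω / K)) μ
  integral_env : ∀ u₁ u₂ u₃ v : Vec d, ‖u₁‖ ≤ 1 → ‖u₂‖ ≤ 1 → ‖u₃‖ ≤ 1 → ‖v‖ ≤ 1 →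
    ∫ ω, Real.exp (envelope x z ε u₁ u₂ u₃ v ω / K) ∂μ ≤ H
  separation : ∫ ω, ((1 + |⟪x ω, γs.2.1 - γs.2.2⟫|)⁻¹) ^ 2 ∂μ ≤ κ
  nondegenerate : ∀ᵐ ω ∂μ, ξ < Real.sigmoid ⟪z ω, γs.1⟫ ∧ Real.sigmoid ⟪z ω, γs.1⟫ < 1 - ξ
  moment_x : ∀ v : Vec d, ‖v‖ = 1 → 1 / M < ∫ ω, ⟪x ω, v⟫ ^ 2 ∂μ
  moment_z : ∀ v : Vec d, ‖v‖ = 1 → 1 / M < ∫ ω, ⟪z ω, v⟫ ^ 2 ∂μ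
  bayes : ∀ f : Obs d → ℝ, Measurable f → Integrable (fun ω => f (record γs x z g ε ω)) μ →
    ∫ ω, weight σ (record γs x z g ε ω) γs * f (record γs x z g ε ω) ∂μ
      = ∫ ω, (if g ω = 0 then f (record γs x z g ε ω) else 0) ∂μ
  group : ∀ f : Vec d × Vec d → ℝ, Measurable f → Integrable (fun ω => f (x ω, z ω)) μ →
    ∫ ω, (if g ω = 0 then f (x ω, z ω) else 0) ∂μ
      = ∫ ω, Real.sigmoid ⟪z ω, γs.1⟫ * f (x ω, z ω) ∂μ
  noise : ∀ v : Vec d, ∫ ω, (if g ω = 0 then ε ω * ⟪x ω, v⟫ else 0) ∂μ = 0 ∧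
    ∫ ω, (if g ω = 0 then 0 else ε ω * ⟪x ω, v⟫) ∂μ = 0

/-- The conclusion of `weight_perturb`, for the constant `C`. -/
def WeightBound (σ l C : ℝ) : Prop :=
  ∀ (d : ℕ) (γ γs : Param d) (x z : Vec d) (y ε : ℝ), |⟪z, γs.1⟫| ≤ l →
      (y = ⟪x, γs.2.1⟫ + ε ∨ y = ⟪x, γs.2.2⟫ + ε) → ∀ R : ℝ,
      R = |⟪x, γ.2.1 - γs.2.1⟫| + |⟪x, γ.2.2 - γs.2.2⟫| + |⟪z, γ.1 - γs.1⟫| →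
      |weight σ (y, x, z) γ - weight σ (y, x, z) γs| *
          ((1 + |y - ⟪x, γs.2.1⟫| + |y - ⟪x, γs.2.2⟫|) * (1 + |⟪x, γs.2.1 - γs.2.2⟫|))
        ≤ C * (R * (1 + |ε| + R) ^ 5) ∧
      weight σ (y, x, z) γ * |y - ⟪x, γs.2.1⟫| ≤ C * (1 + |ε| + R) ∧
      (1 - weight σ (y, x, z) γ) * |y - ⟪x, γs.2.2⟫| ≤ C * (1 + |ε| + R)

/-- The feature entering the three regressions. -/
def feat {d : ℕ} (c : Fin 3) (o : Obs d) : Vec d := ![o.2.1, o.2.1, o.2.2] c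

/-- The weight of a record in the three regressions. -/
def cweight {d : ℕ} (σ : ℝ) (c : Fin 3) (γ : Param d) (o : Obs d) : ℝ :=
  ![weight σ o γ, 1 - weight σ o γ, 1] c

/-- The scalar factor of the score of the three regressions at the truth. -/
def resid {d : ℕ} (σ : ℝ) (γs : Param d) (c : Fin 3) (γ : Param d) (o : Obs d) : ℝ :=
  ![weight σ o γ * (o.1 - ⟪o.2.1, γs.2.1⟫) / σ ^ 2,
    (1 - weight σ o γ) * (o.1 - ⟪o.2.1, γs.2.2⟫) / σ ^ 2,
    weight σ o γ - Real.sigmoid ⟪o.2.2, γs.1⟫] c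

/-- The score of the three regressions at the truth, with E-step weights from `γ`. -/
def score {d : ℕ} (σ : ℝ) (γs : Param d) (c : Fin 3) (γ : Param d) (o : Obs d) : Vec d :=
  resid σ γs c γ o • feat c o

lemma one_le_envelope {Ω : Type*} {d : ℕ} (x z : Ω → Vec d) (ε : Ω → ℝ) (u₁ u₂ u₃ v : Vec d)
    (ω : Ω) : 1 ≤ envelope x z ε u₁ u₂ u₃ v ω := by
  unfold envelope
  have := sq_nonneg (ε ω)
  have := sq_nonneg ⟪x ω, u₁⟫
  have := sq_nonneg ⟪x ω, u₂⟫
  have := sq_nonneg ⟪z ω, u₃⟫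
  have := sq_nonneg ⟪x ω, v⟫
  have := sq_nonneg ⟪z ω, v⟫
  linarith

lemma abs_inner_le_of_sigmoid {ξ u : ℝ} (hξ : 0 < ξ) (h1 : ξ < Real.sigmoid u)
    (h2 : Real.sigmoid u < 1 - ξ) : |u| ≤ Real.log (1 / ξ) := by
  have key : ∀ w : ℝ, ξ < Real.sigmoid w → -w ≤ Real.log (1 / ξ) := by
    intro w hw
    rw [Real.le_log_iff_exp_le (by positivity), le_div_iff₀ hξ]
    have h3 := Real.sigmoid_mul_rexp_neg w
    have h4 := Real.sigmoid_le_one (-w)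
    have := Real.exp_pos (-w)
    nlinarith
  rw [abs_le]
  constructor
  · have := key u h1; linarith
  · have := key (-u) (by rw [Real.sigmoid_neg]; linarith); linarith

/-- A perturbation of the truth, written with directions of norm at most one. -/
lemma exists_directions {d : ℕ} (γ γs : Param d) : ∃ u₁ u₂ u₃ : Vec d,
    ‖u₁‖ ≤ 1 ∧ ‖u₂‖ ≤ 1 ∧ ‖u₃‖ ≤ 1 ∧ γ.2.1 - γs.2.1 = err2 γ γs • u₁ ∧
    γ.2.2 - γs.2.2 = err2 γ γs • u₂ ∧ γ.1 - γs.1 = err2 γ γs • u₃ := by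
  set e := err2 γ γs with he
  have h1 := norm_nonneg (γ.2.1 - γs.2.1)
  have h2 := norm_nonneg (γ.2.2 - γs.2.2)
  have h3 := norm_nonneg (γ.1 - γs.1)
  have he' : e = ‖γ.2.1 - γs.2.1‖ + ‖γ.2.2 - γs.2.2‖ + ‖γ.1 - γs.1‖ := rfl
  have key : ∀ a : Vec d, ‖a‖ ≤ e → ‖e⁻¹ • a‖ ≤ 1 ∧ a = e • (e⁻¹ • a) := by
    intro a ha
    have he0 : 0 ≤ e := (norm_nonneg a).trans ha
    rcases he0.eq_or_lt with h | h
    · have : a = 0 := by rw [← norm_le_zero_iff]; linarith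
      simp [this]
    · constructor
      · rw [norm_smul, norm_inv, Real.norm_of_nonneg he0, inv_mul_le_iff₀ h]; linarith
      · rw [smul_smul, mul_inv_cancel₀ h.ne', one_smul]
  obtain ⟨a1, a2⟩ := key (γ.2.1 - γs.2.1) (by linarith)
  obtain ⟨b1, b2⟩ := key (γ.2.2 - γs.2.2) (by linarith)
  obtain ⟨c1, c2⟩ := key (γ.1 - γs.1) (by linarith)
  exact ⟨_, _, _, a1, b1, c1, a2, b2, c2⟩

lemma err2_nonneg {d : ℕ} (γ γs : Param d) : 0 ≤ err2 γ γs := by unfold err2; positivity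

lemma measurable_weight {d : ℕ} (σ : ℝ) :
    Measurable fun p : Param d × Obs d => weight σ p.2 p.1 := by
  unfold weight
  have h1 : Measurable (Real.sigmoid) := continuous_sigmoid.measurable
  have h2 : Measurable (gaussianPDFReal 0 1) := measurable_gaussianPDFReal 0 1
  have i1 : Measurable fun p : Param d × Obs d => Real.sigmoid ⟪p.2.2.2, p.1.1⟫ :=
    h1.comp (by fun_prop)
  have i2 : Measurable fun p : Param d × Obs d =>
      gaussianPDFReal 0 1 ((p.2.1 - ⟪p.2.2.1, p.1.2.1⟫) / σ) := h2.comp (by fun_prop)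
  have i3 : Measurable fun p : Param d × Obs d =>
      gaussianPDFReal 0 1 ((p.2.1 - ⟪p.2.2.1, p.1.2.2⟫) / σ) := h2.comp (by fun_prop)
  exact (i1.mul i2).div ((i1.mul i2).add ((measurable_const.sub i1).mul i3))

lemma measurable_weight_right {d : ℕ} (σ : ℝ) (γ : Param d) :
    Measurable fun o : Obs d => weight σ o γ :=
  Measurable.comp (g := fun p : Param d × Obs d => weight σ p.2 p.1) (f := fun o => (γ, o))
    (measurable_weight σ) measurable_prodMk_left

lemma measurable_resid {d : ℕ} (σ : ℝ) (γs : Param d) (c : Fin 3) :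
    Measurable fun p : Param d × Obs d => resid σ γs c p.1 p.2 := by
  have hw := measurable_weight (d := d) σ
  have h1 : Measurable (Real.sigmoid) := continuous_sigmoid.measurable
  have i1 : Measurable fun p : Param d × Obs d => Real.sigmoid ⟪p.2.2.2, γs.1⟫ :=
    h1.comp (by fun_prop)
  fin_cases c
  · exact (hw.mul (by fun_prop)).div_const _
  · exact ((measurable_const.sub hw).mul (by fun_prop)).div_const _
  · exact hw.sub i1

lemma measurable_cweight {d : ℕ} (σ : ℝ) (c : Fin 3) :
    Measurable fun p : Param d × Obs d => cweight σ c p.1 p.2 := by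
  have hw := measurable_weight (d := d) σ
  fin_cases c
  · exact hw
  · exact measurable_const.sub hw
  · exact measurable_const

lemma measurable_feat {d : ℕ} (c : Fin 3) : Measurable fun o : Obs d => feat c o := by
  fin_cases c
  · exact measurable_snd.fst
  · exact measurable_snd.fst
  · exact measurable_snd.snd

lemma measurable_score {d : ℕ} (σ : ℝ) (γs : Param d) (c : Fin 3) :
    Measurable fun p : Param d × Obs d => score σ γs c p.1 p.2 :=
  (measurable_resid σ γs c).smul ((measurable_feat c).comp measurable_snd)

lemma measurable_score_right {d : ℕ} (σ : ℝ) (γs : Param d) (c : Fin 3) (γ : Param d) :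
    Measurable fun o : Obs d => score σ γs c γ o :=
  Measurable.comp (g := fun p : Param d × Obs d => score σ γs c p.1 p.2) (f := fun o => (γ, o))
    (measurable_score σ γs c) measurable_prodMk_left

lemma cweight_mem {d : ℕ} {σ : ℝ} (hσ : 0 < σ) (c : Fin 3) (γ : Param d) (o : Obs d) :
    0 ≤ cweight σ c γ o ∧ cweight σ c γ o ≤ 1 := by
  have h0 := weight_nonneg hσ o γ
  have h1 := weight_le_one hσ o γ
  fin_cases c <;> simp [cweight] <;> constructor <;> linarith

lemma record_cases {Ω : Type*} {d : ℕ} (γs : Param d) (x z : Ω → Vec d) (g : Ω → Fin 2) (ε : Ω → ℝ) (ω : Ω) :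
    (record γs x z g ε ω).1 = ⟪x ω, γs.2.1⟫ + ε ω ∨
    (record γs x z g ε ω).1 = ⟪x ω, γs.2.2⟫ + ε ω := by
  unfold record
  by_cases hg : g ω = 0
  · left; simp [hg]
  · right; simp [hg]

/-- Elementary consequences of a quadratic envelope. -/
lemma envelope_arith {a b c t p q e N : ℝ} (ha : 0 ≤ a) (hb : 0 ≤ b) (hc : 0 ≤ c)
    (hp : 0 ≤ p) (he : 0 ≤ e) (he1 : e ≤ 1)
    (hN : N = 1 + t ^ 2 + a ^ 2 + b ^ 2 + c ^ 2 + p ^ 2 + q ^ 2) :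
    e * a + e * b + e * c ≤ e * (3 * N) ∧ 1 + t + (e * a + e * b + e * c) ≤ 5 * N ∧
      (1 + t + (e * a + e * b + e * c)) * p ≤ 3 * N ∧ q ≤ N := by
  have am : ∀ y : ℝ, y ≤ (1 + y ^ 2) / 2 := fun y => by nlinarith [sq_nonneg (y - 1)]
  have sa := sq_nonneg a
  have sb := sq_nonneg b
  have sc := sq_nonneg c
  have st := sq_nonneg t
  have sp := sq_nonneg p
  have sq' := sq_nonneg q
  have aN : a ≤ N := by linarith [am a]
  have bN : b ≤ N := by linarith [am b]
  have cN : c ≤ N := by linarith [am c]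
  have tN : t ≤ N := by linarith [am t]
  have qN : q ≤ N := by linarith [am q]
  have ea : e * a ≤ a := mul_le_of_le_one_left ha he1
  have eb : e * b ≤ b := mul_le_of_le_one_left hb he1
  have ec : e * c ≤ c := mul_le_of_le_one_left hc he1
  have hR : e * a + e * b + e * c ≤ e * (3 * N) := by
    have : e * (a + b + c) ≤ e * (3 * N) := mul_le_mul_of_nonneg_left (by linarith) he
    linarith
  have hR0 : 0 ≤ e * a + e * b + e * c := by positivity
  refine ⟨hR, by linarith, ?_, qN⟩
  have hle : 1 + t + (e * a + e * b + e * c) ≤ 1 + t + a + b + c := by linarith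
  have h5 : (1 + t + a + b + c) ^ 2 ≤ 5 * (1 + t ^ 2 + a ^ 2 + b ^ 2 + c ^ 2) := by
    nlinarith [sq_nonneg (1 - t), sq_nonneg (1 - a), sq_nonneg (1 - b), sq_nonneg (1 - c),
      sq_nonneg (t - a), sq_nonneg (t - b), sq_nonneg (t - c), sq_nonneg (a - b),
      sq_nonneg (a - c), sq_nonneg (b - c)]
  calc (1 + t + (e * a + e * b + e * c)) * p ≤ (1 + t + a + b + c) * p := by gcongr
    _ ≤ ((1 + t + a + b + c) ^ 2 + p ^ 2) / 2 := by
        linarith [two_mul_le_add_sq (1 + t + a + b + c) p]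
    _ ≤ 3 * N := by linarith

namespace IsSample

variable {Ω : Type*} [MeasurableSpace Ω] {μ : Measure Ω} {d : ℕ}
  {γs : Param d} {σ ξ M K H κ : ℝ} {x z : Ω → Vec d} {g : Ω → Fin 2} {ε : Ω → ℝ}

lemma measurable_record (h : IsSample μ γs σ ξ M K H κ x z g ε) :
    Measurable (record γs x z g ε) := by
  have hx := h.measurable_x
  have hz := h.measurable_z
  have hε := h.measurable_ε
  have hg : MeasurableSet {ω | g ω = 0} := h.measurable_g (measurableSet_singleton 0)
  unfold record
  refine Measurable.prodMk (Measurable.add ?_ hε) (hx.prodMk hz)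
  exact hx.inner (Measurable.ite hg measurable_const measurable_const)

lemma measurable_weight_record (h : IsSample μ γs σ ξ M K H κ x z g ε) (γ : Param d) :
    Measurable fun ω => weight σ (record γs x z g ε ω) γ :=
  Measurable.comp (g := fun o => weight σ o γ) (f := record γs x z g ε)
    (measurable_weight_right σ γ) h.measurable_record

lemma measurable_score_record (h : IsSample μ γs σ ξ M K H κ x z g ε) (c : Fin 3) (γ v : _) :
    Measurable fun ω => ⟪score σ γs c γ (record γs x z g ε ω), v⟫ :=
  (Measurable.comp (g := fun o => score σ γs c γ o) (f := record γs x z g ε)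
    (measurable_score_right σ γs c γ) h.measurable_record).inner measurable_const

lemma measurable_envelope (h : IsSample μ γs σ ξ M K H κ x z g ε) (u₁ u₂ u₃ v : Vec d) :
    Measurable (envelope x z ε u₁ u₂ u₃ v) := by
  have hx := h.measurable_x
  have hz := h.measurable_z
  have hε := h.measurable_ε
  unfold envelope
  fun_prop

lemma env_moment (h : IsSample μ γs σ ξ M K H κ x z g ε) (hK : 0 < K) {u₁ u₂ u₃ v : Vec d}
    (h₁ : ‖u₁‖ ≤ 1) (h₂ : ‖u₂‖ ≤ 1) (h₃ : ‖u₃‖ ≤ 1) (hv : ‖v‖ ≤ 1) (k : ℕ) :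
    Integrable (fun ω => envelope x z ε u₁ u₂ u₃ v ω ^ k) μ ∧
    ∫ ω, envelope x z ε u₁ u₂ u₃ v ω ^ k ∂μ ≤ k.factorial * K ^ k * H :=
  moment_of_exp_moment (h.measurable_envelope u₁ u₂ u₃ v)
    (fun ω => zero_le_one.trans (one_le_envelope x z ε u₁ u₂ u₃ v ω)) hK
    (h.integrable_env u₁ u₂ u₃ v h₁ h₂ h₃ hv) (h.integral_env u₁ u₂ u₃ v h₁ h₂ h₃ hv) k

/-- Pointwise bounds for the weights in terms of the envelope. -/
lemma pointwise (h : IsSample μ γs σ ξ M K H κ x z g ε) (hσ : 0 < σ) (hξ : 0 < ξ) {C : ℝ}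
    (hC : 1 ≤ C) (hW : WeightBound σ (Real.log (1 / ξ)) C) {γ : Param d} (he : err2 γ γs ≤ 1)
    {u₁ u₂ u₃ : Vec d} (e₁ : γ.2.1 - γs.2.1 = err2 γ γs • u₁)
    (e₂ : γ.2.2 - γs.2.2 = err2 γ γs • u₂) (e₃ : γ.1 - γs.1 = err2 γ γs • u₃) (v : Vec d) :
    ∀ᵐ ω ∂μ,
      |weight σ (record γs x z g ε ω) γ - weight σ (record γs x z g ε ω) γs| *
        (1 + |(record γs x z g ε ω).1 - ⟪x ω, γs.2.1⟫| + |(record γs x z g ε ω).1 - ⟪x ω, γs.2.2⟫|)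
        ≤ 9375 * C * err2 γ γs * envelope x z ε u₁ u₂ u₃ v ω ^ 6 *
          (1 + |⟪x ω, γs.2.1 - γs.2.2⟫|)⁻¹ ∧
      ∀ c, |⟪score σ γs c γ (record γs x z g ε ω), v⟫|
        ≤ (3 * C / σ ^ 2 + 1) * envelope x z ε u₁ u₂ u₃ v ω := by
  filter_upwards [h.nondegenerate] with ω hω
  set o := record γs x z g ε ω with ho
  have hl := abs_inner_le_of_sigmoid hξ hω.1 hω.2
  set e := err2 γ γs with hedef
  have he0 : 0 ≤ e := err2_nonneg γ γs
  obtain ⟨k1, k2, k3⟩ := hW d γ γs (x ω) (z ω) o.1 (ε ω) hl (record_cases γs x z g ε ω) _ rfl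
  have ho' : (o.1, x ω, z ω) = o := rfl
  rw [ho'] at k1 k2 k3
  rw [e₁, e₂, e₃, real_inner_smul_right, real_inner_smul_right, real_inner_smul_right,
    abs_mul, abs_mul, abs_mul, abs_of_nonneg he0] at k1 k2 k3
  set a := |⟪x ω, u₁⟫| with ha
  set b := |⟪x ω, u₂⟫| with hb
  set c₀ := |⟪z ω, u₃⟫| with hc
  set N := envelope x z ε u₁ u₂ u₃ v ω with hN
  have hN1 : 1 ≤ N := one_le_envelope x z ε u₁ u₂ u₃ v ω
  have hNe : N = 1 + |ε ω| ^ 2 + a ^ 2 + b ^ 2 + c₀ ^ 2 + |⟪x ω, v⟫| ^ 2 + |⟪z ω, v⟫| ^ 2 := by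
    rw [hN, ha, hb, hc]; simp only [sq_abs]; rfl
  have a0 : 0 ≤ a := abs_nonneg _
  have b0 : 0 ≤ b := abs_nonneg _
  have c00 : 0 ≤ c₀ := abs_nonneg _
  set t := |ε ω| with ht
  have t0 : 0 ≤ t := abs_nonneg _
  set p := |⟪x ω, v⟫| with hp
  set q := |⟪z ω, v⟫| with hq
  have p0 : 0 ≤ p := abs_nonneg _
  have q0 : 0 ≤ q := abs_nonneg _
  obtain ⟨hR, hW5, hWp, qN⟩ := envelope_arith a0 b0 c00 p0 he0 he hNe
  have hR0 : 0 ≤ e * a + e * b + e * c₀ := by positivity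
  set R := e * a + e * b + e * c₀ with hRdef
  constructor
  · have hD : 0 < 1 + |⟪x ω, γs.2.1 - γs.2.2⟫| := by positivity
    rw [← div_eq_mul_inv, le_div_iff₀ hD, mul_assoc]
    refine k1.trans ?_
    calc C * (R * (1 + t + R) ^ 5) ≤ C * (e * (3 * N) * (5 * N) ^ 5) := by gcongr
      _ = 9375 * C * e * N ^ 6 := by ring
  · have hw0 := weight_nonneg hσ o γ
    have hw1 := weight_le_one hσ o γ
    have hσ2 : 0 < σ ^ 2 := by positivity
    have hox : o.2.1 = x ω := rfl
    have hoz : o.2.2 = z ω := rfl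
    have hbig : ∀ y : ℝ, 0 ≤ y → y ≤ C * (1 + t + R) →
        y / σ ^ 2 * p ≤ (3 * C / σ ^ 2 + 1) * N := by
      intro y hy0 hy
      calc y / σ ^ 2 * p ≤ C * (1 + t + R) / σ ^ 2 * p := by gcongr
        _ = C / σ ^ 2 * ((1 + t + R) * p) := by ring
        _ ≤ C / σ ^ 2 * (3 * N) := by gcongr
        _ = 3 * C / σ ^ 2 * N := by ring
        _ ≤ _ := by rw [add_mul, one_mul]; linarith
    intro c
    unfold score
    rw [real_inner_smul_left, abs_mul]
    fin_cases c
    · simp only [resid, feat, Fin.zero_eta, Matrix.cons_val_zero, hox]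
      rw [abs_div, abs_of_pos hσ2, abs_mul, abs_of_nonneg hw0]
      exact hbig _ (by positivity) k2
    · simp only [resid, feat, Fin.mk_one, Matrix.cons_val_one, Matrix.cons_val_zero, hox]
      rw [abs_div, abs_of_pos hσ2, abs_mul, abs_of_nonneg (by linarith : 0 ≤ 1 - weight σ o γ)]
      exact hbig _ (mul_nonneg (by linarith) (abs_nonneg _)) k3
    · simp only [resid, feat, Fin.reduceFinMk, Matrix.cons_val, hoz]
      have h1 : |weight σ o γ - Real.sigmoid ⟪z ω, γs.1⟫| ≤ 1 := by
        rw [abs_le]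
        have := Real.sigmoid_nonneg ⟪z ω, γs.1⟫
        have := Real.sigmoid_le_one ⟪z ω, γs.1⟫
        constructor <;> linarith
      have h3 : 0 ≤ 3 * C / σ ^ 2 * N := by positivity
      rw [add_mul, one_mul]
      exact (mul_le_of_le_one_left q0 h1).trans (by linarith)

/-- Exponential moment of the scores. -/
lemma score_exp_moment (h : IsSample μ γs σ ξ M K H κ x z g ε) (hσ : 0 < σ) (hξ : 0 < ξ)
    (hK : 0 < K) {C : ℝ} (hC : 1 ≤ C) (hW : WeightBound σ (Real.log (1 / ξ)) C) {γ : Param d}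
    (he : err2 γ γs ≤ 1) {v : Vec d} (hv : ‖v‖ ≤ 1) (c : Fin 3) :
    Integrable (fun ω => Real.exp (|⟪score σ γs c γ (record γs x z g ε ω), v⟫| /
      ((3 * C / σ ^ 2 + 1) * K))) μ ∧
    ∫ ω, Real.exp (|⟪score σ γs c γ (record γs x z g ε ω), v⟫| /
      ((3 * C / σ ^ 2 + 1) * K)) ∂μ ≤ H := by
  obtain ⟨u₁, u₂, u₃, h₁, h₂, h₃, e₁, e₂, e₃⟩ := exists_directions γ γs
  have hp := h.pointwise hσ hξ hC hW he e₁ e₂ e₃ v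
  have hi := h.integrable_env u₁ u₂ u₃ v h₁ h₂ h₃ hv
  have hpos : 0 < 3 * C / σ ^ 2 + 1 := by positivity
  have hae : ∀ᵐ ω ∂μ, Real.exp (|⟪score σ γs c γ (record γs x z g ε ω), v⟫| /
      ((3 * C / σ ^ 2 + 1) * K)) ≤ Real.exp (envelope x z ε u₁ u₂ u₃ v ω / K) := by
    filter_upwards [hp] with ω hω
    apply Real.exp_le_exp.2
    rw [div_le_div_iff₀ (by positivity) hK]
    have := mul_le_mul_of_nonneg_right (hω.2 c) hK.le
    linarith
  have hmeas := h.measurable_score_record c γ v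
  have hintg : Integrable (fun ω => Real.exp (|⟪score σ γs c γ (record γs x z g ε ω), v⟫| /
      ((3 * C / σ ^ 2 + 1) * K))) μ := by
    refine hi.mono' (hmeas.abs.div_const _).exp.aestronglyMeasurable ?_
    filter_upwards [hae] with ω hω
    rwa [Real.norm_of_nonneg (Real.exp_pos _).le]
  exact ⟨hintg, (integral_mono_ae hintg hi hae).trans (h.integral_env u₁ u₂ u₃ v h₁ h₂ h₃ hv)⟩

end IsSample

/-- The moment of order `14` guaranteed by an exponential moment. -/
def envMoment (K H : ℝ) : ℝ := Nat.factorial 14 * K ^ 14 * H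

lemma envMoment_pos {K H : ℝ} (hK : 0 < K) (hH : 0 < H) : 0 < envMoment K H := by
  unfold envMoment; positivity

namespace IsSample

variable {Ω : Type*} [MeasurableSpace Ω] {μ : Measure Ω} {d : ℕ}
  {γs : Param d} {σ ξ M K H κ : ℝ} {x z : Ω → Vec d} {g : Ω → Fin 2} {ε : Ω → ℝ}

/-- The change of the weights is small on average if the groups are well separated. -/
lemma weight_diff_moment [IsProbabilityMeasure μ] (h : IsSample μ γs σ ξ M K H κ x z g ε) (hσ : 0 < σ) (hξ : 0 < ξ)
    (hK : 0 < K) (hH : 0 < H) {C : ℝ} (hC : 1 ≤ C) (hW : WeightBound σ (Real.log (1 / ξ)) C)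
    {κ' : ℝ} (hκ' : 0 < κ')
    (hκ : κ ≤ κ' ^ 2 / ((9375 * C) ^ 2 * envMoment K H))
    {γ : Param d} (he : err2 γ γs ≤ 1) {v : Vec d} (hv : ‖v‖ ≤ 1) :
    ∃ N : Ω → ℝ, (∀ ω, ⟪x ω, v⟫ ^ 2 ≤ N ω) ∧ (∀ ω, |⟪x ω, v⟫| ≤ N ω) ∧ (∀ ω, |⟪z ω, v⟫| ≤ N ω) ∧
      Integrable (fun ω => |weight σ (record γs x z g ε ω) γ - weight σ (record γs x z g ε ω) γs| *
        (1 + |(record γs x z g ε ω).1 - ⟪x ω, γs.2.1⟫| + |(record γs x z g ε ω).1 - ⟪x ω, γs.2.2⟫|)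
        * N ω) μ ∧
      ∫ ω, |weight σ (record γs x z g ε ω) γ - weight σ (record γs x z g ε ω) γs| *
        (1 + |(record γs x z g ε ω).1 - ⟪x ω, γs.2.1⟫| + |(record γs x z g ε ω).1 - ⟪x ω, γs.2.2⟫|)
        * N ω ∂μ ≤ κ' * err2 γ γs := by
  obtain ⟨u₁, u₂, u₃, h₁, h₂, h₃, e₁, e₂, e₃⟩ := exists_directions γ γs
  have hp := h.pointwise hσ hξ hC hW he e₁ e₂ e₃ v
  have hNm := h.measurable_envelope u₁ u₂ u₃ v
  obtain ⟨hm1, hm2⟩ := h.env_moment hK h₁ h₂ h₃ hv 14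
  rw [← envMoment] at hm2
  have he0 : 0 ≤ err2 γ γs := err2_nonneg γ γs
  set N := envelope x z ε u₁ u₂ u₃ v with hN
  have hN1 : ∀ ω, 1 ≤ N ω := one_le_envelope x z ε u₁ u₂ u₃ v
  have hxs : ∀ ω, ⟪x ω, v⟫ ^ 2 + ⟪z ω, v⟫ ^ 2 + 1 ≤ N ω := by
    intro ω
    rw [hN]; unfold envelope
    have := sq_nonneg (ε ω)
    have := sq_nonneg ⟪x ω, u₁⟫
    have := sq_nonneg ⟪x ω, u₂⟫
    have := sq_nonneg ⟪z ω, u₃⟫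
    linarith
  have am : ∀ y : ℝ, |y| ≤ 1 + y ^ 2 := fun y => by
    rw [← sq_abs]; nlinarith [sq_nonneg (|y| - 1), abs_nonneg y]
  refine ⟨N, fun ω => by nlinarith [hxs ω, sq_nonneg ⟪z ω, v⟫],
    fun ω => (am _).trans (by nlinarith [hxs ω, sq_nonneg ⟪z ω, v⟫]),
    fun ω => (am _).trans (by nlinarith [hxs ω, sq_nonneg ⟪x ω, v⟫]), ?_⟩
  set A := 9375 * C with hA
  have hA0 : 0 < A := by positivity
  set m := envMoment K H with hm
  have hm0 : 0 < m := envMoment_pos hK hH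
  set τ := κ' / (A * m) with hτ
  have hτ0 : 0 < τ := by positivity
  set D : Ω → ℝ := fun ω => (1 + |⟪x ω, γs.2.1 - γs.2.2⟫|)⁻¹ with hD
  have hDm : Measurable D := by
    have hx := h.measurable_x
    have : Measurable fun ω => 1 + |⟪x ω, γs.2.1 - γs.2.2⟫| :=
      measurable_const.add (hx.inner measurable_const).abs
    exact this.inv
  have hD0 : ∀ ω, 0 ≤ D ω := fun ω => by rw [hD]; positivity
  have hD1 : ∀ ω, D ω ≤ 1 := fun ω => by
    apply inv_le_one_of_one_le₀; linarith [abs_nonneg ⟪x ω, γs.2.1 - γs.2.2⟫]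
  have hDi : Integrable (fun ω => D ω ^ 2) μ := by
    refine Integrable.of_bound (hDm.pow_const 2).aestronglyMeasurable 1
      (Filter.Eventually.of_forall fun ω => ?_)
    rw [Real.norm_of_nonneg (sq_nonneg _)]
    exact pow_le_one₀ (hD0 ω) (hD1 ω)
  have hdom : Integrable (fun ω => A * err2 γ γs * ((τ * N ω ^ 14 + τ⁻¹ * D ω ^ 2) / 2)) μ :=
    (((hm1.const_mul τ).add (hDi.const_mul τ⁻¹)).div_const 2).const_mul _
  have hbd : ∀ᵐ ω ∂μ, |weight σ (record γs x z g ε ω) γ - weight σ (record γs x z g ε ω) γs| *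
        (1 + |(record γs x z g ε ω).1 - ⟪x ω, γs.2.1⟫| + |(record γs x z g ε ω).1 - ⟪x ω, γs.2.2⟫|)
        * N ω ≤ A * err2 γ γs * ((τ * N ω ^ 14 + τ⁻¹ * D ω ^ 2) / 2) := by
    filter_upwards [hp] with ω hω
    have hN0 : 0 ≤ N ω := zero_le_one.trans (hN1 ω)
    calc _ ≤ A * err2 γ γs * N ω ^ 6 * D ω * N ω := by
          exact mul_le_mul_of_nonneg_right hω.1 hN0
      _ = A * err2 γ γs * (N ω ^ 7 * D ω) := by ring
      _ ≤ _ := by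
          refine mul_le_mul_of_nonneg_left ?_ (by positivity)
          have hs : τ * τ⁻¹ = 1 := mul_inv_cancel₀ hτ0.ne'
          have h3 : 0 ≤ τ * (N ω ^ 7 - τ⁻¹ * D ω) ^ 2 := by positivity
          have h4 : τ * (N ω ^ 7 - τ⁻¹ * D ω) ^ 2
              = τ * N ω ^ 14 - 2 * (τ * τ⁻¹) * (N ω ^ 7 * D ω) + (τ * τ⁻¹) * τ⁻¹ * D ω ^ 2 := by
            ring
          rw [h4, hs] at h3
          linarith
  have hrm := h.measurable_record
  have hwm := h.measurable_weight_record
  have hmeas : Measurable fun ω =>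
      |weight σ (record γs x z g ε ω) γ - weight σ (record γs x z g ε ω) γs| *
        (1 + |(record γs x z g ε ω).1 - ⟪x ω, γs.2.1⟫| + |(record γs x z g ε ω).1 - ⟪x ω, γs.2.2⟫|)
        * N ω := by
    have hx := h.measurable_x
    have i1 : Measurable fun ω => |(record γs x z g ε ω).1 - ⟪x ω, γs.2.1⟫| :=
      (hrm.fst.sub (hx.inner measurable_const)).abs
    have i2 : Measurable fun ω => |(record γs x z g ε ω).1 - ⟪x ω, γs.2.2⟫| :=
      (hrm.fst.sub (hx.inner measurable_const)).abs
    exact (((hwm γ).sub (hwm γs)).abs.mul ((measurable_const.add i1).add i2)).mul hNm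
  have hintg : Integrable (fun ω =>
      |weight σ (record γs x z g ε ω) γ - weight σ (record γs x z g ε ω) γs| *
        (1 + |(record γs x z g ε ω).1 - ⟪x ω, γs.2.1⟫| + |(record γs x z g ε ω).1 - ⟪x ω, γs.2.2⟫|)
        * N ω) μ := by
    refine hdom.mono' hmeas.aestronglyMeasurable ?_
    filter_upwards [hbd] with ω hω
    rw [Real.norm_of_nonneg]
    · exact hω
    · have : 0 ≤ N ω := zero_le_one.trans (hN1 ω)
      positivity
  refine ⟨hintg, (integral_mono_ae hintg hdom hbd).trans ?_⟩
  rw [integral_const_mul, integral_div, integral_add (hm1.const_mul τ) (hDi.const_mul τ⁻¹),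
    integral_const_mul, integral_const_mul]
  have hsep := h.separation
  have h5 : τ * ∫ ω, N ω ^ 14 ∂μ ≤ κ' / A := by
    calc _ ≤ τ * m := by gcongr
      _ = κ' / A := by rw [hτ]; field_simp
  have h6 : τ⁻¹ * ∫ ω, D ω ^ 2 ∂μ ≤ κ' / A := by
    calc _ ≤ τ⁻¹ * (κ' ^ 2 / (A ^ 2 * m)) := by gcongr; exact hsep.trans hκ
      _ = κ' / A := by rw [hτ]; field_simp
  calc A * err2 γ γs * ((τ * ∫ ω, N ω ^ 14 ∂μ + τ⁻¹ * ∫ ω, D ω ^ 2 ∂μ) / 2)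
      ≤ A * err2 γ γs * ((κ' / A + κ' / A) / 2) := by gcongr
    _ = κ' * err2 γ γs := by field_simp; ring

lemma memLp_noise (h : IsSample μ γs σ ξ M K H κ x z g ε) (hK : 0 < K) : MemLp ε 2 μ := by
  obtain ⟨h1, -⟩ := h.env_moment hK (u₁ := 0) (u₂ := 0) (u₃ := 0) (v := 0) (by simp) (by simp)
    (by simp) (by simp) 1
  rw [memLp_two_iff_integrable_sq h.measurable_ε.aestronglyMeasurable]
  refine h1.mono' (h.measurable_ε.pow_const 2).aestronglyMeasurable
    (Filter.Eventually.of_forall fun ω => ?_)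
  rw [Real.norm_of_nonneg (sq_nonneg _)]
  simp [envelope]

lemma memLp_inner (h : IsSample μ γs σ ξ M K H κ x z g ε) (hK : 0 < K) (v : Vec d) :
    MemLp (fun ω => ⟪x ω, v⟫) 2 μ ∧ MemLp (fun ω => ⟪z ω, v⟫) 2 μ := by
  have key : ∀ u : Vec d, ‖u‖ ≤ 1 →
      MemLp (fun ω => ⟪x ω, u⟫) 2 μ ∧ MemLp (fun ω => ⟪z ω, u⟫) 2 μ := by
    intro u hu
    obtain ⟨h1, -⟩ := h.env_moment hK (u₁ := 0) (u₂ := 0) (u₃ := 0) (v := u) (by simp) (by simp)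
      (by simp) hu 1
    have hx : Measurable fun ω => ⟪x ω, u⟫ := h.measurable_x.inner measurable_const
    have hz : Measurable fun ω => ⟪z ω, u⟫ := h.measurable_z.inner measurable_const
    rw [memLp_two_iff_integrable_sq hx.aestronglyMeasurable,
      memLp_two_iff_integrable_sq hz.aestronglyMeasurable]
    constructor
    · refine h1.mono' (hx.pow_const 2).aestronglyMeasurable (Filter.Eventually.of_forall fun ω => ?_)
      rw [Real.norm_of_nonneg (sq_nonneg _)]
      simp only [envelope, pow_one, inner_zero_right]
      nlinarith [sq_nonneg (ε ω), sq_nonneg ⟪z ω, u⟫]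
    · refine h1.mono' (hz.pow_const 2).aestronglyMeasurable (Filter.Eventually.of_forall fun ω => ?_)
      rw [Real.norm_of_nonneg (sq_nonneg _)]
      simp only [envelope, pow_one, inner_zero_right]
      nlinarith [sq_nonneg (ε ω), sq_nonneg ⟪x ω, u⟫]
  rcases eq_or_ne v 0 with rfl | hv
  · exact key 0 (by simp)
  · have hv' : ‖v‖ ≠ 0 := norm_ne_zero_iff.2 hv
    obtain ⟨h1, h2⟩ := key (‖v‖⁻¹ • v) (by rw [norm_smul, norm_inv, norm_norm, inv_mul_cancel₀ hv'])
    have e : ∀ y : Vec d, ⟪y, v⟫ = ‖v‖ * ⟪y, ‖v‖⁻¹ • v⟫ := by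
      intro y; rw [real_inner_smul_right, ← mul_assoc, mul_inv_cancel₀ hv', one_mul]
    simp_rw [e]
    exact ⟨h1.const_mul _, h2.const_mul _⟩

lemma integrable_score_inner (h : IsSample μ γs σ ξ M K H κ x z g ε) (hσ : 0 < σ) (hξ : 0 < ξ)
    (hK : 0 < K) {C : ℝ} (hC : 1 ≤ C) (hW : WeightBound σ (Real.log (1 / ξ)) C) {γ : Param d}
    (he : err2 γ γs ≤ 1) {v : Vec d} (hv : ‖v‖ ≤ 1) (c : Fin 3) :
    Integrable (fun ω => ⟪score σ γs c γ (record γs x z g ε ω), v⟫) μ := by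
  obtain ⟨h1, h2⟩ := h.score_exp_moment hσ hξ hK hC hW he hv c
  have hmeas := h.measurable_score_record c γ v
  have := (moment_of_exp_moment hmeas.abs (fun ω => abs_nonneg _) (by positivity) h1 h2 1).1
  simp only [pow_one] at this
  exact (integrable_norm_iff hmeas.aestronglyMeasurable).1 this

lemma integrable_score (h : IsSample μ γs σ ξ M K H κ x z g ε) (hσ : 0 < σ) (hξ : 0 < ξ)
    (hK : 0 < K) {C : ℝ} (hC : 1 ≤ C) (hW : WeightBound σ (Real.log (1 / ξ)) C) {γ : Param d}
    (he : err2 γ γs ≤ 1) (c : Fin 3) :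
    Integrable (fun ω => score σ γs c γ (record γs x z g ε ω)) μ := by
  refine Integrable.of_eval_piLp fun j => ?_
  have := h.integrable_score_inner hσ hξ hK hC hW he (v := EuclideanSpace.single j 1) (by simp) c
  simpa [EuclideanSpace.inner_single_right] using this

lemma integrable_weight_mul (h : IsSample μ γs σ ξ M K H κ x z g ε) (hσ : 0 < σ) (γ : Param d)
    {f : Ω → ℝ} (hf : Integrable f μ) :
    Integrable (fun ω => weight σ (record γs x z g ε ω) γ * f ω) μ := by
  have hwm := h.measurable_weight_record γ
  refine hf.abs.mono' (hwm.aestronglyMeasurable.mul hf.aestronglyMeasurable)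
    (Filter.Eventually.of_forall fun ω => ?_)
  rw [Real.norm_eq_abs, abs_mul, abs_of_nonneg (weight_nonneg hσ _ _)]
  exact mul_le_of_le_one_left (abs_nonneg _) (weight_le_one hσ _ _)

lemma integrable_sigmoid_mul (h : IsSample μ γs σ ξ M K H κ x z g ε) {f : Ω → ℝ}
    (hf : Integrable f μ) : Integrable (fun ω => Real.sigmoid ⟪z ω, γs.1⟫ * f ω) μ := by
  have hwm : Measurable fun ω => Real.sigmoid ⟪z ω, γs.1⟫ :=
    continuous_sigmoid.measurable.comp (h.measurable_z.inner measurable_const)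
  refine hf.abs.mono' (hwm.aestronglyMeasurable.mul hf.aestronglyMeasurable)
    (Filter.Eventually.of_forall fun ω => ?_)
  rw [Real.norm_eq_abs, abs_mul, abs_of_nonneg (Real.sigmoid_nonneg _)]
  exact mul_le_of_le_one_left (abs_nonneg _) (Real.sigmoid_le_one _)

/-- The scores with the true weights are centered. -/
lemma score_true_mean [IsProbabilityMeasure μ] (h : IsSample μ γs σ ξ M K H κ x z g ε)
    (hσ : 0 < σ) (hK : 0 < K) (v : Vec d)
    (c : Fin 3) : ∫ ω, ⟪score σ γs c γs (record γs x z g ε ω), v⟫ ∂μ = 0 := by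
  have hx := fun u => (h.memLp_inner hK u).1
  have hz := fun u => (h.memLp_inner hK u).2
  have hε := h.memLp_noise hK
  have hgm : MeasurableSet {ω | g ω = 0} := h.measurable_g (measurableSet_singleton 0)
  have hrm := h.measurable_record
  have hres : ∀ β : Vec d, Integrable (fun ω =>
      ((record γs x z g ε ω).1 - ⟪x ω, β⟫) * ⟪x ω, v⟫) μ := by
    intro β
    have i1 : Integrable (fun ω => ⟪x ω, γs.2.1⟫ * ⟪x ω, v⟫) μ := (hx _).integrable_mul (hx v)
    have i2 : Integrable (fun ω => ⟪x ω, γs.2.2⟫ * ⟪x ω, v⟫) μ := (hx _).integrable_mul (hx v)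
    have i3 : Integrable (fun ω => ⟪x ω, β⟫ * ⟪x ω, v⟫) μ := (hx _).integrable_mul (hx v)
    have i4 : Integrable (fun ω => ε ω * ⟪x ω, v⟫) μ := hε.integrable_mul (hx v)
    have := (((i1.indicator hgm).add (i2.indicator hgm.compl)).add i4).sub i3
    refine this.congr (Filter.Eventually.of_forall fun ω => ?_)
    simp only [Pi.add_apply, Pi.sub_apply, record]
    by_cases hg : g ω = 0
    · simp [hg]; ring
    · simp [hg]; ring
  fin_cases c
  · have e1 : ∀ ω, ⟪score σ γs 0 γs (record γs x z g ε ω), v⟫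
        = weight σ (record γs x z g ε ω) γs *
          (((record γs x z g ε ω).1 - ⟪x ω, γs.2.1⟫) * ⟪x ω, v⟫ / σ ^ 2) := by
      intro ω
      simp only [score, resid, feat, Matrix.cons_val_zero, real_inner_smul_left]
      simp only [record]
      ring
    simp only [Fin.zero_eta]
    simp_rw [e1]
    have := h.bayes (fun o => (o.1 - ⟪o.2.1, γs.2.1⟫) * ⟪o.2.1, v⟫ / σ ^ 2) (by fun_prop)
      ((hres γs.2.1).div_const _)
    refine (this.trans ?_)
    have e2 : ∀ ω, (if g ω = 0 then ((record γs x z g ε ω).1 - ⟪(record γs x z g ε ω).2.1, γs.2.1⟫)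
        * ⟪(record γs x z g ε ω).2.1, v⟫ / σ ^ 2 else 0)
        = (if g ω = 0 then ε ω * ⟪x ω, v⟫ else 0) / σ ^ 2 := by
      intro ω
      by_cases hg : g ω = 0 <;> simp [hg, record]
    simp_rw [e2]
    rw [integral_div, (h.noise v).1, zero_div]
  · have e1 : ∀ ω, ⟪score σ γs 1 γs (record γs x z g ε ω), v⟫
        = ((record γs x z g ε ω).1 - ⟪x ω, γs.2.2⟫) * ⟪x ω, v⟫ / σ ^ 2
          - weight σ (record γs x z g ε ω) γs *
          (((record γs x z g ε ω).1 - ⟪x ω, γs.2.2⟫) * ⟪x ω, v⟫ / σ ^ 2) := by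
      intro ω
      simp only [score, resid, feat, Matrix.cons_val_one, Matrix.cons_val_zero,
        real_inner_smul_left]
      simp only [record]
      ring
    simp only [Fin.mk_one]
    simp_rw [e1]
    have hb := h.bayes (fun o => (o.1 - ⟪o.2.1, γs.2.2⟫) * ⟪o.2.1, v⟫ / σ ^ 2) (by fun_prop)
      ((hres γs.2.2).div_const _)
    have hi := (hres γs.2.2).div_const (σ ^ 2)
    have hi2 : Integrable (fun ω => weight σ (record γs x z g ε ω) γs *
          (((record γs x z g ε ω).1 - ⟪x ω, γs.2.2⟫) * ⟪x ω, v⟫ / σ ^ 2)) μ := h.integrable_weight_mul hσ γs hi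
    have hi3 : Integrable (fun ω => if g ω = 0 then
        ((record γs x z g ε ω).1 - ⟪x ω, γs.2.2⟫) * ⟪x ω, v⟫ / σ ^ 2 else 0) μ := by
      refine (hi.indicator hgm).congr (Filter.Eventually.of_forall fun ω => ?_)
      by_cases hg : g ω = 0 <;> simp [hg]
    rw [integral_sub hi hi2]
    refine (congrArg (fun t => _ - t) hb).trans ?_
    refine (integral_sub hi hi3).symm.trans ?_
    have e2 : ∀ ω, ((record γs x z g ε ω).1 - ⟪x ω, γs.2.2⟫) * ⟪x ω, v⟫ / σ ^ 2 - (if g ω = 0 then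
        ((record γs x z g ε ω).1 - ⟪x ω, γs.2.2⟫) * ⟪x ω, v⟫ / σ ^ 2 else 0)
        = (if g ω = 0 then 0 else ε ω * ⟪x ω, v⟫) / σ ^ 2 := by
      intro ω
      by_cases hg : g ω = 0 <;> simp [hg, record]
    simp_rw [e2]
    rw [integral_div, (h.noise v).2, zero_div]
  · have hzi : Integrable (fun ω => ⟪z ω, v⟫) μ := (hz v).integrable (by norm_num)
    have e1 : ∀ ω, ⟪score σ γs 2 γs (record γs x z g ε ω), v⟫
        = weight σ (record γs x z g ε ω) γs * ⟪z ω, v⟫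
          - Real.sigmoid ⟪z ω, γs.1⟫ * ⟪z ω, v⟫ := by
      intro ω
      simp only [score, resid, feat, Matrix.cons_val, real_inner_smul_left]
      simp only [record]
      ring
    simp only [Fin.reduceFinMk]
    simp_rw [e1]
    have hb := h.bayes (fun o => ⟪o.2.2, v⟫) (by fun_prop) hzi
    have hg := h.group (fun p => ⟪p.2, v⟫) (by fun_prop) hzi
    rw [integral_sub (h.integrable_weight_mul hσ γs hzi) (h.integrable_sigmoid_mul hzi), sub_eq_zero]
    exact hb.trans hg

/-- The mean score at the truth, with weights from `γ`, contracts. -/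
lemma score_mean [IsProbabilityMeasure μ] (h : IsSample μ γs σ ξ M K H κ x z g ε) (hσ : 0 < σ)
    (hξ : 0 < ξ) (hK : 0 < K) (hH : 0 < H) {C : ℝ} (hC : 1 ≤ C)
    (hW : WeightBound σ (Real.log (1 / ξ)) C) {κ' : ℝ} (hκ' : 0 < κ')
    (hκ : κ ≤ κ' ^ 2 / ((9375 * C) ^ 2 * envMoment K H))
    {γ : Param d} (he : err2 γ γs ≤ 1) (c : Fin 3) (u : Vec d) :
    ⟪∫ ω, score σ γs c γ (record γs x z g ε ω) ∂μ, u⟫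
      ≤ (1 + 1 / σ ^ 2) * κ' * err2 γ γs * ‖u‖ := by
  have key : ∀ v : Vec d, ‖v‖ ≤ 1 → ⟪∫ ω, score σ γs c γ (record γs x z g ε ω) ∂μ, v⟫
      ≤ (1 + 1 / σ ^ 2) * κ' * err2 γ γs := by
    intro v hv
    have hintg := h.integrable_score hσ hξ hK hC hW he c
    have hintv := h.integrable_score_inner hσ hξ hK hC hW he hv c
    have hints := h.integrable_score_inner (γ := γs) hσ hξ hK hC hW (by simp [err2]) hv c
    rw [real_inner_comm, ← integral_inner hintg]
    have e0 : ∫ ω, ⟪v, score σ γs c γ (record γs x z g ε ω)⟫ ∂μ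
        = ∫ ω, (⟪score σ γs c γ (record γs x z g ε ω), v⟫
          - ⟪score σ γs c γs (record γs x z g ε ω), v⟫) ∂μ := by
      rw [integral_sub hintv hints, h.score_true_mean hσ hK v c, sub_zero]
      simp_rw [real_inner_comm]
    rw [e0]
    obtain ⟨N, -, hN1, hN2, hi, hle⟩ := h.weight_diff_moment hσ hξ hK hH hC hW hκ' hκ he hv
    have hc1 : 0 ≤ 1 + 1 / σ ^ 2 := by positivity
    have hc2 : 1 / σ ^ 2 ≤ 1 + 1 / σ ^ 2 := by linarith
    have hc3 : 1 ≤ 1 + 1 / σ ^ 2 := by have : 0 ≤ 1 / σ ^ 2 := by positivity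
                                       linarith
    calc _ ≤ ∫ ω, (1 + 1 / σ ^ 2) *
          (|weight σ (record γs x z g ε ω) γ - weight σ (record γs x z g ε ω) γs| *
        (1 + |(record γs x z g ε ω).1 - ⟪x ω, γs.2.1⟫| + |(record γs x z g ε ω).1 - ⟪x ω, γs.2.2⟫|)
        * N ω) ∂μ := by
          refine integral_mono (hintv.sub hints) (hi.const_mul _) fun ω => ?_
          have hN0 : 0 ≤ N ω := (abs_nonneg _).trans (hN1 ω)
          set W := weight σ (record γs x z g ε ω) γ - weight σ (record γs x z g ε ω) γs with hWdef
          set A₁ := (record γs x z g ε ω).1 - ⟪x ω, γs.2.1⟫ with hA₁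
          set A₂ := (record γs x z g ε ω).1 - ⟪x ω, γs.2.2⟫ with hA₂
          have q1 : |A₁| ≤ 1 + |A₁| + |A₂| := by linarith [abs_nonneg A₂]
          have q2 : |A₂| ≤ 1 + |A₁| + |A₂| := by linarith [abs_nonneg A₁]
          have q3 : 1 ≤ 1 + |A₁| + |A₂| := by linarith [abs_nonneg A₁, abs_nonneg A₂]
          have fin : ∀ a b y k : ℝ, 0 ≤ k → k ≤ 1 + 1 / σ ^ 2 → |a| ≤ |W| → |b| ≤ 1 + |A₁| + |A₂| →
              |y| ≤ N ω → k * (a * b * y) ≤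
                (1 + 1 / σ ^ 2) * (|W| * (1 + |A₁| + |A₂|) * N ω) := by
            intro a b y k hk hk' ha hb hy
            calc k * (a * b * y) ≤ k * (|a| * |b| * |y|) := by
                  rw [← abs_mul, ← abs_mul]
                  exact mul_le_mul_of_nonneg_left (le_abs_self _) hk
              _ ≤ _ := by gcongr
          fin_cases c
          · have e : ⟪score σ γs 0 γ (record γs x z g ε ω), v⟫
                - ⟪score σ γs 0 γs (record γs x z g ε ω), v⟫ = 1 / σ ^ 2 * (W * A₁ * ⟪x ω, v⟫) := by
              simp only [score, resid, feat, Matrix.cons_val_zero, real_inner_smul_left]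
              simp only [hWdef, hA₁, record]
              ring
            exact (le_of_eq e).trans (fin _ _ _ _ (by positivity) hc2 le_rfl q1 (hN1 ω))
          · have e : ⟪score σ γs 1 γ (record γs x z g ε ω), v⟫
                - ⟪score σ γs 1 γs (record γs x z g ε ω), v⟫
                = 1 / σ ^ 2 * (-W * A₂ * ⟪x ω, v⟫) := by
              simp only [score, resid, feat, Matrix.cons_val_one, Matrix.cons_val_zero,
                real_inner_smul_left]
              simp only [hWdef, hA₂, record]
              ring
            exact (le_of_eq e).trans (fin _ _ _ _ (by positivity) hc2 (abs_neg W).le q2 (hN1 ω))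
          · have e : ⟪score σ γs 2 γ (record γs x z g ε ω), v⟫
                - ⟪score σ γs 2 γs (record γs x z g ε ω), v⟫ = 1 * (W * 1 * ⟪z ω, v⟫) := by
              simp only [score, resid, feat, Matrix.cons_val, real_inner_smul_left]
              simp only [hWdef, record]
              ring
            exact (le_of_eq e).trans (fin _ _ _ _ zero_le_one hc3 le_rfl (by simpa using q3) (hN2 ω))
      _ = (1 + 1 / σ ^ 2) * _ := integral_const_mul _ _
      _ ≤ (1 + 1 / σ ^ 2) * (κ' * err2 γ γs) := by gcongr
      _ = _ := by ring
  rcases eq_or_ne u 0 with rfl | hu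
  · simp
  · have hu' : 0 < ‖u‖ := norm_pos_iff.2 hu
    have := key (‖u‖⁻¹ • u) (by rw [norm_smul, norm_inv, norm_norm, inv_mul_cancel₀ hu'.ne'])
    rw [real_inner_smul_right, inv_mul_le_iff₀ hu'] at this
    linarith

end IsSample

lemma sq_sub_trunc_sq_le {B : ℝ} (hB : 0 < B) (b : ℝ) :
    b ^ 2 - b ^ 4 / B ^ 2 ≤ (min |b| B) ^ 2 := by
  rcases le_total |b| B with h | h
  · rw [min_eq_left h, sq_abs]
    have : 0 ≤ b ^ 4 / B ^ 2 := by positivity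
    linarith
  · have h1 : B ^ 2 ≤ b ^ 2 := by
      rw [← sq_abs b]; exact pow_le_pow_left₀ hB.le h 2
    have h2 : b ^ 2 ≤ b ^ 4 / B ^ 2 := by
      rw [le_div_iff₀ (by positivity)]
      nlinarith [sq_nonneg b]
    have : 0 ≤ (min |b| B) ^ 2 := sq_nonneg _
    linarith

lemma measurable_trunc {Ω : Type*} [MeasurableSpace Ω] {y : Ω → ℝ} (hy : Measurable y) (B : ℝ) :
    Measurable fun ω => (min |y ω| B) ^ 2 :=
  (hy.abs.min measurable_const).pow_const 2

lemma trunc_sq_le {B : ℝ} (hB : 0 ≤ B) (b : ℝ) : (min |b| B) ^ 2 ≤ B ^ 2 :=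
  pow_le_pow_left₀ (le_min (abs_nonneg _) hB) (min_le_right _ _) 2

lemma trunc_sq_le_sq {B : ℝ} (hB : 0 ≤ B) (b : ℝ) : (min |b| B) ^ 2 ≤ b ^ 2 := by
  rw [← sq_abs b]
  exact pow_le_pow_left₀ (le_min (abs_nonneg _) hB) (min_le_left _ _) 2

lemma integrable_trunc {Ω : Type*} [MeasurableSpace Ω] {μ : Measure Ω} [IsProbabilityMeasure μ]
    {y : Ω → ℝ} (hy : Measurable y) {B : ℝ} (hB : 0 ≤ B) :
    Integrable (fun ω => (min |y ω| B) ^ 2) μ := by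
  refine Integrable.of_bound (measurable_trunc hy B).aestronglyMeasurable (B ^ 2)
    (Filter.Eventually.of_forall fun ω => ?_)
  rw [Real.norm_of_nonneg (sq_nonneg _)]
  exact trunc_sq_le hB _

/-- Truncation at a high level loses only a small part of the second moment. -/
lemma trunc_moment_lower {Ω : Type*} [MeasurableSpace Ω] {μ : Measure Ω} [IsProbabilityMeasure μ]
    {y N : Ω → ℝ} (hy : Measurable y) {B M m : ℝ} (hB : 0 < B) (hM : 0 < M)
    (hyN : ∀ ω, y ω ^ 2 ≤ 9 / 4 * N ω)
    (hN : Integrable (fun ω => N ω ^ 2) μ) (hm : ∫ ω, N ω ^ 2 ∂μ ≤ m)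
    (hlow : 1 / (4 * M) ≤ ∫ ω, y ω ^ 2 ∂μ) (hy2 : Integrable (fun ω => y ω ^ 2) μ)
    (hBm : 48 * M * m ≤ B ^ 2) :
    1 / (8 * M) ≤ ∫ ω, (min |y ω| B) ^ 2 ∂μ := by
  have h4 : ∀ ω, y ω ^ 4 ≤ 81 / 16 * N ω ^ 2 := by
    intro ω
    have := pow_le_pow_left₀ (sq_nonneg (y ω)) (hyN ω) 2
    calc y ω ^ 4 = (y ω ^ 2) ^ 2 := by ring
      _ ≤ _ := this
      _ = _ := by ring
  have hdom : Integrable (fun ω => y ω ^ 2 - 81 / 16 / B ^ 2 * N ω ^ 2) μ :=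
    hy2.sub (hN.const_mul _)
  have h5 : ∫ ω, (y ω ^ 2 - 81 / 16 / B ^ 2 * N ω ^ 2) ∂μ ≤ ∫ ω, (min |y ω| B) ^ 2 ∂μ := by
    refine integral_mono hdom (integrable_trunc hy hB.le) fun ω => ?_
    have h6 := sq_sub_trunc_sq_le hB (y ω)
    have h7 : y ω ^ 4 / B ^ 2 ≤ 81 / 16 / B ^ 2 * N ω ^ 2 := by
      rw [div_mul_eq_mul_div]; gcongr; exact h4 ω
    simp only
    linarith
  rw [integral_sub hy2 (hN.const_mul _), integral_const_mul] at h5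
  have h8 : 81 / 16 / B ^ 2 * ∫ ω, N ω ^ 2 ∂μ ≤ 1 / (8 * M) := by
    calc 81 / 16 / B ^ 2 * ∫ ω, N ω ^ 2 ∂μ ≤ 81 / 16 / B ^ 2 * m := by gcongr
      _ ≤ 1 / (8 * M) := by
        rw [div_mul_eq_mul_div, div_le_div_iff₀ (by positivity) (by positivity)]
        have hm0 : 0 ≤ m := (integral_nonneg fun ω => sq_nonneg _).trans hm
        nlinarith [mul_nonneg hM.le hm0]
  have h9 : 1 / (4 * M) = 1 / (8 * M) + 1 / (8 * M) := by field_simp; norm_num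
  linarith

namespace IsSample

variable {Ω : Type*} [MeasurableSpace Ω] {μ : Measure Ω} {d : ℕ}
  {γs : Param d} {σ ξ M K H κ : ℝ} {x z : Ω → Vec d} {g : Ω → Fin 2} {ε : Ω → ℝ}

/-- Curvature of the population losses, after truncation. -/
lemma curvature [IsProbabilityMeasure μ] (h : IsSample μ γs σ ξ M K H κ x z g ε) (hσ : 0 < σ)
    (hξ : 0 < ξ) (hξ1 : ξ < 1 / 2) (hM : 0 < M) (hK : 0 < K) (hH : 0 < H) {C : ℝ} (hC : 1 ≤ C)
    (hW : WeightBound σ (Real.log (1 / ξ)) C) {κ' : ℝ} (hκ' : 0 < κ') (hκM : κ' ≤ ξ / (36 * M))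
    (hκ : κ ≤ κ' ^ 2 / ((9375 * C) ^ 2 * envMoment K H)) {B : ℝ} (hB : 0 < B)
    (hBm : 48 * M * (2 * K ^ 2 * H) ≤ B ^ 2)
    {γ : Param d} (he : err2 γ γs ≤ 1) (c : Fin 3) {v : Vec d} (hv1 : 1 / 2 ≤ ‖v‖)
    (hv2 : ‖v‖ ≤ 3 / 2) :
    ξ / (16 * M) ≤ ∫ ω, cweight σ c γ (record γs x z g ε ω) *
      (min |⟪feat c (record γs x z g ε ω), v⟫| B) ^ 2 ∂μ := by
  set u : Vec d := (2 / 3 : ℝ) • v with hu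
  have hvu : v = (3 / 2 : ℝ) • u := by rw [hu, smul_smul]; norm_num
  have hun : ‖u‖ ≤ 1 := by
    rw [hu, norm_smul, Real.norm_of_nonneg (by norm_num)]; linarith
  obtain ⟨hN2, hN2'⟩ := h.env_moment hK (u₁ := 0) (u₂ := 0) (u₃ := 0) (v := u) (by simp)
    (by simp) (by simp) hun 2
  set N := envelope x z ε 0 0 0 u with hN
  have hm2 : ∫ ω, N ω ^ 2 ∂μ ≤ 2 * K ^ 2 * H := by simpa [Nat.factorial] using hN2'
  have hxu : ∀ ω, ⟪x ω, u⟫ ^ 2 + ⟪z ω, u⟫ ^ 2 ≤ N ω := by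
    intro ω; rw [hN]; unfold envelope
    have := sq_nonneg (ε ω)
    simp only [inner_zero_right]
    linarith
  have hiv : ∀ y : Vec d, ⟪y, v⟫ ^ 2 = 9 / 4 * ⟪y, u⟫ ^ 2 := by
    intro y
    have : ⟪y, v⟫ = 3 / 2 * ⟪y, u⟫ := by rw [← real_inner_smul_right, ← hvu]
    rw [this]; ring
  have hlowgen : ∀ w : Ω → Vec d, (∀ q : Vec d, ‖q‖ = 1 → 1 / M < ∫ ω, ⟪w ω, q⟫ ^ 2 ∂μ) →
      1 / (4 * M) ≤ ∫ ω, ⟪w ω, v⟫ ^ 2 ∂μ := by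
    intro w hw
    have hv0 : 0 < ‖v‖ := by linarith
    have h1 := hw (‖v‖⁻¹ • v) (by rw [norm_smul, norm_inv, norm_norm, inv_mul_cancel₀ hv0.ne'])
    have h2 : ∀ ω, ⟪w ω, v⟫ ^ 2 = ‖v‖ ^ 2 * ⟪w ω, ‖v‖⁻¹ • v⟫ ^ 2 := by
      intro ω; rw [real_inner_smul_right]; field_simp
    simp_rw [h2]
    rw [integral_const_mul]
    have h3 : (1 / 4 : ℝ) ≤ ‖v‖ ^ 2 := by nlinarith
    calc 1 / (4 * M) = 1 / 4 * (1 / M) := by field_simp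
      _ ≤ ‖v‖ ^ 2 * ∫ ω, ⟪w ω, ‖v‖⁻¹ • v⟫ ^ 2 ∂μ := by gcongr
  have hxm : Measurable fun ω => ⟪x ω, v⟫ := h.measurable_x.inner measurable_const
  have hzm : Measurable fun ω => ⟪z ω, v⟫ := h.measurable_z.inner measurable_const
  have hTx : 1 / (8 * M) ≤ ∫ ω, (min |⟪x ω, v⟫| B) ^ 2 ∂μ :=
    trunc_moment_lower hxm hB hM (fun ω => by
      rw [hiv]; nlinarith [hxu ω, sq_nonneg ⟪z ω, u⟫]) hN2 hm2 (hlowgen x h.moment_x)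
      ((h.memLp_inner hK v).1.integrable_sq) hBm
  have hTz : 1 / (8 * M) ≤ ∫ ω, (min |⟪z ω, v⟫| B) ^ 2 ∂μ :=
    trunc_moment_lower hzm hB hM (fun ω => by
      rw [hiv]; nlinarith [hxu ω, sq_nonneg ⟪x ω, u⟫]) hN2 hm2 (hlowgen z h.moment_z)
      ((h.memLp_inner hK v).2.integrable_sq) hBm
  have hTi : Integrable (fun ω => (min |⟪x ω, v⟫| B) ^ 2) μ := integrable_trunc hxm hB.le
  set T := ∫ ω, (min |⟪x ω, v⟫| B) ^ 2 ∂μ with hT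
  have hP1 : ∫ ω, weight σ (record γs x z g ε ω) γs * (min |⟪x ω, v⟫| B) ^ 2 ∂μ
      = ∫ ω, Real.sigmoid ⟪z ω, γs.1⟫ * (min |⟪x ω, v⟫| B) ^ 2 ∂μ := by
    have hb := h.bayes (fun o => (min |⟪o.2.1, v⟫| B) ^ 2) (by fun_prop) hTi
    have hg := h.group (fun p => (min |⟪p.1, v⟫| B) ^ 2) (by fun_prop) hTi
    exact hb.trans hg
  have hsi := h.integrable_sigmoid_mul hTi
  have hP2 : ξ * T ≤ ∫ ω, Real.sigmoid ⟪z ω, γs.1⟫ * (min |⟪x ω, v⟫| B) ^ 2 ∂μ := by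
    rw [hT, ← integral_const_mul]
    refine integral_mono_ae (hTi.const_mul _) hsi ?_
    filter_upwards [h.nondegenerate] with ω hω
    exact mul_le_mul_of_nonneg_right hω.1.le (sq_nonneg _)
  have hP3 : ∫ ω, Real.sigmoid ⟪z ω, γs.1⟫ * (min |⟪x ω, v⟫| B) ^ 2 ∂μ ≤ (1 - ξ) * T := by
    rw [hT, ← integral_const_mul]
    refine integral_mono_ae hsi (hTi.const_mul _) ?_
    filter_upwards [h.nondegenerate] with ω hω
    exact mul_le_mul_of_nonneg_right hω.2.le (sq_nonneg _)
  have hwi := h.integrable_weight_mul hσ γ hTi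
  have hwsi := h.integrable_weight_mul hσ γs hTi
  have hdiff : |∫ ω, weight σ (record γs x z g ε ω) γ * (min |⟪x ω, v⟫| B) ^ 2 ∂μ
      - ∫ ω, weight σ (record γs x z g ε ω) γs * (min |⟪x ω, v⟫| B) ^ 2 ∂μ| ≤ ξ / (16 * M) := by
    obtain ⟨N', hN1, -, -, hi, hle⟩ := h.weight_diff_moment hσ hξ hK hH hC hW hκ' hκ he hun
    rw [← integral_sub hwi hwsi]
    refine (abs_integral_le_integral_abs).trans ?_
    have hstep : ∫ ω, |weight σ (record γs x z g ε ω) γ * (min |⟪x ω, v⟫| B) ^ 2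
        - weight σ (record γs x z g ε ω) γs * (min |⟪x ω, v⟫| B) ^ 2| ∂μ
        ≤ ∫ ω, 9 / 4 * (|weight σ (record γs x z g ε ω) γ - weight σ (record γs x z g ε ω) γs| *
        (1 + |(record γs x z g ε ω).1 - ⟪x ω, γs.2.1⟫| + |(record γs x z g ε ω).1 - ⟪x ω, γs.2.2⟫|)
        * N' ω) ∂μ := by
      refine integral_mono (hwi.sub hwsi).abs (hi.const_mul _) fun ω => ?_
      simp only
      rw [← sub_mul, abs_mul, abs_of_nonneg (sq_nonneg (min |⟪x ω, v⟫| B))]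
      set A₁ := |(record γs x z g ε ω).1 - ⟪x ω, γs.2.1⟫| with hA₁
      set A₂ := |(record γs x z g ε ω).1 - ⟪x ω, γs.2.2⟫| with hA₂
      have hA₁0 : 0 ≤ A₁ := abs_nonneg _
      have hA₂0 : 0 ≤ A₂ := abs_nonneg _
      have hN'0 : 0 ≤ N' ω := (sq_nonneg _).trans (hN1 ω)
      set W := |weight σ (record γs x z g ε ω) γ - weight σ (record γs x z g ε ω) γs|
      have hW0 : 0 ≤ W := abs_nonneg _
      calc W * (min |⟪x ω, v⟫| B) ^ 2 ≤ W * (9 / 4 * N' ω) := by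
            gcongr
            refine (trunc_sq_le_sq hB.le _).trans ?_
            rw [hiv]; linarith [hN1 ω]
        _ = 9 / 4 * (W * 1 * N' ω) := by ring
        _ ≤ 9 / 4 * (W * (1 + A₁ + A₂) * N' ω) := by
            gcongr; linarith
    refine hstep.trans ?_
    rw [integral_const_mul]
    calc 9 / 4 * _ ≤ 9 / 4 * (κ' * err2 γ γs) := by gcongr
      _ ≤ 9 / 4 * (ξ / (36 * M) * 1) := by
          have := err2_nonneg γ γs
          gcongr
      _ = ξ / (16 * M) := by field_simp; norm_num
  have hd := abs_le.1 hdiff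
  have hfin : ξ / (16 * M) + ξ / (16 * M) ≤ ξ * T := by
    calc ξ / (16 * M) + ξ / (16 * M) = ξ * (1 / (8 * M)) := by field_simp; norm_num
      _ ≤ _ := by gcongr
  fin_cases c
  · simp only [cweight, feat, Fin.zero_eta, Matrix.cons_val_zero]
    change _ ≤ ∫ ω, weight σ (record γs x z g ε ω) γ * (min |⟪x ω, v⟫| B) ^ 2 ∂μ
    linarith
  · simp only [cweight, feat, Fin.mk_one, Matrix.cons_val_one, Matrix.cons_val_zero]
    change _ ≤ ∫ ω, (1 - weight σ (record γs x z g ε ω) γ) * (min |⟪x ω, v⟫| B) ^ 2 ∂μ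
    simp_rw [sub_mul, one_mul]
    rw [integral_sub hTi hwi]
    linarith
  · simp only [cweight, feat, Fin.reduceFinMk, Matrix.cons_val, one_mul]
    change _ ≤ ∫ ω, (min |⟪z ω, v⟫| B) ^ 2 ∂μ
    refine le_trans ?_ hTz
    rw [div_le_div_iff₀ (by positivity) (by positivity)]
    nlinarith

/-- Exponential moment of squared feature coordinates. -/
lemma feat_exp_moment (h : IsSample μ γs σ ξ M K H κ x z g ε) (hK : 0 < K) (c : Fin 3)
    {v : Vec d} (hv : ‖v‖ ≤ 1) :
    Integrable (fun ω => Real.exp (|⟪feat c (record γs x z g ε ω), v⟫ ^ 2| / K)) μ ∧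
    ∫ ω, Real.exp (|⟪feat c (record γs x z g ε ω), v⟫ ^ 2| / K) ∂μ ≤ H := by
  have hi := h.integrable_env 0 0 0 v (by simp) (by simp) (by simp) hv
  have hH := h.integral_env 0 0 0 v (by simp) (by simp) (by simp) hv
  have hb : ∀ ω, Real.exp (|⟪feat c (record γs x z g ε ω), v⟫ ^ 2| / K)
      ≤ Real.exp (envelope x z ε 0 0 0 v ω / K) := by
    intro ω
    apply Real.exp_le_exp.2
    gcongr
    rw [abs_of_nonneg (sq_nonneg _)]
    unfold envelope
    simp only [inner_zero_right]
    have := sq_nonneg (ε ω)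
    have h1 := sq_nonneg ⟪x ω, v⟫
    have h2 := sq_nonneg ⟪z ω, v⟫
    fin_cases c
    · change ⟪x ω, v⟫ ^ 2 ≤ _; linarith
    · change ⟪x ω, v⟫ ^ 2 ≤ _; linarith
    · change ⟪z ω, v⟫ ^ 2 ≤ _; linarith
  have hm : Measurable fun ω => ⟪feat c (record γs x z g ε ω), v⟫ :=
    (Measurable.comp (g := fun o => feat c o) (f := record γs x z g ε)
      (measurable_feat c) h.measurable_record).inner measurable_const
  have hintg : Integrable (fun ω => Real.exp (|⟪feat c (record γs x z g ε ω), v⟫ ^ 2| / K)) μ := by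
    refine hi.mono' (((hm.pow_const 2).abs.div_const K).exp).aestronglyMeasurable
      (Filter.Eventually.of_forall fun ω => ?_)
    rw [Real.norm_of_nonneg (Real.exp_pos _).le]
    exact hb ω
  exact ⟨hintg, (integral_mono hintg hi hb).trans hH⟩

end IsSample

/-! ### One EM iteration on a batch -/

/-- The three components of a parameter, in the order of the regressions. -/
def comp {d : ℕ} (γ : Param d) (c : Fin 3) : Vec d := ![γ.2.1, γ.2.2, γ.1] c

/-- The favourable event for one iteration on the batch `I`: the centered scores are controlled
along signed sums of `m` coordinates, the columns of the design are bounded, and the design has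
curvature along the normalized signed sums of `k` coordinates. -/
structure BatchGood {d : ℕ} (σ : ℝ) (γs γ : Param d) (I : Finset ℕ) (o : ℕ → Obs d)
    (mean : ℕ → Fin 3 → Vec d) (m k : ℕ) (lam ρ B Ccol ccurv : ℝ) : Prop where
  noise : ∀ (c : Fin 3) (φ : Fin m → Fin d × Bool),
    ∑ i ∈ I, ⟪score σ γs c γ (o i) - mean i c, dirVec φ⟫
      ≤ I.card * (‖dirVec φ‖ * (√m * lam / 2))
  column : ∀ (c : Fin 3) (j : Fin d), ∑ i ∈ I, (feat c (o i) j) ^ 2 ≤ Ccol * I.card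
  curvature : ∀ (c : Fin 3) (φ : Fin k → Fin d × Bool), 1 / 2 ≤ ‖(ρ / k) • dirVec φ‖ →
    ‖(ρ / k) • dirVec φ‖ ≤ 3 / 2 →
    ccurv * I.card ≤ ∑ i ∈ I, cweight σ c γ (o i) *
      (min |⟪feat c (o i), (ρ / k) • dirVec φ⟫| B) ^ 2

/-- The lower bound for the curvature of the losses. -/
def lossCurv (σ ξ : ℝ) : ℝ := min (1 / (2 * σ ^ 2)) (ξ ^ 2 / 8)

lemma lossCurv_pos {σ ξ : ℝ} (hσ : 0 < σ) (hξ : 0 < ξ) : 0 < lossCurv σ ξ :=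
  lt_min (by positivity) (by positivity)

/-- The basic inequality of a weighted least squares step. -/
lemma least_squares_basic {d : ℕ} {I : Finset ℕ} (hI : 0 < I.card) {σ lam : ℝ} (hσ : 0 < σ)
    (w : ℕ → ℝ) (y : ℕ → ℝ) (x : ℕ → Vec d) {βs β : Vec d}
    (hmin : -(-(1 / (2 * (I.card : ℝ))) * ∑ i ∈ I, w i * ((y i - ⟪x i, β⟫) ^ 2 / σ ^ 2)) + lam * l1 β
      ≤ -(-(1 / (2 * (I.card : ℝ))) * ∑ i ∈ I, w i * ((y i - ⟪x i, βs⟫) ^ 2 / σ ^ 2))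
        + lam * l1 βs) :
    1 / (2 * σ ^ 2) * ∑ i ∈ I, w i * ⟪x i, β - βs⟫ ^ 2
      ≤ ∑ i ∈ I, w i * (y i - ⟪x i, βs⟫) / σ ^ 2 * ⟪x i, β - βs⟫
        + I.card * (lam * (l1 βs - l1 β)) := by
  have hn : (0 : ℝ) < I.card := by exact_mod_cast hI
  have e : ∀ i, w i * ((y i - ⟪x i, β⟫) ^ 2 / σ ^ 2) = w i * ((y i - ⟪x i, βs⟫) ^ 2 / σ ^ 2)
      + 2 * (1 / (2 * σ ^ 2) * (w i * ⟪x i, β - βs⟫ ^ 2)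
        - w i * (y i - ⟪x i, βs⟫) / σ ^ 2 * ⟪x i, β - βs⟫) := by
    intro i
    rw [inner_sub_right]
    field_simp
    ring
  simp_rw [e] at hmin
  rw [Finset.sum_add_distrib, ← Finset.mul_sum, Finset.sum_sub_distrib, ← Finset.mul_sum] at hmin
  set P := ∑ i ∈ I, w i * ((y i - ⟪x i, βs⟫) ^ 2 / σ ^ 2)
  set A := 1 / (2 * σ ^ 2) * ∑ i ∈ I, w i * ⟪x i, β - βs⟫ ^ 2
  set G := ∑ i ∈ I, w i * (y i - ⟪x i, βs⟫) / σ ^ 2 * ⟪x i, β - βs⟫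
  have h2 := mul_le_mul_of_nonneg_left hmin hn.le
  have e2 : (I.card : ℝ) * (-(-(1 / (2 * (I.card : ℝ))) * (P + 2 * (A - G))) + lam * l1 β)
      = P / 2 + (A - G) + I.card * (lam * l1 β) := by field_simp
  have e3 : (I.card : ℝ) * (-(-(1 / (2 * (I.card : ℝ))) * P) + lam * l1 βs)
      = P / 2 + I.card * (lam * l1 βs) := by field_simp
  rw [e2, e3] at h2
  linarith

/-- The basic inequality of the penalized steps of an EM iteration. -/
lemma basic_inequality {d : ℕ} {I : Finset ℕ} (hI : 0 < I.card) {σ ξ lam : ℝ} (hσ : 0 < σ)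
    (hξ : 0 < ξ) {o : ℕ → Obs d} {γs γ γ' : Param d} (hstep : IsEMStep σ lam I o γ γ')
    (hz : ∀ i ∈ I, ξ < Real.sigmoid ⟪(o i).2.2, γs.1⟫ ∧ Real.sigmoid ⟪(o i).2.2, γs.1⟫ < 1 - ξ)
    (c : Fin 3) :
    lossCurv σ ξ * ∑ i ∈ I, cweight σ c γ (o i) * hub ⟪feat c (o i), comp γ' c - comp γs c⟫
      ≤ ∑ i ∈ I, ⟪score σ γs c γ (o i), comp γ' c - comp γs c⟫
        + I.card * (lam * (l1 (comp γs c) - l1 (comp γ' c))) := by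
  have hn : (0 : ℝ) < I.card := by exact_mod_cast hI
  have hw0 : ∀ c i, 0 ≤ cweight σ c γ (o i) := fun c i => (cweight_mem hσ c γ (o i)).1
  have hsum : ∀ (c : Fin 3) (v : Vec d),
      lossCurv σ ξ * ∑ i ∈ I, cweight σ c γ (o i) * hub ⟪feat c (o i), v⟫
      ≤ 1 / (2 * σ ^ 2) * ∑ i ∈ I, cweight σ c γ (o i) * ⟪feat c (o i), v⟫ ^ 2 := by
    intro c v
    have hnn : 0 ≤ ∑ i ∈ I, cweight σ c γ (o i) * hub ⟪feat c (o i), v⟫ :=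
      Finset.sum_nonneg fun i _ => mul_nonneg (hw0 c i) (hub_nonneg _)
    refine mul_le_mul (min_le_left _ _) ?_ hnn (by positivity)
    exact Finset.sum_le_sum fun i _ => mul_le_mul_of_nonneg_left (hub_le_sq _) (hw0 c i)
  fin_cases c
  · refine (hsum 0 _).trans ?_
    have h1 := hstep.β₁ (Set.mem_univ γs.2.1)
    have h2 := least_squares_basic hI hσ (fun i => weight σ (o i) γ) (fun i => (o i).1)
      (fun i => (o i).2.1) h1
    simpa [cweight, feat, score, resid, comp, real_inner_smul_left] using h2
  · refine (hsum 1 _).trans ?_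
    have h1 := hstep.β₂ (Set.mem_univ γs.2.2)
    have h2 := least_squares_basic hI hσ (fun i => 1 - weight σ (o i) γ) (fun i => (o i).1)
      (fun i => (o i).2.1) h1
    simpa [cweight, feat, score, resid, comp, real_inner_smul_left] using h2
  · have h1 := hstep.θ (Set.mem_univ γs.1)
    simp only [Q3] at h1
    change lossCurv σ ξ * ∑ i ∈ I, (1 : ℝ) * hub ⟪(o i).2.2, γ'.1 - γs.1⟫
      ≤ ∑ i ∈ I, ⟪score σ γs 2 γ (o i), γ'.1 - γs.1⟫ + I.card * (lam * (l1 γs.1 - l1 γ'.1))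
    set Lf : Vec d → ℝ := fun θ => ∑ i ∈ I, (weight σ (o i) γ * Real.log (Real.sigmoid ⟪(o i).2.2, θ⟫) +
      (1 - weight σ (o i) γ) * Real.log (1 - Real.sigmoid ⟪(o i).2.2, θ⟫)) with hLf
    have h3 : I.card * (-(1 / (I.card : ℝ) * Lf γ'.1) + lam * l1 γ'.1)
        ≤ I.card * (-(1 / (I.card : ℝ) * Lf γs.1) + lam * l1 γs.1) :=
      mul_le_mul_of_nonneg_left h1 hn.le
    have e2 : ∀ a b : ℝ, (I.card : ℝ) * (-(1 / (I.card : ℝ) * a) + b) = -a + I.card * b := by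
      intro a b; field_simp
    rw [e2, e2] at h3
    have h4 : ∑ i ∈ I, (ξ ^ 2 / 8 * hub ⟪(o i).2.2, γ'.1 - γs.1⟫
        - ⟪score σ γs 2 γ (o i), γ'.1 - γs.1⟫) ≤ -Lf γ'.1 + Lf γs.1 := by
      rw [hLf]
      simp only
      rw [← Finset.sum_neg_distrib, ← Finset.sum_add_distrib]
      refine Finset.sum_le_sum fun i hi => ?_
      have h5 := logistic_excess (b := ⟪(o i).2.2, γ'.1 - γs.1⟫) (w := weight σ (o i) γ) hξ
        (hz i hi).1 (hz i hi).2
      have e3 : ⟪(o i).2.2, γs.1⟫ + ⟪(o i).2.2, γ'.1 - γs.1⟫ = ⟪(o i).2.2, γ'.1⟫ := by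
        rw [inner_sub_right]; ring
      rw [e3] at h5
      have e4 : ⟪score σ γs 2 γ (o i), γ'.1 - γs.1⟫
          = (weight σ (o i) γ - Real.sigmoid ⟪(o i).2.2, γs.1⟫) * ⟪(o i).2.2, γ'.1 - γs.1⟫ := by
        simp [score, resid, feat, real_inner_smul_left]
      rw [e4]; exact h5
    rw [Finset.sum_sub_distrib, ← Finset.mul_sum] at h4
    have h6 : lossCurv σ ξ * ∑ i ∈ I, (1 : ℝ) * hub ⟪(o i).2.2, γ'.1 - γs.1⟫
        ≤ ξ ^ 2 / 8 * ∑ i ∈ I, hub ⟪(o i).2.2, γ'.1 - γs.1⟫ := by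
      simp_rw [one_mul]
      exact mul_le_mul_of_nonneg_right (min_le_right _ _)
        (Finset.sum_nonneg fun i _ => hub_nonneg _)
    linarith

/-- On the favourable event an EM iteration contracts up to the statistical error. -/
lemma em_step_error {d s m k : ℕ} (hd : 0 < d) (hm : 0 < m) (hk : 0 < k) {I : Finset ℕ}
    (hI : 0 < I.card) {σ ξ lam η ρ B Ccol ccurv : ℝ} (hσ : 0 < σ) (hξ : 0 < ξ) (hlam : 0 < lam)
    (hη : 0 ≤ η) (hρ0 : 0 < ρ) (hB : 1 ≤ B) (hCcol : 0 ≤ Ccol) (hccurv : 0 < ccurv)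
    {o : ℕ → Obs d} {γs γ γ' : Param d} (hstep : IsEMStep σ lam I o γ γ')
    (hz : ∀ i ∈ I, ξ < Real.sigmoid ⟪(o i).2.2, γs.1⟫ ∧ Real.sigmoid ⟪(o i).2.2, γs.1⟫ < 1 - ξ)
    {mean : ℕ → Fin 3 → Vec d} (hgood : BatchGood σ γs γ I o mean m k lam ρ B Ccol ccurv)
    (hmean : ∀ i ∈ I, ∀ c u, ⟪mean i c, u⟫ ≤ η * ‖u‖)
    (hs : ∀ c, l0 (comp γs c) ≤ s)
    (hk1 : ρ ^ 2 * (Ccol + 1) / k ≤ 1 / 4) (hk2 : ρ ^ 2 * (Ccol + 1) / k ≤ ccurv / 4)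
    (hρ : 4 * √s + m + 2 * η / lam ≤ ρ)
    (hsmall : 2 * lam * √s + m * lam / 2 + η < lossCurv σ ξ * (ccurv / (4 * B))) :
    err2 γ' γs ≤ 3 * ((2 * lam * √s + m * lam / 2 + η) / (lossCurv σ ξ * (ccurv / (4 * B)))) ∧
      err1 γ' γs ≤ ρ * err2 γ' γs := by
  have hn : (0 : ℝ) < I.card := by exact_mod_cast hI
  have hc0 := lossCurv_pos hσ hξ
  have hB0 : 0 < B := by linarith
  have key : ∀ c, ‖comp γ' c - comp γs c‖
      ≤ (2 * lam * √s + m * lam / 2 + η) / (lossCurv σ ξ * (ccurv / (4 * B))) ∧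
      l1 (comp γ' c - comp γs c) ≤ ρ * ‖comp γ' c - comp γs c‖ := by
    intro c
    have hb := basic_inequality hI hσ hξ hstep hz c
    set v := comp γ' c - comp γs c with hv
    have hadd : comp γs c + v = comp γ' c := by rw [hv]; abel
    set curv : Vec d → ℝ := fun v =>
      lossCurv σ ξ * (∑ i ∈ I, cweight σ c γ (o i) * hub ⟪feat c (o i), v⟫) / I.card with hcurv
    refine penalized_error (curv := curv) (score := fun i => score σ γs c γ (o i))
      (mean := fun i => mean i c) hm hI (hs c) hlam hη (by positivity) ?_ (hgood.noise c)
      (fun i hi u => hmean i hi c u) ?_ ?_ hρ hsmall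
    · rw [hadd, hcurv]
      simp only
      rw [mul_div_cancel₀ _ hn.ne']
      exact hb
    · rw [hcurv]
      have : 0 ≤ ∑ i ∈ I, cweight σ c γ (o i) * hub ⟪feat c (o i), v⟫ :=
        Finset.sum_nonneg fun i _ => mul_nonneg (cweight_mem hσ c γ (o i)).1 (hub_nonneg _)
      simp only
      positivity
    · intro hcone
      have h1 := restricted_curvature hd hk (fun i => feat c (o i)) (fun i => cweight σ c γ (o i))
        (fun i => cweight_mem hσ c γ (o i)) hB hCcol hρ0 (hgood.column c) hk1 hk2
        (hgood.curvature c) hcone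
      rw [hcurv]
      simp only
      rw [le_div_iff₀ hn]
      calc lossCurv σ ξ * (ccurv / (4 * B)) * min (‖v‖ ^ 2) ‖v‖ * I.card
          = lossCurv σ ξ * (ccurv / (4 * B) * min (‖v‖ ^ 2) ‖v‖ * I.card) := by ring
        _ ≤ _ := mul_le_mul_of_nonneg_left h1 hc0.le
  have k0 := key 0
  have k1 := key 1
  have k2 := key 2
  simp only [comp, Matrix.cons_val_zero, Matrix.cons_val_one, Matrix.cons_val] at k0 k1 k2
  unfold err2 err1
  constructor
  · linarith [k0.1, k1.1, k2.1]
  · linarith [k0.2, k1.2, k2.2]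

/-! ### Probability of the favourable event -/

lemma card_dir (d m : ℕ) : (Fintype.card (Fin m → Fin d × Bool) : ℝ) = (2 * d : ℝ) ^ m := by
  simp [Fintype.card_prod, mul_comm]

lemma measureReal_iUnion_le_card {Ω ι : Type*} [MeasurableSpace Ω] {μ : Measure Ω}
    [IsFiniteMeasure μ] [Fintype ι] {f : ι → Set Ω} {p : ℝ} (h : ∀ i, μ.real (f i) ≤ p) :
    μ.real (⋃ i, f i) ≤ Fintype.card ι * p := by
  refine (measureReal_iUnion_fintype_le f).trans ?_
  calc ∑ i, μ.real (f i) ≤ ∑ _i : ι, p := Finset.sum_le_sum fun i _ => h i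
    _ = _ := by simp

section Batch

variable {Ω : Type*} [MeasurableSpace Ω] {μ : Measure Ω} [IsProbabilityMeasure μ] {d : ℕ}
  {γs : Param d} {σ ξ M K H κ : ℝ} {x z : ℕ → Ω → Vec d} {g : ℕ → Ω → Fin 2} {ε : ℕ → Ω → ℝ}
  {I : Finset ℕ}

lemma noise_tail (hS : ∀ i ∈ I, IsSample μ γs σ ξ M K H κ (x i) (z i) (g i) (ε i))
    (hrm : ∀ i, Measurable (record γs (x i) (z i) (g i) (ε i)))
    (hind : iIndepFun (fun i => record γs (x i) (z i) (g i) (ε i)) μ)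
    (hσ : 0 < σ) (hξ : 0 < ξ) (hK : 0 < K) (hH : 0 < H) {C : ℝ} (hC : 1 ≤ C)
    (hW : WeightBound σ (Real.log (1 / ξ)) C) {γ : Param d} (he : err2 γ γs ≤ 1) {r : ℝ}
    (hr : 0 ≤ r) (hr' : r ≤ 8 * H * ((3 * C / σ ^ 2 + 1) * K)) (c : Fin 3) (V : Vec d) :
    μ.real {ω | I.card * (‖V‖ * r) < ∑ i ∈ I, ⟪score σ γs c γ (record γs (x i) (z i) (g i) (ε i) ω)
        - ∫ ω', score σ γs c γ (record γs (x i) (z i) (g i) (ε i) ω') ∂μ, V⟫}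
      ≤ Real.exp (-(I.card * r ^ 2 / (32 * H * ((3 * C / σ ^ 2 + 1) * K) ^ 2))) := by
  rcases eq_or_ne V 0 with rfl | hV
  · simp [Real.exp_nonneg]
  have hV0 : 0 < ‖V‖ := norm_pos_iff.2 hV
  set v : Vec d := ‖V‖⁻¹ • V with hv
  have hv1 : ‖v‖ ≤ 1 := by rw [hv, norm_smul, norm_inv, norm_norm, inv_mul_cancel₀ hV0.ne']
  set X : ℕ → Ω → ℝ := fun i ω => ⟪score σ γs c γ (record γs (x i) (z i) (g i) (ε i) ω), v⟫ with hX
  have hfm : Measurable fun o : Obs d => ⟪score σ γs c γ o, v⟫ :=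
    (measurable_score_right σ γs c γ).inner measurable_const
  have hXind : iIndepFun X μ := hind.comp (fun _ o => ⟪score σ γs c γ o, v⟫) fun _ => hfm
  have hXm : ∀ i, Measurable (X i) := fun i => hfm.comp (hrm i)
  have hb := bernstein hXind hXm (K := (3 * C / σ ^ 2 + 1) * K) (H := H) (by positivity) hH I
    (fun i hi => ((hS i hi).score_exp_moment hσ hξ hK hC hW he hv1 c).1)
    (fun i hi => ((hS i hi).score_exp_moment hσ hξ hK hC hW he hv1 c).2) hr hr'
  refine le_trans (measureReal_mono ?_) hb
  intro ω hω
  rw [Set.mem_ofPred_eq] at hω ⊢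
  have e : ∑ i ∈ I, ⟪score σ γs c γ (record γs (x i) (z i) (g i) (ε i) ω)
        - ∫ ω', score σ γs c γ (record γs (x i) (z i) (g i) (ε i) ω') ∂μ, V⟫
      = ‖V‖ * ∑ i ∈ I, (X i ω - ∫ ω', X i ω' ∂μ) := by
    rw [Finset.mul_sum]
    refine Finset.sum_congr rfl fun i hi => ?_
    have hVv : V = ‖V‖ • v := by rw [hv, smul_smul, mul_inv_cancel₀ hV0.ne', one_smul]
    have hintg := (hS i hi).integrable_score hσ hξ hK hC hW he c
    have e2 : ∫ ω', X i ω' ∂μ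
        = ⟪∫ ω', score σ γs c γ (record γs (x i) (z i) (g i) (ε i) ω') ∂μ, v⟫ := by
      rw [real_inner_comm, ← integral_inner hintg]
      refine integral_congr_ae (Filter.Eventually.of_forall fun ω' => ?_)
      exact real_inner_comm _ _
    rw [e2, hX]
    simp only
    rw [← inner_sub_left]
    conv_lhs => rw [hVv]
    rw [real_inner_smul_right]
  rw [e] at hω
  have h2 : ‖V‖ * (I.card * r) < ‖V‖ * ∑ i ∈ I, (X i ω - ∫ ω', X i ω' ∂μ) := by linarith
  exact (lt_of_mul_lt_mul_left h2 hV0.le).le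

lemma column_tail (hS : ∀ i ∈ I, IsSample μ γs σ ξ M K H κ (x i) (z i) (g i) (ε i))
    (hrm : ∀ i, Measurable (record γs (x i) (z i) (g i) (ε i)))
    (hind : iIndepFun (fun i => record γs (x i) (z i) (g i) (ε i)) μ)
    (hK : 0 < K) (hH : 0 < H) (c : Fin 3) (j : Fin d) :
    μ.real {ω | 9 * H * K * I.card <
        ∑ i ∈ I, (feat c (record γs (x i) (z i) (g i) (ε i) ω) j) ^ 2}
      ≤ Real.exp (-(2 * H * I.card)) := by
  set v : Vec d := EuclideanSpace.single j 1 with hv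
  have hv1 : ‖v‖ ≤ 1 := by simp [hv]
  set X : ℕ → Ω → ℝ := fun i ω => ⟪feat c (record γs (x i) (z i) (g i) (ε i) ω), v⟫ ^ 2 with hX
  have hfm : Measurable fun o : Obs d => ⟪feat c o, v⟫ ^ 2 :=
    ((measurable_feat c).inner measurable_const).pow_const 2
  have hXind : iIndepFun X μ := hind.comp (fun _ o => ⟪feat c o, v⟫ ^ 2) fun _ => hfm
  have hXm : ∀ i, Measurable (X i) := fun i => hfm.comp (hrm i)
  have hb := bernstein hXind hXm hK hH I
    (fun i hi => ((hS i hi).feat_exp_moment hK c hv1).1)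
    (fun i hi => ((hS i hi).feat_exp_moment hK c hv1).2) (r := 8 * H * K) (by positivity) le_rfl
  have hmean : ∀ i ∈ I, ∫ ω, X i ω ∂μ ≤ H * K := by
    intro i hi
    obtain ⟨h1, h2⟩ := (hS i hi).feat_exp_moment hK c hv1
    have h3 := (moment_of_exp_moment (hXm i).abs (fun ω => abs_nonneg _) hK h1 h2 1).2
    have h4 : ∀ ω, |X i ω| ^ 1 = X i ω := fun ω => by
      rw [pow_one, abs_of_nonneg]; exact sq_nonneg _
    simp only [h4] at h3
    simpa [mul_comm] using h3
  refine (measureReal_mono ?_).trans (hb.trans (le_of_eq ?_))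
  · intro ω hω
    rw [Set.mem_ofPred_eq] at hω ⊢
    have e : ∀ i, (feat c (record γs (x i) (z i) (g i) (ε i) ω) j) ^ 2 = X i ω := by
      intro i; simp [hX, hv, EuclideanSpace.inner_single_right]
    simp_rw [e] at hω
    rw [Finset.sum_sub_distrib]
    have : ∑ i ∈ I, ∫ ω, X i ω ∂μ ≤ I.card * (H * K) := by
      calc _ ≤ ∑ _i ∈ I, H * K := Finset.sum_le_sum hmean
        _ = _ := by simp
    linarith
  · congr 1; field_simp; ring

lemma curvature_tail (hS : ∀ i ∈ I, IsSample μ γs σ ξ M K H κ (x i) (z i) (g i) (ε i))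
    (hrm : ∀ i, Measurable (record γs (x i) (z i) (g i) (ε i)))
    (hind : iIndepFun (fun i => record γs (x i) (z i) (g i) (ε i)) μ)
    (hσ : 0 < σ) (hξ : 0 < ξ) (hξ1 : ξ < 1 / 2) (hM : 1 < M) (hK : 0 < K) (hH : 0 < H) {C : ℝ}
    (hC : 1 ≤ C) (hW : WeightBound σ (Real.log (1 / ξ)) C) {κ' : ℝ} (hκ' : 0 < κ')
    (hκM : κ' ≤ ξ / (36 * M)) (hκ : κ ≤ κ' ^ 2 / ((9375 * C) ^ 2 * envMoment K H)) {B : ℝ}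
    (hB : 1 ≤ B) (hBm : 48 * M * (2 * K ^ 2 * H) ≤ B ^ 2)
    {γ : Param d} (he : err2 γ γs ≤ 1) (c : Fin 3) {v : Vec d} (hv1 : 1 / 2 ≤ ‖v‖)
    (hv2 : ‖v‖ ≤ 3 / 2) :
    μ.real {ω | ∑ i ∈ I, cweight σ c γ (record γs (x i) (z i) (g i) (ε i) ω) *
        (min |⟪feat c (record γs (x i) (z i) (g i) (ε i) ω), v⟫| B) ^ 2
        < ξ / (32 * M) * I.card}
      ≤ Real.exp (-(I.card * (ξ / (32 * M)) ^ 2 / (96 * B ^ 4))) := by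
  have hB0 : 0 < B := by linarith
  have hM0 : 0 < M := by linarith
  set F : Obs d → ℝ := fun o => cweight σ c γ o * (min |⟪feat c o, v⟫| B) ^ 2 with hF
  have hcw : Measurable fun o : Obs d => cweight σ c γ o :=
    Measurable.comp (g := fun p : Param d × Obs d => cweight σ c p.1 p.2) (f := fun o => (γ, o))
      (measurable_cweight σ c) measurable_prodMk_left
  have hFm : Measurable F :=
    hcw.mul (measurable_trunc ((measurable_feat c).inner measurable_const) B)
  have hF0 : ∀ o, 0 ≤ F o := fun o => mul_nonneg (cweight_mem hσ c γ o).1 (sq_nonneg _)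
  have hFB : ∀ o, F o ≤ B ^ 2 := fun o => by
    calc F o ≤ 1 * B ^ 2 := mul_le_mul (cweight_mem hσ c γ o).2 (trunc_sq_le hB0.le _)
          (sq_nonneg _) zero_le_one
      _ = B ^ 2 := one_mul _
  set X : ℕ → Ω → ℝ := fun i ω => -F (record γs (x i) (z i) (g i) (ε i) ω) with hX
  have hXind : iIndepFun X μ := hind.comp (fun _ o => -F o) fun _ => hFm.neg
  have hXm : ∀ i, Measurable (X i) := fun i => hFm.neg.comp (hrm i)
  have hXe : ∀ i ω, Real.exp (|X i ω| / B ^ 2) ≤ 3 := by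
    intro i ω
    have h1 : |X i ω| / B ^ 2 ≤ 1 := by
      rw [div_le_one (by positivity), hX]
      simp only [abs_neg]
      rw [abs_of_nonneg (hF0 _)]
      exact hFB _
    exact (Real.exp_le_exp.2 h1).trans Real.exp_one_lt_three.le
  have hXi : ∀ i, Integrable (fun ω => Real.exp (|X i ω| / B ^ 2)) μ := by
    intro i
    refine Integrable.of_bound (((hXm i).abs.div_const _).exp).aestronglyMeasurable 3
      (Filter.Eventually.of_forall fun ω => ?_)
    rw [Real.norm_of_nonneg (Real.exp_pos _).le]
    exact hXe i ω
  have hr : ξ / (32 * M) ≤ 8 * 3 * B ^ 2 := by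
    rw [div_le_iff₀ (by positivity)]
    nlinarith [sq_nonneg B]
  have hb := bernstein hXind hXm (K := B ^ 2) (H := 3) (by positivity) (by norm_num) I
    (fun i _ => hXi i)
    (fun i _ => by
      calc ∫ ω, Real.exp (|X i ω| / B ^ 2) ∂μ ≤ ∫ _, (3 : ℝ) ∂μ :=
            integral_mono (hXi i) (integrable_const _) (hXe i)
        _ = 3 := by simp) (r := ξ / (32 * M)) (by positivity) hr
  refine (measureReal_mono ?_).trans (hb.trans (le_of_eq ?_))
  · intro ω hω
    rw [Set.mem_ofPred_eq] at hω ⊢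
    rw [Finset.sum_sub_distrib]
    have h1 : ∑ i ∈ I, X i ω = -∑ i ∈ I, F (record γs (x i) (z i) (g i) (ε i) ω) := by
      rw [← Finset.sum_neg_distrib]
    have h2 : ∑ i ∈ I, ∫ ω, X i ω ∂μ ≤ -(I.card * (ξ / (16 * M))) := by
      calc _ ≤ ∑ _i ∈ I, -(ξ / (16 * M)) := Finset.sum_le_sum fun i hi => by
            rw [hX]; simp only
            rw [integral_neg, neg_le_neg_iff]
            exact (hS i hi).curvature hσ hξ hξ1 hM0 hK hH hC hW hκ' hκM hκ hB0 hBm he c hv1 hv2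
        _ = _ := by simp
    have h3 : ξ / (16 * M) = ξ / (32 * M) + ξ / (32 * M) := by field_simp; norm_num
    rw [h1]
    rw [h3] at h2
    change ∑ i ∈ I, F (record γs (x i) (z i) (g i) (ε i) ω) < _ at hω
    linarith
  · congr 1; field_simp; ring

end Batch

section BatchProbability

variable {Ω : Type*} [MeasurableSpace Ω] {μ : Measure Ω} [IsProbabilityMeasure μ] {d : ℕ}
  {γs : Param d} {σ ξ M K H κ : ℝ} {x z : ℕ → Ω → Vec d} {g : ℕ → Ω → Fin 2} {ε : ℕ → Ω → ℝ}
  {I : Finset ℕ}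

/-- The favourable event has high probability if the records are independent samples. -/
lemma batchGood_probability
    (hS : ∀ i ∈ I, IsSample μ γs σ ξ M K H κ (x i) (z i) (g i) (ε i))
    (hrm : ∀ i, Measurable (record γs (x i) (z i) (g i) (ε i)))
    (hind : iIndepFun (fun i => record γs (x i) (z i) (g i) (ε i)) μ)
    (hσ : 0 < σ) (hξ : 0 < ξ) (hξ1 : ξ < 1 / 2) (hM : 1 < M) (hK : 0 < K) (hH : 0 < H) {C : ℝ}
    (hC : 1 ≤ C) (hW : WeightBound σ (Real.log (1 / ξ)) C) {κ' : ℝ} (hκ' : 0 < κ')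
    (hκM : κ' ≤ ξ / (36 * M)) (hκ : κ ≤ κ' ^ 2 / ((9375 * C) ^ 2 * envMoment K H)) {B : ℝ}
    (hB : 1 ≤ B) (hBm : 48 * M * (2 * K ^ 2 * H) ≤ B ^ 2)
    {γ : Param d} (he : err2 γ γs ≤ 1) (m k : ℕ) (ρ : ℝ) {lam : ℝ} (hlam : 0 ≤ lam)
    (hr : √m * lam / 2 ≤ 8 * H * ((3 * C / σ ^ 2 + 1) * K)) :
    μ.real {ω | ¬ BatchGood σ γs γ I (fun i => record γs (x i) (z i) (g i) (ε i) ω)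
        (fun i c => ∫ ω', score σ γs c γ (record γs (x i) (z i) (g i) (ε i) ω') ∂μ)
        m k lam ρ B (9 * H * K) (ξ / (32 * M))}
      ≤ 3 * ((2 * d) ^ m * Real.exp (-(I.card * (√m * lam / 2) ^ 2 /
            (32 * H * ((3 * C / σ ^ 2 + 1) * K) ^ 2)))
          + d * Real.exp (-(2 * H * I.card))
          + (2 * d) ^ k * Real.exp (-(I.card * (ξ / (32 * M)) ^ 2 / (96 * B ^ 4)))) := by
  set o : ℕ → Ω → Obs d := fun i ω => record γs (x i) (z i) (g i) (ε i) ω with ho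
  set E₁ : Fin 3 → (Fin m → Fin d × Bool) → Set Ω := fun c φ =>
    {ω | I.card * (‖dirVec φ‖ * (√m * lam / 2)) <
      ∑ i ∈ I, ⟪score σ γs c γ (o i ω) - ∫ ω', score σ γs c γ (o i ω') ∂μ, dirVec φ⟫} with hE₁
  set E₂ : Fin 3 → Fin d → Set Ω := fun c j =>
    {ω | 9 * H * K * I.card < ∑ i ∈ I, (feat c (o i ω) j) ^ 2} with hE₂
  set E₃ : Fin 3 → (Fin k → Fin d × Bool) → Set Ω := fun c φ =>
    {ω | (1 / 2 ≤ ‖(ρ / k) • dirVec φ‖ ∧ ‖(ρ / k) • dirVec φ‖ ≤ 3 / 2) ∧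
      ∑ i ∈ I, cweight σ c γ (o i ω) * (min |⟪feat c (o i ω), (ρ / k) • dirVec φ⟫| B) ^ 2
        < ξ / (32 * M) * I.card} with hE₃
  have h1 : ∀ c, μ.real (⋃ φ, E₁ c φ) ≤ (2 * d) ^ m * Real.exp (-(I.card * (√m * lam / 2) ^ 2 /
      (32 * H * ((3 * C / σ ^ 2 + 1) * K) ^ 2))) := fun c => by
    have := measureReal_iUnion_le_card (μ := μ) (f := E₁ c) fun φ =>
      noise_tail hS hrm hind hσ hξ hK hH hC hW he (by positivity) hr c (dirVec φ)
    rwa [card_dir] at this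
  have h2 : ∀ c, μ.real (⋃ j, E₂ c j) ≤ d * Real.exp (-(2 * H * I.card)) := fun c => by
    have := measureReal_iUnion_le_card (μ := μ) (f := E₂ c) fun j =>
      column_tail hS hrm hind hK hH c j
    rwa [Fintype.card_fin] at this
  have h3 : ∀ c, μ.real (⋃ φ, E₃ c φ)
      ≤ (2 * d) ^ k * Real.exp (-(I.card * (ξ / (32 * M)) ^ 2 / (96 * B ^ 4))) := fun c => by
    have := measureReal_iUnion_le_card (μ := μ) (f := E₃ c) (p :=
      Real.exp (-(I.card * (ξ / (32 * M)) ^ 2 / (96 * B ^ 4)))) fun φ => by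
        by_cases hφ : 1 / 2 ≤ ‖(ρ / k) • dirVec φ‖ ∧ ‖(ρ / k) • dirVec φ‖ ≤ 3 / 2
        · refine (measureReal_mono fun ω hω => ?_).trans
            (curvature_tail hS hrm hind hσ hξ hξ1 hM hK hH hC hW hκ' hκM hκ hB hBm he c hφ.1 hφ.2)
          exact hω.2
        · have : E₃ c φ = ∅ := by
            ext ω; simp only [hE₃, Set.mem_ofPred_eq, Set.mem_empty_iff_false, iff_false]
            exact fun h => hφ h.1
          rw [this]; simp [Real.exp_nonneg]
    rwa [card_dir] at this
  have hsub : {ω | ¬ BatchGood σ γs γ I (fun i => o i ω)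
        (fun i c => ∫ ω', score σ γs c γ (o i ω') ∂μ)
        m k lam ρ B (9 * H * K) (ξ / (32 * M))}
      ⊆ ⋃ c, ((⋃ φ, E₁ c φ) ∪ (⋃ j, E₂ c j)) ∪ (⋃ φ, E₃ c φ) := by
    intro ω hω
    by_contra hno
    simp only [Set.mem_iUnion, Set.mem_union, not_exists, not_or] at hno
    refine hω ⟨fun c φ => ?_, fun c j => ?_, fun c φ ha hb => ?_⟩
    · exact not_lt.1 ((hno c).1.1 φ)
    · exact not_lt.1 ((hno c).1.2 j)
    · exact not_lt.1 fun h => (hno c).2 φ ⟨⟨ha, hb⟩, h⟩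
  refine (measureReal_mono hsub).trans ?_
  have h4 := measureReal_iUnion_le_card (μ := μ)
    (f := fun c : Fin 3 => ((⋃ φ, E₁ c φ) ∪ (⋃ j, E₂ c j)) ∪ (⋃ φ, E₃ c φ)) fun c =>
      (measureReal_union_le _ _).trans (add_le_add ((measureReal_union_le _ _).trans
        (add_le_add (h1 c) (h2 c))) (h3 c))
  simpa using h4

end BatchProbability

/-! ### Conditional group probabilities and Bayes' rule -/

section Mixture

variable {Ω 𝒲 : Type*} [MeasurableSpace Ω] [MeasurableSpace 𝒲] {μ : Measure Ω}
  [IsProbabilityMeasure μ]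

lemma restrict_map_eq_withDensity {W : Ω → 𝒲} (hW : Measurable W) {G : Set Ω}
    {p : 𝒲 → ℝ} (hp : Measurable p) (hp0 : ∀ w, 0 ≤ p w) (hp1 : ∀ w, p w ≤ 1)
    (h : ∀ A, MeasurableSet A → μ.real (G ∩ W ⁻¹' A) = ∫ ω in W ⁻¹' A, p (W ω) ∂μ) :
    (μ.restrict G).map W = (μ.map W).withDensity fun w => ENNReal.ofReal (p w) := by
  ext A hA
  rw [Measure.map_apply hW hA, Measure.restrict_apply (hW hA), withDensity_apply _ hA,
    setLIntegral_map hA (by fun_prop) hW, ← ofReal_integral_eq_lintegral_ofReal, ← h A hA,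
    Set.inter_comm, ofReal_measureReal]
  · refine Integrable.of_bound (hp.comp hW).aestronglyMeasurable 1
      (Filter.Eventually.of_forall fun ω => ?_)
    rw [Real.norm_of_nonneg (hp0 _)]; exact hp1 _
  · exact Filter.Eventually.of_forall fun ω => hp0 _

lemma compl_group {W : Ω → 𝒲} (hW : Measurable W) {G : Set Ω} (hG : MeasurableSet G)
    {p : 𝒲 → ℝ} (hp : Measurable p) (hp0 : ∀ w, 0 ≤ p w) (hp1 : ∀ w, p w ≤ 1)
    (h : ∀ A, MeasurableSet A → μ.real (G ∩ W ⁻¹' A) = ∫ ω in W ⁻¹' A, p (W ω) ∂μ)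
    (A : Set 𝒲) (hA : MeasurableSet A) :
    μ.real (Gᶜ ∩ W ⁻¹' A) = ∫ ω in W ⁻¹' A, (1 - p (W ω)) ∂μ := by
  have hintg : Integrable (fun ω => p (W ω)) (μ.restrict (W ⁻¹' A)) := by
    refine Integrable.of_bound (hp.comp hW).aestronglyMeasurable 1
      (Filter.Eventually.of_forall fun ω => ?_)
    rw [Real.norm_of_nonneg (hp0 _)]; exact hp1 _
  rw [integral_sub (integrable_const _) hintg, ← h A hA]
  have := measureReal_inter_add_sdiff (μ := μ) (s := W ⁻¹' A) hG
  have e : W ⁻¹' A \ G = Gᶜ ∩ W ⁻¹' A := by rw [Set.sdiff_eq, Set.inter_comm]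
  rw [e, Set.inter_comm] at this
  simp only [integral_const, smul_eq_mul, mul_one, measureReal_restrict_apply MeasurableSet.univ,
    Set.univ_inter]
  linarith

/-- The law of a Gaussian observation with random mean on an event with known conditional
probability. -/
lemma setLIntegral_shift {W : Ω → 𝒲} (hW : Measurable W) {G : Set Ω}
    {p : 𝒲 → ℝ} (hp : Measurable p) (hp0 : ∀ w, 0 ≤ p w) (hp1 : ∀ w, p w ≤ 1)
    (h : ∀ A, MeasurableSet A → μ.real (G ∩ W ⁻¹' A) = ∫ ω in W ⁻¹' A, p (W ω) ∂μ)
    {ε : Ω → ℝ} (hε : Measurable ε) {v : NNReal} (hv : v ≠ 0) (hlaw : μ.map ε = gaussianReal 0 v)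
    (hind : ∀ A B, MeasurableSet A → MeasurableSet B →
      μ ((W ⁻¹' A ∩ ε ⁻¹' B) ∩ G) = μ (W ⁻¹' A ∩ G) * μ (ε ⁻¹' B))
    {m : 𝒲 → ℝ} (hm : Measurable m) {F : 𝒲 × ℝ → ENNReal} (hF : Measurable F) :
    ∫⁻ ω in G, F (W ω, m (W ω) + ε ω) ∂μ
      = ∫⁻ q, ENNReal.ofReal (p q.1) * gaussianPDF 0 v (q.2 - m q.1) * F q
          ∂((μ.map W).prod volume) := by
  have hprod : (μ.restrict G).map (fun ω => (W ω, ε ω))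
      = ((μ.restrict G).map W).prod (μ.map ε) := by
    have : IsProbabilityMeasure (μ.map ε) := Measure.isProbabilityMeasure_map hε.aemeasurable
    refine (Measure.prod_eq fun A B hA hB => ?_).symm
    rw [Measure.map_apply (hW.prodMk hε) (hA.prod hB), Measure.map_apply hW hA,
      Measure.map_apply hε hB, Measure.restrict_apply (hW hA),
      Measure.restrict_apply ((hW.prodMk hε) (hA.prod hB)), ← hind A B hA hB]
    rfl
  have hpm : Measurable fun w => ENNReal.ofReal (p w) := hp.ennreal_ofReal
  have hg : Measurable (gaussianPDF 0 v) := measurable_gaussianPDF 0 v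
  have hF1 : Measurable fun q : 𝒲 × ℝ => F (q.1, m q.1 + q.2) := by fun_prop
  have : IsProbabilityMeasure (μ.map W) := Measure.isProbabilityMeasure_map hW.aemeasurable
  have hG2 : Measurable fun q : 𝒲 × ℝ => gaussianPDF 0 v (q.2 - m q.1) :=
    hg.comp (measurable_snd.sub (hm.comp measurable_fst))
  calc ∫⁻ ω in G, F (W ω, m (W ω) + ε ω) ∂μ
      = ∫⁻ q, F (q.1, m q.1 + q.2) ∂((μ.restrict G).map (fun ω => (W ω, ε ω))) := by
        rw [lintegral_map hF1 (hW.prodMk hε)]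
    _ = ∫⁻ w, ∫⁻ e, F (w, m w + e) ∂(μ.map ε) ∂((μ.restrict G).map W) := by
        have : IsProbabilityMeasure (μ.map ε) := Measure.isProbabilityMeasure_map hε.aemeasurable
        rw [hprod, lintegral_prod _ hF1.aemeasurable]
    _ = ∫⁻ w, ENNReal.ofReal (p w) * ∫⁻ e, F (w, m w + e) ∂(μ.map ε) ∂(μ.map W) := by
        have : IsProbabilityMeasure (μ.map ε) := Measure.isProbabilityMeasure_map hε.aemeasurable
        rw [restrict_map_eq_withDensity hW hp hp0 hp1 h,
          lintegral_withDensity_eq_lintegral_mul _ hpm (hF1.lintegral_prod_right')]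
        rfl
    _ = ∫⁻ w, ∫⁻ y, ENNReal.ofReal (p w) * gaussianPDF 0 v (y - m w) * F (w, y) ∂volume ∂(μ.map W) := by
        refine lintegral_congr fun w => ?_
        have hFw : Measurable fun y => F (w, y) := hF.comp measurable_prodMk_left
        rw [hlaw, gaussianReal_of_var_ne_zero 0 hv,
          lintegral_withDensity_eq_lintegral_mul _ hg (by fun_prop)]
        have e := lintegral_add_left_eq_self (μ := (volume : Measure ℝ))
          (fun y => gaussianPDF 0 v (y - m w) * F (w, y)) (m w)
        simp only [add_sub_cancel_left] at e
        simp only [Pi.mul_apply]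
        rw [e, ← lintegral_const_mul _ (by fun_prop)]
        simp only [mul_assoc]
    _ = _ := by
        rw [lintegral_prod]
        exact (((hpm.comp measurable_fst).mul hG2).mul hF).aemeasurable

end Mixture

lemma gaussianPDFReal_div {σ : ℝ} (hσ : 0 < σ) (u : ℝ) :
    gaussianPDFReal 0 1 (u / σ) = σ * gaussianPDFReal 0 (σ ^ 2).toNNReal u := by
  have hc : (((σ ^ 2).toNNReal : NNReal) : ℝ) = σ ^ 2 := Real.coe_toNNReal _ (sq_nonneg _)
  unfold gaussianPDFReal
  rw [hc]
  have e1 : √(2 * Real.pi * σ ^ 2) = √(2 * Real.pi) * σ := by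
    rw [Real.sqrt_mul (by positivity), Real.sqrt_sq hσ.le]
  have e2 : -(u / σ - 0) ^ 2 / (2 * ((1 : NNReal) : ℝ)) = -(u - 0) ^ 2 / (2 * σ ^ 2) := by
    simp only [NNReal.coe_one, sub_zero]; field_simp
  rw [e1, e2]
  simp only [NNReal.coe_one, mul_one]
  field_simp

/-- The E-step weight at the truth is the posterior probability of the first group. -/
lemma weight_mul_mixture {d : ℕ} {σ : ℝ} (hσ : 0 < σ) (o : Obs d) (γ : Param d) :
    weight σ o γ * (Real.sigmoid ⟪o.2.2, γ.1⟫ *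
        gaussianPDFReal 0 (σ ^ 2).toNNReal (o.1 - ⟪o.2.1, γ.2.1⟫)
      + (1 - Real.sigmoid ⟪o.2.2, γ.1⟫) *
        gaussianPDFReal 0 (σ ^ 2).toNNReal (o.1 - ⟪o.2.1, γ.2.2⟫))
      = Real.sigmoid ⟪o.2.2, γ.1⟫ *
        gaussianPDFReal 0 (σ ^ 2).toNNReal (o.1 - ⟪o.2.1, γ.2.1⟫) := by
  unfold weight
  rw [gaussianPDFReal_div hσ, gaussianPDFReal_div hσ]
  have hv : (σ ^ 2).toNNReal ≠ 0 := by
    rw [Ne, Real.toNNReal_eq_zero]; simp; positivity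
  have h1 := gaussianPDFReal_pos 0 _ (o.1 - ⟪o.2.1, γ.2.1⟫) hv
  have h2 := gaussianPDFReal_pos 0 _ (o.1 - ⟪o.2.1, γ.2.2⟫) hv
  have h3 := Real.sigmoid_pos ⟪o.2.2, γ.1⟫
  have h4 := Real.sigmoid_lt_one ⟪o.2.2, γ.1⟫
  have h5 : 0 < Real.sigmoid ⟪o.2.2, γ.1⟫ * gaussianPDFReal 0 (σ ^ 2).toNNReal (o.1 - ⟪o.2.1, γ.2.1⟫)
      + (1 - Real.sigmoid ⟪o.2.2, γ.1⟫) *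
        gaussianPDFReal 0 (σ ^ 2).toNNReal (o.1 - ⟪o.2.1, γ.2.2⟫) :=
    add_pos (mul_pos h3 h1) (mul_pos (by linarith) h2)
  set a := Real.sigmoid ⟪o.2.2, γ.1⟫
  set b := gaussianPDFReal 0 (σ ^ 2).toNNReal (o.1 - ⟪o.2.1, γ.2.1⟫)
  set c := gaussianPDFReal 0 (σ ^ 2).toNNReal (o.1 - ⟪o.2.1, γ.2.2⟫)
  have e : a * (σ * b) + (1 - a) * (σ * c) = σ * (a * b + (1 - a) * c) := by ring
  rw [e]
  field_simp

section Bayes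

variable {Ω 𝒲 : Type*} [MeasurableSpace Ω] [MeasurableSpace 𝒲] {μ : Measure Ω}
  [IsProbabilityMeasure μ] {d : ℕ}

lemma group_identity {W : Ω → 𝒲} (hW : Measurable W) {g : Ω → Fin 2} (hg : Measurable g)
    {p : 𝒲 → ℝ} (hp : Measurable p) (hp0 : ∀ w, 0 ≤ p w) (hp1 : ∀ w, p w ≤ 1)
    (h : ∀ A, MeasurableSet A → μ.real ({ω | g ω = 0} ∩ W ⁻¹' A) = ∫ ω in W ⁻¹' A, p (W ω) ∂μ)
    {f : 𝒲 → ℝ} (hf : Measurable f) :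
    ∫ ω, (if g ω = 0 then f (W ω) else 0) ∂μ = ∫ ω, p (W ω) * f (W ω) ∂μ := by
  have hG : MeasurableSet {ω | g ω = 0} := hg (measurableSet_singleton 0)
  have e := restrict_map_eq_withDensity hW hp hp0 hp1 h
  have e1 : ∫ ω, (if g ω = 0 then f (W ω) else 0) ∂μ = ∫ ω in {ω | g ω = 0}, f (W ω) ∂μ := by
    rw [← integral_indicator hG]
    exact integral_congr_ae (Filter.Eventually.of_forall fun ω => by simp [Set.indicator_apply])
  rw [e1, ← integral_map (φ := W) hW.aemeasurable hf.aestronglyMeasurable, e,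
    integral_withDensity_eq_integral_toReal_smul hp.ennreal_ofReal
      (Filter.Eventually.of_forall fun w => ENNReal.ofReal_lt_top),
    integral_map hW.aemeasurable]
  · simp only [ENNReal.toReal_ofReal (hp0 _), smul_eq_mul]
  · exact (hp.ennreal_ofReal.ennreal_toReal.smul hf).aestronglyMeasurable

lemma bayes_identity {γs : Param d} {σ : ℝ} (hσ : 0 < σ) {W : Ω → 𝒲} (hW : Measurable W)
    {g : Ω → Fin 2} (hg : Measurable g) {ε : Ω → ℝ} (hε : Measurable ε)
    {fx fz : 𝒲 → Vec d} (hfx : Measurable fx) (hfz : Measurable fz)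
    (h : ∀ A, MeasurableSet A → μ.real ({ω | g ω = 0} ∩ W ⁻¹' A)
      = ∫ ω in W ⁻¹' A, Real.sigmoid ⟪fz (W ω), γs.1⟫ ∂μ)
    (hlaw : μ.map ε = gaussianReal 0 (σ ^ 2).toNNReal)
    (hind : IndepFun ε (fun ω => (W ω, g ω)) μ) {f : Obs d → ℝ} (hf : Measurable f) :
    ∫ ω, weight σ (record γs (fx ∘ W) (fz ∘ W) g ε ω) γs *
        f (record γs (fx ∘ W) (fz ∘ W) g ε ω) ∂μ
      = ∫ ω, (if g ω = 0 then f (record γs (fx ∘ W) (fz ∘ W) g ε ω) else 0) ∂μ := by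
  set p : 𝒲 → ℝ := fun w => Real.sigmoid ⟪fz w, γs.1⟫ with hp_def
  have hp : Measurable p := continuous_sigmoid.measurable.comp (hfz.inner measurable_const)
  have hp0 : ∀ w, 0 ≤ p w := fun w => Real.sigmoid_nonneg _
  have hp1 : ∀ w, p w ≤ 1 := fun w => Real.sigmoid_le_one _
  set G : Set Ω := {ω | g ω = 0} with hGdef
  have hG : MeasurableSet G := hg (measurableSet_singleton 0)
  have hGc : MeasurableSet Gᶜ := hG.compl
  have hv : (σ ^ 2).toNNReal ≠ 0 := by
    rw [Ne, Real.toNNReal_eq_zero]; simp; positivity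
  set v := (σ ^ 2).toNNReal
  have hi0 : ∀ A B, MeasurableSet A → MeasurableSet B →
      μ ((W ⁻¹' A ∩ ε ⁻¹' B) ∩ G) = μ (W ⁻¹' A ∩ G) * μ (ε ⁻¹' B) := by
    intro A B hA hB
    have := hind.measure_inter_preimage_eq_mul _ _ hB (hA.prod (measurableSet_singleton (0 : Fin 2)))
    rw [mul_comm] at this
    have e1 : (W ⁻¹' A ∩ ε ⁻¹' B) ∩ G = ε ⁻¹' B ∩ (fun ω => (W ω, g ω)) ⁻¹' A ×ˢ {0} := by
      ext ω
      simp only [Set.mem_inter_iff, Set.mem_preimage, Set.mem_prod, Set.mem_singleton_iff,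
        hGdef, Set.mem_ofPred_eq]
      tauto
    have e2 : W ⁻¹' A ∩ G = (fun ω => (W ω, g ω)) ⁻¹' A ×ˢ {0} := by
      ext ω
      simp only [Set.mem_inter_iff, Set.mem_preimage, Set.mem_prod, Set.mem_singleton_iff,
        hGdef, Set.mem_ofPred_eq]
    rw [e1, e2, this]
  have hi1 : ∀ A B, MeasurableSet A → MeasurableSet B →
      μ ((W ⁻¹' A ∩ ε ⁻¹' B) ∩ Gᶜ) = μ (W ⁻¹' A ∩ Gᶜ) * μ (ε ⁻¹' B) := by
    intro A B hA hB
    have := hind.measure_inter_preimage_eq_mul _ _ hB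
      (hA.prod (measurableSet_singleton (0 : Fin 2)).compl)
    rw [mul_comm] at this
    have e1 : (W ⁻¹' A ∩ ε ⁻¹' B) ∩ Gᶜ = ε ⁻¹' B ∩ (fun ω => (W ω, g ω)) ⁻¹' A ×ˢ {0}ᶜ := by
      ext ω
      simp only [Set.mem_inter_iff, Set.mem_preimage, Set.mem_prod, Set.mem_singleton_iff,
        Set.mem_compl_iff, hGdef, Set.mem_ofPred_eq]
      tauto
    have e2 : W ⁻¹' A ∩ Gᶜ = (fun ω => (W ω, g ω)) ⁻¹' A ×ˢ {0}ᶜ := by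
      ext ω
      simp only [Set.mem_inter_iff, Set.mem_preimage, Set.mem_prod, Set.mem_singleton_iff,
        Set.mem_compl_iff, hGdef, Set.mem_ofPred_eq]
    rw [e1, e2, this]
  set rec := record γs (fx ∘ W) (fz ∘ W) g ε with hrec
  have hrm : Measurable rec := by
    refine Measurable.prodMk (Measurable.add ?_ hε) ((hfx.comp hW).prodMk (hfz.comp hW))
    exact (hfx.comp hW).inner (Measurable.ite (hg (measurableSet_singleton 0)) measurable_const
      measurable_const)
  set obs : 𝒲 × ℝ → Obs d := fun q => (q.2, fx q.1, fz q.1) with hobs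
  have hobsm : Measurable obs := by fun_prop
  have hr0 : ∀ ω ∈ G, rec ω = obs (W ω, ⟪fx (W ω), γs.2.1⟫ + ε ω) := by
    intro ω hω
    have hω' : g ω = 0 := hω
    simp [hrec, record, hobs, hω']
  have hr1 : ∀ ω ∈ Gᶜ, rec ω = obs (W ω, ⟪fx (W ω), γs.2.2⟫ + ε ω) := by
    intro ω hω
    have hω' : ¬ g ω = 0 := hω
    simp [hrec, record, hobs, hω']
  have hm1 : Measurable fun w => ⟪fx w, γs.2.1⟫ := hfx.inner measurable_const
  have hm2 : Measurable fun w => ⟪fx w, γs.2.2⟫ := hfx.inner measurable_const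
  have hwm : Measurable fun o : Obs d => ENNReal.ofReal (weight σ o γs) :=
    (measurable_weight_right σ γs).ennreal_ofReal
  have hG0 : ∀ F : Obs d → ENNReal, Measurable F → ∫⁻ ω in G, F (rec ω) ∂μ
      = ∫⁻ q, ENNReal.ofReal (p q.1) * gaussianPDF 0 v (q.2 - ⟪fx q.1, γs.2.1⟫) * F (obs q)
          ∂((μ.map W).prod volume) := by
    intro F hF
    refine Eq.trans ?_ (setLIntegral_shift hW hp hp0 hp1 h hε hv hlaw hi0 hm1 (hF.comp hobsm))
    exact setLIntegral_congr_fun hG fun ω hω => congrArg F (hr0 ω hω)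
  have hG1 : ∀ F : Obs d → ENNReal, Measurable F → ∫⁻ ω in Gᶜ, F (rec ω) ∂μ
      = ∫⁻ q, ENNReal.ofReal (1 - p q.1) * gaussianPDF 0 v (q.2 - ⟪fx q.1, γs.2.2⟫) * F (obs q)
          ∂((μ.map W).prod volume) := by
    intro F hF
    refine Eq.trans ?_ (setLIntegral_shift hW (p := fun w => 1 - p w) (measurable_const.sub hp)
      (fun w => by linarith [hp1 w]) (fun w => by linarith [hp0 w])
      (compl_group hW hG hp hp0 hp1 h) hε hv hlaw hi1 hm2 (hF.comp hobsm))
    exact setLIntegral_congr_fun hGc fun ω hω => congrArg F (hr1 ω hω)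
  have hpm : Measurable fun q : 𝒲 × ℝ => ENNReal.ofReal (p q.1) :=
    (hp.comp measurable_fst).ennreal_ofReal
  have hgm1 : Measurable fun q : 𝒲 × ℝ => gaussianPDF 0 v (q.2 - ⟪fx q.1, γs.2.1⟫) :=
    (measurable_gaussianPDF 0 v).comp (measurable_snd.sub (hm1.comp measurable_fst))
  have hmeas : (μ.map rec).withDensity (fun o => ENNReal.ofReal (weight σ o γs))
      = (μ.restrict G).map rec := by
    refine Measure.ext_of_lintegral _ fun F hF => ?_
    rw [lintegral_withDensity_eq_lintegral_mul _ hwm hF, lintegral_map (hwm.mul hF) hrm,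
      lintegral_map hF hrm, ← lintegral_add_compl _ hG, hG0 _ (hwm.mul hF), hG1 _ (hwm.mul hF),
      hG0 _ hF]
    refine (lintegral_add_left ((hpm.mul hgm1).mul ((hwm.mul hF).comp hobsm)) _).symm.trans ?_
    refine lintegral_congr fun q => ?_
    have key := weight_mul_mixture hσ (obs q) γs
    simp only [Pi.mul_apply, gaussianPDF, Function.comp_apply]
    have w0 := weight_nonneg hσ (obs q) γs
    have a0 : 0 ≤ p q.1 := hp0 _
    have a1 : 0 ≤ 1 - p q.1 := by linarith [hp1 q.1]
    have b0 := gaussianPDFReal_nonneg 0 v (q.2 - ⟪fx q.1, γs.2.1⟫)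
    have b1 := gaussianPDFReal_nonneg 0 v (q.2 - ⟪fx q.1, γs.2.2⟫)
    rw [← mul_assoc, ← mul_assoc, ← add_mul, ← ENNReal.ofReal_mul a0, ← ENNReal.ofReal_mul a1,
      ← ENNReal.ofReal_mul (mul_nonneg a0 b0), ← ENNReal.ofReal_mul (mul_nonneg a1 b1),
      ← ENNReal.ofReal_add (mul_nonneg (mul_nonneg a0 b0) w0) (mul_nonneg (mul_nonneg a1 b1) w0)]
    congr 2
    refine Eq.trans ?_ key
    change _ = weight σ (obs q) γs * (p q.1 * gaussianPDFReal 0 v (q.2 - ⟪fx q.1, γs.2.1⟫)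
      + (1 - p q.1) * gaussianPDFReal 0 v (q.2 - ⟪fx q.1, γs.2.2⟫))
    ring
  have e1 : ∫ ω, (if g ω = 0 then f (rec ω) else 0) ∂μ = ∫ ω in G, f (rec ω) ∂μ := by
    rw [← integral_indicator hG]
    exact integral_congr_ae (Filter.Eventually.of_forall fun ω => by
      simp [Set.indicator_apply, hGdef])
  rw [e1, ← integral_map (φ := rec) hrm.aemeasurable hf.aestronglyMeasurable, ← hmeas,
    integral_withDensity_eq_integral_toReal_smul hwm
      (Filter.Eventually.of_forall fun w => ENNReal.ofReal_lt_top),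
    integral_map hrm.aemeasurable]
  · simp only [ENNReal.toReal_ofReal (weight_nonneg hσ _ γs), smul_eq_mul]
  · exact (hwm.ennreal_toReal.smul hf).aestronglyMeasurable

end Bayes

/-! ### Records of the bandit as samples -/

lemma indepFun_prodMk_left {Ω α β δ : Type*} [MeasurableSpace Ω] [MeasurableSpace α]
    [MeasurableSpace β] [MeasurableSpace δ] {μ : Measure Ω} [IsProbabilityMeasure μ]
    {A : Ω → α} {B : Ω → β} {C : Ω → δ} (hA : Measurable A) (hB : Measurable B)
    (hC : Measurable C) (h : IndepFun A (fun ω => (B ω, C ω)) μ) (h' : IndepFun B C μ) :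
    IndepFun (fun ω => (A ω, B ω)) C μ := by
  have pA : IsProbabilityMeasure (μ.map A) := Measure.isProbabilityMeasure_map hA.aemeasurable
  have pB : IsProbabilityMeasure (μ.map B) := Measure.isProbabilityMeasure_map hB.aemeasurable
  have pC : IsProbabilityMeasure (μ.map C) := Measure.isProbabilityMeasure_map hC.aemeasurable
  have hAB : IndepFun A B μ := h.comp measurable_id measurable_fst
  rw [indepFun_iff_map_prod_eq_prod_map_map (hA.prodMk hB).aemeasurable hC.aemeasurable,
    hAB.map_prod_eq_prod_map_map hA.aemeasurable hB.aemeasurable]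
  have e := h.map_prod_eq_prod_map_map hA.aemeasurable (hB.prodMk hC).aemeasurable
  rw [h'.map_prod_eq_prod_map_map hB.aemeasurable hC.aemeasurable, ← Measure.prodAssoc_prod] at e
  have e2 := congrArg (Measure.map MeasurableEquiv.prodAssoc.symm) e
  rw [Measure.map_map MeasurableEquiv.prodAssoc.symm.measurable MeasurableEquiv.prodAssoc.measurable,
    Measure.map_map MeasurableEquiv.prodAssoc.symm.measurable (hA.prodMk (hB.prodMk hC))] at e2
  rw [MeasurableEquiv.symm_comp_self, Measure.map_id] at e2
  exact e2

/-- The scale of the exponential moments of the quadratic envelope. -/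
def envScale (S σ : ℝ) : ℝ := 24 * max S σ ^ 2

/-- The bound of the exponential moments of the quadratic envelope. -/
def envBound (K : ℕ) (S σ : ℝ) : ℝ := Real.exp (1 / envScale S σ) * (2 * K + 3)

lemma envScale_pos {S σ : ℝ} (hS : 0 < S) : 0 < envScale S σ := by
  have : 0 < max S σ := lt_max_of_lt_left hS
  unfold envScale; positivity

lemma envBound_pos (K : ℕ) (S σ : ℝ) : 0 < envBound K S σ := by unfold envBound; positivity

lemma exp_neg_sq_mono {S R t : ℝ} (hS : 0 < S) (hSR : S ≤ R) (ht : 0 ≤ t) :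
    Real.exp (-t / (2 * S ^ 2)) ≤ Real.exp (-t / (2 * R ^ 2)) := by
  rw [Real.exp_le_exp, neg_div, neg_div, neg_le_neg_iff]
  gcongr

lemma SubGaussianVec.sq_tail {Ω : Type*} [MeasurableSpace Ω] {μ : Measure Ω}
    [IsProbabilityMeasure μ] {d : ℕ} {W : Ω → Vec d} {S R : ℝ} (h : SubGaussianVec μ W S)
    (hS : 0 < S) (hSR : S ≤ R) {v : Vec d} (hv : ‖v‖ ≤ 1) {t : ℝ} (ht : 0 ≤ t) :
    μ.real {ω | t ≤ ⟪W ω, v⟫ ^ 2} ≤ 2 * Real.exp (-t / (2 * R ^ 2)) := by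
  rcases eq_or_ne v 0 with rfl | hv0
  · rcases ht.eq_or_lt with rfl | ht
    · refine measureReal_le_one.trans ?_
      simp
    · have : {ω | t ≤ ⟪W ω, (0 : Vec d)⟫ ^ 2} = ∅ := by
        ext ω; simp [ht]
      rw [this]; simp; positivity
  have hn : 0 < ‖v‖ := norm_pos_iff.2 hv0
  have h1 := h (‖v‖⁻¹ • v) (by rw [norm_smul, norm_inv, norm_norm, inv_mul_cancel₀ hn.ne'])
    (√t) (Real.sqrt_nonneg t)
  rw [Real.sq_sqrt ht] at h1
  refine (measureReal_mono fun ω hω => ?_).trans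
    (h1.trans (mul_le_mul_of_nonneg_left (exp_neg_sq_mono hS hSR ht) (by norm_num)))
  rw [Set.mem_ofPred_eq] at hω ⊢
  rw [real_inner_smul_right, abs_mul, abs_inv, abs_norm]
  calc √t ≤ |⟪W ω, v⟫| := Real.sqrt_le_iff.2 ⟨abs_nonneg _, by rwa [sq_abs]⟩
    _ = 1 * |⟪W ω, v⟫| := (one_mul _).symm
    _ ≤ ‖v‖⁻¹ * |⟪W ω, v⟫| := by
        gcongr
        exact (one_le_inv₀ hn).2 hv

/-- The exponential moment of an average is controlled by those of the terms. -/
lemma exp_add_six_le (b a₁ a₂ a₃ a₄ a₅ a₆ : ℝ) :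
    Real.exp (b + (a₁ + a₂ + a₃ + a₄ + a₅ + a₆) / 6)
      ≤ Real.exp b * ((Real.exp a₁ + Real.exp a₂ + Real.exp a₃ + Real.exp a₄ + Real.exp a₅
        + Real.exp a₆) / 6) := by
  rw [Real.exp_add]
  refine mul_le_mul_of_nonneg_left ?_ (Real.exp_pos _).le
  have h := convexOn_exp.map_sum_le (t := Finset.univ) (w := fun _ : Fin 6 => (1 / 6 : ℝ))
    (p := ![a₁, a₂, a₃, a₄, a₅, a₆]) (by intro i _; norm_num) (by simp) (by simp)
  simp only [Fin.sum_univ_six, smul_eq_mul] at h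
  simp only [Matrix.cons_val_zero, Matrix.cons_val_one, Matrix.cons_val] at h
  calc Real.exp ((a₁ + a₂ + a₃ + a₄ + a₅ + a₆) / 6) = _ := by congr 1; ring
    _ ≤ _ := h
    _ = _ := by ring

section Sample

variable {Ω : Type*} [MeasurableSpace Ω] {μ : Measure Ω} {d K : ℕ}
  {γs : Param d} {σ : ℝ} {B : Primitives Ω d K}

namespace IsLatentBandit

lemma measurable_ctx (hB : IsLatentBandit μ γs σ B) (i : ℕ) : Measurable (B.ctx i) :=
  (hB.measurable_customer i).fst

lemma measurable_X (hB : IsLatentBandit μ γs σ B) (i : ℕ) (k : Fin K) :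
    Measurable fun ω => B.X i ω k :=
  (measurable_pi_apply k).comp (hB.measurable_ctx i).fst

lemma measurable_Z (hB : IsLatentBandit μ γs σ B) (i : ℕ) : Measurable (B.Z i) :=
  (hB.measurable_ctx i).snd

lemma measurable_g (hB : IsLatentBandit μ γs σ B) (i : ℕ) : Measurable (B.g i) :=
  (hB.measurable_customer i).snd.fst

lemma measurable_ε (hB : IsLatentBandit μ γs σ B) (i : ℕ) : Measurable (B.ε i) :=
  (hB.measurable_customer i).snd.snd.fst

lemma measurable_U (hB : IsLatentBandit μ γs σ B) (i : ℕ) : Measurable (B.U i) :=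
  (hB.measurable_customer i).snd.snd.snd

variable [IsProbabilityMeasure μ]

lemma noise_indep_explore (hB : IsLatentBandit μ γs σ B) (i : ℕ) :
    IndepFun (B.ε i) (fun ω => ((B.ctx i ω, B.U i ω), B.g i ω)) μ := by
  have hc := hB.measurable_ctx i
  have hg := hB.measurable_g i
  have hε := hB.measurable_ε i
  have hU := hB.measurable_U i
  have h1 : IndepFun (B.U i) (fun ω => ((B.ctx i ω, B.g i ω), B.ε i ω)) μ :=
    (hB.explore_indep i).comp (φ := id)
      (ψ := fun q : ((Fin K → Vec d) × Vec d) × Fin 2 × ℝ => ((q.1, q.2.1), q.2.2))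
      measurable_id (by fun_prop)
  have h2 := indepFun_prodMk_left hU (hc.prodMk hg) hε h1 (hB.noise_indep i).symm
  exact (h2.comp (φ := fun q : Fin K × ((Fin K → Vec d) × Vec d) × Fin 2 =>
    ((q.2.1, q.1), q.2.2)) (ψ := id) (by fun_prop) measurable_id).symm

lemma group_prob_explore (hB : IsLatentBandit μ γs σ B) (i : ℕ)
    (A : Set (((Fin K → Vec d) × Vec d) × Fin K)) (hA : MeasurableSet A) :
    μ.real ({ω | B.g i ω = 0} ∩ (fun ω => (B.ctx i ω, B.U i ω)) ⁻¹' A)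
      = ∫ ω in (fun ω => (B.ctx i ω, B.U i ω)) ⁻¹' A, Real.sigmoid ⟪B.Z i ω, γs.1⟫ ∂μ := by
  have hc := hB.measurable_ctx i
  have hg := hB.measurable_g i
  have hU := hB.measurable_U i
  have hG : MeasurableSet {ω | B.g i ω = 0} := hg (measurableSet_singleton 0)
  set V : Ω → ((Fin K → Vec d) × Vec d) × Fin K := fun ω => (B.ctx i ω, B.U i ω) with hV
  set A' : Fin K → Set ((Fin K → Vec d) × Vec d) := fun k => {c | (c, k) ∈ A} with hA'
  have hA'm : ∀ k, MeasurableSet (A' k) := fun k => measurable_prodMk_right hA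
  have hsplit : V ⁻¹' A = ⋃ k ∈ (Finset.univ : Finset (Fin K)),
      (B.U i ⁻¹' {k} ∩ B.ctx i ⁻¹' A' k) := by
    ext ω
    simp [hV, hA']
  have hdisj : Set.PairwiseDisjoint (↑(Finset.univ : Finset (Fin K)))
      fun k => B.U i ⁻¹' {k} ∩ B.ctx i ⁻¹' A' k := by
    intro k _ l _ hkl
    refine Set.disjoint_left.2 fun ω h1 h2 => hkl ?_
    exact (Eq.symm h1.1).trans h2.1
  have hmk : ∀ k, MeasurableSet (B.U i ⁻¹' {k} ∩ B.ctx i ⁻¹' A' k) := fun k =>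
    (hU (measurableSet_singleton k)).inter (hc (hA'm k))
  have hsm : Measurable fun ω => Real.sigmoid ⟪B.Z i ω, γs.1⟫ :=
    continuous_sigmoid.measurable.comp ((hB.measurable_Z i).inner measurable_const)
  have hsi : Integrable (fun ω => Real.sigmoid ⟪B.Z i ω, γs.1⟫) μ :=
    Integrable.of_bound hsm.aestronglyMeasurable 1 (Filter.Eventually.of_forall fun ω => by
      rw [Real.norm_of_nonneg (Real.sigmoid_nonneg _)]; exact Real.sigmoid_le_one _)
  rw [hsplit, integral_biUnion_finset _ (fun k _ => hmk k) hdisj (fun k _ => hsi.integrableOn),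
    Set.inter_iUnion₂, measureReal_biUnion_finset]
  · refine Finset.sum_congr rfl fun k _ => ?_
    have hi1 := (hB.explore_indep i).measure_inter_preimage_eq_mul {k}
      {q : ((Fin K → Vec d) × Vec d) × Fin 2 × ℝ | q.1 ∈ A' k ∧ q.2.1 = 0}
      (measurableSet_singleton k)
      ((measurable_fst (hA'm k)).inter
        ((measurable_fst.comp measurable_snd) (measurableSet_singleton (0 : Fin 2))))
    have e1 : {ω | B.g i ω = 0} ∩ (B.U i ⁻¹' {k} ∩ B.ctx i ⁻¹' A' k)
        = B.U i ⁻¹' {k} ∩ (fun ω => (B.ctx i ω, B.g i ω, B.ε i ω)) ⁻¹'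
          {q | q.1 ∈ A' k ∧ q.2.1 = 0} := by
      ext ω
      simp only [Set.mem_inter_iff, Set.mem_preimage, Set.mem_singleton_iff, Set.mem_ofPred_eq]
      tauto
    have e2 : (fun ω => (B.ctx i ω, B.g i ω, B.ε i ω)) ⁻¹' {q | q.1 ∈ A' k ∧ q.2.1 = 0}
        = {ω | B.g i ω = 0} ∩ B.ctx i ⁻¹' A' k := by
      ext ω
      simp only [Set.mem_inter_iff, Set.mem_preimage, Set.mem_ofPred_eq]
      tauto
    rw [e1, measureReal_def, hi1, e2, ENNReal.toReal_mul, ← measureReal_def, ← measureReal_def,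
      hB.group_prob i _ (hA'm k)]
    have hind : IndepFun (fun ω => (B.U i ⁻¹' {k}).indicator (fun _ => (1 : ℝ)) ω)
        (fun ω => (B.ctx i ⁻¹' A' k).indicator (fun ω => Real.sigmoid ⟪B.Z i ω, γs.1⟫) ω) μ := by
      have m1 : Measurable fun l : Fin K => ({k} : Set (Fin K)).indicator (fun _ => (1 : ℝ)) l :=
        measurable_const.indicator (measurableSet_singleton k)
      have m2 : Measurable fun q : ((Fin K → Vec d) × Vec d) × Fin 2 × ℝ =>
          (A' k).indicator (fun c => Real.sigmoid ⟪c.2, γs.1⟫) q.1 :=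
        ((continuous_sigmoid.measurable.comp (measurable_snd.inner measurable_const)).indicator
          (hA'm k)).comp measurable_fst
      exact (hB.explore_indep i).comp m1 m2
    have hmul := hind.integral_fun_mul_eq_mul_integral
      (measurable_const.indicator (hU (measurableSet_singleton k))).aestronglyMeasurable
      (hsm.indicator (hc (hA'm k))).aestronglyMeasurable
    rw [integral_indicator (hU (measurableSet_singleton k)), integral_indicator (hc (hA'm k))] at hmul
    simp only [integral_const, smul_eq_mul, mul_one,
      measureReal_restrict_apply MeasurableSet.univ, Set.univ_inter] at hmul
    rw [← hmul, ← integral_indicator (hmk k)]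
    refine integral_congr_ae (Filter.Eventually.of_forall fun ω => ?_)
    by_cases hu : ω ∈ B.U i ⁻¹' {k} <;> by_cases hω : ω ∈ B.ctx i ⁻¹' A' k <;>
      simp only [Set.indicator, Set.mem_inter_iff, hu, hω, if_true, if_false, and_true, and_false,
        one_mul, zero_mul, mul_zero]
  · intro k _ l _ hkl
    exact (hdisj (Finset.mem_coe.2 (Finset.mem_univ k)) (Finset.mem_coe.2 (Finset.mem_univ l))
      hkl).mono Set.inter_subset_right Set.inter_subset_right
  · exact fun k _ => hG.inter (hmk k)

end IsLatentBandit

end Sample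

lemma measurable_eval_fin {d K : ℕ} :
    Measurable fun q : (Fin K → Vec d) × Fin K => q.1 q.2 :=
  measurable_from_prod_countable_left fun k => measurable_pi_apply k

lemma integral_average_six_le {Ω : Type*} [MeasurableSpace Ω] {μ : Measure Ω}
    {f₁ f₂ f₃ f₄ f₅ f₆ : Ω → ℝ} {b : ℝ} (h₁ : Integrable f₁ μ) (h₂ : Integrable f₂ μ)
    (h₃ : Integrable f₃ μ) (h₄ : Integrable f₄ μ) (h₅ : Integrable f₅ μ) (h₆ : Integrable f₆ μ)
    (b₁ : ∫ ω, f₁ ω ∂μ ≤ b) (b₂ : ∫ ω, f₂ ω ∂μ ≤ b) (b₃ : ∫ ω, f₃ ω ∂μ ≤ b)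
    (b₄ : ∫ ω, f₄ ω ∂μ ≤ b) (b₅ : ∫ ω, f₅ ω ∂μ ≤ b) (b₆ : ∫ ω, f₆ ω ∂μ ≤ b) :
    ∫ ω, (f₁ ω + f₂ ω + f₃ ω + f₄ ω + f₅ ω + f₆ ω) / 6 ∂μ ≤ b := by
  have i₂ : Integrable (fun ω => f₁ ω + f₂ ω) μ := h₁.add h₂
  have i₃ : Integrable (fun ω => f₁ ω + f₂ ω + f₃ ω) μ := i₂.add h₃
  have i₄ : Integrable (fun ω => f₁ ω + f₂ ω + f₃ ω + f₄ ω) μ := i₃.add h₄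
  have i₅ : Integrable (fun ω => f₁ ω + f₂ ω + f₃ ω + f₄ ω + f₅ ω) μ := i₄.add h₅
  rw [integral_div, integral_add i₅ h₆, integral_add i₄ h₅, integral_add i₃ h₄,
    integral_add i₂ h₃, integral_add h₁ h₂]
  linarith

section Sample

variable {Ω : Type*} [MeasurableSpace Ω] {μ : Measure Ω} {d K : ℕ}
  {γs : Param d} {σ : ℝ} {B : Primitives Ω d K}

/-- The feature of the arm chosen by the rule `α` from the context and the exploration draw. -/
def chosen (B : Primitives Ω d K) (α : ((Fin K → Vec d) × Vec d) × Fin K → Fin K) (i : ℕ)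
    (ω : Ω) : Vec d :=
  B.X i ω (α (B.ctx i ω, B.U i ω))

lemma IsLatentBandit.measurable_chosen (hB : IsLatentBandit μ γs σ B)
    {α : ((Fin K → Vec d) × Vec d) × Fin K → Fin K} (hα : Measurable α) (i : ℕ) :
    Measurable (chosen B α i) :=
  measurable_eval_fin.comp ((hB.measurable_ctx i).fst.prodMk
    (hα.comp ((hB.measurable_ctx i).prodMk (hB.measurable_U i))))

variable [IsProbabilityMeasure μ]

lemma chosen_sq_tail {S R : ℝ} (hsub : ∀ i k, SubGaussianVec μ (fun ω => B.X i ω k) S)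
    (hS : 0 < S) (hSR : S ≤ R) (α : ((Fin K → Vec d) × Vec d) × Fin K → Fin K) (i : ℕ)
    {v : Vec d} (hv : ‖v‖ ≤ 1) {t : ℝ} (ht : 0 ≤ t) :
    μ.real {ω | t ≤ ⟪chosen B α i ω, v⟫ ^ 2} ≤ (2 * K + 2) * Real.exp (-t / (2 * R ^ 2)) := by
  have h1 : {ω | t ≤ ⟪chosen B α i ω, v⟫ ^ 2} ⊆ ⋃ k : Fin K, {ω | t ≤ ⟪B.X i ω k, v⟫ ^ 2} := by
    intro ω hω
    exact Set.mem_iUnion.2 ⟨α (B.ctx i ω, B.U i ω), hω⟩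
  have h2 := measureReal_iUnion_le_card (μ := μ) (f := fun k : Fin K => {ω | t ≤ ⟪B.X i ω k, v⟫ ^ 2})
    fun k => (hsub i k).sq_tail hS hSR hv ht
  refine (measureReal_mono h1).trans (h2.trans ?_)
  rw [Fintype.card_fin]
  have := Real.exp_pos (-t / (2 * R ^ 2))
  linarith

/-- Exponential moments of the quadratic envelope. -/
lemma envelope_moment (hB : IsLatentBandit μ γs σ B) {S : ℝ} (hS : 0 < S) (hσ : 0 < σ)
    (hX : ∀ i k, SubGaussianVec μ (fun ω => B.X i ω k) S) (hZ : ∀ i, SubGaussianVec μ (B.Z i) S)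
    {α : ((Fin K → Vec d) × Vec d) × Fin K → Fin K} (hα : Measurable α) (i : ℕ)
    {u₁ u₂ u₃ v : Vec d} (h₁ : ‖u₁‖ ≤ 1) (h₂ : ‖u₂‖ ≤ 1) (h₃ : ‖u₃‖ ≤ 1) (hv : ‖v‖ ≤ 1) :
    Integrable (fun ω => Real.exp (envelope (chosen B α i) (B.Z i) (B.ε i) u₁ u₂ u₃ v ω /
        envScale S σ)) μ ∧
      ∫ ω, Real.exp (envelope (chosen B α i) (B.Z i) (B.ε i) u₁ u₂ u₃ v ω / envScale S σ) ∂μ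
        ≤ envBound K S σ := by
  set R := max S σ with hR
  have hSR : S ≤ R := le_max_left _ _
  have hσR : σ ≤ R := le_max_right _ _
  have hR0 : 0 < R := hS.trans_le hSR
  have hb : 0 < 2 * R ^ 2 := by positivity
  have hA : (0 : ℝ) ≤ 2 * K + 2 := by positivity
  have hxm := hB.measurable_chosen hα i
  have hzm := hB.measurable_Z i
  have hεm := hB.measurable_ε i
  have hE : ∀ t : ℝ, 2 * Real.exp (-t / (2 * R ^ 2)) ≤ (2 * K + 2) * Real.exp (-t / (2 * R ^ 2)) :=
    fun t => mul_le_mul_of_nonneg_right (by linarith [Nat.cast_nonneg (α := ℝ) K])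
      (Real.exp_pos _).le
  have mx : ∀ u : Vec d, ‖u‖ ≤ 1 → _ := fun u hu =>
    exp_moment_of_tail (μ := μ) (Y := fun ω => ⟪chosen B α i ω, u⟫ ^ 2)
      ((hxm.inner measurable_const).pow_const 2) hA hb
      fun t ht => chosen_sq_tail hX hS hSR α i hu ht
  have mz : ∀ u : Vec d, ‖u‖ ≤ 1 → _ := fun u hu =>
    exp_moment_of_tail (μ := μ) (Y := fun ω => ⟪B.Z i ω, u⟫ ^ 2)
      ((hzm.inner measurable_const).pow_const 2) hA hb
      fun t ht => ((hZ i).sq_tail hS hSR hu ht).trans (hE t)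
  have me := exp_moment_of_tail (μ := μ) (Y := fun ω => B.ε i ω ^ 2) (hεm.pow_const 2) hA hb
    fun t ht => by
      have h1 := gaussian_abs_tail hεm (hB.noise_law i) (Real.sqrt_nonneg t)
      rw [Real.sq_sqrt ht] at h1
      refine le_trans (measureReal_mono fun ω hω => ?_) (h1.trans ((mul_le_mul_of_nonneg_left
        (exp_neg_sq_mono hσ hσR ht) (by norm_num)).trans (hE t)))
      rw [Set.mem_ofPred_eq] at hω ⊢
      exact Real.sqrt_le_iff.2 ⟨abs_nonneg _, by rwa [sq_abs]⟩
  have hpt : ∀ ω, Real.exp (envelope (chosen B α i) (B.Z i) (B.ε i) u₁ u₂ u₃ v ω / envScale S σ)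
      ≤ Real.exp (1 / envScale S σ) *
        ((Real.exp (B.ε i ω ^ 2 / (2 * (2 * R ^ 2)))
        + Real.exp (⟪chosen B α i ω, u₁⟫ ^ 2 / (2 * (2 * R ^ 2)))
        + Real.exp (⟪chosen B α i ω, u₂⟫ ^ 2 / (2 * (2 * R ^ 2)))
        + Real.exp (⟪B.Z i ω, u₃⟫ ^ 2 / (2 * (2 * R ^ 2)))
        + Real.exp (⟪chosen B α i ω, v⟫ ^ 2 / (2 * (2 * R ^ 2)))
        + Real.exp (⟪B.Z i ω, v⟫ ^ 2 / (2 * (2 * R ^ 2)))) / 6) := by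
    intro ω
    refine le_trans (le_of_eq ?_) (exp_add_six_le _ _ _ _ _ _ _)
    congr 1
    unfold envelope envScale
    rw [← hR]
    field_simp
    ring
  have hintg : Integrable (fun ω => Real.exp (1 / envScale S σ) *
        ((Real.exp (B.ε i ω ^ 2 / (2 * (2 * R ^ 2)))
        + Real.exp (⟪chosen B α i ω, u₁⟫ ^ 2 / (2 * (2 * R ^ 2)))
        + Real.exp (⟪chosen B α i ω, u₂⟫ ^ 2 / (2 * (2 * R ^ 2)))
        + Real.exp (⟪B.Z i ω, u₃⟫ ^ 2 / (2 * (2 * R ^ 2)))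
        + Real.exp (⟪chosen B α i ω, v⟫ ^ 2 / (2 * (2 * R ^ 2)))
        + Real.exp (⟪B.Z i ω, v⟫ ^ 2 / (2 * (2 * R ^ 2)))) / 6)) μ :=
    ((((((me.1.add (mx u₁ h₁).1).add (mx u₂ h₂).1).add (mz u₃ h₃).1).add (mx v hv).1).add
      (mz v hv).1).div_const 6).const_mul _
  have hmeas : Measurable fun ω =>
      Real.exp (envelope (chosen B α i) (B.Z i) (B.ε i) u₁ u₂ u₃ v ω / envScale S σ) := by
    unfold envelope
    fun_prop
  have hintg' : Integrable (fun ω =>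
      Real.exp (envelope (chosen B α i) (B.Z i) (B.ε i) u₁ u₂ u₃ v ω / envScale S σ)) μ :=
    hintg.mono' hmeas.aestronglyMeasurable (Filter.Eventually.of_forall fun ω => by
      rw [Real.norm_of_nonneg (Real.exp_pos _).le]; exact hpt ω)
  refine ⟨hintg', (integral_mono hintg' hintg hpt).trans ?_⟩
  rw [integral_const_mul]
  unfold envBound
  refine mul_le_mul_of_nonneg_left ?_ (Real.exp_pos _).le
  rw [show (2 * K + 3 : ℝ) = 1 + (2 * K + 2) by ring]
  exact integral_average_six_le me.1 (mx u₁ h₁).1 (mx u₂ h₂).1 (mz u₃ h₃).1 (mx v hv).1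
    (mz v hv).1 me.2 (mx u₁ h₁).2 (mx u₂ h₂).2 (mz u₃ h₃).2 (mx v hv).2 (mz v hv).2

lemma separation_bound (hB : IsLatentBandit μ γs σ B) {L Δ h : ℝ} (hh : 0 < h) (hΔ : 0 < Δ)
    (hΔs : Δ ≤ ‖γs.2.1 - γs.2.2‖)
    (hball : ∀ i k (h : ℝ), 0 < h →
      μ.real {ω | |⟪B.X i ω k, γs.2.1 - γs.2.2⟫| ≤ h * ‖γs.2.1 - γs.2.2‖} ≤ L * h)
    {α : ((Fin K → Vec d) × Vec d) × Fin K → Fin K} (hα : Measurable α) (i : ℕ) :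
    ∫ ω, ((1 + |⟪chosen B α i ω, γs.2.1 - γs.2.2⟫|)⁻¹) ^ 2 ∂μ ≤ K * (L * h) + 1 / (h * Δ) ^ 2 := by
  set D : Ω → ℝ := fun ω => ⟪chosen B α i ω, γs.2.1 - γs.2.2⟫ with hD
  have hDm : Measurable D := (hB.measurable_chosen hα i).inner measurable_const
  set A : Set Ω := {ω | |D ω| ≤ h * ‖γs.2.1 - γs.2.2‖} with hA
  have hAm : MeasurableSet A := measurableSet_le hDm.abs measurable_const
  have hAp : μ.real A ≤ K * (L * h) := by
    have h1 : A ⊆ ⋃ k : Fin K, {ω | |⟪B.X i ω k, γs.2.1 - γs.2.2⟫| ≤ h * ‖γs.2.1 - γs.2.2‖} := by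
      intro ω hω
      exact Set.mem_iUnion.2 ⟨α (B.ctx i ω, B.U i ω), hω⟩
    have h2 := measureReal_iUnion_le_card (μ := μ) (f := fun k : Fin K =>
      {ω | |⟪B.X i ω k, γs.2.1 - γs.2.2⟫| ≤ h * ‖γs.2.1 - γs.2.2‖}) fun k => hball i k h hh
    rw [Fintype.card_fin] at h2
    exact (measureReal_mono h1).trans h2
  have hpt : ∀ ω, ((1 + |D ω|)⁻¹) ^ 2 ≤ A.indicator (fun _ => (1 : ℝ)) ω + 1 / (h * Δ) ^ 2 := by
    intro ω
    have h0 := abs_nonneg (D ω)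
    by_cases hω : ω ∈ A
    · rw [Set.indicator_of_mem hω]
      have : ((1 + |D ω|)⁻¹) ^ 2 ≤ 1 := pow_le_one₀ (by positivity) (inv_le_one_of_one_le₀ (by linarith))
      have : 0 ≤ 1 / (h * Δ) ^ 2 := by positivity
      linarith
    · rw [Set.indicator_of_notMem hω, zero_add, inv_pow, ← one_div]
      have h1 : h * ‖γs.2.1 - γs.2.2‖ < |D ω| := not_le.1 hω
      have h2 : h * Δ ≤ 1 + |D ω| := by
        have := mul_le_mul_of_nonneg_left hΔs hh.le
        linarith
      gcongr
  have hi1 : Integrable (fun ω => A.indicator (fun _ => (1 : ℝ)) ω) μ :=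
    (integrable_const (1 : ℝ)).indicator hAm
  have hi2 : Integrable (fun ω => ((1 + |D ω|)⁻¹) ^ 2) μ := by
    refine Integrable.of_bound (by fun_prop) 1 (Filter.Eventually.of_forall fun ω => ?_)
    rw [Real.norm_of_nonneg (by positivity)]
    exact pow_le_one₀ (by positivity) (inv_le_one_of_one_le₀ (by linarith [abs_nonneg (D ω)]))
  calc ∫ ω, ((1 + |D ω|)⁻¹) ^ 2 ∂μ
      ≤ ∫ ω, (A.indicator (fun _ => (1 : ℝ)) ω + 1 / (h * Δ) ^ 2) ∂μ :=
        integral_mono hi2 (hi1.add (integrable_const _)) hpt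
    _ = μ.real A + 1 / (h * Δ) ^ 2 := by
        rw [integral_add hi1 (integrable_const _), integral_indicator hAm]
        simp
    _ ≤ _ := by linarith

/-- The record of a customer served by an arm chosen from context and exploration draw. -/
lemma isSample_chosen (hB : IsLatentBandit μ γs σ B) {s : ℕ} {ξ M S L CSNR δ h : ℝ}
    {am : (Fin K → ℝ) → Fin K} (hR : Regular μ s ξ M S L σ CSNR δ am γs B) (hS : 0 < S)
    (hσ : 0 < σ) (hC : 0 < CSNR) (hh : 0 < h)
    {α : ((Fin K → Vec d) × Vec d) × Fin K → Fin K} (hα : Measurable α) (i : ℕ)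
    (hmom : SecondMomentGT μ (chosen B α i) (1 / M)) :
    IsSample μ γs σ ξ M (envScale S σ) (envBound K S σ)
      (K * (L * h) + 1 / (h * (CSNR * σ)) ^ 2) (chosen B α i) (B.Z i) (B.g i) (B.ε i) := by
  have hc := hB.measurable_ctx i
  have hU := hB.measurable_U i
  have hg := hB.measurable_g i
  have hε := hB.measurable_ε i
  have hx := hB.measurable_chosen hα i
  set W : Ω → ((Fin K → Vec d) × Vec d) × Fin K := fun ω => (B.ctx i ω, B.U i ω) with hW
  have hWm : Measurable W := hc.prodMk hU
  set fx : ((Fin K → Vec d) × Vec d) × Fin K → Vec d := fun w => w.1.1 (α w) with hfx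
  set fz : ((Fin K → Vec d) × Vec d) × Fin K → Vec d := fun w => w.1.2 with hfz
  have hfxm : Measurable fx :=
    measurable_eval_fin.comp (measurable_fst.fst.prodMk hα)
  have hfzm : Measurable fz := measurable_fst.snd
  have hmean : ∫ ω, B.ε i ω ∂μ = 0 := by
    have := integral_map (μ := μ) (φ := B.ε i) hε.aemeasurable (f := fun e : ℝ => e)
      measurable_id.aestronglyMeasurable
    rw [← this, hB.noise_law i]
    exact integral_id_gaussianReal
  have hnoise : ∀ (v : Vec d) (q : Fin 2 → ℝ),
      ∫ ω, B.ε i ω * (q (B.g i ω) * ⟪chosen B α i ω, v⟫) ∂μ = 0 := by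
    intro v q
    have hψ : Measurable fun p : (((Fin K → Vec d) × Vec d) × Fin K) × Fin 2 =>
        q p.2 * ⟪fx p.1, v⟫ :=
      ((measurable_of_finite q).comp measurable_snd).mul
        ((hfxm.comp measurable_fst).inner measurable_const)
    have hi := (hB.noise_indep_explore i).comp (φ := fun e : ℝ => e) measurable_id hψ
    have := hi.integral_fun_mul_eq_mul_integral hε.aestronglyMeasurable
      (hψ.comp (hWm.prodMk hg)).aestronglyMeasurable
    simp only [Function.comp_def] at this
    rw [hmean, zero_mul] at this
    exact this
  refine ⟨hx, hB.measurable_Z i, hg, hε,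
    fun u₁ u₂ u₃ v a b c e =>
      (envelope_moment hB hS hσ hR.subGaussian_X hR.subGaussian_Z hα i a b c e).1,
    fun u₁ u₂ u₃ v a b c e =>
      (envelope_moment hB hS hσ hR.subGaussian_X hR.subGaussian_Z hα i a b c e).2,
    separation_bound hB hh (by positivity) ((le_div_iff₀ hσ).1 hR.snr) hR.small_ball hα i,
    hR.group_nondegenerate i, hmom, (hR.moment_Z i).1, ?_, ?_, ?_⟩
  · intro f hf _
    exact bayes_identity (fx := fx) (fz := fz) hσ hWm hg hε hfxm hfzm
      (hB.group_prob_explore i) (hB.noise_law i) (hB.noise_indep_explore i) hf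
  · intro f hf _
    exact group_identity (p := fun w => Real.sigmoid ⟪fz w, γs.1⟫)
      (f := fun w => f (fx w, fz w)) hWm hg
      (continuous_sigmoid.measurable.comp (hfzm.inner measurable_const))
      (fun _ => Real.sigmoid_nonneg _) (fun _ => Real.sigmoid_le_one _)
      (hB.group_prob_explore i) (hf.comp (hfxm.prodMk hfzm))
  · intro v
    have h0 := hnoise v fun j => if j = 0 then 1 else 0
    have h1 := hnoise v fun j => if j = 0 then 0 else 1
    constructor
    · refine Eq.trans ?_ h0
      refine integral_congr_ae (Filter.Eventually.of_forall fun ω => ?_)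
      by_cases hω : B.g i ω = 0 <;> simp [hω]
    · refine Eq.trans ?_ h1
      refine integral_congr_ae (Filter.Eventually.of_forall fun ω => ?_)
      by_cases hω : B.g i ω = 0 <;> simp [hω]

/-- Uniform exploration collects non-degenerate features. -/
lemma explore_moment (hB : IsLatentBandit μ γs σ B) {s : ℕ} {ξ M S L CSNR δ : ℝ}
    {am : (Fin K → ℝ) → Fin K} (hR : Regular μ s ξ M S L σ CSNR δ am γs B) (hS : 0 < S)
    (i : ℕ) :
    SecondMomentGT μ (chosen B (fun w => w.2) i) (1 / M) := by
  intro v hv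
  have hU := hB.measurable_U i
  have hK : 0 < K := by
    have hne : Nonempty Ω := nonempty_of_isProbabilityMeasure μ
    obtain ⟨ω⟩ := hne
    exact Fin.pos (B.U i ω)
  have hintg : ∀ k, Integrable (fun ω => ⟪B.X i ω k, v⟫ ^ 2) μ := by
    intro k
    have hm := exp_moment_of_tail (μ := μ) (Y := fun ω => ⟪B.X i ω k, v⟫ ^ 2)
      (((hB.measurable_X i k).inner measurable_const).pow_const 2) (A := 2) (b := 2 * S ^ 2)
      (by norm_num) (by positivity) fun t ht => (hR.subGaussian_X i k).sq_tail hS le_rfl hv.le ht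
    have := (moment_of_exp_moment (((hB.measurable_X i k).inner measurable_const).pow_const 2)
      (fun ω => sq_nonneg _) (by positivity) hm.1 hm.2 1).1
    simpa using this
  have hpt : ∀ ω, ⟪chosen B (fun w => w.2) i ω, v⟫ ^ 2
      = ∑ k, (B.U i ⁻¹' {k}).indicator (fun _ => (1 : ℝ)) ω * ⟪B.X i ω k, v⟫ ^ 2 := by
    intro ω
    rw [Finset.sum_eq_single (B.U i ω)]
    · simp [chosen]
    · intro k _ hk
      rw [Set.indicator_of_notMem, zero_mul]
      exact fun h => hk (Eq.symm h)
    · simp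
  have hk : ∀ k, Integrable (fun ω => (B.U i ⁻¹' {k}).indicator (fun _ => (1 : ℝ)) ω *
      ⟪B.X i ω k, v⟫ ^ 2) μ ∧
      ∫ ω, (B.U i ⁻¹' {k}).indicator (fun _ => (1 : ℝ)) ω * ⟪B.X i ω k, v⟫ ^ 2 ∂μ
        = 1 / K * ∫ ω, ⟪B.X i ω k, v⟫ ^ 2 ∂μ := by
    intro k
    have hmk : MeasurableSet (B.U i ⁻¹' {k}) := hU (measurableSet_singleton k)
    constructor
    · refine ((hintg k).indicator hmk).congr (Filter.Eventually.of_forall fun ω => ?_)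
      by_cases hω : ω ∈ B.U i ⁻¹' {k} <;> simp [Set.indicator, hω]
    · have m1 : Measurable fun l : Fin K => ({k} : Set (Fin K)).indicator (fun _ => (1 : ℝ)) l :=
        measurable_const.indicator (measurableSet_singleton k)
      have m2 : Measurable fun q : ((Fin K → Vec d) × Vec d) × Fin 2 × ℝ => ⟪q.1.1 k, v⟫ ^ 2 :=
        ((((measurable_pi_apply k).comp measurable_fst.fst)).inner measurable_const).pow_const 2
      have hi : IndepFun (fun ω => (B.U i ⁻¹' {k}).indicator (fun _ => (1 : ℝ)) ω)
          (fun ω => ⟪B.X i ω k, v⟫ ^ 2) μ := (hB.explore_indep i).comp m1 m2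
      rw [hi.integral_fun_mul_eq_mul_integral (measurable_const.indicator hmk).aestronglyMeasurable
        (hintg k).aestronglyMeasurable, integral_indicator hmk]
      have := hB.explore_law i k
      simp only [integral_const, smul_eq_mul, mul_one,
        measureReal_restrict_apply MeasurableSet.univ, Set.univ_inter]
      congr 1
  simp_rw [hpt]
  rw [integral_finsetSum _ fun k _ => (hk k).1]
  simp_rw [(hk _).2]
  have hne : (Finset.univ : Finset (Fin K)).Nonempty := ⟨⟨0, hK⟩, Finset.mem_univ _⟩
  have hK' : (0 : ℝ) < K := by exact_mod_cast hK
  calc 1 / M = ∑ _k : Fin K, 1 / (K : ℝ) * (1 / M) := by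
        simp only [Finset.sum_const, Finset.card_univ, Fintype.card_fin, nsmul_eq_mul]
        field_simp
    _ < _ := Finset.sum_lt_sum_of_nonempty hne fun k _ =>
        mul_lt_mul_of_pos_left ((hR.moment_X i k).1 v hv) (by positivity)

end Sample

/-! ### Conditioning on the past -/

/-- The space of everything random about one customer. -/
abbrev Customer (d K : ℕ) : Type := ((Fin K → Vec d) × Vec d) × Fin 2 × ℝ × Fin K

/-- The record of a customer who is served by the rule `α`. -/
def custObs {d K : ℕ} (γs : Param d) (α : ((Fin K → Vec d) × Vec d) × Fin K → Fin K)
    (c : Customer d K) : Obs d :=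
  (⟪c.1.1 (α (c.1, c.2.2.2)), if c.2.1 = 0 then γs.2.1 else γs.2.2⟫ + c.2.2.1,
    c.1.1 (α (c.1, c.2.2.2)), c.1.2)

lemma measurable_custObs {d K : ℕ} (γs : Param d)
    {pol : Param d → ((Fin K → Vec d) × Vec d) × Fin K → Fin K}
    (hpol : Measurable fun q : Param d × ((Fin K → Vec d) × Vec d) × Fin K => pol q.1 q.2) :
    Measurable fun q : Param d × Customer d K => custObs γs (pol q.1) q.2 := by
  have h1 : Measurable fun q : Param d × Customer d K => pol q.1 (q.2.1, q.2.2.2.2) :=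
    hpol.comp (f := fun q : Param d × Customer d K => (q.1, (q.2.1, q.2.2.2.2)))
      (measurable_fst.prodMk (measurable_snd.fst.prodMk measurable_snd.snd.snd.snd))
  have h2 : Measurable fun q : Param d × Customer d K => q.2.1.1 (pol q.1 (q.2.1, q.2.2.2.2)) :=
    measurable_eval_fin.comp (measurable_snd.fst.fst.prodMk h1)
  have h3 : Measurable fun q : Param d × Customer d K =>
      if q.2.2.1 = 0 then γs.2.1 else γs.2.2 :=
    Measurable.ite (measurable_snd.snd.fst (measurableSet_singleton 0)) measurable_const
      measurable_const
  exact ((h2.inner h3).add measurable_snd.snd.snd.fst).prodMk (h2.prodMk measurable_snd.fst.snd)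

lemma measurable_greedyArm {d K : ℕ} {am : (Fin K → ℝ) → Fin K} (ham : Measurable am) :
    Measurable fun q : Param d × ((Fin K → Vec d) × Vec d) × Fin K =>
      greedyArm am q.1 q.2.1 := by
  unfold greedyArm
  refine ham.comp (measurable_pi_lambda _ fun k => Measurable.inner ?_ ?_)
  · exact (measurable_pi_apply k).comp measurable_snd.fst.fst
  · exact Measurable.ite (measurableSet_le measurable_const
      (measurable_snd.fst.snd.inner measurable_fst.fst)) measurable_fst.snd.fst measurable_fst.snd.snd

/-- A bound that holds conditionally on an independent variable holds unconditionally. -/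
lemma measureReal_le_of_indepFun {Ω α β : Type*} [MeasurableSpace Ω] [MeasurableSpace α]
    [MeasurableSpace β] {μ : Measure Ω} [IsProbabilityMeasure μ] {Y : Ω → α} {C : Ω → β}
    (hY : Measurable Y) (hC : Measurable C) (hind : IndepFun Y C μ) {good : Set α}
    (hgood : MeasurableSet good) {bad : Set (α × β)} (hbad : MeasurableSet bad) {p : ℝ}
    (hp : 0 ≤ p) (h : ∀ y ∈ good, μ.real {ω | (y, C ω) ∈ bad} ≤ p) :
    μ.real {ω | Y ω ∈ good ∧ (Y ω, C ω) ∈ bad} ≤ p := by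
  have pY : IsProbabilityMeasure (μ.map Y) := Measure.isProbabilityMeasure_map hY.aemeasurable
  have pC : IsProbabilityMeasure (μ.map C) := Measure.isProbabilityMeasure_map hC.aemeasurable
  set A : Set (α × β) := Prod.fst ⁻¹' good ∩ bad with hA
  have hAm : MeasurableSet A := (measurable_fst hgood).inter hbad
  have e : μ {ω | Y ω ∈ good ∧ (Y ω, C ω) ∈ bad} = (μ.map Y).prod (μ.map C) A := by
    rw [← hind.map_prod_eq_prod_map_map hY.aemeasurable hC.aemeasurable,
      Measure.map_apply (hY.prodMk hC) hAm]
    rfl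
  rw [measureReal_def, e, Measure.prod_apply hAm]
  refine ENNReal.toReal_le_of_le_ofReal hp ?_
  calc ∫⁻ y, μ.map C (Prod.mk y ⁻¹' A) ∂(μ.map Y) ≤ ∫⁻ _, ENNReal.ofReal p ∂(μ.map Y) := by
        refine lintegral_mono fun y => ?_
        by_cases hy : y ∈ good
        · rw [Measure.map_apply hC (measurable_prodMk_left hAm)]
          have h2 := h y hy
          refine (ENNReal.le_ofReal_iff_toReal_le (measure_ne_top _ _) hp).2 (le_trans ?_ h2)
          exact measureReal_mono fun ω hω => hω.2
        · have : Prod.mk y ⁻¹' A = ∅ := by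
            ext c
            simp [hA, hy]
          rw [this]; simp
    _ = ENNReal.ofReal p := by simp

/-- The favourable event only depends on the records of the batch. -/
lemma BatchGood.congr {d : ℕ} {σ : ℝ} {γs γ : Param d} {I : Finset ℕ} {o o' : ℕ → Obs d}
    {mean : ℕ → Fin 3 → Vec d} {m k : ℕ} {lam ρ B Ccol ccurv : ℝ}
    (h : BatchGood σ γs γ I o mean m k lam ρ B Ccol ccurv) (ho : ∀ i ∈ I, o i = o' i) :
    BatchGood σ γs γ I o' mean m k lam ρ B Ccol ccurv := by
  refine ⟨fun c φ => ?_, fun c j => ?_, fun c φ h1 h2 => ?_⟩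
  · refine (le_of_eq (Finset.sum_congr rfl fun i hi => ?_)).trans (h.noise c φ)
    rw [ho i hi]
  · refine (le_of_eq (Finset.sum_congr rfl fun i hi => ?_)).trans (h.column c j)
    rw [ho i hi]
  · refine (h.curvature c φ h1 h2).trans (le_of_eq (Finset.sum_congr rfl fun i hi => ?_))
    rw [ho i hi]

lemma measurableSet_batchGood {𝒴 : Type*} [MeasurableSpace 𝒴] {d : ℕ} (σ : ℝ) (γs : Param d)
    (I : Finset ℕ) {γ : 𝒴 → Param d} (hγ : Measurable γ) {o : ℕ → 𝒴 → Obs d}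
    (ho : ∀ i, Measurable (o i)) {mean : ℕ → Fin 3 → 𝒴 → Vec d}
    (hmean : ∀ i c, Measurable (mean i c)) (m k : ℕ) (lam ρ B Ccol ccurv : ℝ) :
    MeasurableSet {y | BatchGood σ γs (γ y) I (fun i => o i y) (fun i c => mean i c y)
      m k lam ρ B Ccol ccurv} := by
  have hs : ∀ c i, Measurable fun y => score σ γs c (γ y) (o i y) := fun c i =>
    Measurable.comp (g := fun p : Param d × Obs d => score σ γs c p.1 p.2)
      (f := fun y => (γ y, o i y)) (measurable_score σ γs c) (hγ.prodMk (ho i))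
  have hw : ∀ c i, Measurable fun y => cweight σ c (γ y) (o i y) := fun c i =>
    Measurable.comp (g := fun p : Param d × Obs d => cweight σ c p.1 p.2)
      (f := fun y => (γ y, o i y)) (measurable_cweight σ c) (hγ.prodMk (ho i))
  have hf : ∀ c i, Measurable fun y => feat c (o i y) := fun c i => (measurable_feat c).comp (ho i)
  have h1 : MeasurableSet {y | ∀ (c : Fin 3) (φ : Fin m → Fin d × Bool),
      ∑ i ∈ I, ⟪score σ γs c (γ y) (o i y) - mean i c y, dirVec φ⟫
        ≤ I.card * (‖dirVec φ‖ * (√m * lam / 2))} := by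
    simp only [Set.ofPred_forall]
    refine MeasurableSet.iInter fun c => MeasurableSet.iInter fun φ => measurableSet_le ?_
      measurable_const
    exact Finset.measurable_fun_sum I fun i _ =>
      ((hs c i).sub (hmean i c)).inner measurable_const
  have h2 : MeasurableSet {y | ∀ (c : Fin 3) (j : Fin d),
      ∑ i ∈ I, (feat c (o i y) j) ^ 2 ≤ Ccol * I.card} := by
    simp only [Set.ofPred_forall]
    refine MeasurableSet.iInter fun c => MeasurableSet.iInter fun j => measurableSet_le ?_
      measurable_const
    refine Finset.measurable_fun_sum I fun i _ => Measurable.pow_const ?_ 2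
    exact (EuclideanSpace.proj (𝕜 := ℝ) j).continuous.measurable.comp (hf c i)
  have h3 : MeasurableSet {y | ∀ (c : Fin 3) (φ : Fin k → Fin d × Bool),
      1 / 2 ≤ ‖(ρ / k) • dirVec φ‖ → ‖(ρ / k) • dirVec φ‖ ≤ 3 / 2 →
      ccurv * I.card ≤ ∑ i ∈ I, cweight σ c (γ y) (o i y) *
        (min |⟪feat c (o i y), (ρ / k) • dirVec φ⟫| B) ^ 2} := by
    simp only [Set.ofPred_forall]
    refine MeasurableSet.iInter fun c => MeasurableSet.iInter fun φ =>
      MeasurableSet.iInter fun _ => MeasurableSet.iInter fun _ => measurableSet_le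
      measurable_const ?_
    exact Finset.measurable_fun_sum I fun i _ =>
      (hw c i).mul (measurable_trunc ((hf c i).inner measurable_const) B)
  convert h1.inter (h2.inter h3) using 1
  ext y
  exact ⟨fun h => ⟨h.noise, h.column, h.curvature⟩, fun h => ⟨h.1, h.2.1, h.2.2⟩⟩

section Adapted

variable {Ω : Type*} {d K : ℕ}

/-- The initial estimate together with the first `N` customers. -/
def history (γ₀ : Ω → Param d) (B : Primitives Ω d K) (N : ℕ) (ω : Ω) :
    Param d × (Finset.range N → Customer d K) :=
  (γ₀ ω, fun j => B.customer j ω)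

/-- The information in the initial estimate and the first `N` customers. -/
abbrev past (γ₀ : Ω → Param d) (B : Primitives Ω d K) (N : ℕ) : MeasurableSpace Ω :=
  MeasurableSpace.comap (history γ₀ B N) inferInstance

lemma measurable_past_init (γ₀ : Ω → Param d) (B : Primitives Ω d K) (N : ℕ) :
    Measurable[past γ₀ B N] γ₀ :=
  measurable_fst.comp (comap_measurable (history γ₀ B N))

lemma measurable_past_customer (γ₀ : Ω → Param d) (B : Primitives Ω d K) {N i : ℕ} (hi : i < N) :
    Measurable[past γ₀ B N] (B.customer i) :=
  ((measurable_pi_apply (⟨i, Finset.mem_range.2 hi⟩ : Finset.range N)).comp measurable_snd).comp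
    (comap_measurable (history γ₀ B N))

lemma past_mono (γ₀ : Ω → Param d) (B : Primitives Ω d K) {N N' : ℕ} (h : N ≤ N') :
    past γ₀ B N ≤ past γ₀ B N' := by
  refine Measurable.comap_le ?_
  exact (measurable_past_init γ₀ B N').prodMk (@measurable_pi_lambda _ _ _ (past γ₀ B N') _ _ fun j =>
    measurable_past_customer γ₀ B ((Finset.mem_range.1 j.2).trans_le h))

end Adapted

/-! ### The run of the algorithm -/

lemma epStart_succ (n₀ τ : ℕ) : epStart n₀ (τ + 1) = epStart n₀ τ + epLen n₀ τ :=
  Finset.sum_range_succ _ _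

lemma exists_episode {n₀ i : ℕ} (hn : 0 < n₀) :
    ∃ τ, epStart n₀ τ ≤ i ∧ i < epStart n₀ (τ + 1) := by
  induction i with
  | zero => exact ⟨0, by simp [epStart], by simp [epStart, epLen, hn]⟩
  | succ i ih =>
    obtain ⟨τ, h1, h2⟩ := ih
    rcases Nat.lt_or_ge (i + 1) (epStart n₀ (τ + 1)) with h | h
    · exact ⟨τ, by omega, h⟩
    · refine ⟨τ + 1, h, ?_⟩
      rw [epStart_succ n₀ (τ + 1)]
      have : 0 < epLen n₀ (τ + 1) := by unfold epLen; positivity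
      omega

lemma batchEnd_mono (n₀ : ℕ) (tmax : ℕ → ℕ) (τ : ℕ) : Monotone (batchEnd n₀ tmax τ) := by
  intro t t' h
  unfold batchEnd
  gcongr

lemma batchEnd_le_epStart (n₀ : ℕ) (tmax : ℕ → ℕ) {τ t : ℕ} (hτ : 1 ≤ τ) (ht : t ≤ tmax τ) :
    batchEnd n₀ tmax τ t ≤ epStart n₀ τ := by
  obtain ⟨r, rfl⟩ : ∃ r, τ = r + 1 := ⟨τ - 1, by omega⟩
  unfold batchEnd batchSize
  rw [Nat.add_sub_cancel, epStart_succ]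
  have h1 : t * (epLen n₀ r / tmax (r + 1)) ≤ tmax (r + 1) * (epLen n₀ r / tmax (r + 1)) :=
    Nat.mul_le_mul_right _ ht
  have h2 := Nat.mul_div_le (epLen n₀ r) (tmax (r + 1))
  omega

lemma card_batch (n₀ : ℕ) (tmax : ℕ → ℕ) {τ t : ℕ} (ht : 1 ≤ t) :
    (batch n₀ tmax τ t).card = batchSize n₀ tmax τ := by
  obtain ⟨r, rfl⟩ : ∃ r, t = r + 1 := ⟨t - 1, by omega⟩
  unfold batch batchEnd
  rw [Nat.card_Ico, Nat.add_sub_cancel, Nat.succ_mul]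
  omega

/-- The rule that serves the customers whose records are used in episode `τ`. -/
def policy {d K : ℕ} (am : (Fin K → ℝ) → Fin K) (τ : ℕ) (γ : Param d)
    (w : ((Fin K → Vec d) × Vec d) × Fin K) : Fin K :=
  if τ = 1 then w.2 else greedyArm am γ w.1

lemma measurable_policy {d K : ℕ} {am : (Fin K → ℝ) → Fin K} (ham : Measurable am) (τ : ℕ) :
    Measurable fun q : Param d × ((Fin K → Vec d) × Vec d) × Fin K => policy am τ q.1 q.2 := by
  unfold policy
  split_ifs
  · exact measurable_snd.snd
  · exact measurable_greedyArm ham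

section Run

variable {Ω : Type*} [MeasurableSpace Ω] {μ : Measure Ω} {d K : ℕ} {am : (Fin K → ℝ) → Fin K}
  {γs : Param d} {σ : ℝ} {B : Primitives Ω d K} {n₀ : ℕ} {tmax : ℕ → ℕ} {lam : ℕ → ℕ → ℝ}
  {a : ℕ → Ω → Fin K} {γ : ℕ → ℕ → Ω → Param d}

namespace IsRun

lemma obs_batch (hrun : IsRun μ am γs σ B n₀ tmax lam a γ) {τ t i : ℕ} (hτ : 1 ≤ τ)
    (ht : t ≤ tmax τ) (hi : i ∈ batch n₀ tmax τ t) (ω : Ω) :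
    B.obs γs a i ω = custObs γs (policy am τ (γ τ 0 ω)) (B.customer i ω) := by
  obtain ⟨h1, h2⟩ := Finset.mem_Ico.1 hi
  have h3 : epStart n₀ (τ - 1) ≤ i := (Nat.le_add_right _ _).trans h1
  have h4 : i < epStart n₀ τ := h2.trans_le (batchEnd_le_epStart n₀ tmax hτ ht)
  have harm : a i ω = policy am τ (γ τ 0 ω) (B.ctx i ω, B.U i ω) := by
    unfold policy
    split_ifs with h
    · subst h
      exact hrun.explore i ω (by simpa [epStart] using h4)
    · have h5 := hrun.exploit (τ - 1) i ω (by omega) h3 (by rwa [Nat.sub_add_cancel hτ])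
      rw [h5, hrun.warm_start τ ω (by omega)]
  simp only [Primitives.obs, custObs, Primitives.customer, harm]
  rfl

lemma measurable_iterate_of_obs (hrun : IsRun μ am γs σ B n₀ tmax lam a γ) {τ t N : ℕ}
    (hτ : 1 ≤ τ) (ht1 : 1 ≤ t) (ht : t ≤ tmax τ) (hN : batchEnd n₀ tmax τ t ≤ N)
    (hobs : ∀ i < N, Measurable[past (γ 1 0) B N] (B.obs γs a i)) :
    Measurable[past (γ 1 0) B N] (γ τ t) := by
  refine (hrun.adapted τ t hτ ht1 ht).mono (Measurable.comap_le ?_) le_rfl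
  exact (measurable_past_init (γ 1 0) B N).prodMk
    (@measurable_pi_lambda _ _ _ (past (γ 1 0) B N) _ _ fun j => hobs j (j.2.trans_le hN))

lemma measurable_obs (hrun : IsRun μ am γs σ B n₀ tmax lam a γ) (ham : Measurable am)
    (hn : 0 < n₀) (htmax : ∀ τ, 1 ≤ τ → 1 ≤ tmax τ) (i : ℕ) :
    Measurable[past (γ 1 0) B (i + 1)] (B.obs γs a i) := by
  induction i using Nat.strong_induction_on with
  | _ i ih =>
    have hc := measurable_past_customer (γ 1 0) B (Nat.lt_succ_self i)
    obtain ⟨τ, h1, h2⟩ := exists_episode (i := i) hn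
    rcases Nat.eq_zero_or_pos τ with rfl | hτ
    · have harm : ∀ ω, a i ω = B.U i ω := fun ω => hrun.explore i ω (by simpa [epStart] using h2)
      have e : B.obs γs a i = (fun q : Param d × Customer d K => custObs γs (policy am 1 q.1) q.2) ∘
          fun ω => (γ 1 0 ω, B.customer i ω) := by
        ext1 ω
        simp only [Primitives.obs, custObs, Primitives.customer, harm, Function.comp_apply, policy]
        rfl
      rw [e]
      exact (measurable_custObs γs (measurable_policy ham 1)).comp
        ((measurable_past_init (γ 1 0) B (i + 1)).prodMk hc)
    · have hγ : Measurable[past (γ 1 0) B (i + 1)] (γ τ (tmax τ)) := by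
        have h3 : batchEnd n₀ tmax τ (tmax τ) ≤ i := (batchEnd_le_epStart n₀ tmax hτ le_rfl).trans h1
        have := hrun.measurable_iterate_of_obs hτ (htmax τ hτ) le_rfl h3 fun j hj =>
          (ih j hj).mono (past_mono (γ 1 0) B hj) le_rfl
        exact this.mono (past_mono (γ 1 0) B (Nat.le_succ i)) le_rfl
      have e : B.obs γs a i = (fun q : Param d × Customer d K => custObs γs (policy am 2 q.1) q.2) ∘
          fun ω => (γ τ (tmax τ) ω, B.customer i ω) := by
        ext1 ω
        simp only [Primitives.obs, custObs, Primitives.customer, hrun.exploit τ i ω hτ h1 h2,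
          Function.comp_apply, policy]
        rfl
      rw [e]
      exact (measurable_custObs γs (measurable_policy ham 2)).comp (hγ.prodMk hc)

lemma measurable_iterate (hrun : IsRun μ am γs σ B n₀ tmax lam a γ) (ham : Measurable am)
    (hn : 0 < n₀) (htmax : ∀ τ, 1 ≤ τ → 1 ≤ tmax τ) {τ t : ℕ} (hτ : 1 ≤ τ) (ht : t ≤ tmax τ) :
    Measurable[past (γ 1 0) B (batchEnd n₀ tmax τ t)] (γ τ t) := by
  have hobs : ∀ N, ∀ i < N, Measurable[past (γ 1 0) B N] (B.obs γs a i) := fun N i hi =>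
    (hrun.measurable_obs ham hn htmax i).mono (past_mono (γ 1 0) B hi) le_rfl
  rcases Nat.eq_zero_or_pos t with rfl | ht1
  · rcases Nat.lt_or_ge τ 2 with h | h
    · obtain rfl : τ = 1 := by omega
      exact measurable_past_init (γ 1 0) B _
    · have e : γ τ 0 = γ (τ - 1) (tmax (τ - 1)) := funext fun ω => hrun.warm_start τ ω h
      rw [e]
      refine hrun.measurable_iterate_of_obs (by omega) (htmax _ (by omega)) le_rfl ?_ (hobs _)
      refine (batchEnd_le_epStart n₀ tmax (by omega) le_rfl).trans ?_
      unfold batchEnd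
      exact Nat.le_add_right _ _
  · exact hrun.measurable_iterate_of_obs hτ ht1 ht le_rfl (hobs _)

lemma past_le (hrun : IsRun μ am γs σ B n₀ tmax lam a γ) (hB : IsLatentBandit μ γs σ B) (N : ℕ) :
    past (γ 1 0) B N ≤ ‹MeasurableSpace Ω› :=
  Measurable.comap_le (hrun.init_measurable.prodMk
    (measurable_pi_lambda _ fun j => hB.measurable_customer j))

variable [IsProbabilityMeasure μ]

lemma indepFun_history (hrun : IsRun μ am γs σ B n₀ tmax lam a γ) (hB : IsLatentBandit μ γs σ B)
    {N : ℕ} {I : Finset ℕ} (hI : ∀ i ∈ I, N ≤ i) :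
    IndepFun (history (γ 1 0) B N) (fun ω (i : I) => B.customer i ω) μ := by
  have hdisj : Disjoint (Finset.range N) I :=
    Finset.disjoint_left.2 fun i h1 h2 => absurd (Finset.mem_range.1 h1) (not_lt.2 (hI i h2))
  have h1 := hB.indep_customers.indepFun_finset (Finset.range N) I hdisj hB.measurable_customer
  have h2 : IndepFun (γ 1 0) (fun ω => ((fun j : Finset.range N => B.customer j ω),
      (fun i : I => B.customer i ω))) μ :=
    hrun.init_indep.comp (φ := id) (ψ := fun c : ℕ → Customer d K =>
        ((fun j : Finset.range N => c j), (fun i : I => c i))) measurable_id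
      ((measurable_pi_lambda _ fun j => measurable_pi_apply _).prodMk
        (measurable_pi_lambda _ fun j => measurable_pi_apply _))
  exact indepFun_prodMk_left hrun.init_measurable
    (measurable_pi_lambda _ fun j => hB.measurable_customer j)
    (measurable_pi_lambda _ fun j => hB.measurable_customer j) h2 h1

/-- The iterates are independent of the customers in later batches. -/
lemma indepFun_batch (hrun : IsRun μ am γs σ B n₀ tmax lam a γ) (hB : IsLatentBandit μ γs σ B)
    (ham : Measurable am) (hn : 0 < n₀) (htmax : ∀ τ, 1 ≤ τ → 1 ≤ tmax τ) {τ t : ℕ} (hτ : 1 ≤ τ)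
    (ht1 : 1 ≤ t) (ht : t ≤ tmax τ) :
    Measurable (fun ω => (γ τ (t - 1) ω, γ τ 0 ω)) ∧
      IndepFun (fun ω => (γ τ (t - 1) ω, γ τ 0 ω))
        (fun ω (i : batch n₀ tmax τ t) => B.customer i ω) μ := by
  set N := batchEnd n₀ tmax τ (t - 1) with hN
  have m1 : Measurable[past (γ 1 0) B N] (γ τ (t - 1)) :=
    hrun.measurable_iterate ham hn htmax hτ (by omega)
  have m2 : Measurable[past (γ 1 0) B N] (γ τ 0) :=
    (hrun.measurable_iterate ham hn htmax hτ (Nat.zero_le _)).mono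
      (past_mono (γ 1 0) B (batchEnd_mono n₀ tmax τ (Nat.zero_le _))) le_rfl
  have m3 : Measurable[past (γ 1 0) B N] (fun ω => (γ τ (t - 1) ω, γ τ 0 ω)) := m1.prodMk m2
  refine ⟨m3.mono (hrun.past_le hB N) le_rfl, ?_⟩
  have hI : ∀ i ∈ batch n₀ tmax τ t, N ≤ i := fun i hi => (Finset.mem_Ico.1 hi).1
  have h := hrun.indepFun_history hB hI
  rw [IndepFun_iff_Indep] at h ⊢
  exact indep_of_indep_of_le_left h m3.comap_le

end IsRun

end Run

lemma measurable_err2 {d : ℕ} (γs : Param d) : Measurable fun γ : Param d => err2 γ γs := by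
  unfold err2; fun_prop

section Step

variable {Ω : Type*} [MeasurableSpace Ω] {μ : Measure Ω} [IsProbabilityMeasure μ] {d K : ℕ}
  {am : (Fin K → ℝ) → Fin K} {γs : Param d} {σ : ℝ} {B : Primitives Ω d K} {n₀ : ℕ}
  {tmax : ℕ → ℕ} {lam : ℕ → ℕ → ℝ} {a : ℕ → Ω → Fin K} {γ : ℕ → ℕ → Ω → Param d}

/-- The expected score of customer `i` for given weights and a given rule. -/
def meanScore (μ : Measure Ω) (B : Primitives Ω d K) (σ : ℝ) (γs : Param d)
    (pol : Param d → ((Fin K → Vec d) × Vec d) × Fin K → Fin K) (i : ℕ) (c : Fin 3)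
    (y : Param d × Param d) : Vec d :=
  ∫ ω, score σ γs c y.1 (custObs γs (pol y.2) (B.customer i ω)) ∂μ

lemma measurable_meanScore (hB : IsLatentBandit μ γs σ B)
    {pol : Param d → ((Fin K → Vec d) × Vec d) × Fin K → Fin K}
    (hpol : Measurable fun q : Param d × ((Fin K → Vec d) × Vec d) × Fin K => pol q.1 q.2)
    (i : ℕ) (c : Fin 3) : Measurable (meanScore μ B σ γs pol i c) := by
  have h1 : Measurable fun q : (Param d × Param d) × Ω =>
      custObs γs (pol q.1.2) (B.customer i q.2) :=
    Measurable.comp (g := fun q : Param d × Customer d K => custObs γs (pol q.1) q.2)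
      (f := fun q : (Param d × Param d) × Ω => (q.1.2, B.customer i q.2))
      (measurable_custObs γs hpol)
      (measurable_fst.snd.prodMk ((hB.measurable_customer i).comp measurable_snd))
  have h2 : Measurable fun q : (Param d × Param d) × Ω =>
      score σ γs c q.1.1 (custObs γs (pol q.1.2) (B.customer i q.2)) :=
    Measurable.comp (g := fun p : Param d × Obs d => score σ γs c p.1 p.2)
      (f := fun q : (Param d × Param d) × Ω => (q.1.1, custObs γs (pol q.1.2) (B.customer i q.2)))
      (measurable_score σ γs c) (measurable_fst.fst.prodMk h1)
  exact (h2.stronglyMeasurable.integral_prod_right (ν := μ)).measurable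

lemma isSample_policy (hB : IsLatentBandit μ γs σ B) {s : ℕ} {ξ M S L CSNR δ h : ℝ}
    (ham : Measurable am) (hR : Regular μ s ξ M S L σ CSNR δ am γs B) (hS : 0 < S)
    (hσ : 0 < σ) (hC : 0 < CSNR) (hh : 0 < h) (τ : ℕ) {γg : Param d} (hg : err2 γg γs ≤ δ)
    (i : ℕ) :
    IsSample μ γs σ ξ M (envScale S σ) (envBound K S σ)
      (K * (L * h) + 1 / (h * (CSNR * σ)) ^ 2) (chosen B (policy am τ γg) i) (B.Z i) (B.g i)
      (B.ε i) := by
  have hα : Measurable (policy am τ γg) :=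
    Measurable.comp (g := fun q : Param d × ((Fin K → Vec d) × Vec d) × Fin K =>
      policy am τ q.1 q.2) (f := fun w => (γg, w)) (measurable_policy ham τ) measurable_prodMk_left
  refine isSample_chosen hB hR hS hσ hC hh hα i ?_
  by_cases hτ : τ = 1
  · have e : chosen B (policy am τ γg) i = chosen B (fun w => w.2) i := by
      ext1 ω; simp [chosen, policy, hτ]
    rw [e]
    exact explore_moment hB hR hS i
  · have e : chosen B (policy am τ γg) i = fun ω => B.X i ω (greedyArm am γg (B.ctx i ω)) := by
      ext1 ω; simp [chosen, policy, hτ]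
    rw [e]
    exact hR.greedy i γg hg

/-- One iteration of the algorithm succeeds with high probability. -/
lemma IsRun.step_probability (hrun : IsRun μ am γs σ B n₀ tmax lam a γ)
    (hB : IsLatentBandit μ γs σ B) (ham : Measurable am) {s : ℕ} {ξ M S L CSNR δ h : ℝ}
    (hR : Regular μ s ξ M S L σ CSNR δ am γs B) (hS : 0 < S) (hσ : 0 < σ) (hC : 0 < CSNR)
    (hh : 0 < h) (hξ : 0 < ξ) (hξ1 : ξ < 1 / 2) (hM : 1 < M) (hn : 0 < n₀)
    (htmax : ∀ τ, 1 ≤ τ → 1 ≤ tmax τ) (hd : 0 < d) {Cw : ℝ} (hCw : 1 ≤ Cw)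
    (hW : WeightBound σ (Real.log (1 / ξ)) Cw) {κ : ℝ} (hκ : 0 < κ) (hκM : κ ≤ ξ / (36 * M))
    (hsep : K * (L * h) + 1 / (h * (CSNR * σ)) ^ 2
      ≤ κ ^ 2 / ((9375 * Cw) ^ 2 * envMoment (envScale S σ) (envBound K S σ)))
    {R : ℝ} (hR1 : 1 ≤ R) (hRm : 48 * M * (2 * envScale S σ ^ 2 * envBound K S σ) ≤ R ^ 2)
    {τ t m k : ℕ} (hτ : 1 ≤ τ) (ht1 : 1 ≤ t) (ht : t ≤ tmax τ) (hm : 0 < m) (hk : 0 < k)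
    (hnb : 0 < batchSize n₀ tmax τ) {e η ρ : ℝ} (he : e ≤ 1) (hlam : 0 < lam τ t) (hρ0 : 0 < ρ)
    (hη0 : 0 ≤ η) (hη : (1 + 1 / σ ^ 2) * κ * e ≤ η)
    (hk1 : ρ ^ 2 * (9 * envBound K S σ * envScale S σ + 1) / k ≤ 1 / 4)
    (hk2 : ρ ^ 2 * (9 * envBound K S σ * envScale S σ + 1) / k ≤ ξ / (32 * M) / 4)
    (hρ : 4 * √s + m + 2 * η / lam τ t ≤ ρ)
    (hsmall : 2 * lam τ t * √s + m * lam τ t / 2 + η < lossCurv σ ξ * (ξ / (32 * M) / (4 * R)))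
    (hr : √m * lam τ t / 2 ≤ 8 * envBound K S σ * ((3 * Cw / σ ^ 2 + 1) * envScale S σ)) :
    μ.real {ω | (err2 (γ τ (t - 1) ω) γs ≤ e ∧ err2 (γ τ 0 ω) γs ≤ δ) ∧
        ¬ (err2 (γ τ t ω) γs ≤ 3 * ((2 * lam τ t * √s + m * lam τ t / 2 + η) /
            (lossCurv σ ξ * (ξ / (32 * M) / (4 * R)))) ∧
          err1 (γ τ t ω) γs ≤ ρ * err2 (γ τ t ω) γs)}
      ≤ 3 * ((2 * d) ^ m * Real.exp (-(batchSize n₀ tmax τ * (√m * lam τ t / 2) ^ 2 /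
            (32 * envBound K S σ * ((3 * Cw / σ ^ 2 + 1) * envScale S σ) ^ 2)))
          + d * Real.exp (-(2 * envBound K S σ * batchSize n₀ tmax τ))
          + (2 * d) ^ k * Real.exp (-(batchSize n₀ tmax τ * (ξ / (32 * M)) ^ 2 / (96 * R ^ 4)))) := by
  set I := batch n₀ tmax τ t with hI
  set K₀ := envScale S σ with hK₀
  set H := envBound K S σ with hH
  have hK₀p : 0 < K₀ := envScale_pos hS
  have hHp : 0 < H := envBound_pos K S σ
  have hcard : I.card = batchSize n₀ tmax τ := card_batch n₀ tmax ht1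
  have hIc : 0 < I.card := hcard ▸ hnb
  rw [← hcard]
  set pol : Param d → ((Fin K → Vec d) × Vec d) × Fin K → Fin K := policy am τ with hpol
  have hpolm := measurable_policy (d := d) ham τ
  obtain ⟨hYm, hYind⟩ := hrun.indepFun_batch hB ham hn htmax hτ ht1 ht
  set Y : Ω → Param d × Param d := fun ω => (γ τ (t - 1) ω, γ τ 0 ω) with hY
  obtain ⟨ω₀⟩ : Nonempty Ω := nonempty_of_isProbabilityMeasure μ
  set extend : (I → Customer d K) → ℕ → Customer d K := fun f i =>
    if hi : i ∈ I then f ⟨i, hi⟩ else B.customer 0 ω₀ with hext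
  have hextm : Measurable extend := by
    refine measurable_pi_lambda _ fun i => ?_
    by_cases hi : i ∈ I
    · simp only [hext, hi, dif_pos]
      exact measurable_pi_apply _
    · simp only [hext, hi, dif_neg, not_false_eq_true]
      exact measurable_const
  set C : Ω → ℕ → Customer d K := fun ω => extend fun i => B.customer i ω with hCdef
  have hCm : Measurable C := hextm.comp (measurable_pi_lambda _ fun j => hB.measurable_customer j)
  have hCI : ∀ ω, ∀ i ∈ I, C ω i = B.customer i ω := by
    intro ω i hi
    simp [hCdef, hext, hi]
  have hind : IndepFun Y C μ := hYind.comp (φ := id) measurable_id hextm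
  set good : Set (Param d × Param d) := {y | err2 y.1 γs ≤ e ∧ err2 y.2 γs ≤ δ} with hgood
  have hgoodm : MeasurableSet good :=
    (measurableSet_le ((measurable_err2 γs).comp measurable_fst) measurable_const).inter
      (measurableSet_le ((measurable_err2 γs).comp measurable_snd) measurable_const)
  set bg : Set ((Param d × Param d) × (ℕ → Customer d K)) := {q |
    BatchGood σ γs q.1.1 I (fun i => custObs γs (pol q.1.2) (q.2 i))
      (fun i c => meanScore μ B σ γs pol i c q.1) m k (lam τ t) ρ R (9 * H * K₀) (ξ / (32 * M))}
    with hbg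
  have hbgm : MeasurableSet bg := by
    refine measurableSet_batchGood σ γs I (γ := fun q : (Param d × Param d) × (ℕ → Customer d K) =>
      q.1.1) measurable_fst.fst (o := fun i q => custObs γs (pol q.1.2) (q.2 i)) (fun i => ?_)
      (mean := fun i c q => meanScore μ B σ γs pol i c q.1)
      (fun i c => (measurable_meanScore hB hpolm i c).comp measurable_fst) m k _ _ _ _ _
    exact Measurable.comp (g := fun q : Param d × Customer d K => custObs γs (pol q.1) q.2)
      (f := fun q : (Param d × Param d) × (ℕ → Customer d K) => (q.1.2, q.2 i))
      (measurable_custObs γs hpolm)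
      (measurable_fst.snd.prodMk ((measurable_pi_apply i).comp measurable_snd))
  set p : ℝ := 3 * ((2 * d) ^ m * Real.exp (-(I.card * (√m * lam τ t / 2) ^ 2 /
            (32 * H * ((3 * Cw / σ ^ 2 + 1) * K₀) ^ 2)))
          + d * Real.exp (-(2 * H * I.card))
          + (2 * d) ^ k * Real.exp (-(I.card * (ξ / (32 * M)) ^ 2 / (96 * R ^ 4)))) with hp
  have hp0 : 0 ≤ p := by positivity
  have hsample : ∀ y ∈ good, ∀ i, IsSample μ γs σ ξ M K₀ H
      (K * (L * h) + 1 / (h * (CSNR * σ)) ^ 2) (chosen B (pol y.2) i) (B.Z i) (B.g i) (B.ε i) :=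
    fun y hy i => isSample_policy hB ham hR hS hσ hC hh τ hy.2 i
  have hcond : ∀ y ∈ good, μ.real {ω | (y, C ω) ∈ bgᶜ} ≤ p := by
    intro y hy
    have hrm : ∀ i, Measurable (record γs (chosen B (pol y.2) i) (B.Z i) (B.g i) (B.ε i)) := by
      intro i
      exact Measurable.comp (g := fun q : Param d × Customer d K => custObs γs (pol q.1) q.2)
        (f := fun ω => (y.2, B.customer i ω)) (measurable_custObs γs hpolm)
        (measurable_const.prodMk (hB.measurable_customer i))
    have hco : Measurable fun c : Customer d K => custObs γs (pol y.2) c :=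
      Measurable.comp (g := fun q : Param d × Customer d K => custObs γs (pol q.1) q.2)
        (f := fun c => (y.2, c)) (measurable_custObs γs hpolm) measurable_prodMk_left
    have hri : iIndepFun (fun i => record γs (chosen B (pol y.2) i) (B.Z i) (B.g i) (B.ε i)) μ :=
      hB.indep_customers.comp (fun _ c => custObs γs (pol y.2) c) fun _ => hco
    have := batchGood_probability (I := I) (fun i _ => hsample y hy i) hrm hri hσ hξ hξ1 hM hK₀p
      hHp hCw hW hκ hκM hsep hR1 hRm (hy.1.trans he) m k ρ hlam.le hr
    refine le_trans (measureReal_mono fun ω hω => ?_) this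
    intro hg
    refine hω ?_
    exact hg.congr fun i hi => by
      change _ = custObs γs (pol y.2) (C ω i)
      rw [hCI ω i hi]; rfl
  have hfin := measureReal_le_of_indepFun hYm hCm hind hgoodm hbgm.compl hp0 hcond
  have hz : ∀ᵐ ω ∂μ, ∀ i, ξ < Real.sigmoid ⟪B.Z i ω, γs.1⟫ ∧
      Real.sigmoid ⟪B.Z i ω, γs.1⟫ < 1 - ξ := ae_all_iff.2 hR.group_nondegenerate
  refine le_trans (ENNReal.toReal_mono (measure_ne_top _ _) (measure_mono_ae ?_)) hfin
  filter_upwards [hz] with ω hzω hω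
  obtain ⟨hω1, hω2⟩ := hω
  refine ⟨hω1, fun hbad => hω2 ?_⟩
  have hobs : ∀ i ∈ I, custObs γs (pol (γ τ 0 ω)) (C ω i) = B.obs γs a i ω := fun i hi => by
    rw [hCI ω i hi, hrun.obs_batch hτ ht hi ω]
  have hg2 := BatchGood.congr hbad hobs
  have hsc : ∀ c, l0 (comp γs c) ≤ s := by
    intro c
    fin_cases c
    · exact hR.sparse_β₁
    · exact hR.sparse_β₂
    · exact hR.sparse_θ
  refine em_step_error hd hm hk hIc hσ hξ hlam hη0 hρ0 hR1 (by positivity)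
    (by have : 0 < M := by linarith
        positivity) (hrun.em_step τ t ω hτ ht1 ht) (fun i _ => hzω i) hg2 ?_ hsc hk1 hk2 hρ hsmall
  intro i hi c u
  have h1 := (hsample (Y ω) hω1 i).score_mean hσ hξ hK₀p hHp hCw hW hκ hsep
    (γ := γ τ (t - 1) ω) (hω1.1.trans he) c u
  refine le_trans h1 (mul_le_mul_of_nonneg_right (le_trans ?_ hη) (norm_nonneg u))
  exact mul_le_mul_of_nonneg_left hω1.1 (by positivity)

end Step

/-! ### One iteration with explicit constants -/

lemma exists_separation {k L σ κ : ℝ} (hk : 0 ≤ k) (hL : 0 < L) (hσ : 0 < σ) (hκ : 0 < κ) :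
    ∃ h CSNR : ℝ, 0 < h ∧ 0 < CSNR ∧ k * (L * h) + 1 / (h * (CSNR * σ)) ^ 2 ≤ κ := by
  have h1 : 0 < 2 * (k * L + 1) := by positivity
  refine ⟨κ / (2 * (k * L + 1)), (1 + 2 / κ) / (κ / (2 * (k * L + 1)) * σ), by positivity,
    by positivity, ?_⟩
  have e1 : κ / (2 * (k * L + 1)) * ((1 + 2 / κ) / (κ / (2 * (k * L + 1)) * σ) * σ) = 1 + 2 / κ := by
    field_simp
  rw [e1]
  have h2 : k * (L * (κ / (2 * (k * L + 1)))) ≤ κ / 2 := by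
    have : k * (L * (κ / (2 * (k * L + 1)))) = κ / 2 * (k * L / (k * L + 1)) := by field_simp
    rw [this]
    refine mul_le_of_le_one_right (by positivity) ?_
    rw [div_le_one (by positivity)]
    linarith
  have h3 : 1 / (1 + 2 / κ) ^ 2 ≤ κ / 2 := by
    rw [div_le_iff₀ (by positivity)]
    have e2 : κ / 2 * (1 + 2 / κ) ^ 2 = 1 + (κ / 2 + 1 + 2 / κ) := by field_simp; ring
    rw [e2]
    have : 0 < κ / 2 + 1 + 2 / κ := by positivity
    linarith
  linarith

lemma two_mul_pow_le_exp {d : ℕ} (hd : 2 ≤ d) (k : ℕ) :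
    (2 * d : ℝ) ^ k ≤ Real.exp (2 * k * Real.log d) := by
  have hd' : (2 : ℝ) ≤ d := by exact_mod_cast hd
  have h1 : (2 * d : ℝ) ≤ Real.exp (2 * Real.log d) := by
    rw [two_mul (Real.log d), Real.exp_add, Real.exp_log (by linarith)]
    exact mul_le_mul_of_nonneg_right hd' (by linarith)
  calc (2 * d : ℝ) ^ k ≤ Real.exp (2 * Real.log d) ^ k := pow_le_pow_left₀ (by positivity) h1 k
    _ = Real.exp (2 * k * Real.log d) := by rw [← Real.exp_nat_mul]; congr 1; ring

lemma failure_bound {d m k : ℕ} (hd : 2 ≤ d) (hk : 0 < k) {n x y c c₂ w : ℝ}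
    (hn : 0 ≤ n) (hx : 2 * c ≤ x) (hy : 2 * c ≤ y)
    (hkn : 2 * k * Real.log d ≤ c * n) :
    3 * ((2 * d : ℝ) ^ m * Real.exp (-(m * (c₂ * n * w))) + d * Real.exp (-(x * n))
        + (2 * d : ℝ) ^ k * Real.exp (-(n * y)))
      ≤ 3 * Real.exp (-(m * (c₂ * n * w - 2 * Real.log d))) + 6 * Real.exp (-(c * n)) := by
  have hd' : (2 : ℝ) ≤ d := by exact_mod_cast hd
  have h1 : (2 * d : ℝ) ^ m * Real.exp (-(m * (c₂ * n * w)))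
      ≤ Real.exp (-(m * (c₂ * n * w - 2 * Real.log d))) := by
    calc _ ≤ Real.exp (2 * m * Real.log d) * Real.exp (-(m * (c₂ * n * w))) :=
          mul_le_mul_of_nonneg_right (two_mul_pow_le_exp hd m) (Real.exp_pos _).le
      _ = _ := by rw [← Real.exp_add]; congr 1; ring
  have h2 : ∀ z, 2 * c ≤ z → (2 * d : ℝ) ^ k * Real.exp (-(z * n)) ≤ Real.exp (-(c * n)) := by
    intro z hz
    calc _ ≤ Real.exp (2 * k * Real.log d) * Real.exp (-(z * n)) :=
          mul_le_mul_of_nonneg_right (two_mul_pow_le_exp hd k) (Real.exp_pos _).le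
      _ = Real.exp (2 * k * Real.log d - z * n) := by rw [← Real.exp_add]; rfl
      _ ≤ _ := by
          rw [Real.exp_le_exp]
          have := mul_le_mul_of_nonneg_right hz hn
          linarith
  have h3 : (d : ℝ) * Real.exp (-(x * n)) ≤ Real.exp (-(c * n)) := by
    refine le_trans (mul_le_mul_of_nonneg_right ?_ (Real.exp_pos _).le) (h2 x hx)
    calc (d : ℝ) ≤ (2 * d) ^ 1 := by rw [pow_one]; linarith
      _ ≤ (2 * d) ^ k := pow_le_pow_right₀ (by linarith) hk
  have h4 := h2 y hy
  rw [mul_comm y n] at h4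
  linarith

/-- One iteration succeeds with high probability, with constants that only depend on the
parameters of the problem. -/
lemma exists_step_constants (K : ℕ) {ξ M S L σ : ℝ} (hξ : 0 < ξ) (hξ1 : ξ < 1 / 2) (hM : 1 < M)
    (hS : 0 < S) (hL : 0 < L) (hσ : 0 < σ) :
    ∃ C₁ c₁ c₂ c₃ C₂ : ℝ, 1 ≤ C₁ ∧ 0 < c₁ ∧ 0 < c₂ ∧ 0 < c₃ ∧ 0 < C₂ ∧
      ∀ q : ℝ, 0 < q → ∃ CSNR : ℝ, 0 < CSNR ∧
      ∀ (Ω : Type*) [MeasurableSpace Ω] (μ : Measure Ω) [IsProbabilityMeasure μ] (d s n₀ : ℕ)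
        (tmax : ℕ → ℕ) (lam : ℕ → ℕ → ℝ) (am : (Fin K → ℝ) → Fin K) (γs : Param d)
        (B : Primitives Ω d K) (a : ℕ → Ω → Fin K) (γ : ℕ → ℕ → Ω → Param d) (δ : ℝ),
        2 ≤ d → 1 ≤ s → 0 < n₀ → (∀ τ, 1 ≤ τ → 1 ≤ tmax τ) → Measurable am →
        IsLatentBandit μ γs σ B → Regular μ s ξ M S L σ CSNR δ am γs B →
        IsRun μ am γs σ B n₀ tmax lam a γ →
        ∀ (τ t m : ℕ) (e : ℝ), 1 ≤ τ → 1 ≤ t → t ≤ tmax τ → 1 ≤ m →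
          0 < batchSize n₀ tmax τ → 0 < lam τ t → 0 ≤ e → e ≤ 1 →
          q * e ≤ √s * m * lam τ t → √s * m * lam τ t ≤ c₃ →
          C₂ * s * m ^ 2 * Real.log d ≤ c₁ * batchSize n₀ tmax τ →
          μ.real {ω | (err2 (γ τ (t - 1) ω) γs ≤ e ∧ err2 (γ τ 0 ω) γs ≤ δ) ∧
            ¬ (err2 (γ τ t ω) γs ≤ C₁ * (√s * m * lam τ t) ∧
              err1 (γ τ t ω) γs ≤ 6 * √s * m * err2 (γ τ t ω) γs)}
            ≤ 3 * Real.exp (-(m * (c₂ * batchSize n₀ tmax τ * lam τ t ^ 2 - 2 * Real.log d)))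
              + 6 * Real.exp (-(c₁ * batchSize n₀ tmax τ)) := by
  obtain ⟨Cw, hCw, hW⟩ := weight_perturb (l := Real.log (1 / ξ)) hσ
    (Real.log_nonneg (by rw [le_div_iff₀ hξ]; linarith))
  have hM0 : 0 < M := by linarith
  set K₀ := envScale S σ with hK₀
  set H := envBound K S σ with hH
  have hK₀p : 0 < K₀ := envScale_pos hS
  have hHp : 0 < H := envBound_pos K S σ
  set K₁ := (3 * Cw / σ ^ 2 + 1) * K₀ with hK₁
  have hK₁p : 0 < K₁ := by positivity
  set R := 1 + 48 * M * (2 * K₀ ^ 2 * H) with hRdef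
  have hRm0 : 0 < 48 * M * (2 * K₀ ^ 2 * H) := by positivity
  have hR1 : 1 ≤ R := by linarith
  have hR0 : 0 < R := by linarith
  have hRm : 48 * M * (2 * K₀ ^ 2 * H) ≤ R ^ 2 := by
    calc 48 * M * (2 * K₀ ^ 2 * H) ≤ R := by linarith
      _ ≤ R ^ 2 := le_self_pow₀ hR1 two_ne_zero
  set cv := ξ / (32 * M) with hcv
  have hcv0 : 0 < cv := by positivity
  set cL := lossCurv σ ξ * (cv / (4 * R)) with hcL
  have hcL0 : 0 < cL := mul_pos (lossCurv_pos hσ hξ) (by positivity)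
  set Cc := 9 * H * K₀ + 1 with hCc
  have hCc0 : 0 < Cc := by positivity
  set D := 36 * Cc * (4 + 4 / cv) with hD
  have hD0 : 0 < D := by positivity
  set c₁ := min (2 * H) (cv ^ 2 / (96 * R ^ 4)) / 2 with hc₁
  have hc₁0 : 0 < c₁ := half_pos (lt_min (by positivity) (by positivity))
  refine ⟨max 1 (9 / cL), c₁, 1 / (128 * H * K₁ ^ 2), min (cL / 4) (8 * H * K₁), 2 * (D + 1),
    le_max_left _ _, hc₁0, by positivity, lt_min (by positivity) (by positivity), by positivity, ?_⟩
  intro q hq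
  set κ := min (ξ / (36 * M)) (q / (2 * (1 + 1 / σ ^ 2))) with hκdef
  have hκ0 : 0 < κ := lt_min (by positivity) (by positivity)
  have hEM := envMoment_pos hK₀p hHp
  obtain ⟨h, CSNR, hh, hC, hsep⟩ := exists_separation (k := K) (Nat.cast_nonneg K) hL hσ
    (κ := κ ^ 2 / ((9375 * Cw) ^ 2 * envMoment K₀ H)) (by positivity)
  refine ⟨CSNR, hC, ?_⟩
  intro Ω _ μ _ d s n₀ tmax lam am γs B a γ δ hd hs hn htmax ham hB hR hrun τ t m e hτ ht1 ht hm
    hnb hlam he0 he1 hqe hsm hC₂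
  have hm' : (1 : ℝ) ≤ m := by exact_mod_cast hm
  have hs' : (1 : ℝ) ≤ s := by exact_mod_cast hs
  have hss : 1 ≤ √(s : ℝ) := Real.one_le_sqrt.2 hs'
  have hss0 : 0 < √(s : ℝ) := by linarith
  have hsq : √(s : ℝ) ^ 2 = s := Real.sq_sqrt (by linarith)
  set l := lam τ t with hl
  have hx1 : √(s : ℝ) ≤ √s * m := le_mul_of_one_le_right hss0.le hm'
  have hx2 : (m : ℝ) ≤ √s * m := le_mul_of_one_le_left (by linarith) hss
  set X := √(s : ℝ) * m with hX
  have hX0 : 0 < X := by positivity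
  have hX1 : 1 ≤ X := hss.trans hx1
  have hXs : X ^ 2 = s * m ^ 2 := by rw [hX, mul_pow, hsq]
  set k := ⌈D * X ^ 2⌉₊ with hk
  have hk1 : D * X ^ 2 ≤ k := Nat.le_ceil _
  have hkp : 0 < D * X ^ 2 := by positivity
  have hk0 : (0 : ℝ) < k := hkp.trans_le hk1
  have hk2 : (k : ℝ) ≤ (D + 1) * X ^ 2 := by
    have := (Nat.ceil_lt_add_one hkp.le).le
    have hX2 : 1 ≤ X ^ 2 := one_le_pow₀ hX1
    calc (k : ℝ) ≤ D * X ^ 2 + 1 := this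
      _ ≤ D * X ^ 2 + X ^ 2 := by linarith
      _ = _ := by ring
  have hρk : (6 * X) ^ 2 * Cc / k ≤ 1 / (4 + 4 / cv) := by
    rw [div_le_div_iff₀ hk0 (by positivity)]
    calc (6 * X) ^ 2 * Cc * (4 + 4 / cv) = D * X ^ 2 := by rw [hD]; ring
      _ ≤ 1 * (k : ℝ) := by linarith
  have hcv4 : 0 < 4 / cv := by positivity
  have hXl : X * l ≤ cL / 4 := hsm.trans (min_le_left _ _)
  have hXl' : X * l ≤ 8 * H * K₁ := hsm.trans (min_le_right _ _)
  have hl1 : √(s : ℝ) * l ≤ X * l := mul_le_mul_of_nonneg_right hx1 hlam.le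
  have hl2 : (m : ℝ) * l ≤ X * l := mul_le_mul_of_nonneg_right hx2 hlam.le
  have hXl0 : 0 < X * l := by positivity
  have hmain := hrun.step_probability hB ham hR hS hσ hC hh hξ hξ1 hM hn htmax (by omega) hCw hW
    hκ0 (min_le_left _ _) hsep hR1 hRm hτ ht1 ht (Nat.lt_of_lt_of_le Nat.zero_lt_one hm)
    (k := k) (by exact_mod_cast hk0) hnb he1 hlam (η := X * l / 2) (ρ := 6 * X) (by positivity)
    (by positivity)
    (by
      have h1 : (1 + 1 / σ ^ 2) * κ ≤ q / 2 := by
        calc (1 + 1 / σ ^ 2) * κ ≤ (1 + 1 / σ ^ 2) * (q / (2 * (1 + 1 / σ ^ 2))) :=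
              mul_le_mul_of_nonneg_left (min_le_right _ _) (by positivity)
          _ = q / 2 := by field_simp
      have h2 := mul_le_mul_of_nonneg_right h1 he0
      linarith)
    (hρk.trans (one_div_le_one_div_of_le (by norm_num) (by linarith)))
    (hρk.trans (by
      rw [div_le_div_iff₀ (by positivity) (by norm_num)]
      have : cv * (4 + 4 / cv) = 4 * cv + 4 := by field_simp
      linarith))
    (by
      have : 2 * (X * l / 2) / l = X := by field_simp
      rw [← hl, this]
      linarith)
    (by rw [← hl]; linarith)
    (by
      rw [← hl]
      have h1 : √(m : ℝ) ≤ m := by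
        rw [Real.sqrt_le_iff]
        exact ⟨by linarith, by rw [sq]; exact le_mul_of_one_le_left (by linarith) hm'⟩
      have h2 : √(m : ℝ) * l ≤ m * l := mul_le_mul_of_nonneg_right h1 hlam.le
      linarith)
  rw [← hl, ← hcL] at hmain
  have hfail := failure_bound (m := m) hd (Nat.cast_pos.1 hk0) (n := batchSize n₀ tmax τ)
    (x := 2 * H) (y := cv ^ 2 / (96 * R ^ 4)) (c := c₁) (c₂ := 1 / (128 * H * K₁ ^ 2)) (w := l ^ 2)
    (Nat.cast_nonneg _) (by rw [hc₁]; linarith [min_le_left (2 * H) (cv ^ 2 / (96 * R ^ 4))])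
    (by rw [hc₁]; linarith [min_le_right (2 * H) (cv ^ 2 / (96 * R ^ 4))])
    (by
      have hlog : 0 ≤ Real.log d := Real.log_natCast_nonneg d
      calc 2 * k * Real.log d ≤ 2 * ((D + 1) * X ^ 2) * Real.log d := by gcongr
        _ = 2 * (D + 1) * s * m ^ 2 * Real.log d := by rw [hXs]; ring
        _ ≤ _ := hC₂)
  refine le_trans (measureReal_mono fun ω hω => ?_) (hmain.trans (le_trans (le_of_eq ?_) hfail))
  · refine ⟨hω.1, fun hgood => hω.2 ⟨hgood.1.trans ?_, hgood.2.trans (le_of_eq ?_)⟩⟩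
    · calc 3 * ((2 * l * √s + m * l / 2 + X * l / 2) / cL) ≤ 3 * ((3 * (X * l)) / cL) := by
            gcongr
            linarith
        _ = 9 / cL * (X * l) := by ring
        _ ≤ max 1 (9 / cL) * (X * l) := by
            gcongr
            exact le_max_right _ _
    · rw [hX]; ring
  · have hmm : √(m : ℝ) ^ 2 = m := Real.sq_sqrt (Nat.cast_nonneg m)
    have e1 : (batchSize n₀ tmax τ : ℝ) * (√m * l / 2) ^ 2 / (32 * H * K₁ ^ 2)
        = m * (1 / (128 * H * K₁ ^ 2) * batchSize n₀ tmax τ * l ^ 2) := by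
      rw [div_pow, mul_pow, hmm]; field_simp; ring
    rw [e1, mul_div_assoc]

/-! ### Chaining the iterations -/

lemma measureReal_compl_chain {Ω : Type*} [MeasurableSpace Ω] {μ : Measure Ω}
    [IsProbabilityMeasure μ] {tmax : ℕ → ℕ} {G : ℕ → ℕ → Set Ω} {p : ℕ → ℕ → ℝ} {N : ℕ}
    (h0 : μ.real (G 1 0)ᶜ = 0)
    (hstep : ∀ τ t, 1 ≤ τ → τ ≤ N → 1 ≤ t → t ≤ tmax τ → μ.real (G τ (t - 1) ∩ (G τ t)ᶜ) ≤ p τ t)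
    (hnext : ∀ τ, 1 ≤ τ → τ < N → G τ (tmax τ) ⊆ G (τ + 1) 0) (τ : ℕ) (hτ : 1 ≤ τ) (hτN : τ ≤ N) :
    μ.real (G τ (tmax τ))ᶜ ≤ ∑ r ∈ Finset.Icc 1 τ, ∑ t ∈ Finset.Icc 1 (tmax r), p r t := by
  have inner : ∀ τ, 1 ≤ τ → τ ≤ N → ∀ t, t ≤ tmax τ →
      μ.real (G τ t)ᶜ ≤ μ.real (G τ 0)ᶜ + ∑ u ∈ Finset.Icc 1 t, p τ u := by
    intro τ h1 h2 t
    induction t with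
    | zero => intro _; simp
    | succ t ih =>
      intro ht
      have h3 := ih (by omega)
      have h4 := hstep τ (t + 1) h1 h2 (by omega) ht
      rw [Nat.add_sub_cancel] at h4
      rw [Finset.sum_Icc_succ_top (by omega)]
      have h5 : (G τ (t + 1))ᶜ ⊆ (G τ t)ᶜ ∪ (G τ t ∩ (G τ (t + 1))ᶜ) := by
        intro ω hω
        by_cases h : ω ∈ G τ t
        · exact Or.inr ⟨h, hω⟩
        · exact Or.inl h
      have h6 := (measureReal_mono (μ := μ) h5).trans (measureReal_union_le _ _)
      linarith
  induction τ, hτ using Nat.le_induction with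
  | base =>
    have := inner 1 le_rfl hτN (tmax 1) le_rfl
    simpa [h0] using this
  | succ τ hτ ih =>
    have h1 := ih (by omega)
    have h2 := inner (τ + 1) (by omega) hτN (tmax (τ + 1)) le_rfl
    have h3 : μ.real (G (τ + 1) 0)ᶜ ≤ μ.real (G τ (tmax τ))ᶜ :=
      measureReal_mono (Set.compl_subset_compl.2 (hnext τ hτ (by omega)))
    rw [Finset.sum_Icc_succ_top (by omega)]
    linarith

/-- The error level of the iterate `t` of episode `τ`. -/
def errorLevel (δ C₁ : ℝ) (s : ℕ) (m tmax : ℕ → ℕ) (lam : ℕ → ℕ → ℝ) (τ t : ℕ) : ℝ :=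
  if t = 0 then
    if τ = 1 then δ else C₁ * (√s * m (τ - 1) * lam (τ - 1) (tmax (τ - 1)))
  else C₁ * (√s * m τ * lam τ t)

section Chain

variable {Ω : Type*} [MeasurableSpace Ω] {μ : Measure Ω} [IsProbabilityMeasure μ] {d K : ℕ}
  {am : (Fin K → ℝ) → Fin K} {γs : Param d} {σ : ℝ} {B : Primitives Ω d K} {n₀ : ℕ}
  {tmax : ℕ → ℕ} {lam : ℕ → ℕ → ℝ} {a : ℕ → Ω → Fin K} {γ : ℕ → ℕ → Ω → Param d}

lemma IsRun.final_probability (hrun : IsRun μ am γs σ B n₀ tmax lam a γ) {s N : ℕ} {m : ℕ → ℕ}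
    {C₁ c₃ δ q : ℝ} {p : ℕ → ℕ → ℝ} (hC₁ : 0 < C₁) (hδ0 : 0 ≤ δ) (hδ1 : δ ≤ 1)
    (htmax : ∀ τ, 1 ≤ τ → 1 ≤ tmax τ) (hlam : ∀ τ t, 0 < lam τ t)
    (hbase : ∀ᵐ ω ∂μ, err2 (γ 1 0 ω) γs ≤ δ)
    (hone : ∀ (τ t : ℕ) (e : ℝ), 1 ≤ τ → τ ≤ N → 1 ≤ t → t ≤ tmax τ → 0 ≤ e → e ≤ 1 →
      q * e ≤ √s * m τ * lam τ t → √s * m τ * lam τ t ≤ c₃ →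
      μ.real {ω | (err2 (γ τ (t - 1) ω) γs ≤ e ∧ err2 (γ τ 0 ω) γs ≤ δ) ∧
        ¬ (err2 (γ τ t ω) γs ≤ C₁ * (√s * m τ * lam τ t) ∧
          err1 (γ τ t ω) γs ≤ 6 * √s * m τ * err2 (γ τ t ω) γs)} ≤ p τ t)
    (hstart : q * δ ≤ √s * m 1 * lam 1 1)
    (hwithin : ∀ τ t, 1 ≤ τ → τ ≤ N → 2 ≤ t → t ≤ tmax τ → q * C₁ * lam τ (t - 1) ≤ lam τ t)
    (hnext : ∀ τ, 2 ≤ τ → τ ≤ N →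
      q * C₁ * (m (τ - 1) * lam (τ - 1) (tmax (τ - 1))) ≤ m τ * lam τ 1)
    (hsmall : ∀ τ t, 1 ≤ τ → τ ≤ N → 1 ≤ t → t ≤ tmax τ →
      √s * m τ * lam τ t ≤ c₃ ∧ C₁ * (√s * m τ * lam τ t) ≤ 1)
    (hend : ∀ τ, 1 ≤ τ → τ < N → C₁ * (√s * m τ * lam τ (tmax τ)) ≤ δ) (hN : 1 ≤ N) :
    μ.real {ω | err2 (γ N (tmax N) ω) γs ≤ C₁ * (√s * m N * lam N (tmax N)) ∧
        err1 (γ N (tmax N) ω) γs ≤ 6 * √s * m N * err2 (γ N (tmax N) ω) γs}ᶜ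
      ≤ ∑ r ∈ Finset.Icc 1 N, ∑ t ∈ Finset.Icc 1 (tmax r), p r t := by
  set E := errorLevel δ C₁ s m tmax lam with hE
  set G : ℕ → ℕ → Set Ω := fun τ t => {ω | err2 (γ τ 0 ω) γs ≤ δ ∧ err2 (γ τ t ω) γs ≤ E τ t ∧
    (1 ≤ t → err1 (γ τ t ω) γs ≤ 6 * √s * m τ * err2 (γ τ t ω) γs)} with hG
  have hEpos : ∀ τ t, 1 ≤ t → E τ t = C₁ * (√s * m τ * lam τ t) := by
    intro τ t ht
    rw [hE]; unfold errorLevel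
    rw [if_neg (by omega)]
  have hE10 : E 1 0 = δ := by rw [hE]; unfold errorLevel; simp
  have hE0 : ∀ τ, 2 ≤ τ → E τ 0 = C₁ * (√s * m (τ - 1) * lam (τ - 1) (tmax (τ - 1))) := by
    intro τ hτ
    rw [hE]; unfold errorLevel
    rw [if_pos rfl, if_neg (by omega)]
  have hlevel : ∀ τ t, 0 ≤ C₁ * (√s * m τ * lam τ t) := fun τ t => by
    have := (hlam τ t).le
    positivity
  have h0 : μ.real (G 1 0)ᶜ = 0 := by
    rw [measureReal_def, ENNReal.toReal_eq_zero_iff]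
    refine Or.inl (measure_mono_null (fun ω hω => ?_) (ae_iff.1 hbase))
    intro h
    exact hω ⟨h, by rw [hE10]; exact h, by intro h; omega⟩
  have hE01 : ∀ τ t, 1 ≤ τ → τ ≤ N → 1 ≤ t → t ≤ tmax τ →
      0 ≤ E τ (t - 1) ∧ E τ (t - 1) ≤ 1 ∧ q * E τ (t - 1) ≤ √s * m τ * lam τ t := by
    intro τ t hτ hτN ht1 ht
    rcases Nat.lt_or_ge t 2 with h | h
    · obtain rfl : t = 1 := by omega
      rw [Nat.sub_self]
      rcases Nat.lt_or_ge τ 2 with h' | h'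
      · obtain rfl : τ = 1 := by omega
        rw [hE10]
        exact ⟨hδ0, hδ1, hstart⟩
      · rw [hE0 τ h']
        refine ⟨hlevel _ _, (hend (τ - 1) (by omega) (by omega)).trans hδ1, ?_⟩
        have := mul_le_mul_of_nonneg_left (hnext τ h' hτN) (Real.sqrt_nonneg s)
        linarith
    · rw [hEpos τ (t - 1) (by omega)]
      refine ⟨hlevel _ _, (hsmall τ (t - 1) hτ hτN (by omega) (by omega)).2, ?_⟩
      have := mul_le_mul_of_nonneg_left (hwithin τ t hτ hτN h ht)
        (show (0 : ℝ) ≤ √s * m τ by positivity)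
      linarith
  have hstep : ∀ τ t, 1 ≤ τ → τ ≤ N → 1 ≤ t → t ≤ tmax τ →
      μ.real (G τ (t - 1) ∩ (G τ t)ᶜ) ≤ p τ t := by
    intro τ t hτ hτN ht1 ht
    obtain ⟨h1, h2, h3⟩ := hE01 τ t hτ hτN ht1 ht
    refine le_trans (measureReal_mono fun ω hω => ?_)
      (hone τ t (E τ (t - 1)) hτ hτN ht1 ht h1 h2 h3 (hsmall τ t hτ hτN ht1 ht).1)
    obtain ⟨⟨ha, hb, hc⟩, hω2⟩ := hω
    refine ⟨⟨hb, ha⟩, fun h => hω2 ⟨ha, ?_, fun _ => h.2⟩⟩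
    rw [hEpos τ t ht1]; exact h.1
  have hnext' : ∀ τ, 1 ≤ τ → τ < N → G τ (tmax τ) ⊆ G (τ + 1) 0 := by
    intro τ hτ hτN ω hω
    obtain ⟨_, hb, _⟩ := hω
    rw [hEpos τ _ (htmax τ hτ)] at hb
    have hw := hrun.warm_start (τ + 1) ω (by omega)
    rw [Nat.add_sub_cancel] at hw
    refine ⟨?_, ?_, by intro h; omega⟩
    · rw [hw]; exact hb.trans (hend τ hτ hτN)
    · rw [hw, hE0 (τ + 1) (by omega), Nat.add_sub_cancel]; exact hb
  refine le_trans (measureReal_mono (Set.compl_subset_compl.2 fun ω hω => ?_))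
    (measureReal_compl_chain h0 hstep hnext' N hN le_rfl)
  obtain ⟨_, hb, hc⟩ := hω
  rw [hEpos N _ (htmax N hN)] at hb
  exact ⟨hb, hc (htmax N hN)⟩

end Chain

/-! ### Scalar estimates for the schedule -/

lemma exists_scale (l : List ℝ) : ∃ y : ℝ, 0 < y ∧ y ≤ 1 ∧ ∀ b ∈ l, b * y ≤ 1 := by
  induction l with
  | nil => exact ⟨1, one_pos, le_rfl, by simp⟩
  | cons b l ih =>
    obtain ⟨y, h0, h1, h2⟩ := ih
    have hb : 0 < 1 + |b| := by positivity
    refine ⟨y / (1 + |b|), by positivity, (div_le_self h0.le (by linarith [abs_nonneg b])).trans h1,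
      ?_⟩
    intro c hc
    rcases List.mem_cons.1 hc with rfl | hc
    · rw [← mul_div_assoc, div_le_one hb]
      have := mul_le_mul_of_nonneg_right (le_abs_self c) h0.le
      have := mul_le_mul_of_nonneg_left h1 (abs_nonneg c)
      linarith
    · rcases le_or_gt 0 c with hc0 | hc0
      · refine le_trans (mul_le_mul_of_nonneg_left ?_ hc0) (h2 c hc)
        exact div_le_self h0.le (by linarith [abs_nonneg b])
      · have : c * (y / (1 + |b|)) ≤ 0 := mul_nonpos_of_nonpos_of_nonneg hc0.le (by positivity)
        linarith

lemma half_le_log {n : ℕ} (hn : 2 ≤ n) : 1 / 2 ≤ Real.log n := by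
  have h1 : Real.log 2 ≤ Real.log n := Real.log_le_log (by norm_num) (by exact_mod_cast hn)
  have := Real.log_two_gt_d9
  linarith

lemma sum_half_pow_rev (N : ℕ) : ∑ τ ∈ Finset.Icc 1 N, (1 / 2 : ℝ) ^ (N - τ) ≤ 2 := by
  induction N with
  | zero => simp
  | succ N ih =>
    rw [Finset.sum_Icc_succ_top (by omega)]
    have e : ∑ τ ∈ Finset.Icc 1 N, (1 / 2 : ℝ) ^ (N + 1 - τ)
        = 1 / 2 * ∑ τ ∈ Finset.Icc 1 N, (1 / 2 : ℝ) ^ (N - τ) := by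
      rw [Finset.mul_sum]
      refine Finset.sum_congr rfl fun τ hτ => ?_
      rw [Nat.sub_add_comm (Finset.mem_Icc.1 hτ).2, pow_succ]; ring
    rw [e]
    simp only [Nat.sub_self, pow_zero]
    linarith

lemma sum_half_pow (N : ℕ) : ∑ τ ∈ Finset.Icc 1 N, (1 / 2 : ℝ) ^ τ ≤ 1 := by
  have h : ∀ N : ℕ, ∑ τ ∈ Finset.Icc 1 N, (1 / 2 : ℝ) ^ τ = 1 - (1 / 2) ^ N := by
    intro N
    induction N with
    | zero => simp
    | succ N ih => rw [Finset.sum_Icc_succ_top (by omega), ih, pow_succ]; ring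
  rw [h]
  have : (0 : ℝ) ≤ (1 / 2) ^ N := by positivity
  linarith

lemma exp_neg_le_half_pow (k : ℕ) : Real.exp (-(k : ℝ)) ≤ (1 / 2) ^ k := by
  have h1 : Real.exp (-1) ≤ 1 / 2 := by
    have := Real.exp_neg_one_lt_d9
    linarith
  calc Real.exp (-(k : ℝ)) = Real.exp (-1) ^ k := by rw [← Real.exp_nat_mul]; congr 1; ring
    _ ≤ (1 / 2) ^ k := pow_le_pow_left₀ (Real.exp_pos _).le h1 k

lemma succ_sq_le (n : ℕ) : ((n : ℝ) + 1) ^ 2 ≤ 4 * 2 ^ n := by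
  have key : ∀ n : ℕ, (n + 1) ^ 2 ≤ 4 * 2 ^ n := by
    intro n
    rcases Nat.lt_or_ge n 3 with h | h
    · interval_cases n <;> norm_num
    · induction n, h using Nat.le_induction with
      | base => norm_num
      | succ n hn ih =>
        rw [pow_succ 2 n]
        nlinarith
  exact_mod_cast key n

lemma le_two_mul_div {N t : ℕ} (ht : 0 < t) (h : t ≤ N) : 0 < N / t ∧ N ≤ 2 * t * (N / t) := by
  have h1 : 0 < N / t := Nat.div_pos h ht
  refine ⟨h1, ?_⟩
  have h2 := Nat.lt_mul_div_succ N ht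
  have h3 : t * 1 ≤ t * (N / t) := Nat.mul_le_mul_left t h1
  have h4 : t * (N / t + 1) = t * (N / t) + t := by ring
  have h5 : 2 * t * (N / t) = t * (N / t) + t * (N / t) := by ring
  omega

section Regime

variable {S ℓ Λ n y b : ℝ}

/-- Elementary consequences of the scaling condition. -/
lemma scaling_facts (hS : 1 ≤ S) (hℓ : 1 / 2 ≤ ℓ) (hΛ : 1 / 2 ≤ Λ)
    (h : S ^ 2 * ℓ * Λ ≤ y ^ 2 * n) :
    S * ℓ * Λ ≤ y ^ 2 * n ∧ S * ℓ ≤ 2 * y ^ 2 * n ∧ ℓ * Λ ≤ y ^ 2 * n ∧ S ^ 2 * Λ ≤ 2 * y ^ 2 * n ∧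
      Λ ≤ 2 * y ^ 2 * n ∧ ℓ ≤ 2 * y ^ 2 * n ∧ 1 ≤ 4 * y ^ 2 * n := by
  have hS2 : S ≤ S ^ 2 := le_self_pow₀ hS two_ne_zero
  have hS0 : 0 < S := by linarith
  have hℓ0 : 0 < ℓ := by linarith
  have hΛ0 : 0 < Λ := by linarith
  have h1 : S * ℓ * Λ ≤ y ^ 2 * n := le_trans (by gcongr) h
  have h2 : ℓ * Λ ≤ S * ℓ * Λ := by
    rw [mul_assoc]; exact le_mul_of_one_le_left (by positivity) hS
  have h3 : S * ℓ * (1 / 2) ≤ S * ℓ * Λ := by gcongr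
  have h4 : S ^ 2 * (1 / 2) * Λ ≤ S ^ 2 * ℓ * Λ := by gcongr
  have h5 : 1 / 2 * Λ ≤ ℓ * Λ := by gcongr
  have h6 : ℓ * (1 / 2) ≤ ℓ * Λ := by gcongr
  refine ⟨h1, by linarith, by linarith, by linarith, by linarith, by linarith, by linarith⟩

lemma sparsity_log_sq (hΛ : 1 / 2 ≤ Λ) (hn : 0 < n) (hy : 0 < y)
    (h : S ^ 2 * Λ ≤ 2 * y ^ 2 * n) (hcube : Λ ^ 3 ≤ 6 * n) : S * Λ ^ 2 ≤ 4 * y * n := by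
  refine le_of_sq_le_sq ?_ (by positivity)
  calc (S * Λ ^ 2) ^ 2 = (S ^ 2 * Λ) * Λ ^ 3 := by ring
    _ ≤ (2 * y ^ 2 * n) * (6 * n) := by
        have : 0 < Λ := by linarith
        gcongr
    _ ≤ (4 * y * n) ^ 2 := by nlinarith [sq_nonneg (y * n)]

/-- The penalties of the first episode are small. -/
lemma first_penalty_small (hS : 1 ≤ S) (hΛ : 1 / 2 ≤ Λ) (hn : 0 < n)
    (hy : 0 < y) (hy1 : y ≤ 1) (hb : 0 < b) (h1 : S * ℓ * Λ ≤ y ^ 2 * n)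
    (h2 : S * Λ ^ 2 ≤ 4 * y * n) {A c u w m : ℝ} (hA : 0 < A) (hc : 0 ≤ c) (hu : u ≤ b * Λ)
    (hm0 : 0 ≤ m) (hm : m ≤ 2) (hw : w ≤ c / 4) (hAy : A * (1 + 2 * b) * y ≤ (c / 4) ^ 2) :
    √S * m * (√(A * (ℓ + u / 2) * Λ / n) + w / √S) ≤ c := by
  have hS0 : 0 < √S := Real.sqrt_pos.2 (by linarith)
  have hΛ0 : 0 < Λ := by linarith
  have key : S * (A * (ℓ + u / 2) * Λ / n) ≤ (c / 4) ^ 2 := by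
    have e : S * (A * (ℓ + u / 2) * Λ / n) = A * (S * ℓ * Λ + S * u * Λ / 2) / n := by ring
    rw [e, div_le_iff₀ hn]
    have h3 : S * u * Λ ≤ b * (4 * y * n) := by
      calc S * u * Λ ≤ S * (b * Λ) * Λ := by gcongr
        _ = b * (S * Λ ^ 2) := by ring
        _ ≤ _ := by gcongr
    have h4 : y ^ 2 * n ≤ y * n := by
      have : y ^ 2 ≤ y := by rw [sq]; exact mul_le_of_le_one_left hy.le hy1
      gcongr
    calc A * (S * ℓ * Λ + S * u * Λ / 2) ≤ A * (y * n + b * (4 * y * n) / 2) :=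
          mul_le_mul_of_nonneg_left (by linarith) hA.le
      _ = A * (1 + 2 * b) * y * n := by ring
      _ ≤ _ := by gcongr
  have h5 : √S * √(A * (ℓ + u / 2) * Λ / n) ≤ c / 4 := by
    rw [← Real.sqrt_mul (by linarith)]
    exact Real.sqrt_le_iff.2 ⟨by positivity, key⟩
  calc √S * m * (√(A * (ℓ + u / 2) * Λ / n) + w / √S)
      = m * (√S * √(A * (ℓ + u / 2) * Λ / n) + w) := by field_simp
    _ ≤ m * (c / 4 + c / 4) := by gcongr
    _ ≤ 2 * (c / 4 + c / 4) := by gcongr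
    _ = c := by ring

/-- The last penalty of the first episode has the optimal order. -/
lemma first_penalty_end (hS : 1 ≤ S) (hℓ : 1 / 2 ≤ ℓ) (hΛ : 1 / 2 ≤ Λ) (hn : 0 < n) {A δ w : ℝ}
    (hA : 1 ≤ A) (hδ0 : 0 ≤ δ) (hδ : δ ≤ 1) (hw0 : 0 ≤ w) (hw : w ≤ √(1 / n)) :
    √(A * (ℓ + 0 / 2) * Λ / n) + w * δ / √S ≤ 3 * √(A * ℓ * Λ / n) := by
  have hS0 : 1 ≤ √S := Real.one_le_sqrt.2 hS
  have h1 : w * δ / √S ≤ 2 * √(A * ℓ * Λ / n) := by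
    calc w * δ / √S ≤ w * δ := div_le_self (by positivity) hS0
      _ ≤ w := mul_le_of_le_one_right hw0 hδ
      _ ≤ √(1 / n) := hw
      _ ≤ √(2 ^ 2 * (A * ℓ * Λ / n)) := by
          refine Real.sqrt_le_sqrt ?_
          rw [← mul_div_assoc]
          refine div_le_div_of_nonneg_right ?_ hn.le
          have : (1 : ℝ) * (1 / 2) * (1 / 2) ≤ A * ℓ * Λ := by gcongr
          linarith
      _ = 2 * √(A * ℓ * Λ / n) := by
          rw [Real.sqrt_mul (by norm_num), Real.sqrt_sq (by norm_num)]
  rw [zero_div, add_zero]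
  linarith

/-- A penalty of the optimal order is small, uniformly over the episodes. -/
lemma end_penalty_small (hS : 1 ≤ S) (hn : 0 < n) (h1 : S * ℓ * Λ ≤ y ^ 2 * n) (hy : 0 < y)
    (hy1 : y ≤ 1) {A c m P : ℝ} (hA : 0 < A) (hc : 0 ≤ c) (hm0 : 0 ≤ m) (hP : 0 < P)
    (hm : m ^ 2 ≤ 8 * P) (hAy : 72 * A * y ≤ c ^ 2) :
    √S * m * (3 * √(A * ℓ * Λ / (P * n))) ≤ c := by
  have key : S * (A * ℓ * Λ / (P * n)) * (3 * m) ^ 2 ≤ c ^ 2 := by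
    have e : S * (A * ℓ * Λ / (P * n)) * (3 * m) ^ 2
        = 9 * A * (S * ℓ * Λ / n) * (m ^ 2 / P) := by field_simp; ring
    have h2 : S * ℓ * Λ / n ≤ y := by
      rw [div_le_iff₀ hn]
      have : y ^ 2 ≤ y := by rw [sq]; exact mul_le_of_le_one_left hy.le hy1
      exact h1.trans (mul_le_mul_of_nonneg_right this hn.le)
    have h3 : m ^ 2 / P ≤ 8 := by rwa [div_le_iff₀ hP]
    rw [e]
    calc 9 * A * (S * ℓ * Λ / n) * (m ^ 2 / P) ≤ 9 * A * y * 8 := by gcongr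
      _ = 72 * A * y := by ring
      _ ≤ _ := hAy
  have h5 : √S * √(A * ℓ * Λ / (P * n)) * (3 * m) ≤ c := by
    rw [← Real.sqrt_mul (by linarith)]
    have := Real.sqrt_le_sqrt key
    rw [Real.sqrt_mul' _ (sq_nonneg _), Real.sqrt_sq (by positivity), Real.sqrt_sq hc] at this
    exact this
  linarith

/-- Failure of the design conditions in the first episode. -/
lemma first_design_failure (hℓ : 1 / 2 ≤ ℓ) (hΛ : 1 / 2 ≤ Λ) (hn : 0 < n)
    (hy : 0 < y) (hy1 : y ≤ 1) (hb : 0 < b) (h1 : ℓ * Λ ≤ y ^ 2 * n) (hsq : Λ ^ 2 ≤ 2 * n)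
    {c k t : ℝ} (hc : 0 < c) (ht : t ≤ b * Λ) (hk : n ≤ 2 * b * Λ * k)
    (hy2 : 4 * b / c * y ≤ 1) (hy3 : 1536 * b * (2 * b) ^ 2 / c ^ 2 * y ≤ 1) :
    t * (6 * Real.exp (-(c * k))) ≤ 1 / 8 * Real.exp (-ℓ) := by
  have hΛ0 : 0 < Λ := by linarith
  set X := n / Λ with hX
  have hX0 : 0 < X := by positivity
  have hyy : y ^ 2 ≤ y := by rw [sq]; exact mul_le_of_le_one_left hy.le hy1
  have hXℓ : ℓ ≤ y * X := by
    rw [hX, ← mul_div_assoc, le_div_iff₀ hΛ0]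
    exact h1.trans (mul_le_mul_of_nonneg_right hyy hn.le)
  set c' := c / (2 * b) with hc'
  have hc'0 : 0 < c' := by positivity
  have hck : c' * X ≤ c * k := by
    rw [hc', hX, div_mul_div_comm, div_le_iff₀ (by positivity)]
    calc c * n ≤ c * (2 * b * Λ * k) := by gcongr
      _ = _ := by ring
  have ht2 : t ≤ 2 * b * X := by
    refine ht.trans ?_
    rw [hX, ← mul_div_assoc, le_div_iff₀ hΛ0]
    calc b * Λ * Λ = b * Λ ^ 2 := by ring
      _ ≤ b * (2 * n) := by gcongr
      _ = _ := by ring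
  set w := c' * X / 2 with hw
  have hw0 : 0 < w := by positivity
  have hwℓ : ℓ ≤ w := by
    have h2 : y ≤ c' / 2 := by
      rw [hc', div_div, le_div_iff₀ (by positivity)]
      have := mul_le_mul_of_nonneg_right hy2 hc.le
      calc y * (2 * b * 2) = 4 * b / c * y * c := by field_simp; ring
        _ ≤ 1 * c := this
        _ = c := one_mul c
    calc ℓ ≤ y * X := hXℓ
      _ ≤ c' / 2 * X := by gcongr
      _ = w := by rw [hw]; ring
  have hquad : Real.exp (-w) ≤ 2 / w ^ 2 := by
    rw [Real.exp_neg, inv_eq_one_div, div_le_div_iff₀ (Real.exp_pos _) (by positivity)]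
    have := Real.quadratic_le_exp_of_nonneg hw0.le
    linarith
  have hsplit : Real.exp (-(c * k)) ≤ Real.exp (-w) * Real.exp (-ℓ) := by
    rw [← Real.exp_add, Real.exp_le_exp]
    have : c' * X = w + w := by rw [hw]; ring
    linarith
  have hXinv : 1 ≤ 2 * y * X := by linarith
  calc t * (6 * Real.exp (-(c * k))) ≤ (2 * b * X) * (6 * ((2 / w ^ 2) * Real.exp (-ℓ))) := by
        refine mul_le_mul ht2 ?_ (by positivity) (by positivity)
        have := mul_le_mul_of_nonneg_right hquad (Real.exp_pos (-ℓ)).le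
        linarith
    _ = 96 * b / (c' ^ 2 * X) * Real.exp (-ℓ) := by rw [hw]; field_simp; ring
    _ ≤ 1 / 8 * Real.exp (-ℓ) := by
        refine mul_le_mul_of_nonneg_right ?_ (Real.exp_pos _).le
        rw [div_le_div_iff₀ (by positivity) (by norm_num)]
        have e1 : 1536 * b * (2 * b) ^ 2 / c ^ 2 * y = 1536 * b / c' ^ 2 * y := by
          rw [hc']; field_simp
        rw [e1, div_mul_eq_mul_div, div_le_one (by positivity)] at hy3
        calc 96 * b * 8 = 768 * b * 1 := by ring
          _ ≤ 768 * b * (2 * y * X) := by gcongr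
          _ = 1536 * b * y * X := by ring
          _ ≤ c' ^ 2 * X := by gcongr
          _ = 1 * (c' ^ 2 * X) := (one_mul _).symm

/-- Failure of the design conditions in the later episodes. -/
lemma later_design_failure (hℓ : 1 / 2 ≤ ℓ) (hn : 0 < n) (hy : 0 < y) (hy1 : y ≤ 1)
    (h1 : ℓ ≤ 2 * y ^ 2 * n) {c k t T P : ℝ} (hc : 0 < c) (hT : 0 < T) (ht : t ≤ T) (hP : 1 ≤ P)
    (hk : P * n ≤ 2 * T * k) (hy2 : 8 * T / c * y ≤ 1) (hy3 : 768 * T ^ 2 / c * y ≤ 1) :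
    t * (6 * Real.exp (-(c * k))) ≤ 1 / 8 * Real.exp (-ℓ) * (1 / P) := by
  have hyy : y ^ 2 ≤ y := by rw [sq]; exact mul_le_of_le_one_left hy.le hy1
  have hn1 : ℓ ≤ 2 * y * n := by
    refine h1.trans ?_
    gcongr
  have hn2 : 1 ≤ 4 * y * n := by linarith
  set w := c * (P * n) / (4 * T) with hw
  have hw0 : 0 < w := by positivity
  have hck : w + w ≤ c * k := by
    have e : w + w = c * (P * n) / (2 * T) := by rw [hw]; field_simp; ring
    rw [e, div_le_iff₀ (by positivity)]
    calc c * (P * n) ≤ c * (2 * T * k) := by gcongr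
      _ = _ := by ring
  have hwℓ : ℓ ≤ w := by
    rw [hw, le_div_iff₀ (by positivity)]
    rw [div_mul_eq_mul_div, div_le_one hc] at hy2
    calc ℓ * (4 * T) ≤ (2 * y * n) * (4 * T) := by gcongr
      _ = 8 * T * y * n := by ring
      _ ≤ c * n := by gcongr
      _ ≤ c * (P * n) := by
          have : n ≤ P * n := le_mul_of_one_le_left hn.le hP
          gcongr
  have hlin : Real.exp (-w) ≤ 1 / w := by
    rw [Real.exp_neg, inv_eq_one_div]
    exact one_div_le_one_div_of_le hw0 (by linarith [Real.add_one_le_exp w])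
  have hsplit : Real.exp (-(c * k)) ≤ Real.exp (-w) * Real.exp (-ℓ) := by
    rw [← Real.exp_add, Real.exp_le_exp]
    linarith
  have hP0 : 0 < P := by linarith
  calc t * (6 * Real.exp (-(c * k))) ≤ T * (6 * ((1 / w) * Real.exp (-ℓ))) := by
        refine mul_le_mul ht ?_ (by positivity) hT.le
        have := mul_le_mul_of_nonneg_right hlin (Real.exp_pos (-ℓ)).le
        linarith
    _ = 24 * T ^ 2 / (c * n) * Real.exp (-ℓ) * (1 / P) := by rw [hw]; field_simp; ring
    _ ≤ 1 / 8 * Real.exp (-ℓ) * (1 / P) := by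
        refine mul_le_mul_of_nonneg_right (mul_le_mul_of_nonneg_right ?_ (Real.exp_pos _).le)
          (by positivity)
        rw [div_le_div_iff₀ (by positivity) (by norm_num)]
        rw [div_mul_eq_mul_div, div_le_one hc] at hy3
        calc 24 * T ^ 2 * 8 = 192 * T ^ 2 * 1 := by ring
          _ ≤ 192 * T ^ 2 * (4 * y * n) := by gcongr
          _ = 768 * T ^ 2 * y * n := by ring
          _ ≤ c * n := by gcongr
          _ = 1 * (c * n) := (one_mul _).symm

end Regime

section Noise

variable {ℓ Λ n b k A c : ℝ} {m : ℕ}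

lemma first_noise_exponent (hm : 1 ≤ m) (hℓ : 1 / 2 ≤ ℓ) (hΛ : 1 / 2 ≤ Λ) (hn : 0 < n) (hb : 0 < b)
    (hc : 0 < c) (hk : n ≤ 2 * b * Λ * k) (hcA : 16 * b ≤ c * A) {u lam : ℝ}
    (hu : 0 ≤ u) (hlam : √(A * (ℓ + u / 2) * Λ / n) ≤ lam) :
    6 * ℓ + u ≤ m * (c * k * lam ^ 2 - 2 * ℓ) := by
  have hΛ0 : 0 < Λ := by linarith
  have hk0 : 0 < k := by
    by_contra h
    have : 2 * b * Λ * k ≤ 0 := mul_nonpos_of_nonneg_of_nonpos (by positivity) (not_lt.1 h)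
    linarith
  have hm' : (1 : ℝ) ≤ m := by exact_mod_cast hm
  have h1 : A * (ℓ + u / 2) * Λ / n ≤ lam ^ 2 := (Real.sqrt_le_left ((Real.sqrt_nonneg _).trans hlam)).1 hlam
  have h2 : 8 * (ℓ + u / 2) ≤ c * k * (A * (ℓ + u / 2) * Λ / n) := by
    rw [← mul_div_assoc, le_div_iff₀ hn]
    calc 8 * (ℓ + u / 2) * n ≤ 8 * (ℓ + u / 2) * (2 * b * Λ * k) := by gcongr
      _ = 16 * b * ((ℓ + u / 2) * Λ * k) := by ring
      _ ≤ c * A * ((ℓ + u / 2) * Λ * k) := by gcongr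
      _ = _ := by ring
  have h3 : c * k * (A * (ℓ + u / 2) * Λ / n) ≤ c * k * lam ^ 2 := by gcongr
  have h4 : 6 * ℓ + u ≤ c * k * lam ^ 2 - 2 * ℓ := by linarith
  exact h4.trans (le_mul_of_one_le_left (by linarith) hm')

lemma later_noise_exponent (hm : 1 ≤ m) (hℓ : 1 / 2 ≤ ℓ) (hΛ : 1 / 2 ≤ Λ) {T P : ℝ}
    (hT : 0 < T) (hPn : 0 < P * n) (hA : 0 < A) (hc : 0 < c) (hk : P * n ≤ 2 * T * k)
    (hcA : (10 + 2 * T) * (4 * T) ≤ c * A) :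
    6 * ℓ + m + T ≤ m * (c * k * √(A * ℓ * Λ / (P * n)) ^ 2 - 2 * ℓ) := by
  have hΛ0 : 0 < Λ := by linarith
  have hℓ0 : 0 < ℓ := by linarith
  have hm' : (1 : ℝ) ≤ m := by exact_mod_cast hm
  rw [Real.sq_sqrt (by positivity)]
  have h2 : (10 + 2 * T) * ℓ ≤ c * k * (A * ℓ * Λ / (P * n)) := by
    rw [← mul_div_assoc, le_div_iff₀ hPn]
    have hk0 : 0 < k := by
      by_contra h
      have : 2 * T * k ≤ 0 := mul_nonpos_of_nonneg_of_nonpos (by positivity) (not_lt.1 h)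
      linarith
    calc (10 + 2 * T) * ℓ * (P * n) ≤ (10 + 2 * T) * ℓ * (2 * T * k) := by gcongr
      _ = (10 + 2 * T) * (4 * T) * (ℓ * (1 / 2) * k) := by ring
      _ ≤ c * A * (ℓ * Λ * k) := by gcongr
      _ = _ := by ring
  calc 6 * ℓ + m + T ≤ m * (6 * ℓ) + m * (2 * ℓ) + m * (2 * T * ℓ) := by
        have a1 : 6 * ℓ ≤ m * (6 * ℓ) := le_mul_of_one_le_left (by linarith) hm'
        have a2 : (m : ℝ) * 1 ≤ m * (2 * ℓ) := by gcongr; linarith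
        have a3 : T ≤ 2 * T * ℓ := by
          calc T = 2 * T * (1 / 2) := by ring
            _ ≤ 2 * T * ℓ := by gcongr
        have a4 : 2 * T * ℓ ≤ m * (2 * T * ℓ) := le_mul_of_one_le_left (by positivity) hm'
        linarith
    _ = m * ((10 + 2 * T) * ℓ - 2 * ℓ) := by ring
    _ ≤ _ := by gcongr

end Noise

/-- The order of the sparse approximation used in episode `τ` when the estimate of episode `N`
is analysed. -/
def approxOrder (N τ : ℕ) : ℕ := 1 + min (N - τ) τ

lemma approxOrder_le_two_mul {N τ : ℕ} (hτ : 2 ≤ τ) (hN : τ ≤ N) :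
    approxOrder N (τ - 1) ≤ 2 * approxOrder N τ := by
  unfold approxOrder; omega

lemma approxOrder_one_le (N : ℕ) : approxOrder N 1 ≤ 2 := by
  unfold approxOrder; omega

lemma approxOrder_sq_le {N τ : ℕ} (hτ : 1 ≤ τ) :
    (approxOrder N τ : ℝ) ^ 2 ≤ 8 * 2 ^ (τ - 1) := by
  have h1 : approxOrder N τ ≤ τ + 1 := by unfold approxOrder; omega
  have h2 : (approxOrder N τ : ℝ) ≤ τ + 1 := by exact_mod_cast h1
  obtain ⟨r, rfl⟩ : ∃ r, τ = r + 1 := ⟨τ - 1, by omega⟩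
  calc (approxOrder N (r + 1) : ℝ) ^ 2 ≤ (((r + 1 : ℕ) : ℝ) + 1) ^ 2 := by gcongr
    _ ≤ 4 * 2 ^ (r + 1) := succ_sq_le (r + 1)
    _ = 8 * 2 ^ (r + 1 - 1) := by rw [Nat.add_sub_cancel, pow_succ]; ring

lemma half_pow_approxOrder (N τ : ℕ) :
    (1 / 2 : ℝ) ^ approxOrder N τ ≤ 1 / 2 * ((1 / 2) ^ (N - τ) + (1 / 2) ^ τ) := by
  unfold approxOrder
  rw [pow_add, pow_one]
  have h1 : (0 : ℝ) ≤ (1 / 2) ^ (N - τ) := by positivity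
  have h2 : (0 : ℝ) ≤ (1 / 2) ^ τ := by positivity
  rcases min_choice (N - τ) τ with h | h <;> rw [h] <;> linarith

/-- The total failure probability of the first episode. -/
lemma first_episode_failure {N t₁ : ℕ} {ℓ x D : ℝ} {f : ℕ → ℝ} (hD : D = Real.exp (-ℓ))
    (hD2 : D ≤ 1 / 2) (hf : ∀ t ∈ Finset.Icc 1 t₁, 6 * ℓ + ((t₁ - t : ℕ) : ℝ) ≤ f t)
    (hx : t₁ * (6 * x) ≤ 1 / 8 * D) :
    ∑ t ∈ Finset.Icc 1 t₁, (3 * Real.exp (-f t) + 6 * x)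
      ≤ D * (1 / 8 * (1 / 2) ^ (N - 1) + 3 / 4 * (1 / 2) ^ 1) := by
  have hD0 : 0 < D := hD ▸ Real.exp_pos _
  have hD6 : Real.exp (-(6 * ℓ)) = D ^ 6 := by
    rw [hD, ← Real.exp_nat_mul]; congr 1; push_cast; ring
  have hD6' : D ^ 6 ≤ D / 32 := by
    have : D ^ 5 ≤ (1 / 2) ^ 5 := pow_le_pow_left₀ hD0.le hD2 5
    calc D ^ 6 = D * D ^ 5 := by ring
      _ ≤ D * (1 / 2) ^ 5 := by gcongr
      _ = D / 32 := by ring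
  have h1 : ∀ t ∈ Finset.Icc 1 t₁, Real.exp (-f t) ≤ D ^ 6 * (1 / 2) ^ (t₁ - t) := by
    intro t ht
    calc Real.exp (-f t) ≤ Real.exp (-(6 * ℓ) + -((t₁ - t : ℕ) : ℝ)) := by
          rw [Real.exp_le_exp]; linarith [hf t ht]
      _ = D ^ 6 * Real.exp (-((t₁ - t : ℕ) : ℝ)) := by rw [Real.exp_add, hD6]
      _ ≤ _ := mul_le_mul_of_nonneg_left (exp_neg_le_half_pow _) (by positivity)
  have h2 : ∑ t ∈ Finset.Icc 1 t₁, Real.exp (-f t) ≤ D ^ 6 * 2 := by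
    refine (Finset.sum_le_sum h1).trans ?_
    rw [← Finset.mul_sum]
    exact mul_le_mul_of_nonneg_left (sum_half_pow_rev t₁) (by positivity)
  rw [Finset.sum_add_distrib, ← Finset.mul_sum, Finset.sum_const, Nat.card_Icc, nsmul_eq_mul,
    Nat.add_sub_cancel]
  have h3 : (0 : ℝ) ≤ D * (1 / 8 * (1 / 2) ^ (N - 1)) := by positivity
  linarith

/-- The total failure probability of a later episode. -/
lemma later_episode_failure {N τ t₁ T : ℕ} {ℓ x D f : ℝ} (hD : D = Real.exp (-ℓ))
    (hD2 : D ≤ 1 / 2) (hτ : 1 ≤ τ) (ht : t₁ ≤ T)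
    (hf : 6 * ℓ + approxOrder N τ + T ≤ f)
    (hx : t₁ * (6 * x) ≤ 1 / 8 * D * (1 / 2 ^ (τ - 1))) :
    ∑ _t ∈ Finset.Icc 1 t₁, (3 * Real.exp (-f) + 6 * x)
      ≤ D * (1 / 8 * (1 / 2) ^ (N - τ) + 3 / 4 * (1 / 2) ^ τ) := by
  have hD0 : 0 < D := hD ▸ Real.exp_pos _
  have hD6 : Real.exp (-(6 * ℓ)) = D ^ 6 := by
    rw [hD, ← Real.exp_nat_mul]; congr 1; push_cast; ring
  have hD6' : D ^ 6 ≤ D / 32 := by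
    have : D ^ 5 ≤ (1 / 2) ^ 5 := pow_le_pow_left₀ hD0.le hD2 5
    calc D ^ 6 = D * D ^ 5 := by ring
      _ ≤ D * (1 / 2) ^ 5 := by gcongr
      _ = D / 32 := by ring
  have hTT : (T : ℝ) * Real.exp (-(T : ℝ)) ≤ 1 := by
    rw [Real.exp_neg, ← div_eq_mul_inv, div_le_one (Real.exp_pos _)]
    linarith [Real.add_one_le_exp (T : ℝ)]
  have h1 : (t₁ : ℝ) * Real.exp (-f) ≤ D / 64 * ((1 / 2) ^ (N - τ) + (1 / 2) ^ τ) := by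
    have ht' : (t₁ : ℝ) ≤ T := by exact_mod_cast ht
    calc (t₁ : ℝ) * Real.exp (-f)
        ≤ T * Real.exp (-(6 * ℓ) + -(approxOrder N τ : ℝ) + -(T : ℝ)) := by
          refine mul_le_mul ht' ?_ (Real.exp_pos _).le (Nat.cast_nonneg T)
          rw [Real.exp_le_exp]; linarith
      _ = (T * Real.exp (-(T : ℝ))) * (D ^ 6 * Real.exp (-(approxOrder N τ : ℝ))) := by
          rw [Real.exp_add, Real.exp_add, hD6]; ring
      _ ≤ 1 * (D / 32 * (1 / 2 * ((1 / 2) ^ (N - τ) + (1 / 2) ^ τ))) := by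
          refine mul_le_mul hTT ?_ (by positivity) zero_le_one
          refine mul_le_mul hD6' ?_ (Real.exp_pos _).le (by positivity)
          exact (exp_neg_le_half_pow _).trans (half_pow_approxOrder N τ)
      _ = _ := by ring
  have hP : (1 / 2 ^ (τ - 1) : ℝ) = 2 * (1 / 2) ^ τ := by
    obtain ⟨r, rfl⟩ : ∃ r, τ = r + 1 := ⟨τ - 1, by omega⟩
    rw [Nat.add_sub_cancel, pow_succ, one_div_pow]; ring
  rw [hP] at hx
  rw [Finset.sum_const, Nat.card_Icc, nsmul_eq_mul, Nat.add_sub_cancel]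
  have h3 : (0 : ℝ) ≤ D * (1 / 2) ^ (N - τ) := by positivity
  have h4 : (0 : ℝ) ≤ D * (1 / 2) ^ τ := by positivity
  calc (t₁ : ℝ) * (3 * Real.exp (-f) + 6 * x) = 3 * (t₁ * Real.exp (-f)) + t₁ * (6 * x) := by ring
    _ ≤ 3 * (D / 64 * ((1 / 2) ^ (N - τ) + (1 / 2) ^ τ)) + 1 / 8 * D * (2 * (1 / 2) ^ τ) := by
        linarith
    _ ≤ _ := by linarith

lemma sum_episode_failure {N : ℕ} {D : ℝ} (hD : 0 ≤ D) {P : ℕ → ℝ}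
    (hP : ∀ τ ∈ Finset.Icc 1 N, P τ ≤ D * (1 / 8 * (1 / 2) ^ (N - τ) + 3 / 4 * (1 / 2) ^ τ)) :
    ∑ τ ∈ Finset.Icc 1 N, P τ ≤ D := by
  refine (Finset.sum_le_sum hP).trans ?_
  rw [← Finset.mul_sum, Finset.sum_add_distrib, ← Finset.mul_sum, ← Finset.mul_sum]
  refine mul_le_of_le_one_right hD ?_
  linarith [sum_half_pow_rev N, sum_half_pow N]

/-! ### The regularization levels -/

/-- The regularization levels: in the first episode the level decreases geometrically to the
statistical level of the batches, with a logarithmic correction for the early batches. -/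
def penalty (A r δ : ℝ) (d s n₀ : ℕ) (tmax : ℕ → ℕ) (τ t : ℕ) : ℝ :=
  if τ ≤ 1 then
    √(A * (Real.log d + ((tmax 1 - t : ℕ) : ℝ) / 2) * Real.log n₀ / n₀) + r ^ t * δ / √s
  else √(A * Real.log d * Real.log n₀ / (2 ^ (τ - 1) * n₀))

lemma penalty_pos {A r δ : ℝ} {d s n₀ : ℕ} {tmax : ℕ → ℕ} (hA : 0 < A) (hr : 0 ≤ r) (hδ : 0 ≤ δ)
    (hd : 2 ≤ d) (hn : 2 ≤ n₀) (τ t : ℕ) : 0 < penalty A r δ d s n₀ tmax τ t := by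
  have h1 : 0 < Real.log d := by linarith [half_le_log hd]
  have h2 : 0 < Real.log n₀ := by linarith [half_le_log hn]
  have h3 : (0 : ℝ) < n₀ := by exact_mod_cast (by omega : 0 < n₀)
  unfold penalty
  split_ifs
  · refine add_pos_of_pos_of_nonneg (Real.sqrt_pos.2 (by positivity)) (by positivity)
  · exact Real.sqrt_pos.2 (by positivity)

/-- Consecutive levels have a bounded ratio. -/
lemma penalty_ratio {A r δ : ℝ} {d s n₀ : ℕ} {tmax : ℕ → ℕ} (hA : 0 < A)
    (hr1 : r ≤ 1 / 2) (hd : 2 ≤ d) {τ t : ℕ}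
    (ht : 2 ≤ t) (htm : t ≤ tmax τ) (hτ : 1 ≤ τ) :
    r * penalty A r δ d s n₀ tmax τ (t - 1) ≤ penalty A r δ d s n₀ tmax τ t := by
  have h1 := half_le_log hd
  have h2 : 0 ≤ Real.log n₀ := Real.log_natCast_nonneg n₀
  unfold penalty
  split_ifs with h
  · obtain rfl : τ = 1 := by omega
    obtain ⟨k, rfl⟩ : ∃ k, t = k + 1 := ⟨t - 1, by omega⟩
    rw [Nat.add_sub_cancel]
    have e : tmax 1 - k = (tmax 1 - (k + 1)) + 1 := by omega
    rw [e, mul_add]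
    refine add_le_add ?_ (le_of_eq (by rw [pow_succ]; ring))
    set u : ℝ := ((tmax 1 - (k + 1) : ℕ) : ℝ) with hu
    have hu0 : 0 ≤ u := Nat.cast_nonneg _
    have h3 : √(A * (Real.log d + ((tmax 1 - (k + 1) + 1 : ℕ) : ℝ) / 2) * Real.log n₀ / n₀)
        ≤ 2 * √(A * (Real.log d + u / 2) * Real.log n₀ / n₀) := by
      have e2 : 2 * √(A * (Real.log d + u / 2) * Real.log n₀ / n₀)
          = √(2 ^ 2 * (A * (Real.log d + u / 2) * Real.log n₀ / n₀)) := by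
        rw [Real.sqrt_mul (by norm_num), Real.sqrt_sq (by norm_num)]
      rw [e2]
      refine Real.sqrt_le_sqrt ?_
      rw [← mul_div_assoc]
      refine div_le_div_of_nonneg_right ?_ (Nat.cast_nonneg _)
      push_cast
      rw [← hu]
      calc A * (Real.log d + (u + 1) / 2) * Real.log n₀
          ≤ A * (2 ^ 2 * (Real.log d + u / 2)) * Real.log n₀ := by
            refine mul_le_mul_of_nonneg_right (mul_le_mul_of_nonneg_left ?_ hA.le) h2
            linarith
        _ = _ := by ring
    calc r * √(A * (Real.log d + ((tmax 1 - (k + 1) + 1 : ℕ) : ℝ) / 2) * Real.log n₀ / n₀)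
        ≤ 1 / 2 * (2 * √(A * (Real.log d + u / 2) * Real.log n₀ / n₀)) :=
          mul_le_mul hr1 h3 (Real.sqrt_nonneg _) (by norm_num)
      _ = _ := by ring
  · exact mul_le_of_le_one_left (Real.sqrt_nonneg _) (by linarith)

lemma pow_le_sqrt_inv {a r : ℝ} {n₀ t : ℕ} (ha : 0 < a) (hr : 0 ≤ r)
    (hr1 : r ≤ Real.exp (-(1 / (2 * a)))) (hn : 0 < n₀) (ht : a * Real.log n₀ ≤ t) :
    r ^ t ≤ √(1 / n₀) := by
  have hn' : (0 : ℝ) < n₀ := by exact_mod_cast hn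
  refine Real.le_sqrt_of_sq_le ?_
  calc (r ^ t) ^ 2 ≤ (Real.exp (-(1 / (2 * a))) ^ t) ^ 2 := by gcongr
    _ = Real.exp (-(t / a)) := by
        rw [← pow_mul, ← Real.exp_nat_mul]; congr 1; push_cast; field_simp
    _ ≤ Real.exp (-Real.log n₀) := by
        rw [Real.exp_le_exp, neg_le_neg_iff, le_div_iff₀ ha]; linarith
    _ = 1 / n₀ := by rw [Real.exp_neg, Real.exp_log hn', one_div]

/-- At the end of an episode the levels have the optimal order. -/
lemma penalty_end {A a r δ : ℝ} {d s n₀ : ℕ} {tmax : ℕ → ℕ} (hA : 1 ≤ A) (ha : 0 < a) (hr : 0 ≤ r)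
    (hr1 : r ≤ Real.exp (-(1 / (2 * a)))) (hδ : 0 ≤ δ) (hδ1 : δ ≤ 1) (hd : 2 ≤ d) (hs : 1 ≤ s)
    (hn : 2 ≤ n₀) (ht : a * Real.log n₀ ≤ tmax 1) {τ : ℕ} (hτ : 1 ≤ τ) :
    penalty A r δ d s n₀ tmax τ (tmax τ)
      ≤ 3 * √(A * Real.log d * Real.log n₀ / (2 ^ (τ - 1) * n₀)) := by
  unfold penalty
  split_ifs with h
  · obtain rfl : τ = 1 := by omega
    have := first_penalty_end (S := s) (ℓ := Real.log d) (Λ := Real.log n₀) (n := n₀) (A := A)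
      (δ := δ) (w := r ^ tmax 1) (by exact_mod_cast hs) (half_le_log hd) (half_le_log hn)
      (by exact_mod_cast (by omega : 0 < n₀)) hA hδ hδ1 (by positivity)
      (pow_le_sqrt_inv ha hr hr1 (by omega) ht)
    simpa using this
  · have := Real.sqrt_nonneg (A * Real.log d * Real.log n₀ / (2 ^ (τ - 1) * n₀))
    linarith

/-- The sample size is large compared to sparsity, dimension and number of iterations. -/
structure LargeSample (a b y : ℝ) (T d s n₀ : ℕ) (tmax : ℕ → ℕ) : Prop where
  two_le_d : 2 ≤ d
  one_le_s : 1 ≤ s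
  two_le_n : 2 ≤ n₀
  scale : (s : ℝ) ^ 2 * Real.log d * Real.log n₀ ≤ y ^ 2 * n₀
  first_ge : a * Real.log n₀ ≤ tmax 1
  first_le : tmax 1 ≤ b * Real.log n₀
  later : ∀ τ, 2 ≤ τ → 1 ≤ tmax τ ∧ tmax τ ≤ T
  a_pos : 0 < a
  b_pos : 0 < b
  y_pos : 0 < y
  y_le_one : y ≤ 1
  b_le : 2 * b * y ≤ 1
  T_le : 4 * T * y ≤ 1

namespace LargeSample

variable {a b y : ℝ} {T d s n₀ : ℕ} {tmax : ℕ → ℕ} (h : LargeSample a b y T d s n₀ tmax)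
include h

lemma one_le_T : 1 ≤ T := (h.later 2 le_rfl).1.trans (h.later 2 le_rfl).2

lemma n_pos : (0 : ℝ) < n₀ := by
  have := h.two_le_n
  exact_mod_cast (by omega : 0 < n₀)

lemma facts : (s : ℝ) * Real.log d * Real.log n₀ ≤ y ^ 2 * n₀ ∧
    s * Real.log d ≤ 2 * y ^ 2 * n₀ ∧ Real.log d * Real.log n₀ ≤ y ^ 2 * n₀ ∧
    (s : ℝ) ^ 2 * Real.log n₀ ≤ 2 * y ^ 2 * n₀ ∧ Real.log n₀ ≤ 2 * y ^ 2 * n₀ ∧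
    Real.log d ≤ 2 * y ^ 2 * n₀ ∧ 1 ≤ 4 * y ^ 2 * n₀ :=
  scaling_facts (by exact_mod_cast h.one_le_s) (half_le_log h.two_le_d) (half_le_log h.two_le_n)
    h.scale

lemma one_le_tmax {τ : ℕ} (hτ : 1 ≤ τ) : 1 ≤ tmax τ := by
  rcases Nat.lt_or_ge τ 2 with h2 | h2
  · obtain rfl : τ = 1 := by omega
    have h1 := half_le_log h.two_le_n
    have h3 : (0 : ℝ) < tmax 1 := lt_of_lt_of_le (mul_pos h.a_pos (by linarith)) h.first_ge
    exact_mod_cast h3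
  · exact (h.later τ h2).1

lemma sq_le : y ^ 2 ≤ y := by
  rw [sq]; exact mul_le_of_le_one_left h.y_pos.le h.y_le_one

lemma first_batchSize : 0 < batchSize n₀ tmax 1 ∧
    (n₀ : ℝ) ≤ 2 * b * Real.log n₀ * batchSize n₀ tmax 1 := by
  have hn := h.n_pos
  obtain ⟨-, -, -, -, f5, -, -⟩ := h.facts
  have h1 : (tmax 1 : ℝ) ≤ n₀ := by
    calc (tmax 1 : ℝ) ≤ b * Real.log n₀ := h.first_le
      _ ≤ b * (2 * y ^ 2 * n₀) := mul_le_mul_of_nonneg_left f5 h.b_pos.le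
      _ ≤ b * (2 * y * n₀) := by
          have := h.sq_le
          have := h.b_pos
          gcongr
      _ = 2 * b * y * n₀ := by ring
      _ ≤ 1 * n₀ := mul_le_mul_of_nonneg_right h.b_le hn.le
      _ = n₀ := one_mul _
  have e : batchSize n₀ tmax 1 = n₀ / tmax 1 := by simp [batchSize, epLen]
  obtain ⟨h2, h3⟩ := le_two_mul_div (h.one_le_tmax le_rfl) (show tmax 1 ≤ n₀ by exact_mod_cast h1)
  rw [e]
  refine ⟨h2, ?_⟩
  have h4 : (n₀ : ℝ) ≤ 2 * tmax 1 * (n₀ / tmax 1 : ℕ) := by exact_mod_cast h3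
  calc (n₀ : ℝ) ≤ 2 * tmax 1 * (n₀ / tmax 1 : ℕ) := h4
    _ ≤ 2 * (b * Real.log n₀) * (n₀ / tmax 1 : ℕ) := by
        have := h.first_le
        gcongr
    _ = _ := by ring

lemma later_batchSize {τ : ℕ} (hτ : 2 ≤ τ) : 0 < batchSize n₀ tmax τ ∧
    (2 : ℝ) ^ (τ - 1) * n₀ ≤ 2 * T * batchSize n₀ tmax τ := by
  have hn := h.n_pos
  obtain ⟨-, -, -, -, -, -, f7⟩ := h.facts
  obtain ⟨ht, htT⟩ := h.later τ hτ
  have h1 : (T : ℝ) ≤ n₀ := by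
    have h2 : (T : ℝ) * 1 ≤ T * (4 * y ^ 2 * n₀) :=
      mul_le_mul_of_nonneg_left f7 (Nat.cast_nonneg T)
    have h3 : (T : ℝ) * (4 * y ^ 2 * n₀) ≤ T * (4 * y * n₀) := by
      have := h.sq_le
      gcongr
    have h4 := mul_le_mul_of_nonneg_right h.T_le hn.le
    linarith
  have h5 : tmax τ ≤ 2 ^ (τ - 1) * n₀ := by
    have : T ≤ n₀ := by exact_mod_cast h1
    exact (htT.trans this).trans (Nat.le_mul_of_pos_left _ (by positivity))
  obtain ⟨h2, h3⟩ := le_two_mul_div ht h5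
  unfold batchSize epLen
  refine ⟨h2, ?_⟩
  have h4 : (2 : ℝ) ^ (τ - 1) * n₀ ≤ 2 * tmax τ * (2 ^ (τ - 1) * n₀ / tmax τ : ℕ) := by
    exact_mod_cast h3
  refine h4.trans ?_
  have : (tmax τ : ℝ) ≤ T := by exact_mod_cast htT
  gcongr

lemma batchSize_pos {τ : ℕ} (hτ : 1 ≤ τ) : 0 < batchSize n₀ tmax τ := by
  rcases Nat.lt_or_ge τ 2 with h2 | h2
  · obtain rfl : τ = 1 := by omega
    exact h.first_batchSize.1
  · exact (h.later_batchSize h2).1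

/-- The batches are large enough for sparse vectors of the required order. -/
lemma design_size {N τ : ℕ} {c C : ℝ} (hc : 0 < c) (hC : 0 < C) (hτ : 1 ≤ τ)
    (hy1 : 8 * b * C / c * y ≤ 1) (hy2 : 32 * T * C / c * y ≤ 1) :
    C * s * (approxOrder N τ : ℝ) ^ 2 * Real.log d ≤ c * batchSize n₀ tmax τ := by
  have hn := h.n_pos
  have hℓ : 0 < Real.log d := by linarith [half_le_log h.two_le_d]
  have hΛ : 0 < Real.log n₀ := by linarith [half_le_log h.two_le_n]
  obtain ⟨f1, f2, -⟩ := h.facts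
  have hyy := h.sq_le
  have hb := h.b_pos
  have hy1' : 8 * b * C * y ≤ c := by
    rw [div_mul_eq_mul_div, div_le_one hc] at hy1; exact hy1
  have hy2' : 32 * T * C * y ≤ c := by
    rw [div_mul_eq_mul_div, div_le_one hc] at hy2; exact hy2
  rcases Nat.lt_or_ge τ 2 with h2 | h2
  · obtain rfl : τ = 1 := by omega
    obtain ⟨-, hk⟩ := h.first_batchSize
    have hm : (approxOrder N 1 : ℝ) ≤ 2 := by exact_mod_cast approxOrder_one_le N
    have hb2 : 0 < 2 * b * Real.log n₀ := by positivity
    refine le_of_mul_le_mul_left ?_ hb2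
    calc 2 * b * Real.log n₀ * (C * s * (approxOrder N 1 : ℝ) ^ 2 * Real.log d)
        ≤ 2 * b * Real.log n₀ * (C * s * 2 ^ 2 * Real.log d) := by gcongr
      _ = 8 * b * C * (s * Real.log d * Real.log n₀) := by ring
      _ ≤ 8 * b * C * (y ^ 2 * n₀) := by gcongr
      _ ≤ 8 * b * C * (y * n₀) := by gcongr
      _ = 8 * b * C * y * n₀ := by ring
      _ ≤ c * (2 * b * Real.log n₀ * batchSize n₀ tmax 1) := by gcongr
      _ = _ := by ring
  · obtain ⟨-, hk⟩ := h.later_batchSize h2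
    calc C * s * (approxOrder N τ : ℝ) ^ 2 * Real.log d
        ≤ C * s * (8 * 2 ^ (τ - 1)) * Real.log d := by
          have := approxOrder_sq_le (N := N) hτ
          gcongr
      _ = 8 * C * 2 ^ (τ - 1) * (s * Real.log d) := by ring
      _ ≤ 8 * C * 2 ^ (τ - 1) * (2 * y ^ 2 * n₀) := by gcongr
      _ ≤ 8 * C * 2 ^ (τ - 1) * (2 * y * n₀) := by gcongr
      _ = 16 * C * y * (2 ^ (τ - 1) * n₀) := by ring
      _ ≤ 16 * C * y * (2 * T * batchSize n₀ tmax τ) := by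
          have := h.y_pos
          gcongr
      _ = 32 * T * C * y * batchSize n₀ tmax τ := by ring
      _ ≤ _ := by gcongr

/-- The accumulated failure probability of all the iterations. -/
lemma sum_failure_le (N : ℕ) {A r δ c₁ c₂ : ℝ} (hA : 0 < A) (hr : 0 ≤ r) (hδ : 0 ≤ δ)
    (hc₁ : 0 < c₁) (hc₂ : 0 < c₂) (hA1 : 16 * b ≤ c₂ * A)
    (hA2 : (10 + 2 * T) * (4 * T) ≤ c₂ * A)
    (hy1 : 4 * b / c₁ * y ≤ 1) (hy2 : 1536 * b * (2 * b) ^ 2 / c₁ ^ 2 * y ≤ 1)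
    (hy3 : 8 * T / c₁ * y ≤ 1) (hy4 : 768 * T ^ 2 / c₁ * y ≤ 1) :
    ∑ τ ∈ Finset.Icc 1 N, ∑ t ∈ Finset.Icc 1 (tmax τ),
      (3 * Real.exp (-(approxOrder N τ * (c₂ * batchSize n₀ tmax τ
            * penalty A r δ d s n₀ tmax τ t ^ 2 - 2 * Real.log d)))
        + 6 * Real.exp (-(c₁ * batchSize n₀ tmax τ))) ≤ (d : ℝ)⁻¹ := by
  have hn := h.n_pos
  have hℓ := half_le_log h.two_le_d
  have hΛ := half_le_log h.two_le_n
  have hd0 : (0 : ℝ) < d := by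
    have := h.two_le_d
    exact_mod_cast (by omega : 0 < d)
  have hd2 : (2 : ℝ) ≤ d := by exact_mod_cast h.two_le_d
  have hD : (d : ℝ)⁻¹ = Real.exp (-Real.log d) := by rw [Real.exp_neg, Real.exp_log hd0]
  have hD2 : (d : ℝ)⁻¹ ≤ 1 / 2 := by
    rw [one_div]; exact inv_anti₀ two_pos hd2
  obtain ⟨-, -, f3, -, -, f6, -⟩ := h.facts
  have hm : ∀ τ, 1 ≤ approxOrder N τ := fun τ => by unfold approxOrder; omega
  refine sum_episode_failure (by positivity) fun τ hτ => ?_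
  obtain ⟨hτ1, -⟩ := Finset.mem_Icc.1 hτ
  rcases Nat.lt_or_ge τ 2 with h2 | h2
  · obtain rfl : τ = 1 := by omega
    obtain ⟨-, hk⟩ := h.first_batchSize
    refine first_episode_failure hD hD2 (fun t _ => ?_) ?_
    · refine first_noise_exponent (hm 1) hℓ hΛ hn h.b_pos hc₂ hk hA1 (Nat.cast_nonneg _) ?_
      unfold penalty
      rw [if_pos le_rfl]
      exact le_add_of_nonneg_right (by positivity)
    · rw [hD]
      have hsq : Real.log n₀ ^ 2 ≤ 2 * n₀ := by
        have := Real.pow_div_factorial_le_exp (Real.log n₀) (by linarith) 2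
        rw [Real.exp_log hn] at this
        norm_num [Nat.factorial] at this
        linarith
      exact first_design_failure hℓ hΛ hn h.y_pos h.y_le_one h.b_pos f3 hsq hc₁ h.first_le hk
        hy1 hy2
  · obtain ⟨-, hk⟩ := h.later_batchSize h2
    obtain ⟨-, htT⟩ := h.later τ h2
    have hT : (0 : ℝ) < T := by exact_mod_cast h.one_le_T
    have e : ∀ t, penalty A r δ d s n₀ tmax τ t
        = √(A * Real.log d * Real.log n₀ / (2 ^ (τ - 1) * n₀)) := fun t => by
      unfold penalty; rw [if_neg (by omega)]
    simp only [e]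
    refine later_episode_failure hD hD2 hτ1 htT
      (later_noise_exponent (hm τ) hℓ hΛ hT (by positivity) hA hc₂ hk hA2) ?_
    rw [hD]
    exact later_design_failure hℓ hn h.y_pos h.y_le_one f6 hc₁ hT (by exact_mod_cast htT)
      (one_le_pow₀ one_le_two) hk hy3 hy4

/-- All regularization levels are small. -/
lemma penalty_small {N τ t : ℕ} {A r δ c c' : ℝ} (hA : 0 < A) (hr : 0 ≤ r) (hr1 : r ≤ 1)
    (hδ : 0 ≤ δ) (hδc : δ ≤ c / 4) (hc' : 0 ≤ c') (hcc : c' ≤ c) (hτ : 1 ≤ τ)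
    (hy1 : A * (1 + 2 * b) * y ≤ (c / 4) ^ 2) (hy2 : 72 * A * y ≤ c' ^ 2) :
    √s * approxOrder N τ * penalty A r δ d s n₀ tmax τ t ≤ c := by
  have hn := h.n_pos
  have hΛ := half_le_log h.two_le_n
  have hs : (1 : ℝ) ≤ s := by exact_mod_cast h.one_le_s
  obtain ⟨f1, -, -, f4, -⟩ := h.facts
  unfold penalty
  split_ifs with h2
  · obtain rfl : τ = 1 := by omega
    have hcube : Real.log n₀ ^ 3 ≤ 6 * n₀ := by
      have := Real.pow_div_factorial_le_exp (Real.log n₀) (by linarith) 3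
      rw [Real.exp_log hn] at this
      norm_num [Nat.factorial] at this
      linarith
    refine first_penalty_small hs hΛ hn h.y_pos h.y_le_one h.b_pos f1
      (sparsity_log_sq hΛ hn h.y_pos f4 hcube) hA (by linarith) ?_ (Nat.cast_nonneg _)
      (by exact_mod_cast approxOrder_one_le N) ?_ hy1
    · exact le_trans (by exact_mod_cast Nat.sub_le _ _) h.first_le
    · exact (mul_le_of_le_one_left hδ (pow_le_one₀ hr hr1)).trans hδc
  · refine le_trans ?_ (hcc.trans' (end_penalty_small hs hn f1 h.y_pos h.y_le_one hA hc'
      (Nat.cast_nonneg (approxOrder N τ)) (pow_pos two_pos (τ - 1)) (approxOrder_sq_le hτ) hy2))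
    refine mul_le_mul_of_nonneg_left ?_ (by positivity)
    linarith [Real.sqrt_nonneg (A * Real.log d * Real.log n₀ / (2 ^ (τ - 1) * n₀))]

/-- The last regularization level of an episode is small. -/
lemma penalty_end_small {N τ : ℕ} {A r δ c : ℝ} (hA : 1 ≤ A) (hr : 0 ≤ r)
    (hr1 : r ≤ Real.exp (-(1 / (2 * a)))) (hδ : 0 ≤ δ) (hδ1 : δ ≤ 1) (hc : 0 ≤ c) (hτ : 1 ≤ τ)
    (hy : 72 * A * y ≤ c ^ 2) :
    √s * approxOrder N τ * penalty A r δ d s n₀ tmax τ (tmax τ) ≤ c := by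
  have hs : (1 : ℝ) ≤ s := by exact_mod_cast h.one_le_s
  refine le_trans ?_ (end_penalty_small hs h.n_pos h.facts.1 h.y_pos h.y_le_one
    (zero_lt_one.trans_le hA) hc (Nat.cast_nonneg (approxOrder N τ)) (pow_pos two_pos (τ - 1))
    (approxOrder_sq_le hτ) hy)
  exact mul_le_mul_of_nonneg_left
    (penalty_end hA h.a_pos hr hr1 hδ hδ1 h.two_le_d h.one_le_s h.two_le_n h.first_ge hτ)
    (by positivity)

/-- The last level of an episode is comparable to the first level of the next one. -/
lemma penalty_next {N τ : ℕ} {A r δ : ℝ} (hA : 1 ≤ A) (hr : 0 ≤ r) (hr1 : r ≤ 1 / 16)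
    (hr2 : r ≤ Real.exp (-(1 / (2 * a)))) (hδ : 0 ≤ δ) (hδ1 : δ ≤ 1) (hτ : 2 ≤ τ) (hN : τ ≤ N) :
    r * (approxOrder N (τ - 1) * penalty A r δ d s n₀ tmax (τ - 1) (tmax (τ - 1)))
      ≤ approxOrder N τ * penalty A r δ d s n₀ tmax τ 1 := by
  have hn := h.n_pos
  have h1 := penalty_end (τ := τ - 1) hA h.a_pos hr hr2 hδ hδ1 h.two_le_d h.one_le_s h.two_le_n
    h.first_ge (by omega)
  have h2 : penalty A r δ d s n₀ tmax τ 1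
      = √(A * Real.log d * Real.log n₀ / (2 ^ (τ - 1) * n₀)) := by
    unfold penalty; rw [if_neg (by omega)]
  have hX : 0 ≤ A * Real.log d * Real.log n₀ / (2 ^ (τ - 1) * n₀) := by
    have := Real.log_natCast_nonneg d
    have := Real.log_natCast_nonneg n₀
    positivity
  have h3 : √(A * Real.log d * Real.log n₀ / (2 ^ (τ - 1 - 1) * n₀))
      ≤ 2 * √(A * Real.log d * Real.log n₀ / (2 ^ (τ - 1) * n₀)) := by
    refine Real.sqrt_le_iff.2 ⟨by positivity, ?_⟩
    rw [mul_pow, Real.sq_sqrt hX]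
    obtain ⟨k, rfl⟩ : ∃ k, τ = k + 2 := ⟨τ - 2, by omega⟩
    have e : A * Real.log d * Real.log n₀ / (2 ^ (k + 2 - 1 - 1) * n₀)
        = 2 * (A * Real.log d * Real.log n₀ / (2 ^ (k + 2 - 1) * n₀)) := by
      rw [show k + 2 - 1 - 1 = k by omega, show k + 2 - 1 = k + 1 by omega, pow_succ]
      field_simp
    rw [e]; linarith
  have hm : (approxOrder N (τ - 1) : ℝ) ≤ 2 * approxOrder N τ := by
    exact_mod_cast approxOrder_le_two_mul hτ hN
  rw [h2]
  set z := √(A * Real.log d * Real.log n₀ / (2 ^ (τ - 1) * n₀)) with hz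
  have hz0 : 0 ≤ z := Real.sqrt_nonneg _
  have h4 : penalty A r δ d s n₀ tmax (τ - 1) (tmax (τ - 1)) ≤ 6 * z := by linarith
  calc r * (approxOrder N (τ - 1) * penalty A r δ d s n₀ tmax (τ - 1) (tmax (τ - 1)))
      ≤ r * (2 * approxOrder N τ * (6 * z)) := by
        refine mul_le_mul_of_nonneg_left ?_ hr
        exact (mul_le_mul_of_nonneg_left h4 (Nat.cast_nonneg _)).trans
          (mul_le_mul_of_nonneg_right hm (by positivity))
    _ ≤ 1 / 16 * (2 * approxOrder N τ * (6 * z)) := by gcongr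
    _ ≤ approxOrder N τ * z := by
        have : 0 ≤ (approxOrder N τ : ℝ) * z := by positivity
        linarith

end LargeSample

lemma eq_zero_of_l0_eq_zero {d : ℕ} {v : Vec d} (h : l0 v ≤ 0) : v = 0 := by
  have h1 : (Finset.univ.filter fun j => v j ≠ 0) = ∅ := Finset.card_eq_zero.1 (Nat.le_zero.1 h)
  ext j
  by_contra hj
  have : j ∈ (Finset.univ.filter fun j => v j ≠ 0) := by simpa using hj
  rw [h1] at this
  simp at this

/-- A positive signal-to-noise ratio excludes vanishing coefficients. -/
lemma Regular.one_le_sparsity {Ω : Type*} [MeasurableSpace Ω] {μ : Measure Ω} {d K s : ℕ}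
    {ξ M S L σ CSNR δ : ℝ} {am : (Fin K → ℝ) → Fin K} {γs : Param d} {B : Primitives Ω d K}
    (h : Regular μ s ξ M S L σ CSNR δ am γs B) (hC : 0 < CSNR) : 1 ≤ s := by
  by_contra hs
  obtain rfl : s = 0 := by omega
  have h1 := h.snr
  rw [eq_zero_of_l0_eq_zero h.sparse_β₁, eq_zero_of_l0_eq_zero h.sparse_β₂] at h1
  simp at h1
  linarith

/-- In dimension at most one the claimed probability bound is trivial. -/
lemma low_dimension {Ω : Type*} [MeasurableSpace Ω] {μ : Measure Ω} [IsProbabilityMeasure μ]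
    {d : ℕ} (hd : d < 2) (γ : Ω → Param d) (γs : Param d) (x y : ℝ) (hx : 0 ≤ x) (hy : 0 ≤ y) :
    1 - (d : ℝ)⁻¹ ≤ μ.real {ω | err2 (γ ω) γs ≤ x ∧ err1 (γ ω) γs ≤ y} := by
  interval_cases d
  · have e : {ω | err2 (γ ω) γs ≤ x ∧ err1 (γ ω) γs ≤ y} = Set.univ := by
      refine Set.eq_univ_of_forall fun ω => ⟨?_, ?_⟩
      · have : γ ω = γs := Subsingleton.elim _ _
        simpa [this, err2] using hx
      · simpa [err1, l1] using hy
    rw [e]; simp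
  · simp

end LHLB

end

theorem theorem1 (K : ℕ) (ξ M S L σ a b : ℝ) (T : ℕ)
    (hξ₀ : 0 < ξ) (hξ₁ : ξ < 1 / 2) (hM : 1 < M) (hS : 0 < S) (hL : 0 < L) (hσ : 0 < σ)
    (ha : 0 < a) (hab : a ≤ b) :
    ∃ δ₀ CSNR c₀ C : ℝ, 0 < δ₀ ∧ 0 < CSNR ∧ 0 < c₀ ∧ 0 < C ∧
      ∀ (d s n₀ : ℕ) (tmax : ℕ → ℕ), 2 ≤ n₀ →
        (s : ℝ) ^ 2 * Real.log d * Real.log n₀ ≤ c₀ * n₀ →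
        a * Real.log n₀ ≤ tmax 1 → tmax 1 ≤ b * Real.log n₀ →
        (∀ τ, 2 ≤ τ → 1 ≤ tmax τ ∧ tmax τ ≤ T) →
        ∃ lam : ℕ → ℕ → ℝ, (∀ τ t, 0 < lam τ t) ∧
          ∀ (Ω : Type*) [MeasurableSpace Ω] (μ : MeasureTheory.Measure Ω)
            [MeasureTheory.IsProbabilityMeasure μ]
            (am : (Fin K → ℝ) → Fin K) (γs : LHLB.Param d) (B : LHLB.Primitives Ω d K)
            (arm : ℕ → Ω → Fin K) (γ : ℕ → ℕ → Ω → LHLB.Param d),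
            LHLB.IsArgmaxRule am →
            LHLB.IsLatentBandit μ γs σ B →
            LHLB.Regular μ s ξ M S L σ CSNR δ₀ am γs B →
            LHLB.IsRun μ am γs σ B n₀ tmax lam arm γ →
            (∀ᵐ ω ∂μ, LHLB.err2 (γ 1 0 ω) γs ≤ δ₀) →
            ∀ τ : ℕ, 1 ≤ τ →
              1 - (d : ℝ)⁻¹ ≤ μ.real {ω |
                LHLB.err2 (γ τ (tmax τ) ω) γs ≤
                    C * √((s : ℝ) * Real.log d * Real.log n₀ / LHLB.epLen n₀ (τ - 1)) ∧
                LHLB.err1 (γ τ (tmax τ) ω) γs ≤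
                    C * √((s : ℝ) ^ 2 * Real.log d * Real.log n₀ / LHLB.epLen n₀ (τ - 1))} := by
  open LHLB in
  obtain ⟨C₁, c₁, c₂, c₃, C₂, hC₁, hc₁, hc₂, hc₃, hC₂, hstep⟩ :=
    exists_step_constants K hξ₀ hξ₁ hM hS hL hσ
  have hC₁0 : 0 < C₁ := by linarith
  have hb : 0 < b := ha.trans_le hab
  set c₄ := min c₃ (1 / C₁) with hc₄
  have hc₄0 : 0 < c₄ := lt_min hc₃ (by positivity)
  have hc₄C : C₁ * c₄ ≤ 1 := by
    have : c₄ ≤ 1 / C₁ := min_le_right _ _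
    rw [le_div_iff₀ hC₁0] at this; linarith
  have hc₄1 : c₄ ≤ 1 := by nlinarith
  set δ₀ := c₄ / 4 with hδ₀
  have hδ0 : 0 < δ₀ := by positivity
  have hδ1 : δ₀ ≤ 1 := by linarith
  set r := min (1 / 16) (Real.exp (-(1 / (2 * a)))) with hr
  have hr0 : 0 < r := lt_min (by norm_num) (Real.exp_pos _)
  have hr16 : r ≤ 1 / 16 := min_le_left _ _
  have hre : r ≤ Real.exp (-(1 / (2 * a))) := min_le_right _ _
  set A := (10 + 2 * (T : ℝ)) * (4 * T + 2 * b) / c₂ + 1 with hA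
  have hA1 : 1 ≤ A := by
    have : 0 ≤ (10 + 2 * (T : ℝ)) * (4 * T + 2 * b) / c₂ := by positivity
    linarith
  have hA0 : 0 < A := by linarith
  have hcA : (10 + 2 * (T : ℝ)) * (4 * T + 2 * b) ≤ c₂ * A := by
    have : c₂ * A = (10 + 2 * (T : ℝ)) * (4 * T + 2 * b) + c₂ := by rw [hA]; field_simp
    linarith
  have hA2 : (10 + 2 * (T : ℝ)) * (4 * T) ≤ c₂ * A := by
    refine le_trans ?_ hcA
    gcongr; linarith
  have hA3 : 16 * b ≤ c₂ * A := by
    have hT0 : (0 : ℝ) ≤ T := Nat.cast_nonneg T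
    refine le_trans ?_ hcA
    nlinarith [mul_nonneg hT0 hb.le, mul_nonneg hT0 hT0]
  obtain ⟨CSNR, hCSNR, hstep⟩ := hstep (r / C₁) (by positivity)
  obtain ⟨y, hy0, hy1, hy⟩ := exists_scale [A * (1 + 2 * b) / (c₄ / 4) ^ 2,
    72 * A / (δ₀ / C₁) ^ 2, 2 * b, 4 * T, 8 * b * C₂ / c₁, 32 * T * C₂ / c₁, 4 * b / c₁,
    1536 * b * (2 * b) ^ 2 / c₁ ^ 2, 8 * T / c₁, 768 * T ^ 2 / c₁]
  simp only [List.forall_mem_cons] at hy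
  obtain ⟨y1, y2, y3, y4, y5, y6, y7, y8, y9, y10, -⟩ := hy
  rw [div_mul_eq_mul_div, div_le_one (by positivity)] at y1 y2
  refine ⟨δ₀, CSNR, y ^ 2, 18 * C₁ * √A, hδ0, hCSNR, by positivity, by positivity, ?_⟩
  intro d s n₀ tmax hn₀ hscale ht1 ht2 ht3
  rcases Nat.lt_or_ge d 2 with hd | hd
  · exact ⟨fun _ _ => 1, fun _ _ => one_pos, fun Ω _ μ _ am γs B arm γ _ _ _ _ _ τ _ =>
      low_dimension hd _ _ _ _ (by positivity) (by positivity)⟩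
  have hpen := fun τ t => penalty_pos (s := s) (tmax := tmax) hA0 hr0.le hδ0.le hd hn₀ τ t
  refine ⟨penalty A r δ₀ d s n₀ tmax, hpen, ?_⟩
  intro Ω _ μ _ am γs B arm γ ham hB hreg hrun hbase N hN
  have hs := hreg.one_le_sparsity hCSNR
  have h : LargeSample a b y T d s n₀ tmax :=
    ⟨hd, hs, hn₀, hscale, ht1, ht2, ht3, ha, hb, hy0, hy1, y3, y4⟩
  have hs0 : 0 < √(s : ℝ) := Real.sqrt_pos.2 (by exact_mod_cast hs)
  have hm : ∀ τ, 1 ≤ approxOrder N τ := fun τ => by unfold approxOrder; omega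
  have hrC : r / C₁ * C₁ = r := div_mul_cancel₀ _ hC₁0.ne'
  have hdC : δ₀ / C₁ ≤ c₄ := (div_le_self hδ0.le hC₁).trans (by linarith)
  have hsmall : ∀ τ t, 1 ≤ τ → √s * approxOrder N τ * penalty A r δ₀ d s n₀ tmax τ t ≤ c₄ :=
    fun τ t hτ => h.penalty_small hA0 hr0.le (by linarith) hδ0.le le_rfl
      (by positivity) hdC hτ y1 y2
  have hfinal := hrun.final_probability (s := s) (N := N) (m := approxOrder N) (C₁ := C₁)
    (c₃ := c₃) (δ := δ₀) (q := r / C₁) hC₁0 hδ0.le hδ1 (fun τ hτ => h.one_le_tmax hτ) hpen hbase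
    (fun τ t e hτ _ ht htm he he1 hqe hle =>
      hstep Ω μ d s n₀ tmax _ am γs B arm γ δ₀ hd hs (by omega) (fun τ hτ => h.one_le_tmax hτ)
        ham.measurable hB hreg hrun τ t (approxOrder N τ) e hτ ht htm (hm τ) (h.batchSize_pos hτ)
        (hpen τ t) he he1 hqe hle (h.design_size hc₁ hC₂ hτ y5 y6))
    ?_ ?_ ?_ ?_ ?_ hN
  · have hle := hfinal.trans (h.sum_failure_le N hA0 hr0.le hδ0.le hc₁ hc₂ hA3 hA2 y7 y8 y9 y10)
    set G := {ω | err2 (γ N (tmax N) ω) γs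
        ≤ C₁ * (√s * approxOrder N N * penalty A r δ₀ d s n₀ tmax N (tmax N)) ∧
      err1 (γ N (tmax N) ω) γs ≤ 6 * √s * approxOrder N N * err2 (γ N (tmax N) ω) γs} with hG
    have h1 : 1 ≤ μ.real G + μ.real Gᶜ := by
      have := measureReal_union_le (μ := μ) G Gᶜ
      rwa [Set.union_compl_self, probReal_univ] at this
    refine le_trans (by linarith) (measureReal_mono (s₁ := G) ?_)
    intro ω hω
    obtain ⟨h2, h3⟩ := hω
    have hmN : (approxOrder N N : ℝ) = 1 := by simp [approxOrder]
    rw [hmN, mul_one] at h2 h3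
    have hend := penalty_end hA1 ha hr0.le hre hδ0.le hδ1 hd hs hn₀ ht1 hN
    have hlen : ((epLen n₀ (N - 1) : ℕ) : ℝ) = 2 ^ (N - 1) * n₀ := by simp [epLen]
    have hX : A * Real.log d * Real.log n₀ / (2 ^ (N - 1) * n₀)
        = A * (Real.log d * Real.log n₀ / epLen n₀ (N - 1)) := by rw [hlen]; ring
    have hX2 : (s : ℝ) * Real.log d * Real.log n₀ / epLen n₀ (N - 1)
        = s * (Real.log d * Real.log n₀ / epLen n₀ (N - 1)) := by ring
    have hX3 : (s : ℝ) ^ 2 * Real.log d * Real.log n₀ / epLen n₀ (N - 1)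
        = s * (s * (Real.log d * Real.log n₀ / epLen n₀ (N - 1))) := by ring
    have hs' : (0 : ℝ) ≤ s := Nat.cast_nonneg s
    rw [hX, Real.sqrt_mul hA0.le] at hend
    rw [Set.mem_ofPred_eq, hX2, hX3, Real.sqrt_mul hs', Real.sqrt_mul hs', Real.sqrt_mul hs']
    set z := √(Real.log d * Real.log n₀ / epLen n₀ (N - 1)) with hz
    have hz0 : 0 ≤ z := Real.sqrt_nonneg _
    have h4 : err2 (γ N (tmax N) ω) γs ≤ 3 * C₁ * √A * (√s * z) := by
      refine h2.trans ?_
      calc C₁ * (√s * penalty A r δ₀ d s n₀ tmax N (tmax N)) ≤ C₁ * (√s * (3 * (√A * z))) := by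
            gcongr
        _ = _ := by ring
    have h5 : 0 ≤ C₁ * √A * (√s * z) := by positivity
    refine ⟨by linarith, h3.trans ?_⟩
    calc 6 * √s * err2 (γ N (tmax N) ω) γs ≤ 6 * √s * (3 * C₁ * √A * (√s * z)) := by gcongr
      _ = _ := by ring
  · have h1 : r * δ₀ / √s ≤ penalty A r δ₀ d s n₀ tmax 1 1 := by
      unfold penalty
      rw [if_pos le_rfl, pow_one]
      exact le_add_of_nonneg_left (Real.sqrt_nonneg _)
    have hm1 : (1 : ℝ) ≤ approxOrder N 1 := by exact_mod_cast hm 1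
    calc r / C₁ * δ₀ ≤ r * δ₀ := by
          gcongr
          exact div_le_self hr0.le hC₁
      _ = √s * 1 * (r * δ₀ / √s) := by field_simp
      _ ≤ _ := by gcongr
  · intro τ t hτ _ ht htm
    rw [hrC]
    exact penalty_ratio hA0 (by linarith) hd ht htm hτ
  · intro τ hτ hτN
    rw [hrC]
    exact h.penalty_next hA1 hr0.le hr16 hre hδ0.le hδ1 hτ hτN
  · intro τ t hτ _ _ _
    exact ⟨(hsmall τ t hτ).trans (min_le_left _ _),
      (mul_le_mul_of_nonneg_left (hsmall τ t hτ) hC₁0.le).trans hc₄C⟩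
  · intro τ hτ _
    have := h.penalty_end_small (N := N) hA1 hr0.le hre hδ0.le hδ1
      (div_nonneg hδ0.le hC₁0.le) hτ y2
    rw [le_div_iff₀ hC₁0] at this
    linarith
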